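/- **Diagonal embedding direct systems.** Let $\mathbb F\in\{\mathbb R,\mathbb C,\mathbb H\}$. Fix $d_0>0$ and sequences of integers $r_n,s_n,t'_n,t''_n\ge 0$ with $r_n+s_n>0$; put $d_{n+1}=d_n(r_{n+1}+s_{n+1})+t'_{n+1}+t''_{n+1}$. A diagonal embedding direct system consists of groups $G_n$ of $d_n\times d_n$ matrices and of the homomorphisms $$\phi_{n+1,n}(g)=\operatorname{diag}\{1,\dots,1;\,g,\dots,g;\,\delta(g),\dots,\delta(g);\,1,\dots,1\}$$ with $t'_{n+1}$ entries $1$, $r_{n+1}$ blocks $g$, $s_{n+1}$ blocks $\delta(g)$ and $t''_{n+1}$ entries $1$, in one of the following families. Let $J$ be the matrix with ones on the antidiagonal and zeros elsewhere; for quaternionic $g$ let $g^t$ be given by the transpose of the complex matrix of twice the size. Forms on $\mathbb F^{d_{n+1}}$ are orthogonal sums of copies of the form on $\mathbb F^{d_n}$, one for each block, and of a standard form on the added coordinates. * $G_n=SL(d_n;\mathbb F)$, $t'_n=0$, $\delta(g)=J(g^t)^{-1}J^{-1}$. * $G_n=SU(d'_n,d''_n;\mathbb F)$, $d_n=d'_n+d''_n$,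 for a diagonal form with entries $\pm1$; the $t'_{n+1}$ first coordinates are positive, the $t''_{n+1}$ last ones negative. Here $d'_n>0$ and $d''_n>0$ for large $n$. If $\mathbb F=\mathbb H$, all $s_n=0$. If $\mathbb F=\mathbb R$ and $d_n$ is odd, $\delta=1$. If $\mathbb F=\mathbb R$ and $d_n$ is even, $\delta(g)=wgw^{-1}$, and if $\mathbb F=\mathbb C$, $\delta(g)=w(g^t)^{-1}w^{-1}$, where $w=w_n$ is any signed permutation matrix that preserves the form, with $\det w=-1$ if $\mathbb F=\mathbb R$. * The group $G_n$ of a standard antisymmetric form on $\mathbb F^{d_n}$, $\mathbb F=\mathbb R$ or $\mathbb C$, with $d_0$ and all $t''_n$ even, $t'_n=0$, $s_n=0$. * $G_n=SO(d_n;\mathbb C)$ for the form with matrix $I$, $t'_n=0$, $\delta(g)=J(g^t)^{-1}J^{-1}$. * $G_n=SO^*(2d_n)$, the group of all $g\in SL(d_n;\mathbb H)$ that preserve $b(x,y)=\sum_a\overline{x_a}\,i\,y_a$, $t'_n=0$, $\delta(g)=J(g^t)^{-1}J^{-1}$. The system is *of classical type* if $r_n+s_n=1$ for all sufficiently large $n$.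 **Restricted roots.** Let $\mathfrak g_n$ be the Lie algebra of $G_n$, let $\theta X=-X^*$ be the Cartan involution and $\mathfrak k_n$ its fixed point set. Let $\mathfrak a_n\subset\mathfrak g_n$ be a standard maximal abelian subspace of the $(-1)$-eigenspace of $\theta$: for the linear and symplectic groups the set of all real diagonal matrices in $\mathfrak g_n$; in the other cases the real span of the matrices $cE_{ij}+\bar cE_{ji}$ with $\{i,j\}$ in a maximal set of disjoint pairs of coordinates, where $c=1$ and $i,j$ have opposite signs for $SU$, $c=\sqrt{-1}$ for $SO(d;\mathbb C)$, and $c$ is the quaternion $\mathbf j$ for $SO^*$. Assume that the pairs are chosen coherently, i.e. $d\phi_{n+1,n}(\mathfrak a_n)\subset\mathfrak a_{n+1}$ for all $n$. Put $\mathfrak g=\varinjlim\mathfrak g_n$, $\mathfrak k=\varinjlim\mathfrak k_n$, $\mathfrak a=\varinjlim\mathfrak a_n$, and let $\mathfrak m$ be the centralizer of $\mathfrak a$ in $\mathfrak k$. Let $\Sigma(\mathfrak g_n,\mathfrak a_n)$ be the set of nonzero restricted roots. For an increasing sequence $\nu=(\nu_0<\nu_1<\cdots)$ let $$\Sigma_\nu(\mathfrak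 g,\mathfrak a)=\varprojlim_k\Sigma(\mathfrak g_{\nu_k},\mathfrak a_{\nu_k})=\{\gamma\in\mathfrak a^*:\ \gamma|_{\mathfrak a_{\nu_k}}\in\Sigma(\mathfrak g_{\nu_k},\mathfrak a_{\nu_k})\text{ for all sufficiently large }k\}.$$ For $\gamma\in\mathfrak a^*$ let $\mathfrak g^\gamma=\{\eta\in\mathfrak g: [\xi,\eta]=\gamma(\xi)\eta\text{ for all }\xi\in\mathfrak a\}$. Regard $\Sigma(\mathfrak g_n,\mathfrak a_n)$ as a subset of $\mathfrak a^*$, extending each root by zero on the orthogonal complement of $\mathfrak a_n$ in $\mathfrak a_m$ for every $m\ge n$, relative to the form $\operatorname{Re}\operatorname{tr}(XY)$, where quaternionic matrices are regarded as complex matrices of twice the size. **Proposition.** For every diagonal embedding direct system as above and every cofinal subsystem $\nu_0<\nu_1<\cdots$ (for instance the system itself, $\nu_k=k$) the following are equivalent. 1. The system is of classical type. 2. $\Sigma_\nu(\mathfrak g,\mathfrak a)$ is countable. 3. After passage to a suitable cofinal subsystem $\nu'$ of $\nu$, $\Sigma_{\nu'}(\mathfrak g,\mathfrak a)=\bigcup_{k\ge0}\Sigma(\mathfrak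 g_{\nu'_k},\mathfrak a_{\nu'_k})$. 4. $\mathfrak g$ is restricted-root-reductive, in the sense that $\mathfrak g=(\mathfrak m+\mathfrak a)+\sum_{\gamma\in\Sigma_\nu(\mathfrak g,\mathfrak a)}\mathfrak g^\gamma$. -/

import Mathlib

open scoped Matrix Quaternion

attribute [local instance] LieRing.ofAssociativeRing

/-! ## The scalars: real numbers, complex numbers and quaternions -/

/-- The data needed to treat matrices over the real numbers, the complex numbers and the quaternions
simultaneously: a realization `toC` of the scalars by complex `e × e` matrices (`e = 1` for `ℝ` and
`ℂ`, `e = 2` for the quaternions), and the anti-automorphism `tr` of the scalars that corresponds to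
the transposition of those complex matrices. -/
class ClassicalScalar (𝕂 : Type) [NormedRing 𝕂] [NormedAlgebra ℝ 𝕂] [StarRing 𝕂] where
  e : ℕ
  toC : 𝕂 →ₐ[ℝ] Matrix (Fin e) (Fin e) ℂ
  toC_injective : Function.Injective toC
  tr : 𝕂 → 𝕂
  toC_tr : ∀ q, toC (tr q) = (toC q)ᵀ
  toC_star : ∀ q, toC (star q) = (toC q)ᴴ

namespace ClassicalScalar

noncomputable instance instReal : ClassicalScalar ℝ where
  e := 1
  toC := Algebra.ofId ℝ (Matrix (Fin 1) (Fin 1) ℂ)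
  toC_injective := by
    intro x y h
    have := congrFun (congrFun h 0) 0
    simpa [Algebra.ofId_apply, Matrix.algebraMap_matrix_apply] using this
  tr q := q
  toC_tr q := by
    ext i j; simp [Algebra.ofId_apply, Matrix.algebraMap_matrix_apply, eq_comm]
  toC_star q := by
    ext i j; fin_cases i; fin_cases j
    simp [Algebra.ofId_apply, Matrix.algebraMap_matrix_apply]

noncomputable instance instComplex : ClassicalScalar ℂ where
  e := 1
  toC := (Algebra.ofId ℂ (Matrix (Fin 1) (Fin 1) ℂ)).restrictScalars ℝ
  toC_injective := by
    intro x y h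
    have := congrFun (congrFun h 0) 0
    simpa [Algebra.ofId_apply, Matrix.algebraMap_matrix_apply] using this
  tr q := q
  toC_tr q := by
    ext i j; simp [Algebra.ofId_apply, Matrix.algebraMap_matrix_apply, eq_comm]
  toC_star q := by
    ext i j; fin_cases i; fin_cases j
    simp [Algebra.ofId_apply, Matrix.algebraMap_matrix_apply]

/-- `a + bi + cj + dk` is realized by the complex matrix with rows `(a + bi, c + di)` and
`(-c + di, a - bi)`. -/
noncomputable instance instQuaternion : ClassicalScalar ℍ[ℝ] where
  e := 2
  toC :=
    { toFun := fun q => !![⟨q.re, q.imI⟩, ⟨q.imJ, q.imK⟩; ⟨-q.imJ, q.imK⟩, ⟨q.re, -q.imI⟩]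
      map_one' := by
        ext i j; fin_cases i <;> fin_cases j <;> simp [Complex.ext_iff]
      map_mul' := fun p q => by
        ext i j
        fin_cases i <;> fin_cases j <;> simp [Complex.ext_iff, Matrix.mul_apply] <;>
          constructor <;> ring
      map_zero' := by
        ext i j; fin_cases i <;> fin_cases j <;> simp [Complex.ext_iff]
      map_add' := fun p q => by
        ext i j
        fin_cases i <;> fin_cases j <;> simp [Complex.ext_iff] <;> ring
      commutes' := fun r => by
        ext i j
        fin_cases i <;> fin_cases j <;>
          simp [Complex.ext_iff, Matrix.algebraMap_matrix_apply] }
  toC_injective := by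
    intro p q h
    have h0 := congrFun (congrFun h 0) 0
    have h1 := congrFun (congrFun h 0) 1
    simp [Complex.ext_iff] at h0 h1
    ext <;> simp [h0, h1]
  tr q := ⟨q.re, q.imI, -q.imJ, q.imK⟩
  toC_tr q := by
    ext i j; fin_cases i <;> fin_cases j <;> simp
  toC_star q := by
    ext i j; fin_cases i <;> fin_cases j <;> simp [Complex.ext_iff]

end ClassicalScalar

/-! ## Exponentials of matrices -/

theorem matrix_hasSum_exp {𝕂 : Type} [NormedRing 𝕂] [NormedAlgebra ℝ 𝕂] [CompleteSpace 𝕂]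
    {n : Type} [Fintype n] [DecidableEq n] (X : Matrix n n 𝕂) :
    HasSum (fun k : ℕ => ((k.factorial : ℝ)⁻¹) • X ^ k) (NormedSpace.exp X) :=
  @NormedSpace.exp_series_hasSum_exp' ℝ (Matrix n n 𝕂) _ _ _ Matrix.linftyOpNormedRing
    Matrix.linftyOpNormedAlgebra (inferInstanceAs (CompleteSpace (n → n → 𝕂))) X

theorem matrix_hasDerivAt_exp {𝕂 : Type} [NormedRing 𝕂] [NormedAlgebra ℝ 𝕂] [CompleteSpace 𝕂]
    {n : Type} [Fintype n] [DecidableEq n] (X : Matrix n n 𝕂) (i j : n) :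
    HasDerivAt (fun t : ℝ => (NormedSpace.exp (t • X) : Matrix n n 𝕂) i j) (X i j) 0 := by
  have h := @hasDerivAt_exp_smul_const ℝ (Matrix n n 𝕂) _ Matrix.linftyOpNormedRing
    Matrix.linftyOpNormedAlgebra (inferInstanceAs (CompleteSpace (n → n → 𝕂))) X (0 : ℝ)
  let L : Matrix n n 𝕂 →ₗ[ℝ] 𝕂 := Matrix.entryLinearMap ℝ 𝕂 i j
  have hc : Continuous L := (continuous_apply j).comp (continuous_apply i)
  let := (Matrix.linftyOpNormedRing : NormedRing (Matrix n n 𝕂))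
  let := (Matrix.linftyOpNormedAlgebra : NormedAlgebra ℝ (Matrix n n 𝕂))
  have := (ContinuousLinearMap.mk L hc).hasFDerivAt.comp_hasDerivAt (0:ℝ) h
  simpa [L] using! this

theorem matrix_exp_add {𝕂 : Type} [NormedRing 𝕂] [NormedAlgebra ℝ 𝕂] [CompleteSpace 𝕂]
    {n : Type} [Fintype n] [DecidableEq n] (X : Matrix n n 𝕂) (s t : ℝ) :
    NormedSpace.exp ((s + t) • X) = NormedSpace.exp (s • X) * NormedSpace.exp (t • X) := by
  rw [add_smul]
  let _ : NormedAlgebra ℚ 𝕂 := NormedAlgebra.restrictScalars ℚ ℝ 𝕂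
  exact Matrix.exp_add_of_commute _ _ (((Commute.refl X).smul_left s).smul_right t)

theorem matrix_hasDerivAt_det_exp {n : Type} [Fintype n] [DecidableEq n] (X : Matrix n n ℂ)
    (t : ℝ) :
    HasDerivAt (fun t : ℝ => (NormedSpace.exp (t • X)).det)
      ((NormedSpace.exp (t • X)).det * X.trace) t := by
  have hd : Differentiable ℝ (fun M : n → n → ℂ => (Matrix.of M).det) := by
    simp only [Matrix.det_apply, Matrix.of_apply]
    fun_prop
  set D := fderiv ℝ (fun M : n → n → ℂ => (Matrix.of M).det) (1 : Matrix n n ℂ) with hD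
  have hdd : HasFDerivAt (fun M : n → n → ℂ => (Matrix.of M).det) D (1 : Matrix n n ℂ) :=
    (hd _).hasFDerivAt
  have h1 : HasDerivAt (fun u : ℝ => (fun i j => (1 + (u : ℂ) • X) i j : n → n → ℂ))
      (fun i j => X i j) 0 := by
    refine hasDerivAt_pi.2 fun i => hasDerivAt_pi.2 fun j => ?_
    simp only [Matrix.add_apply, Matrix.smul_apply, smul_eq_mul]
    simpa using ((Complex.ofRealCLM.hasDerivAt (x := (0 : ℝ))).mul_const (X i j)).const_add
      ((1 : Matrix n n ℂ) i j)
  have h2 : HasDerivAt (fun u : ℝ => (1 + (u : ℂ) • X).det) (D X) 0 := by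
    have := HasFDerivAt.comp_hasDerivAt (0 : ℝ) (f := fun u : ℝ =>
      (fun i j => (1 + (u : ℂ) • X) i j : n → n → ℂ)) (l := fun M : n → n → ℂ =>
        (Matrix.of M).det) (l' := D) (by simpa using! hdd) h1
    exact this
  have h3 : HasDerivAt (fun u : ℝ => (1 + (u : ℂ) • X).det) X.trace 0 := by
    let P := (1 + (Polynomial.X : Polynomial ℂ) • X.map ⇑Polynomial.C).det.divX.divX
    have hf : (fun u : ℝ => (1 + (u : ℂ) • X).det) =
        fun u : ℝ => 1 + X.trace * (u : ℂ) + P.eval (u : ℂ) * (u : ℂ) ^ 2 :=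
      funext fun u => Matrix.det_one_add_smul _ _
    rw [hf]
    have hr : HasDerivAt (fun u : ℝ => (u : ℂ)) 1 0 := by
      simpa using! Complex.ofRealCLM.hasDerivAt (x := (0 : ℝ))
    have hP : HasDerivAt (fun u : ℝ => P.eval (u : ℂ)) (P.derivative.eval ((0 : ℝ) : ℂ) * 1) 0 :=
      (P.hasDerivAt ((0 : ℝ) : ℂ)).comp_of_eq (0 : ℝ) hr rfl
    simpa using! ((hr.const_mul X.trace).const_add 1).add (hP.mul (hr.pow 2))
  have hDX : D X = X.trace := h2.unique h3
  have h0 : HasDerivAt (fun u : ℝ => (NormedSpace.exp (u • X)).det) X.trace 0 := by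
    have hE : HasDerivAt (fun u : ℝ => (fun i j => (NormedSpace.exp (u • X) : Matrix n n ℂ) i j :
        n → n → ℂ)) (fun i j => X i j) 0 :=
      hasDerivAt_pi.2 fun i => hasDerivAt_pi.2 fun j => matrix_hasDerivAt_exp X i j
    have := HasFDerivAt.comp_hasDerivAt (0 : ℝ) (f := fun u : ℝ =>
      (fun i j => (NormedSpace.exp (u • X) : Matrix n n ℂ) i j : n → n → ℂ))
      (l := fun M : n → n → ℂ =>
        (Matrix.of M).det) (l' := D) (by simpa using! hdd) hE
    rw [← hDX]
    exact this
  have h4 : (fun u : ℝ => (NormedSpace.exp (u • X)).det) =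
      fun u : ℝ => (NormedSpace.exp (t • X)).det * (NormedSpace.exp ((u - t) • X)).det := by
    funext u
    rw [← Matrix.det_mul, ← matrix_exp_add]
    simp
  rw [h4]
  have h5 : HasDerivAt (fun u : ℝ => (NormedSpace.exp ((u - t) • X)).det) X.trace t := by
    have := HasDerivAt.comp_sub_const (x := t) (a := t) (f := fun u : ℝ =>
      (NormedSpace.exp (u • X)).det) (f' := X.trace) (by simpa using h0)
    exact this
  exact h5.const_mul _

theorem matrix_det_exp_smul_eq_one_iff {n : Type} [Fintype n] [DecidableEq n]
    (X : Matrix n n ℂ) :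
    (∀ t : ℝ, (NormedSpace.exp (t • X)).det = 1) ↔ X.trace = 0 := by
  constructor
  · intro h
    have h0 := matrix_hasDerivAt_det_exp X 0
    simp only [h, one_mul] at h0
    exact h0.unique (hasDerivAt_const _ _)
  · intro h t
    have := is_const_of_deriv_eq_zero (f := fun t : ℝ => (NormedSpace.exp (t • X)).det)
      (fun t => (matrix_hasDerivAt_det_exp X t).differentiableAt)
      (fun t => by rw [(matrix_hasDerivAt_det_exp X t).deriv, h, mul_zero]) t 0
    simpa using this

theorem matrix_linear_exp {𝕂 𝕃 : Type} [NormedRing 𝕂] [NormedAlgebra ℝ 𝕂] [FiniteDimensional ℝ 𝕂]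
    [NormedRing 𝕃] [NormedAlgebra ℝ 𝕃] [FiniteDimensional ℝ 𝕃] {n m : Type} [Fintype n]
    [DecidableEq n] [Fintype m] [DecidableEq m] (L : Matrix n n 𝕂 →ₗ[ℝ] Matrix m m 𝕃)
    (X : Matrix n n 𝕂) (Y : Matrix m m 𝕃) (h : ∀ k : ℕ, L (X ^ k) = Y ^ k) :
    L (NormedSpace.exp X) = NormedSpace.exp Y := by
  have : CompleteSpace 𝕂 := FiniteDimensional.complete ℝ 𝕂
  have : CompleteSpace 𝕃 := FiniteDimensional.complete ℝ 𝕃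
  have hc : Continuous L := LinearMap.continuous_of_finiteDimensional L
  have h1 := (matrix_hasSum_exp X).map L hc
  have h2 := matrix_hasSum_exp Y
  refine h1.unique ?_
  convert h2 using 1
  funext k
  simp [h]

theorem matrix_exp_mul_mul_exp_iff {𝕂 : Type} [NormedRing 𝕂] [NormedAlgebra ℝ 𝕂] [CompleteSpace 𝕂]
    {n : Type} [Fintype n] [DecidableEq n] (X Y B : Matrix n n 𝕂) :
    (∀ t : ℝ, NormedSpace.exp (t • Y) * B * NormedSpace.exp (t • X) = B) ↔ Y * B + B * X = 0 := by
  have hinv : ∀ t : ℝ, NormedSpace.exp (t • X) * NormedSpace.exp (t • -X) = 1 := fun t => by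
    have := matrix_exp_add X t (-t)
    rw [add_neg_cancel, zero_smul, NormedSpace.exp_zero, neg_smul, ← smul_neg] at this
    exact this.symm
  have hinv' : ∀ t : ℝ, NormedSpace.exp (t • -X) * NormedSpace.exp (t • X) = 1 := fun t => by
    have := matrix_exp_add X (-t) t
    rw [neg_add_cancel, zero_smul, NormedSpace.exp_zero, neg_smul, ← smul_neg] at this
    exact this.symm
  constructor
  · intro h
    have h' : ∀ t : ℝ, NormedSpace.exp (t • Y) * B = B * NormedSpace.exp (t • -X) := fun t => by
      conv_rhs => rw [← h t]
      rw [mul_assoc, hinv, mul_one]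
    rw [← sub_neg_eq_add, ← mul_neg, sub_eq_zero]
    ext i j
    have h1 : HasDerivAt (fun t : ℝ => ∑ k, (NormedSpace.exp (t • Y) : Matrix n n 𝕂) i k * B k j)
        (∑ k, Y i k * B k j) 0 :=
      HasDerivAt.fun_sum fun k _ => (matrix_hasDerivAt_exp Y i k).mul_const (B k j)
    have h2 : HasDerivAt
        (fun t : ℝ => ∑ k, B i k * (NormedSpace.exp (t • -X) : Matrix n n 𝕂) k j)
        (∑ k, B i k * (-X) k j) 0 :=
      HasDerivAt.fun_sum fun k _ => (matrix_hasDerivAt_exp (-X) k j).const_mul (B i k)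
    have h3 : (fun t : ℝ => ∑ k, (NormedSpace.exp (t • Y) : Matrix n n 𝕂) i k * B k j) =
        fun t : ℝ => ∑ k, B i k * (NormedSpace.exp (t • -X) : Matrix n n 𝕂) k j := by
      funext t
      have := congrFun (congrFun (h' t) i) j
      simpa only [Matrix.mul_apply] using this
    rw [h3] at h1
    simpa only [Matrix.mul_apply] using h1.unique h2
  · intro h t
    have h0 : Y * B = B * -X := by
      rw [← sub_eq_zero, mul_neg, sub_neg_eq_add, h]
    have hk : ∀ k : ℕ, (t • Y) ^ k * B = B * (t • -X) ^ k := by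
      intro k
      induction k with
      | zero => simp
      | succ k ih =>
        rw [pow_succ, mul_assoc, smul_mul_assoc, h0, ← mul_smul_comm, ← mul_assoc, ih, mul_assoc,
          ← pow_succ]
    have h1 := (matrix_hasSum_exp (t • Y)).mul_right B
    have h2 := (matrix_hasSum_exp (t • -X)).mul_left B
    have h3 : NormedSpace.exp (t • Y) * B = B * NormedSpace.exp (t • -X) := by
      refine h1.unique ?_
      convert h2 using 1
      funext k
      rw [smul_mul_assoc, hk, mul_smul_comm]
    rw [h3, mul_assoc, hinv', mul_one]

/-! ## Classical groups and their Lie algebras -/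

section Classical

variable {𝕂 : Type} [NormedRing 𝕂] [NormedAlgebra ℝ 𝕂] [StarRing 𝕂] [ClassicalScalar 𝕂]

/-- A matrix over `𝕂`, seen as a complex matrix. -/
noncomputable def cmat (n : Type) [Fintype n] [DecidableEq n] :
    Matrix n n 𝕂 →ₐ[ℝ] Matrix (n × Fin (ClassicalScalar.e 𝕂)) (n × Fin (ClassicalScalar.e 𝕂)) ℂ :=
  (Matrix.compAlgEquiv n (Fin (ClassicalScalar.e 𝕂)) ℂ ℝ).toAlgHom.comp
    (ClassicalScalar.toC (𝕂 := 𝕂)).mapMatrix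

/-- The transpose of a matrix over `𝕂`; for quaternions this is the transpose of the associated
complex matrix of twice the size. -/
noncomputable def transp {n : Type} (M : Matrix n n 𝕂) : Matrix n n 𝕂 :=
  (M.map ClassicalScalar.tr)ᵀ

/-- The conjugate transpose if `sesq`, the transpose otherwise. -/
noncomputable def adj (sesq : Bool) {n : Type} (M : Matrix n n 𝕂) : Matrix n n 𝕂 :=
  if sesq then Mᴴ else transp M

section Lemmas

variable {n : Type} [Fintype n] [DecidableEq n]

theorem cmat_injective : Function.Injective (cmat (𝕂 := 𝕂) n) := by
  intro M N h
  ext i j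
  apply ClassicalScalar.toC_injective
  ext a b
  exact congrFun (congrFun h (i, a)) (j, b)

theorem cmat_transp (M : Matrix n n 𝕂) : cmat n (transp M) = (cmat n M)ᵀ := by
  ext ⟨i, a⟩ ⟨j, b⟩
  exact congrFun (congrFun (ClassicalScalar.toC_tr (M j i)) a) b

theorem cmat_conjTranspose (M : Matrix n n 𝕂) : cmat n Mᴴ = (cmat n M)ᴴ := by
  ext ⟨i, a⟩ ⟨j, b⟩
  exact congrFun (congrFun (ClassicalScalar.toC_star (M j i)) a) b

theorem cmat_adj (sesq : Bool) (M : Matrix n n 𝕂) :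
    cmat n (adj sesq M) = if sesq then (cmat n M)ᴴ else (cmat n M)ᵀ := by
  cases sesq
  · simp [adj, cmat_transp]
  · simp [adj, cmat_conjTranspose]

theorem adj_mul (sesq : Bool) (M N : Matrix n n 𝕂) :
    adj sesq (M * N) = adj sesq N * adj sesq M := by
  apply cmat_injective
  cases sesq <;> simp [cmat_adj, map_mul]

theorem adj_one (sesq : Bool) : adj sesq (1 : Matrix n n 𝕂) = 1 := by
  apply cmat_injective
  cases sesq <;> simp [cmat_adj]

theorem adj_add (sesq : Bool) (M N : Matrix n n 𝕂) :
    adj sesq (M + N) = adj sesq M + adj sesq N := by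
  apply cmat_injective
  cases sesq <;> simp [cmat_adj, map_add]

theorem adj_smul (sesq : Bool) (c : ℝ) (M : Matrix n n 𝕂) :
    adj sesq (c • M) = c • adj sesq M := by
  apply cmat_injective
  cases sesq <;> simp [cmat_adj]

theorem adj_neg (sesq : Bool) (M : Matrix n n 𝕂) : adj sesq (-M) = -adj sesq M := by
  have := adj_smul sesq (-1) M
  simpa using this

theorem adj_adj (sesq : Bool) (M : Matrix n n 𝕂) : adj sesq (adj sesq M) = M := by
  apply cmat_injective
  cases sesq <;> simp [cmat_adj]

/-- `adj` as a real linear map. -/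
noncomputable def adjLinear (sesq : Bool) : Matrix n n 𝕂 →ₗ[ℝ] Matrix n n 𝕂 where
  toFun := adj sesq
  map_add' := adj_add sesq
  map_smul' := adj_smul sesq

theorem adj_pow (sesq : Bool) (M : Matrix n n 𝕂) (k : ℕ) :
    adj sesq (M ^ k) = adj sesq M ^ k := by
  induction k with
  | zero => simp [adj_one]
  | succ k ih => rw [pow_succ, adj_mul, ih, ← pow_succ']

theorem adj_exp [FiniteDimensional ℝ 𝕂] (sesq : Bool) (M : Matrix n n 𝕂) :
    adj sesq (NormedSpace.exp M) = NormedSpace.exp (adj sesq M) :=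
  matrix_linear_exp (adjLinear sesq) M _ fun k => adj_pow sesq M k

theorem cmat_exp [FiniteDimensional ℝ 𝕂] (M : Matrix n n 𝕂) :
    cmat n (NormedSpace.exp M) = NormedSpace.exp (cmat n M) :=
  matrix_linear_exp (cmat n).toLinearMap M _ fun k => map_pow (cmat n) M k

end Lemmas

/-- The group of all invertible matrices `g` over `𝕂` that have determinant one (for quaternions:
whose associated complex matrix has determinant one) and that preserve the bilinear or sesquilinear
form with matrix `B`, i.e. `g* B g = B`. For `B = 0` the second condition is void. -/
noncomputable def classicalGroup {n : Type} [Fintype n] [DecidableEq n] (sesq : Bool)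
    (B : Matrix n n 𝕂) : Subgroup (Matrix n n 𝕂)ˣ where
  carrier := {g | (cmat n (g : Matrix n n 𝕂)).det = 1 ∧
    adj sesq (g : Matrix n n 𝕂) * B * (g : Matrix n n 𝕂) = B}
  one_mem' := by simp [adj_one]
  mul_mem' := by
    rintro g h ⟨hg, hg'⟩ ⟨hh, hh'⟩
    refine ⟨by simp [map_mul, hg, hh], ?_⟩
    calc adj sesq ((g * h : (Matrix n n 𝕂)ˣ) : Matrix n n 𝕂) * B * (g * h : (Matrix n n 𝕂)ˣ)
        = adj sesq (h : Matrix n n 𝕂) * (adj sesq (g : Matrix n n 𝕂) * B * g) * h := by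
          simp only [Units.val_mul, adj_mul, mul_assoc]
      _ = B := by rw [hg', hh']
  inv_mem' := by
    rintro g ⟨hg, hg'⟩
    refine ⟨?_, ?_⟩
    · have h1 : (cmat n ((g⁻¹ : (Matrix n n 𝕂)ˣ) : Matrix n n 𝕂)).det *
          (cmat n (g : Matrix n n 𝕂)).det = 1 := by
        rw [← Matrix.det_mul, ← map_mul, Units.inv_mul, map_one, Matrix.det_one]
      rwa [hg, mul_one] at h1
    · have h1 : adj sesq ((g⁻¹ : (Matrix n n 𝕂)ˣ) : Matrix n n 𝕂) * adj sesq (g : Matrix n n 𝕂) = 1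
          := by rw [← adj_mul, Units.mul_inv, adj_one]
      calc adj sesq ((g⁻¹ : (Matrix n n 𝕂)ˣ) : Matrix n n 𝕂) * B * (g⁻¹ : (Matrix n n 𝕂)ˣ)
          = adj sesq ((g⁻¹ : (Matrix n n 𝕂)ˣ) : Matrix n n 𝕂) *
            (adj sesq (g : Matrix n n 𝕂) * B * g) * (g⁻¹ : (Matrix n n 𝕂)ˣ) := by rw [hg']
        _ = (adj sesq ((g⁻¹ : (Matrix n n 𝕂)ˣ) : Matrix n n 𝕂) * adj sesq (g : Matrix n n 𝕂)) *
            B * (g * (g⁻¹ : (Matrix n n 𝕂)ˣ)) := by simp only [mul_assoc]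
        _ = B := by rw [h1, Units.mul_inv, one_mul, mul_one]

/-- `X` generates a one-parameter subgroup of the matrix group `G`. -/
def GeneratesOneParameterSubgroup {n : Type} [Fintype n] [DecidableEq n]
    (G : Subgroup (Matrix n n 𝕂)ˣ) (X : Matrix n n 𝕂) : Prop :=
  ∀ t : ℝ, ∃ g ∈ G, (g : Matrix n n 𝕂) = NormedSpace.exp (t • X)

/-- The linear equations that describe the Lie algebra of a classical group. -/
theorem generates_classicalGroup_iff [FiniteDimensional ℝ 𝕂] {n : Type} [Fintype n] [DecidableEq n]
    (sesq : Bool) (B X : Matrix n n 𝕂) :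
    GeneratesOneParameterSubgroup (classicalGroup sesq B) X ↔
      (cmat n X).trace = 0 ∧ adj sesq X * B + B * X = 0 := by
  have : CompleteSpace 𝕂 := FiniteDimensional.complete ℝ 𝕂
  rw [← matrix_det_exp_smul_eq_one_iff, ← matrix_exp_mul_mul_exp_iff, ← forall_and]
  refine forall_congr' fun t => ?_
  rw [← adj_smul, ← adj_exp, ← map_smul, ← cmat_exp]
  constructor
  · rintro ⟨g, hg, hgt⟩
    rw [← hgt]
    exact hg
  · intro h
    have h1 : NormedSpace.exp (t • X) * NormedSpace.exp ((-t) • X) = 1 := by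
      rw [← matrix_exp_add, add_neg_cancel, zero_smul, NormedSpace.exp_zero]
    have h2 : NormedSpace.exp ((-t) • X) * NormedSpace.exp (t • X) = 1 := by
      rw [← matrix_exp_add, neg_add_cancel, zero_smul, NormedSpace.exp_zero]
    exact ⟨⟨_, _, h1, h2⟩, h, rfl⟩

/-- The Lie algebra of a classical group: all `X` such that `exp (t X)` is in the group for every
real number `t`. -/
noncomputable def classicalLie [FiniteDimensional ℝ 𝕂] {n : Type} [Fintype n] [DecidableEq n]
    (sesq : Bool) (B : Matrix n n 𝕂) : LieSubalgebra ℝ (Matrix n n 𝕂) where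
  carrier := {X | GeneratesOneParameterSubgroup (classicalGroup sesq B) X}
  zero_mem' := by
    rw [Set.mem_ofPred_eq, generates_classicalGroup_iff]
    have : adj sesq (0 : Matrix n n 𝕂) = 0 := by simpa using adj_smul sesq 0 (0 : Matrix n n 𝕂)
    simp [this]
  add_mem' := by
    intro X Y hX hY
    rw [Set.mem_ofPred_eq, generates_classicalGroup_iff] at *
    refine ⟨by rw [map_add, Matrix.trace_add, hX.1, hY.1, add_zero], ?_⟩
    rw [adj_add, add_mul, mul_add, add_add_add_comm, hX.2, hY.2, add_zero]
  smul_mem' := by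
    intro c X hX
    rw [Set.mem_ofPred_eq, generates_classicalGroup_iff] at *
    refine ⟨by rw [map_smul, Matrix.trace_smul, hX.1, smul_zero], ?_⟩
    rw [adj_smul, smul_mul_assoc, mul_smul_comm, ← smul_add, hX.2, smul_zero]
  lie_mem' := by
    intro X Y hX hY
    rw [Set.mem_ofPred_eq, generates_classicalGroup_iff] at *
    have hX2 : adj sesq X * B = -(B * X) := eq_neg_of_add_eq_zero_left hX.2
    have hY2 : adj sesq Y * B = -(B * Y) := eq_neg_of_add_eq_zero_left hY.2
    refine ⟨?_, ?_⟩
    · rw [Ring.lie_def, map_sub, map_mul, map_mul, Matrix.trace_sub, Matrix.trace_mul_comm,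
        sub_self]
    · rw [Ring.lie_def, sub_eq_add_neg, adj_add, adj_neg, adj_mul, adj_mul, add_mul, neg_mul,
        mul_assoc, mul_assoc, hX2, hY2, mul_neg, mul_neg, ← mul_assoc, ← mul_assoc, hX2, hY2]
      noncomm_ring

end Classical

/-! ## Diagonal embeddings -/

/-- The sizes of a system of diagonal embeddings: a positive size `N₀` to start with and, in step
`n`, `t' n` entries `1`, then `r n` copies of a matrix, then `s n` copies of its image under an
automorphism, then `t'' n` entries `1`. -/
structure BlockData where
  N₀ : ℕ
  N₀_pos : 0 < N₀
  t' : ℕ → ℕ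
  r : ℕ → ℕ
  s : ℕ → ℕ
  t'' : ℕ → ℕ
  rs_pos : ∀ n, 0 < r n + s n

namespace BlockData

variable (D : BlockData)

/-- The size of the matrices at level `n`. -/
def size : ℕ → ℕ
  | 0 => D.N₀
  | n + 1 => D.t' n + (size n * (D.r n + D.s n) + D.t'' n)

/-- `r n + s n = 1` for all sufficiently large `n`. -/
def IsClassical : Prop := ∃ n₀, ∀ n, n₀ ≤ n → D.r n + D.s n = 1

/-- The division of the indices at level `n + 1` into `t' n` indices, then `r n + s n`
consecutive blocks that are copies of the indices at level `n`, then `t'' n` indices. -/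
def split (n : ℕ) :
    Fin (D.t' n) ⊕ ((Fin (D.size n) × Fin (D.r n + D.s n)) ⊕ Fin (D.t'' n)) ≃
      Fin (D.size (n + 1)) :=
  (Equiv.sumCongr (Equiv.refl _)
    ((Equiv.sumCongr ((Equiv.prodComm _ _).trans (finProdFinEquiv.trans
      (finCongr (Nat.mul_comm _ _)))) (Equiv.refl _)).trans finSumFinEquiv)).trans
    (finSumFinEquiv : _ ≃ Fin (D.t' n + (D.size n * (D.r n + D.s n) + D.t'' n)))

/-- The block diagonal matrix with blocks `A`, `X 0`, `X 1`, ..., `C`. -/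
def blk {R : Type} [Zero R] (n : ℕ) (A : Matrix (Fin (D.t' n)) (Fin (D.t' n)) R)
    (X : Fin (D.r n + D.s n) → Matrix (Fin (D.size n)) (Fin (D.size n)) R)
    (C : Matrix (Fin (D.t'' n)) (Fin (D.t'' n)) R) :
    Matrix (Fin (D.size (n + 1))) (Fin (D.size (n + 1))) R :=
  Matrix.reindex (D.split n) (D.split n)
    (Matrix.fromBlocks A 0 0 (Matrix.fromBlocks (Matrix.blockDiagonal X) 0 0 C))

/-- A sequence of integer matrices, each of which is the orthogonal sum of copies of its predecessor
and of given matrices. -/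
def form (B₀ : Matrix (Fin D.N₀) (Fin D.N₀) ℤ)
    (B' : ∀ n, Matrix (Fin (D.t' n)) (Fin (D.t' n)) ℤ)
    (B'' : ∀ n, Matrix (Fin (D.t'' n)) (Fin (D.t'' n)) ℤ) :
    ∀ n, Matrix (Fin (D.size n)) (Fin (D.size n)) ℤ
  | 0 => B₀
  | n + 1 => D.blk n (B' n) (fun _ => form B₀ B' B'' n) (B'' n)

section

variable {D}

theorem blk_mul {R : Type} [Ring R] {n : ℕ} (A A' : Matrix (Fin (D.t' n)) (Fin (D.t' n)) R)
    (X X' : Fin (D.r n + D.s n) → Matrix (Fin (D.size n)) (Fin (D.size n)) R)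
    (C C' : Matrix (Fin (D.t'' n)) (Fin (D.t'' n)) R) :
    D.blk n A X C * D.blk n A' X' C' = D.blk n (A * A') (fun b => X b * X' b) (C * C') := by
  simp only [blk, Matrix.reindex_apply, Matrix.submatrix_mul_equiv, Matrix.fromBlocks_multiply]
  simp [Matrix.blockDiagonal_mul]

theorem blk_one {R : Type} [Ring R] {n : ℕ} :
    D.blk n (1 : Matrix _ _ R) (fun _ => 1) 1 = 1 := by
  have : (Matrix.blockDiagonal fun _ : Fin (D.r n + D.s n) =>
    (1 : Matrix (Fin (D.size n)) (Fin (D.size n)) R)) = 1 := Matrix.blockDiagonal_one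
  simp [blk, this]

theorem blk_add {R : Type} [Ring R] {n : ℕ} (A A' : Matrix (Fin (D.t' n)) (Fin (D.t' n)) R)
    (X X' : Fin (D.r n + D.s n) → Matrix (Fin (D.size n)) (Fin (D.size n)) R)
    (C C' : Matrix (Fin (D.t'' n)) (Fin (D.t'' n)) R) :
    D.blk n A X C + D.blk n A' X' C' = D.blk n (A + A') (fun b => X b + X' b) (C + C') := by
  have := Matrix.blockDiagonal_add X X'
  have h2 : (fun b => X b + X' b) = X + X' := rfl
  rw [h2]
  ext i j
  simp only [blk, Matrix.reindex_apply, Matrix.submatrix_apply, Matrix.add_apply, this]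
  rcases (D.split n).symm i with i | i | i <;> rcases (D.split n).symm j with j | j | j <;> simp

theorem blk_smul {R S : Type} [Ring R] [Monoid S] [DistribMulAction S R] {n : ℕ} (c : S)
    (A : Matrix (Fin (D.t' n)) (Fin (D.t' n)) R)
    (X : Fin (D.r n + D.s n) → Matrix (Fin (D.size n)) (Fin (D.size n)) R)
    (C : Matrix (Fin (D.t'' n)) (Fin (D.t'' n)) R) :
    c • D.blk n A X C = D.blk n (c • A) (fun b => c • X b) (c • C) := by
  ext i j
  simp only [blk, Matrix.reindex_apply, Matrix.submatrix_apply, Matrix.smul_apply]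
  rcases (D.split n).symm i with i | i | i <;> rcases (D.split n).symm j with j | j | j <;>
    simp [Matrix.blockDiagonal_apply, smul_ite]

theorem blk_map {R S : Type} [Zero R] [Zero S] {n : ℕ} (f : R → S) (hf : f 0 = 0)
    (A : Matrix (Fin (D.t' n)) (Fin (D.t' n)) R)
    (X : Fin (D.r n + D.s n) → Matrix (Fin (D.size n)) (Fin (D.size n)) R)
    (C : Matrix (Fin (D.t'' n)) (Fin (D.t'' n)) R) :
    (D.blk n A X C).map f = D.blk n (A.map f) (fun b => (X b).map f) (C.map f) := by
  ext i j
  simp only [blk, Matrix.reindex_apply, Matrix.submatrix_apply, Matrix.map_apply]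
  rcases (D.split n).symm i with i | i | i <;> rcases (D.split n).symm j with j | j | j <;>
    simp [Matrix.blockDiagonal_apply, hf, apply_ite f]

theorem blk_transpose {R : Type} [Zero R] {n : ℕ}
    (A : Matrix (Fin (D.t' n)) (Fin (D.t' n)) R)
    (X : Fin (D.r n + D.s n) → Matrix (Fin (D.size n)) (Fin (D.size n)) R)
    (C : Matrix (Fin (D.t'' n)) (Fin (D.t'' n)) R) :
    (D.blk n A X C)ᵀ = D.blk n Aᵀ (fun b => (X b)ᵀ) Cᵀ := by
  simp [blk, Matrix.fromBlocks_transpose, Matrix.blockDiagonal_transpose]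

theorem exp_blk_zero {𝕂 : Type} [NormedRing 𝕂] [NormedAlgebra ℝ 𝕂] [CompleteSpace 𝕂] {n : ℕ}
    (X : Fin (D.r n + D.s n) → Matrix (Fin (D.size n)) (Fin (D.size n)) 𝕂) :
    NormedSpace.exp (D.blk n 0 X 0) = D.blk n 1 (fun b => NormedSpace.exp (X b)) 1 := by
  have hpow : ∀ k : ℕ, D.blk n 0 X 0 ^ k = D.blk n (0 ^ k) (fun b => X b ^ k) (0 ^ k) := by
    intro k
    induction k with
    | zero => simp [blk_one]
    | succ k ih => rw [pow_succ, ih, blk_mul]; simp [pow_succ]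
  refine (matrix_hasSum_exp (D.blk n 0 X 0)).unique ?_
  have h1 := matrix_hasSum_exp (0 : Matrix (Fin (D.t' n)) (Fin (D.t' n)) 𝕂)
  have h3 := matrix_hasSum_exp (0 : Matrix (Fin (D.t'' n)) (Fin (D.t'' n)) 𝕂)
  have h2 := fun b => matrix_hasSum_exp (X b)
  rw [NormedSpace.exp_zero] at h1 h3
  simp only [hpow, blk_smul]
  refine Pi.hasSum.2 fun i => Pi.hasSum.2 fun j => ?_
  simp only [blk, Matrix.reindex_apply, Matrix.submatrix_apply]
  rcases (D.split n).symm i with i | ⟨i, x⟩ | i <;>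
    rcases (D.split n).symm j with j | ⟨j, y⟩ | j <;>
    simp only [Matrix.fromBlocks_apply₁₁, Matrix.fromBlocks_apply₁₂, Matrix.fromBlocks_apply₂₁,
        Matrix.fromBlocks_apply₂₂, Matrix.zero_apply, Matrix.blockDiagonal_apply] <;>
    first
      | exact hasSum_zero
      | exact Pi.hasSum.1 (Pi.hasSum.1 h1 i) j
      | exact Pi.hasSum.1 (Pi.hasSum.1 h3 i) j
      | skip
  split_ifs
  · exact Pi.hasSum.1 (Pi.hasSum.1 (h2 x) i) j
  · exact hasSum_zero

variable {𝕂 : Type} [NormedRing 𝕂] [NormedAlgebra ℝ 𝕂] [StarRing 𝕂] [ClassicalScalar 𝕂]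

theorem scalar_tr_zero : ClassicalScalar.tr (0 : 𝕂) = 0 := by
  apply ClassicalScalar.toC_injective
  simp [ClassicalScalar.toC_tr]

theorem adj_blk (sesq : Bool) {n : ℕ} (A : Matrix (Fin (D.t' n)) (Fin (D.t' n)) 𝕂)
    (X : Fin (D.r n + D.s n) → Matrix (Fin (D.size n)) (Fin (D.size n)) 𝕂)
    (C : Matrix (Fin (D.t'' n)) (Fin (D.t'' n)) 𝕂) :
    adj sesq (D.blk n A X C) = D.blk n (adj sesq A) (fun b => adj sesq (X b)) (adj sesq C) := by
  cases sesq
  · simp only [adj, transp, Bool.false_eq_true, if_false]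
    rw [blk_map _ scalar_tr_zero, blk_transpose]
  · simp only [adj, if_true, Matrix.conjTranspose]
    rw [blk_transpose, blk_map _ (star_zero 𝕂)]

theorem det_cmat_blk {n : ℕ} (A : Matrix (Fin (D.t' n)) (Fin (D.t' n)) 𝕂)
    (X : Fin (D.r n + D.s n) → Matrix (Fin (D.size n)) (Fin (D.size n)) 𝕂)
    (C : Matrix (Fin (D.t'' n)) (Fin (D.t'' n)) 𝕂) :
    (cmat _ (D.blk n A X C)).det =
      (cmat _ A).det * ((∏ b, (cmat _ (X b)).det) * (cmat _ C).det) := by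
  let ε := Fin (ClassicalScalar.e 𝕂)
  let E : Fin (D.t' n) × ε ⊕ (((Fin (D.size n) × ε) × Fin (D.r n + D.s n)) ⊕ Fin (D.t'' n) × ε) ≃
      Fin (D.size (n + 1)) × ε :=
    (Equiv.sumCongr (Equiv.refl _) ((Equiv.sumCongr ((Equiv.prodAssoc _ _ _).trans
      ((Equiv.prodCongr (Equiv.refl _) (Equiv.prodComm _ _)).trans
        (Equiv.prodAssoc _ _ _).symm)) (Equiv.refl _)).trans
          (Equiv.sumProdDistrib _ _ _).symm)).trans ((Equiv.sumProdDistrib _ _ _).symm.trans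
            (Equiv.prodCongr (D.split n) (Equiv.refl _)))
  have h : (cmat _ (D.blk n A X C)).submatrix E E =
      Matrix.fromBlocks (cmat _ A) 0 0
        (Matrix.fromBlocks (Matrix.blockDiagonal fun b => cmat _ (X b)) 0 0 (cmat _ C)) := by
    have hz : ∀ a b, ClassicalScalar.toC (0 : 𝕂) a b = 0 := by simp
    ext i j
    have hc : ∀ i j : Fin (D.size (n + 1)) × ε, cmat _ (D.blk n A X C) i j =
      ClassicalScalar.toC (D.blk n A X C i.1 j.1) i.2 j.2 := fun _ _ => rfl
    have hb : ∀ u v, D.blk n A X C (D.split n u) (D.split n v) =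
        Matrix.fromBlocks A 0 0 (Matrix.fromBlocks (Matrix.blockDiagonal X) 0 0 C) u v := by
      intro u v; simp [blk]
    rw [Matrix.submatrix_apply, hc]
    rcases i with ⟨i, a⟩ | ⟨⟨i, a⟩, x⟩ | ⟨i, a⟩ <;> rcases j with ⟨j, b⟩ | ⟨⟨j, b⟩, y⟩ | ⟨j, b⟩ <;>
      simp only [E, Equiv.trans_apply, Equiv.sumCongr_apply, Sum.map_inl, Sum.map_inr,
        Equiv.refl_apply, Equiv.sumProdDistrib_symm_apply_left,
        Equiv.sumProdDistrib_symm_apply_right, Equiv.prodCongr_apply, Prod.map, hb,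
        Equiv.prodAssoc_apply, Equiv.prodComm_apply, Equiv.prodAssoc_symm_apply, Prod.swap] <;>
      simp only [Matrix.fromBlocks_apply₁₁, Matrix.fromBlocks_apply₁₂, Matrix.fromBlocks_apply₂₁,
        Matrix.fromBlocks_apply₂₂, Matrix.zero_apply, hz, Matrix.blockDiagonal_apply] <;>
      first
        | rfl
        | (split_ifs <;> first | rfl | exact hz _ _)
  rw [← Matrix.det_submatrix_equiv_self E, h, Matrix.det_fromBlocks_zero₂₁,
    Matrix.det_fromBlocks_zero₂₁, Matrix.det_blockDiagonal]

end

end BlockData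

/-! ## Direct limits of real Lie algebras and their restricted roots -/

/-- A sequence of real Lie algebras and homomorphisms, together with, at each level, the subalgebra
`k` of fixed points of a Cartan involution, a subspace `a` and an invariant bilinear form. This is
only used for the sequences built from diagonal embeddings below. -/
structure LieTower where
  L : ℕ → Type
  [lieRing : ∀ n, LieRing (L n)]
  [lieAlgebra : ∀ n, LieAlgebra ℝ (L n)]
  f : ∀ n, L n →ₗ⁅ℝ⁆ L (n + 1)
  k : ∀ n, Submodule ℝ (L n)
  a : ∀ n, Submodule ℝ (L n)
  form : ∀ n, L n → L n → ℝ

namespace LieTower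

attribute [instance] LieTower.lieRing LieTower.lieAlgebra

variable (T : LieTower)

/-- The homomorphisms `L m → L n` for `m ≤ n`. -/
def trans (m n : ℕ) (h : m ≤ n) : T.L m →ₗ⁅ℝ⁆ T.L n :=
  Nat.leRec (motive := fun n _ => T.L m →ₗ⁅ℝ⁆ T.L n) LieHom.id (fun n _ g => (T.f n).comp g) h

theorem trans_self (m : ℕ) : T.trans m m le_rfl = LieHom.id := by
  simp [trans]

theorem trans_succ (m n : ℕ) (h : m ≤ n) :
    T.trans m (n + 1) (h.trans (Nat.le_succ n)) = (T.f n).comp (T.trans m n h) := by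
  simp only [trans]
  rw [Nat.leRec_succ]

instance : DirectedSystem T.L (T.trans · · ·) where
  map_self := fun i x => by rw [trans_self]; rfl
  map_map := fun k j i hij hjk x => by
    induction hjk with
    | refl => rw [trans_self]; rfl
    | step h ih =>
      rw [T.trans_succ _ _ h, T.trans_succ _ _ (hij.trans h), LieHom.comp_apply, ih,
        LieHom.comp_apply]

/-- The direct limit of the Lie algebras. -/
abbrev Limit : Type := DirectLimit T.L T.trans

noncomputable instance : Bracket T.Limit T.Limit where
  bracket := DirectLimit.map₂ T.trans T.trans T.trans (fun _ x y => ⁅x, y⁆)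
    fun i j h x y => LieHom.map_lie (T.trans i j h) x y

theorem bracket_def (n : ℕ) (x y : T.L n) :
    (⁅(⟦⟨n, x⟩⟧ : T.Limit), (⟦⟨n, y⟩⟧ : T.Limit)⁆ : T.Limit) = ⟦⟨n, ⁅x, y⁆⟩⟧ :=
  DirectLimit.map₂_def ..

noncomputable instance : LieRing T.Limit where
  add_lie := DirectLimit.induction₃ _ fun i x y z => by
    simp only [DirectLimit.add_def, bracket_def, add_lie]
  lie_add := DirectLimit.induction₃ _ fun i x y z => by
    simp only [DirectLimit.add_def, bracket_def, lie_add]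
  lie_self := DirectLimit.induction _ fun i x => by
    simp only [bracket_def, lie_self, ← DirectLimit.zero_def]
  leibniz_lie := DirectLimit.induction₃ _ fun i x y z => by
    simp only [DirectLimit.add_def, bracket_def]
    rw [leibniz_lie]

noncomputable instance : LieAlgebra ℝ T.Limit where
  lie_smul := fun c => DirectLimit.induction₂ _ fun i x y => by
    simp only [DirectLimit.smul_def, bracket_def, lie_smul]

/-- The canonical homomorphism from level `n` to the limit. -/
noncomputable def of (n : ℕ) : T.L n →ₗ⁅ℝ⁆ T.Limit where
  toFun x := ⟦⟨n, x⟩⟧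
  map_add' x y := (DirectLimit.add_def n x y).symm
  map_smul' c x := (DirectLimit.smul_def n x c).symm
  map_lie' {x y} := (T.bracket_def n x y).symm

/-- The homomorphisms map each `a n` into `a (n + 1)`. -/
def Aligned : Prop := ∀ n, (T.a n).map (T.f n : T.L n →ₗ[ℝ] T.L (n + 1)) ≤ T.a (n + 1)

/-- The restricted root system `Σ(L n, a n)`. -/
def roots (n : ℕ) : Set (Module.Dual ℝ (T.a n)) :=
  {γ | γ ≠ 0 ∧ ∃ η : T.L n, η ≠ 0 ∧ ∀ ξ : T.a n, ⁅(ξ : T.L n), η⁆ = γ ξ • η}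

/-- The limit of the `a n`. -/
noncomputable def limitA : Submodule ℝ T.Limit :=
  ⨆ n, (T.a n).map (T.of n : T.L n →ₗ[ℝ] T.Limit)

/-- The limit of the `k n`. -/
noncomputable def limitK : Submodule ℝ T.Limit :=
  ⨆ n, (T.k n).map (T.of n : T.L n →ₗ[ℝ] T.Limit)

/-- The centralizer `m` of `a` in `k`, in the limit. -/
noncomputable def limitM : Submodule ℝ T.Limit where
  carrier := {x | x ∈ T.limitK ∧ ∀ ξ ∈ T.limitA, ⁅ξ, x⁆ = 0}
  zero_mem' := ⟨Submodule.zero_mem _, fun ξ _ => lie_zero ξ⟩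
  add_mem' := fun ⟨hx, hx'⟩ ⟨hy, hy'⟩ =>
    ⟨Submodule.add_mem _ hx hy, fun ξ hξ => by rw [lie_add, hx' ξ hξ, hy' ξ hξ, add_zero]⟩
  smul_mem' := fun c _ ⟨hx, hx'⟩ =>
    ⟨Submodule.smul_mem _ c hx, fun ξ hξ => by rw [lie_smul, hx' ξ hξ, smul_zero]⟩

/-- The canonical map from `a n` to the limit `a`. -/
noncomputable def ofA (n : ℕ) : T.a n →ₗ[ℝ] T.limitA :=
  (T.of n : T.L n →ₗ[ℝ] T.Limit).restrict fun _ hx =>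
    (le_iSup (fun n => (T.a n).map (T.of n : T.L n →ₗ[ℝ] T.Limit)) n)
      (Submodule.mem_map_of_mem hx)

/-- The restriction of a linear functional on the limit `a` to `a n`. -/
noncomputable def res (n : ℕ) (γ : Module.Dual ℝ T.limitA) : Module.Dual ℝ (T.a n) :=
  γ ∘ₗ T.ofA n

/-- The inverse limit of the restricted root systems along the levels `ν 0, ν 1, ...`: the linear
functionals on the limit `a` whose restrictions to `a (ν k)` are roots for all large `k`. -/
def limitRoots (ν : ℕ → ℕ) : Set (Module.Dual ℝ T.limitA) :=
  {γ | ∀ᶠ k in Filter.atTop, T.res (ν k) γ ∈ T.roots (ν k)}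

/-- The root system `Σ(L n, a n)` as a set of functionals on the limit `a`: every root is extended
by zero on the orthogonal complements of `a n` in the `a m`, `m ≥ n`. -/
def extendedRoots (n : ℕ) : Set (Module.Dual ℝ T.limitA) :=
  {γ | T.res n γ ∈ T.roots n ∧ ∀ (m : ℕ) (h : n ≤ m) (y : T.a m),
    (∀ x ∈ T.a n, T.form m (T.trans n m h x) y = 0) → T.res m γ y = 0}

/-- The joint eigenspace of the limit `a` for the functional `γ`. -/
noncomputable def rootSpace (γ : Module.Dual ℝ T.limitA) : Submodule ℝ T.Limit where
  carrier := {η | ∀ ξ : T.limitA, ⁅(ξ : T.Limit), η⁆ = γ ξ • η}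
  zero_mem' := fun ξ => by rw [lie_zero, smul_zero]
  add_mem' := fun hx hy ξ => by rw [lie_add, hx ξ, hy ξ, smul_add]
  smul_mem' := fun c _ hx ξ => by rw [lie_smul, hx ξ, smul_comm]

/-- The limit Lie algebra is `(m + a)` plus the sum of the root spaces. -/
def RestrictedRootReductive (ν : ℕ → ℕ) : Prop :=
  (T.limitM ⊔ T.limitA) ⊔ (⨆ γ ∈ T.limitRoots ν, T.rootSpace γ) = ⊤

end LieTower

/-! ## Automorphisms -/

/-- Orthogonal integer matrices; these are the matrices of permutations of the coordinates combined
with sign changes. -/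
def SignedPerm (N : ℕ) : Type := {w : Matrix (Fin N) (Fin N) ℤ // w * wᵀ = 1}

namespace SignedPerm

/-- The matrix `J` with ones on the antidiagonal and zeros elsewhere. -/
def reversal (N : ℕ) : SignedPerm N :=
  ⟨Matrix.of fun i j => if j = i.rev then 1 else 0, by
    ext i j
    simp [Matrix.mul_apply, Matrix.one_apply, Fin.rev_inj, eq_comm]⟩

variable {𝕂 : Type} [NormedRing 𝕂] [NormedAlgebra ℝ 𝕂] [StarRing 𝕂] [ClassicalScalar 𝕂] {N : ℕ}

/-- A signed permutation as an invertible matrix over `𝕂`. -/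
noncomputable def unit (𝕂 : Type) [NormedRing 𝕂] {N : ℕ} (w : SignedPerm N) :
    (Matrix (Fin N) (Fin N) 𝕂)ˣ where
  val := (Int.castRingHom 𝕂).mapMatrix w.1
  inv := (Int.castRingHom 𝕂).mapMatrix w.1ᵀ
  val_inv := by rw [← map_mul, w.2, map_one]
  inv_val := by rw [← map_mul, mul_eq_one_comm.1 w.2, map_one]

end SignedPerm

section Automorphisms

variable {𝕂 : Type} [NormedRing 𝕂] [NormedAlgebra ℝ 𝕂] [StarRing 𝕂] [ClassicalScalar 𝕂] {N : ℕ}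

/-- The automorphism `g ↦ (gᵗ)⁻¹`. -/
noncomputable def transpInv : (Matrix (Fin N) (Fin N) 𝕂)ˣ →* (Matrix (Fin N) (Fin N) 𝕂)ˣ where
  toFun g := ⟨transp (g⁻¹ : (Matrix (Fin N) (Fin N) 𝕂)ˣ), transp (g : Matrix (Fin N) (Fin N) 𝕂), by
    have := (adj_mul false (g : Matrix (Fin N) (Fin N) 𝕂) (g⁻¹ : (Matrix (Fin N) (Fin N) 𝕂)ˣ)).symm
    simpa [adj, Units.mul_inv] using this.trans (by rw [Units.mul_inv, adj_one]), by
    have := (adj_mul false ((g⁻¹ : (Matrix (Fin N) (Fin N) 𝕂)ˣ) : Matrix (Fin N) (Fin N) 𝕂) g).symm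
    simpa [adj] using this.trans (by rw [Units.inv_mul, adj_one])⟩
  map_one' := by
    ext1
    have := adj_one (𝕂 := 𝕂) (n := Fin N) false
    simpa [adj] using this
  map_mul' g h := by
    ext1
    have := adj_mul false ((h⁻¹ : (Matrix (Fin N) (Fin N) 𝕂)ˣ) : Matrix (Fin N) (Fin N) 𝕂)
      (g⁻¹ : (Matrix (Fin N) (Fin N) 𝕂)ˣ)
    simpa [adj, mul_inv_rev] using this

/-- The automorphism `g ↦ w (gᵗ)⁻¹ w⁻¹` if `inv`, the automorphism `g ↦ w g w⁻¹` otherwise. -/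
noncomputable def twist (inv : Bool) (w : SignedPerm N) :
    (Matrix (Fin N) (Fin N) 𝕂)ˣ →* (Matrix (Fin N) (Fin N) 𝕂)ˣ :=
  (MulAut.conj (w.unit 𝕂)).toMonoidHom.comp (if inv then transpInv else MonoidHom.id _)

/-- The differential of `twist`: `X ↦ - w Xᵗ w⁻¹`, respectively `X ↦ w X w⁻¹`. -/
noncomputable def dtwist (inv : Bool) (w : SignedPerm N) :
    Matrix (Fin N) (Fin N) 𝕂 →ₗ[ℝ] Matrix (Fin N) (Fin N) 𝕂 where
  toFun X := (w.unit 𝕂 : Matrix (Fin N) (Fin N) 𝕂) * (if inv then -transp X else X) *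
    ((w.unit 𝕂)⁻¹ : (Matrix (Fin N) (Fin N) 𝕂)ˣ)
  map_add' X Y := by
    have := adj_add false X Y
    simp only [adj, Bool.false_eq_true, if_false] at this
    cases inv <;> simp [this, mul_add, add_mul, add_comm]
  map_smul' c X := by
    have := adj_smul false c X
    simp only [adj, Bool.false_eq_true, if_false] at this
    cases inv <;> simp [this]

theorem dtwist_lie (inv : Bool) (w : SignedPerm N) (X Y : Matrix (Fin N) (Fin N) 𝕂) :
    dtwist inv w ⁅X, Y⁆ = ⁅dtwist inv w X, dtwist inv w Y⁆ := by
  have key : ∀ A B : Matrix (Fin N) (Fin N) 𝕂,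
      (w.unit 𝕂 : Matrix (Fin N) (Fin N) 𝕂) * A * ((w.unit 𝕂)⁻¹ : (Matrix (Fin N) (Fin N) 𝕂)ˣ) *
      ((w.unit 𝕂 : Matrix (Fin N) (Fin N) 𝕂) * B * ((w.unit 𝕂)⁻¹ : (Matrix (Fin N) (Fin N) 𝕂)ˣ)) =
      (w.unit 𝕂 : Matrix (Fin N) (Fin N) 𝕂) * (A * B) *
        ((w.unit 𝕂)⁻¹ : (Matrix (Fin N) (Fin N) 𝕂)ˣ) := by
    intro A B
    simp only [mul_assoc, Units.inv_mul_cancel_left]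
  have hm := adj_mul (𝕂 := 𝕂) (n := Fin N) false
  have hs := adj_add (𝕂 := 𝕂) (n := Fin N) false
  have hn := adj_neg (𝕂 := 𝕂) (n := Fin N) false
  simp only [adj, Bool.false_eq_true, if_false] at hm hs hn
  simp only [dtwist, LinearMap.coe_mk, AddHom.coe_mk, Ring.lie_def, key]
  rw [← sub_mul, ← mul_sub]
  congr 2
  cases inv
  · simp
  · simp only [if_true, sub_eq_add_neg, hs, hn, hm]
    noncomm_ring

theorem twist_exp [FiniteDimensional ℝ 𝕂] (inv : Bool) (w : SignedPerm N)
    (X : Matrix (Fin N) (Fin N) 𝕂) (g : (Matrix (Fin N) (Fin N) 𝕂)ˣ)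
    (hg : (g : Matrix (Fin N) (Fin N) 𝕂) = NormedSpace.exp X) :
    (twist inv w g : Matrix (Fin N) (Fin N) 𝕂) = NormedSpace.exp (dtwist inv w X) := by
  have : CompleteSpace 𝕂 := FiniteDimensional.complete ℝ 𝕂
  have hconj : ∀ Y : Matrix (Fin N) (Fin N) 𝕂,
      (w.unit 𝕂 : Matrix (Fin N) (Fin N) 𝕂) * NormedSpace.exp Y *
        ((w.unit 𝕂)⁻¹ : (Matrix (Fin N) (Fin N) 𝕂)ˣ) =
      NormedSpace.exp ((w.unit 𝕂 : Matrix (Fin N) (Fin N) 𝕂) * Y *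
        ((w.unit 𝕂)⁻¹ : (Matrix (Fin N) (Fin N) 𝕂)ˣ)) := by
    intro Y
    refine matrix_linear_exp ((LinearMap.mulRight ℝ
      (((w.unit 𝕂)⁻¹ : (Matrix (Fin N) (Fin N) 𝕂)ˣ) : Matrix (Fin N) (Fin N) 𝕂)) ∘ₗ
      (LinearMap.mulLeft ℝ ((w.unit 𝕂 : (Matrix (Fin N) (Fin N) 𝕂)ˣ) : Matrix (Fin N) (Fin N) 𝕂)))
      Y _ fun k => ?_
    simp only [LinearMap.comp_apply, LinearMap.mulLeft_apply, LinearMap.mulRight_apply]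
    rw [Units.conj_pow]
  cases inv
  · simp [twist, dtwist, hg, hconj]
  · have h1 : NormedSpace.exp X * NormedSpace.exp (-X) = 1 := by
      have := matrix_exp_add X 1 (-1)
      simpa using this.symm
    have h2 : ((g⁻¹ : (Matrix (Fin N) (Fin N) 𝕂)ˣ) : Matrix (Fin N) (Fin N) 𝕂) =
        NormedSpace.exp (-X) := by
      rw [Units.inv_eq_of_mul_eq_one_right]
      rw [hg, h1]
    have h3 : transp (NormedSpace.exp (-X)) = NormedSpace.exp (-transp X) := by
      have h4 := adj_exp false (-X)
      rw [adj_neg] at h4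
      simpa [adj] using h4
    simp [twist, dtwist, transpInv, h2, h3, hconj]

end Automorphisms

namespace BlockData

variable {𝕂 : Type} [NormedRing 𝕂] [NormedAlgebra ℝ 𝕂] [StarRing 𝕂] [ClassicalScalar 𝕂]

/-- The diagonal embedding `g ↦ diag (1, …, 1; g, …, g, δ(g), …, δ(g); 1, …, 1)`, with `t' n` entries
`1`, then `r n` blocks `g`, then `s n` blocks `δ(g)`, then `t'' n` entries `1`. -/
noncomputable def embed (D : BlockData) (n : ℕ)
    (δ : (Matrix (Fin (D.size n)) (Fin (D.size n)) 𝕂)ˣ →*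
      (Matrix (Fin (D.size n)) (Fin (D.size n)) 𝕂)ˣ) :
    (Matrix (Fin (D.size n)) (Fin (D.size n)) 𝕂)ˣ →*
      (Matrix (Fin (D.size (n + 1))) (Fin (D.size (n + 1))) 𝕂)ˣ where
  toFun g := ⟨D.blk n 1 (fun b => if b.val < D.r n then g else δ g) 1,
    D.blk n 1 (fun b => if b.val < D.r n then (g⁻¹ : (Matrix _ _ 𝕂)ˣ)
      else ((δ g)⁻¹ : (Matrix _ _ 𝕂)ˣ)) 1, by
      rw [blk_mul, ← blk_one]
      congr 1
      · simp
      · funext b; split_ifs <;> simp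
      · simp, by
      rw [blk_mul, ← blk_one]
      congr 1
      · simp
      · funext b; split_ifs <;> simp
      · simp⟩
  map_one' := by
    ext1
    simp [blk_one]
  map_mul' g h := by
    ext1
    simp only [Units.val_mul, blk_mul, map_mul, mul_one]
    congr 1
    funext b; split_ifs <;> rfl

/-- The differential of `embed`: `X ↦ diag (0, …, 0; X, …, X, dδ(X), …, dδ(X); 0, …, 0)`. -/
noncomputable def dembed (D : BlockData) (n : ℕ)
    (δ : Matrix (Fin (D.size n)) (Fin (D.size n)) 𝕂 →ₗ[ℝ] Matrix (Fin (D.size n)) (Fin (D.size n)) 𝕂) :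
    Matrix (Fin (D.size n)) (Fin (D.size n)) 𝕂 →ₗ[ℝ]
      Matrix (Fin (D.size (n + 1))) (Fin (D.size (n + 1))) 𝕂 where
  toFun X := D.blk n 0 (fun b => if b.val < D.r n then X else δ X) 0
  map_add' X Y := by
    rw [blk_add]
    congr 1
    · simp
    · funext b; split_ifs <;> simp
    · simp
  map_smul' c X := by
    rw [RingHom.id_apply, blk_smul]
    congr 1
    · simp
    · funext b; split_ifs <;> simp
    · simp

theorem dembed_lie (D : BlockData) (n : ℕ)
    (δ : Matrix (Fin (D.size n)) (Fin (D.size n)) 𝕂 →ₗ[ℝ] Matrix (Fin (D.size n)) (Fin (D.size n)) 𝕂)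
    (hδ : ∀ X Y, δ ⁅X, Y⁆ = ⁅δ X, δ Y⁆) (X Y : Matrix (Fin (D.size n)) (Fin (D.size n)) 𝕂) :
    D.dembed n δ ⁅X, Y⁆ = ⁅D.dembed n δ X, D.dembed n δ Y⁆ := by
  simp only [dembed, LinearMap.coe_mk, AddHom.coe_mk]
  rw [Ring.lie_def (D.blk n _ _ _), blk_mul, blk_mul, eq_sub_iff_add_eq, blk_add]
  congr 1
  · simp
  · funext b
    split_ifs
    · simp [Ring.lie_def]
    · rw [hδ, Ring.lie_def, sub_add_cancel]
  · simp

theorem embed_exp [FiniteDimensional ℝ 𝕂] (D : BlockData) (n : ℕ)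
    (δ : (Matrix (Fin (D.size n)) (Fin (D.size n)) 𝕂)ˣ →*
      (Matrix (Fin (D.size n)) (Fin (D.size n)) 𝕂)ˣ)
    (dδ : Matrix (Fin (D.size n)) (Fin (D.size n)) 𝕂 →ₗ[ℝ]
      Matrix (Fin (D.size n)) (Fin (D.size n)) 𝕂)
    (g : (Matrix (Fin (D.size n)) (Fin (D.size n)) 𝕂)ˣ)
    (X : Matrix (Fin (D.size n)) (Fin (D.size n)) 𝕂)
    (h1 : (g : Matrix (Fin (D.size n)) (Fin (D.size n)) 𝕂) = NormedSpace.exp X)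
    (h2 : (δ g : Matrix (Fin (D.size n)) (Fin (D.size n)) 𝕂) = NormedSpace.exp (dδ X)) :
    (D.embed n δ g : Matrix (Fin (D.size (n + 1))) (Fin (D.size (n + 1))) 𝕂) =
      NormedSpace.exp (D.dembed n dδ X) := by
  have : CompleteSpace 𝕂 := FiniteDimensional.complete ℝ 𝕂
  simp only [embed, dembed, LinearMap.coe_mk, AddHom.coe_mk, MonoidHom.coe_mk, OneHom.coe_mk]
  rw [exp_blk_zero]
  congr 1
  funext b
  split_ifs
  · exact h1
  · exact h2

end BlockData

/-! ## Direct systems of classical groups -/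

/-- A direct system of classical groups `G n` over `𝕂` and diagonal embeddings
`φ n : G n → G (n + 1)`. The group `G n` preserves the form with matrix `B n`, the automorphism `δ`
in the definition of `φ n` is `twist inv (w n)`, and `T n` is a space of matrices such that
`a n = T n ∩ g n`. -/
structure ClassicalSystem (𝕂 : Type) [NormedRing 𝕂] [NormedAlgebra ℝ 𝕂] [StarRing 𝕂]
    [ClassicalScalar 𝕂] where
  D : BlockData
  sesq : Bool
  B : ∀ n, Matrix (Fin (D.size n)) (Fin (D.size n)) 𝕂
  inv : Bool
  w : ∀ n, SignedPerm (D.size n)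
  T : ∀ n, Submodule ℝ (Matrix (Fin (D.size n)) (Fin (D.size n)) 𝕂)
  B_succ : ∀ n, ∃ B' B'', B (n + 1) = D.blk n B' (fun _ => B n) B''
  twist_mem : ∀ n, ∀ g ∈ classicalGroup sesq (B n),
    twist inv (w n) g ∈ classicalGroup sesq (B n)

namespace ClassicalSystem

variable {𝕂 : Type} [NormedRing 𝕂] [NormedAlgebra ℝ 𝕂] [StarRing 𝕂] [ClassicalScalar 𝕂]
  (S : ClassicalSystem 𝕂)

/-- The group at level `n`. -/
noncomputable def G (n : ℕ) : Subgroup (Matrix (Fin (S.D.size n)) (Fin (S.D.size n)) 𝕂)ˣ :=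
  classicalGroup S.sesq (S.B n)

theorem embed_mem (n : ℕ) (g : (Matrix (Fin (S.D.size n)) (Fin (S.D.size n)) 𝕂)ˣ)
    (hg : g ∈ S.G n) : S.D.embed n (twist S.inv (S.w n)) g ∈ S.G (n + 1) := by
  obtain ⟨B', B'', hB⟩ := S.B_succ n
  have hb : ∀ b : Fin (S.D.r n + S.D.s n), (if b.val < S.D.r n then g
      else twist S.inv (S.w n) g) ∈ S.G n := by
    intro b
    split_ifs
    · exact hg
    · exact S.twist_mem n g hg
  have hv : (S.D.embed n (twist S.inv (S.w n)) g : Matrix _ _ 𝕂) =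
      S.D.blk n 1 (fun b => ((if b.val < S.D.r n then g
        else twist S.inv (S.w n) g : (Matrix _ _ 𝕂)ˣ) : Matrix _ _ 𝕂)) 1 := by
    simp only [BlockData.embed, MonoidHom.coe_mk, OneHom.coe_mk]
    congr 1
    funext b
    split_ifs <;> rfl
  refine ⟨?_, ?_⟩
  · rw [hv, BlockData.det_cmat_blk, Finset.prod_congr rfl fun b _ => (hb b).1]
    simp
  · rw [hv, hB, BlockData.adj_blk, BlockData.blk_mul, BlockData.blk_mul]
    congr 1
    · simp [adj_one]
    · funext b; exact (hb b).2
    · simp [adj_one]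

/-- The homomorphism `φ n` from the group at level `n` to the group at level `n + 1`. -/
noncomputable def φ (n : ℕ) : S.G n →* S.G (n + 1) :=
  ((S.D.embed n (twist S.inv (S.w n))).comp (S.G n).subtype).codRestrict (S.G (n + 1))
    fun g => S.embed_mem n g g.2

variable [FiniteDimensional ℝ 𝕂]

/-- The Lie algebra of the group at level `n`. -/
noncomputable def g (n : ℕ) : LieSubalgebra ℝ (Matrix (Fin (S.D.size n)) (Fin (S.D.size n)) 𝕂) :=
  classicalLie S.sesq (S.B n)

/-- `dembed` is the differential of `φ n`: if `x = exp X` then `φ n x = exp (dembed X)`. -/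
theorem φ_exp (n : ℕ) (X : Matrix (Fin (S.D.size n)) (Fin (S.D.size n)) 𝕂) (x : S.G n)
    (hx : (x.1.1 : Matrix (Fin (S.D.size n)) (Fin (S.D.size n)) 𝕂) = NormedSpace.exp X) :
    ((S.φ n x).1.1 : Matrix (Fin (S.D.size (n + 1))) (Fin (S.D.size (n + 1))) 𝕂) =
      NormedSpace.exp (S.D.dembed n (dtwist S.inv (S.w n)) X) :=
  BlockData.embed_exp S.D n _ _ x.1 X hx (twist_exp S.inv (S.w n) X x.1 hx)

theorem dembed_mem (n : ℕ) (X : Matrix (Fin (S.D.size n)) (Fin (S.D.size n)) 𝕂)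
    (hX : X ∈ S.g n) : S.D.dembed n (dtwist S.inv (S.w n)) X ∈ S.g (n + 1) := by
  intro t
  obtain ⟨x, hx, hxt⟩ := hX t
  refine ⟨(S.φ n ⟨x, hx⟩).1, (S.φ n ⟨x, hx⟩).2, ?_⟩
  rw [← map_smul]
  exact S.φ_exp n (t • X) ⟨x, hx⟩ hxt

/-- The differential of `φ n`. -/
noncomputable def dφ (n : ℕ) : S.g n →ₗ⁅ℝ⁆ S.g (n + 1) where
  toFun X := ⟨S.D.dembed n (dtwist S.inv (S.w n)) X.1, S.dembed_mem n X.1 X.2⟩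
  map_add' X Y := Subtype.ext (map_add (S.D.dembed n (dtwist S.inv (S.w n))) X.1 Y.1)
  map_smul' c X := Subtype.ext (map_smul (S.D.dembed n (dtwist S.inv (S.w n))) c X.1)
  map_lie' {X Y} := Subtype.ext
    (BlockData.dembed_lie S.D n (dtwist S.inv (S.w n)) (dtwist_lie S.inv (S.w n)) X.1 Y.1)

/-- The fixed points of the Cartan involution `X ↦ - X*`. -/
noncomputable def k (n : ℕ) : Submodule ℝ (S.g n) where
  carrier := {X | adj true X.1 = -X.1}
  zero_mem' := by
    have := adj_smul true 0 (0 : Matrix (Fin (S.D.size n)) (Fin (S.D.size n)) 𝕂)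
    rw [zero_smul, zero_smul] at this
    exact this.trans neg_zero.symm
  add_mem' {X Y} hX hY := by
    have h := adj_add true X.1 Y.1
    rw [Set.mem_ofPred_eq] at hX hY
    rw [hX, hY, ← neg_add] at h
    exact h
  smul_mem' c X hX := by
    have h := adj_smul true c X.1
    rw [Set.mem_ofPred_eq] at hX
    rw [hX, smul_neg] at h
    exact h

/-- The associated direct system of Lie algebras. At each level the Cartan involution is
`X ↦ - X*`, and the invariant form is the real part of the trace of `X Y`. -/
noncomputable def tower : LieTower where
  L n := S.g n
  f := S.dφ
  k := S.k
  a n := (S.T n).comap (S.g n).toSubmodule.subtype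
  form n X Y := (cmat (Fin (S.D.size n)) (X.1 * Y.1)).trace.re

end ClassicalSystem

/-! ## The families of classical groups -/

section Families

variable {𝕂 : Type} [NormedRing 𝕂] [NormedAlgebra ℝ 𝕂] [StarRing 𝕂] [ClassicalScalar 𝕂]

/-- The space of real diagonal matrices. -/
noncomputable def realDiagonal (𝕂 : Type) [NormedRing 𝕂] [NormedAlgebra ℝ 𝕂] (N : ℕ) :
    Submodule ℝ (Matrix (Fin N) (Fin N) 𝕂) :=
  Submodule.span ℝ (Set.range fun i => Matrix.single i i 1)

/-- The real span of the matrices that have entry `c` at `(i, π i)`, entry `c*` at `(π i, i)` and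
zeros elsewhere, where `i` runs through the coordinates with `π i ≠ i`. -/
noncomputable def pairSpan (c : 𝕂) {N : ℕ} (π : Fin N → Fin N) :
    Submodule ℝ (Matrix (Fin N) (Fin N) 𝕂) :=
  Submodule.span ℝ {X | ∃ i, π i ≠ i ∧
    X = Matrix.single i (π i) c + Matrix.single (π i) i (star c)}

theorem conj_mem {N : ℕ} (sesq : Bool) (B : Matrix (Fin N) (Fin N) 𝕂)
    (W g : (Matrix (Fin N) (Fin N) 𝕂)ˣ)
    (hW : adj sesq (W : Matrix (Fin N) (Fin N) 𝕂) * B * W = B)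
    (hg : g ∈ classicalGroup sesq B) : W * g * W⁻¹ ∈ classicalGroup sesq B := by
  have h1 : adj sesq ((W⁻¹ : (Matrix (Fin N) (Fin N) 𝕂)ˣ) : Matrix (Fin N) (Fin N) 𝕂) *
      adj sesq (W : Matrix (Fin N) (Fin N) 𝕂) = 1 := by
    rw [← adj_mul, Units.mul_inv, adj_one]
  have h2 : adj sesq ((W⁻¹ : (Matrix (Fin N) (Fin N) 𝕂)ˣ) : Matrix (Fin N) (Fin N) 𝕂) * B *
      (W⁻¹ : (Matrix (Fin N) (Fin N) 𝕂)ˣ) = B := by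
    conv_lhs => rw [← hW]
    rw [mul_assoc, mul_assoc, Units.mul_inv, mul_one, ← mul_assoc, h1, one_mul]
  refine ⟨?_, ?_⟩
  · have h3 : (cmat (Fin N) (W : Matrix (Fin N) (Fin N) 𝕂)).det *
        (cmat (Fin N) ((W⁻¹ : (Matrix (Fin N) (Fin N) 𝕂)ˣ) : Matrix (Fin N) (Fin N) 𝕂)).det = 1 := by
      rw [← Matrix.det_mul, ← map_mul, Units.mul_inv, map_one, Matrix.det_one]
    rw [Units.val_mul, Units.val_mul, map_mul, map_mul, Matrix.det_mul, Matrix.det_mul, hg.1,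
      mul_one, h3]
  · rw [Units.val_mul, Units.val_mul, adj_mul, adj_mul]
    calc _ = adj sesq ((W⁻¹ : (Matrix (Fin N) (Fin N) 𝕂)ˣ) : Matrix (Fin N) (Fin N) 𝕂) *
          (adj sesq (g : Matrix (Fin N) (Fin N) 𝕂) *
          (adj sesq (W : Matrix (Fin N) (Fin N) 𝕂) * B * W) * g) *
          (W⁻¹ : (Matrix (Fin N) (Fin N) 𝕂)ˣ) := by simp only [mul_assoc]
      _ = B := by rw [hW, hg.2, h2]

theorem det_transpInv {N : ℕ} (g : (Matrix (Fin N) (Fin N) 𝕂)ˣ)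
    (hg : (cmat (Fin N) (g : Matrix (Fin N) (Fin N) 𝕂)).det = 1) :
    (cmat (Fin N) (transpInv g : Matrix (Fin N) (Fin N) 𝕂)).det = 1 := by
  have h : (cmat (Fin N) ((g⁻¹ : (Matrix (Fin N) (Fin N) 𝕂)ˣ) : Matrix (Fin N) (Fin N) 𝕂)).det *
      (cmat (Fin N) (g : Matrix (Fin N) (Fin N) 𝕂)).det = 1 := by
    rw [← Matrix.det_mul, ← map_mul, Units.inv_mul, map_one, Matrix.det_one]
  rw [hg, mul_one] at h
  simp only [transpInv, MonoidHom.coe_mk, OneHom.coe_mk]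
  rw [cmat_transp, Matrix.det_transpose, h]

theorem transpInv_mem_orthogonal {N : ℕ} (g : (Matrix (Fin N) (Fin N) 𝕂)ˣ)
    (hg : g ∈ classicalGroup false (1 : Matrix (Fin N) (Fin N) 𝕂)) :
    transpInv g ∈ classicalGroup false (1 : Matrix (Fin N) (Fin N) 𝕂) := by
  refine ⟨det_transpInv g hg.1, ?_⟩
  have h := (Subgroup.inv_mem _ hg).2
  have h2 := adj_adj false ((g⁻¹ : (Matrix (Fin N) (Fin N) 𝕂)ˣ) : Matrix (Fin N) (Fin N) 𝕂)
  have h3 : adj false ((g⁻¹ : (Matrix (Fin N) (Fin N) 𝕂)ˣ) : Matrix (Fin N) (Fin N) 𝕂) =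
      (g : Matrix (Fin N) (Fin N) 𝕂) := by
    rw [mul_one] at h
    calc _ = adj false ((g⁻¹ : (Matrix (Fin N) (Fin N) 𝕂)ˣ) : Matrix (Fin N) (Fin N) 𝕂) *
          ((g⁻¹ : (Matrix (Fin N) (Fin N) 𝕂)ˣ) * (g : Matrix (Fin N) (Fin N) 𝕂)) := by
          rw [Units.inv_mul, mul_one]
      _ = _ := by rw [← mul_assoc, h, one_mul]
  have h4 : (transpInv g : Matrix (Fin N) (Fin N) 𝕂) =
      adj false ((g⁻¹ : (Matrix (Fin N) (Fin N) 𝕂)ˣ) : Matrix (Fin N) (Fin N) 𝕂) := rfl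
  rw [h4, h2, h3, mul_one, Units.inv_mul]

theorem transpInv_mem_hermitian {N : ℕ} (B : Matrix (Fin N) (Fin N) 𝕂) (hB : adj false B = B)
    (ε : ℤˣ) (hBB : B * B = ((ε : ℤ) : Matrix (Fin N) (Fin N) 𝕂))
    (g : (Matrix (Fin N) (Fin N) 𝕂)ˣ)
    (hg : g ∈ classicalGroup true B) : transpInv g ∈ classicalGroup true B := by
  refine ⟨det_transpInv g hg.1, ?_⟩
  set E : Matrix (Fin N) (Fin N) 𝕂 := ((ε : ℤ) : Matrix (Fin N) (Fin N) 𝕂) with hE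
  have hEE : E * E = 1 := by
    rw [hE, ← Int.cast_mul, ← Units.val_mul, Int.units_mul_self, Units.val_one, Int.cast_one]
  have hEc : ∀ M : Matrix (Fin N) (Fin N) 𝕂, E * M = M * E := fun M => Int.cast_commute _ M
  have hcomm : ∀ M : Matrix (Fin N) (Fin N) 𝕂, adj false (adj true M) = adj true (adj false M) := by
    intro M
    apply cmat_injective
    simp [cmat_adj, Matrix.conjTranspose, Matrix.transpose_map]
  have h := congrArg (adj false) (Subgroup.inv_mem _ hg).2
  set k : Matrix (Fin N) (Fin N) 𝕂 := (transpInv g : Matrix (Fin N) (Fin N) 𝕂) with hk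
  have h4 : k = adj false ((g⁻¹ : (Matrix (Fin N) (Fin N) 𝕂)ˣ) : Matrix (Fin N) (Fin N) 𝕂) := rfl
  rw [adj_mul, adj_mul, hB, hcomm, ← h4] at h
  have h5 : k * (B * adj true k * B * E) = 1 := by
    calc _ = (k * (B * adj true k)) * B * E := by simp only [mul_assoc]
      _ = 1 := by rw [h, hBB, hEE]
  have h6 : (B * adj true k * B * E) * k = 1 :=
    (Units.mul_eq_one_iff_inv_eq.1 h5) ▸ Units.inv_mul (transpInv g)
  calc adj true k * B * k = (E * (B * B)) * (adj true k * B * k) := by rw [hBB, hEE, one_mul]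
    _ = B * ((B * adj true k * B * E) * k) := by
      rw [hEc]
      simp only [mul_assoc]
      rw [hEc k]
      congr 1
      rw [hEc]
      simp only [mul_assoc]
    _ = B := by rw [h6, mul_one]

end Families

/-- The identity matrix as a signed permutation. -/
def SignedPerm.one (N : ℕ) : SignedPerm N := ⟨1, by simp⟩

theorem SignedPerm.unit_one (𝕂 : Type) [NormedRing 𝕂] (N : ℕ) :
    ((SignedPerm.one N).unit 𝕂 : Matrix (Fin N) (Fin N) 𝕂) = 1 := map_one _

theorem SignedPerm.reversal_transpose (N : ℕ) :
    (SignedPerm.reversal N).1ᵀ = (SignedPerm.reversal N).1 := by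
  ext i j
  have h : i = j.rev ↔ j = i.rev := ⟨fun h => by rw [h, Fin.rev_rev], fun h => by rw [h, Fin.rev_rev]⟩
  simp [SignedPerm.reversal, h]

theorem SignedPerm.unit_reversal_mul (𝕂 : Type) [NormedRing 𝕂] (N : ℕ) :
    ((SignedPerm.reversal N).unit 𝕂 : Matrix (Fin N) (Fin N) 𝕂) *
      ((SignedPerm.reversal N).unit 𝕂 : Matrix (Fin N) (Fin N) 𝕂) = 1 := by
  change (Int.castRingHom 𝕂).mapMatrix _ * (Int.castRingHom 𝕂).mapMatrix _ = 1
  have h := (SignedPerm.reversal N).2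
  rw [SignedPerm.reversal_transpose] at h
  rw [← map_mul, h, map_one]

/-- The standard antisymmetric form on a space of even dimension `M`. -/
def standardSymplectic (M : ℕ) : Matrix (Fin M) (Fin M) ℤ :=
  Matrix.of fun i j => if j.val = i.val + M / 2 then 1 else if i.val = j.val + M / 2 then -1 else 0

theorem BlockData.blk_zero {R : Type} [Ring R] (D : BlockData) (n : ℕ) :
    D.blk n (0 : Matrix (Fin (D.t' n)) (Fin (D.t' n)) R) (fun _ => 0) 0 = 0 := by
  have := BlockData.blk_smul (D := D) (n := n) (0 : ℤ) (0 : Matrix _ _ R) (fun _ => 0) 0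
  simpa using this.symm

theorem BlockData.cast_blk {𝕂 : Type} [NormedRing 𝕂] (D : BlockData) (n : ℕ)
    (A : Matrix (Fin (D.t' n)) (Fin (D.t' n)) ℤ)
    (X : Fin (D.r n + D.s n) → Matrix (Fin (D.size n)) (Fin (D.size n)) ℤ)
    (C : Matrix (Fin (D.t'' n)) (Fin (D.t'' n)) ℤ) :
    (Int.castRingHom 𝕂).mapMatrix (D.blk n A X C) =
      D.blk n ((Int.castRingHom 𝕂).mapMatrix A) (fun b => (Int.castRingHom 𝕂).mapMatrix (X b))
        ((Int.castRingHom 𝕂).mapMatrix C) :=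
  D.blk_map (Int.castRingHom 𝕂) (map_zero _) A X C

inductive ScalarKind : Type
  | real
  | complex
  | quaternion

/-- Special linear groups. The number of entries `1` is `t'' n`; there are none in front of the
blocks. -/
structure LinearSystem where
  D : BlockData
  t'_zero : ∀ n, D.t' n = 0

/-- The direct system of the groups `SL (size n; 𝕂)`, with `δ(g) = J (gᵗ)⁻¹ J⁻¹`; the space `a n`
consists of the real diagonal matrices of trace zero. -/
noncomputable def LinearSystem.system (S : LinearSystem) (𝕂 : Type) [NormedRing 𝕂]
    [NormedAlgebra ℝ 𝕂] [StarRing 𝕂] [ClassicalScalar 𝕂] : ClassicalSystem 𝕂 where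
  D := S.D
  sesq := false
  B _ := 0
  inv := true
  w n := SignedPerm.reversal (S.D.size n)
  T n := realDiagonal 𝕂 (S.D.size n)
  B_succ n := ⟨0, 0, (S.D.blk_zero n).symm⟩
  twist_mem n g hg := conj_mem false 0 _ _ (by rw [mul_zero, zero_mul])
    ⟨det_transpInv g hg.1, by rw [mul_zero, zero_mul]⟩

/-- The diagonal form that has signature `(p₀, N₀ - p₀)` at level `0`; in step `n`, the first `t' n`
and the last `t'' n` coordinates that are added are positive and negative, respectively. -/
def BlockData.unitaryForm (D : BlockData) (p₀ : ℕ) (n : ℕ) :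
    Matrix (Fin (D.size n)) (Fin (D.size n)) ℤ :=
  D.form (Matrix.diagonal fun i => if i.val < p₀ then 1 else -1) (fun _ => 1) (fun _ => -1) n

theorem BlockData.unitaryForm_transpose (D : BlockData) (p₀ : ℕ) (n : ℕ) :
    (D.unitaryForm p₀ n)ᵀ = D.unitaryForm p₀ n := by
  induction n with
  | zero => exact Matrix.diagonal_transpose _
  | succ n ih =>
    refine (D.blk_transpose _ _ _).trans ?_
    change D.blk n _ (fun _ => (D.unitaryForm p₀ n)ᵀ) _ = D.blk n _ (fun _ => D.unitaryForm p₀ n) _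
    rw [ih, Matrix.transpose_one, Matrix.transpose_neg, Matrix.transpose_one]

theorem BlockData.unitaryForm_mul (D : BlockData) (p₀ : ℕ) (n : ℕ) :
    D.unitaryForm p₀ n * D.unitaryForm p₀ n = 1 := by
  induction n with
  | zero =>
    refine (Matrix.diagonal_mul_diagonal _ _).trans ?_
    rw [← Matrix.diagonal_one]
    congr 1
    funext i
    split_ifs <;> simp
  | succ n ih =>
    refine (D.blk_mul _ _ _ _ _ _).trans ?_
    change D.blk n _ (fun _ => D.unitaryForm p₀ n * D.unitaryForm p₀ n) _ = _
    rw [ih, mul_one, neg_mul_neg, mul_one]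
    exact D.blk_one

/-- Unitary groups over `ℝ`, `ℂ` or the quaternions. The forms are not all definite. The signed
permutation `w n`, which preserves the form, defines the automorphism `δ`. The involution `π n` of
the coordinates pairs positive with negative coordinates, as many as possible. -/
structure UnitarySystem (F : ScalarKind) where
  D : BlockData
  p₀ : ℕ
  p₀_le : p₀ ≤ D.N₀
  pos : 0 < p₀ ∨ ∃ n, 0 < D.t' n
  neg : p₀ < D.N₀ ∨ ∃ n, 0 < D.t'' n
  s_zero : F = ScalarKind.quaternion → ∀ n, D.s n = 0
  w : ∀ n, SignedPerm (D.size n)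
  w_form : ∀ n, (w n).1ᵀ * D.unitaryForm p₀ n * (w n).1 = D.unitaryForm p₀ n
  w_real_odd : F = ScalarKind.real → ∀ n, Odd (D.size n) → (w n).1 = 1
  w_real_even : F = ScalarKind.real → ∀ n, Even (D.size n) → (w n).1.det = -1
  w_quaternion : F = ScalarKind.quaternion → ∀ n, (w n).1 = 1
  π : ∀ n, Fin (D.size n) → Fin (D.size n)
  π_invol : ∀ n, Function.Involutive (π n)
  π_pair : ∀ n i, π n i ≠ i → D.unitaryForm p₀ n i i + D.unitaryForm p₀ n (π n i) (π n i) = 0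
  π_fixed : ∀ n i j, π n i = i → π n j = j → D.unitaryForm p₀ n i i = D.unitaryForm p₀ n j j

namespace UnitarySystem

variable {F : ScalarKind}

/-- The form over `𝕂`. -/
noncomputable def B (S : UnitarySystem F) (𝕂 : Type) [NormedRing 𝕂] (n : ℕ) :
    Matrix (Fin (S.D.size n)) (Fin (S.D.size n)) 𝕂 :=
  (Int.castRingHom 𝕂).mapMatrix (S.D.unitaryForm S.p₀ n)

theorem B_succ (S : UnitarySystem F) (𝕂 : Type) [NormedRing 𝕂] (n : ℕ) :
    ∃ B' B'', S.B 𝕂 (n + 1) = S.D.blk n B' (fun _ => S.B 𝕂 n) B'' :=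
  ⟨_, _, S.D.cast_blk n _ _ _⟩

theorem adj_cast {𝕂 : Type} [NormedRing 𝕂] [NormedAlgebra ℝ 𝕂] [StarRing 𝕂] [ClassicalScalar 𝕂]
    {N : ℕ} (M : Matrix (Fin N) (Fin N) ℤ) :
    adj true ((Int.castRingHom 𝕂).mapMatrix M) = (Int.castRingHom 𝕂).mapMatrix Mᵀ := by
  ext i j
  simp [adj]

theorem w_B (S : UnitarySystem F) (𝕂 : Type) [NormedRing 𝕂] [NormedAlgebra ℝ 𝕂] [StarRing 𝕂]
    [ClassicalScalar 𝕂] (n : ℕ) :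
    adj true ((S.w n).unit 𝕂 : Matrix (Fin (S.D.size n)) (Fin (S.D.size n)) 𝕂) * S.B 𝕂 n *
      ((S.w n).unit 𝕂 : Matrix (Fin (S.D.size n)) (Fin (S.D.size n)) 𝕂) = S.B 𝕂 n := by
  change adj true ((Int.castRingHom 𝕂).mapMatrix (S.w n).1) * (Int.castRingHom 𝕂).mapMatrix _ *
    (Int.castRingHom 𝕂).mapMatrix (S.w n).1 = (Int.castRingHom 𝕂).mapMatrix _
  rw [adj_cast, ← map_mul, ← map_mul, S.w_form]

/-- The direct system of the unitary groups over `𝕂`, where `δ(g) = w g w⁻¹`. The space `a n` has a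
basis of matrices with two entries `1`, in the positions `(i, π i)` and `(π i, i)`. -/
noncomputable def system (S : UnitarySystem F) (𝕂 : Type) [NormedRing 𝕂]
    [NormedAlgebra ℝ 𝕂] [StarRing 𝕂] [ClassicalScalar 𝕂] : ClassicalSystem 𝕂 where
  D := S.D
  sesq := true
  B := S.B 𝕂
  inv := false
  w := S.w
  T n := pairSpan 1 (S.π n)
  B_succ := S.B_succ 𝕂
  twist_mem n _ hg := conj_mem true (S.B 𝕂 n) _ _ (S.w_B 𝕂 n) hg

/-- The direct system of the unitary groups over `ℂ`, where `δ(g) = w (gᵗ)⁻¹ w⁻¹`. -/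
noncomputable def complexSystem (S : UnitarySystem F) : ClassicalSystem ℂ where
  D := S.D
  sesq := true
  B := S.B ℂ
  inv := true
  w := S.w
  T n := pairSpan 1 (S.π n)
  B_succ := S.B_succ ℂ
  twist_mem n g hg := conj_mem true (S.B ℂ n) _ _ (S.w_B ℂ n) (by
    refine transpInv_mem_hermitian (S.B ℂ n) ?_ 1 ?_ g hg
    · ext i j
      have h := congrFun (congrFun (S.D.unitaryForm_transpose S.p₀ n) i) j
      rw [Matrix.transpose_apply] at h
      change ((S.D.unitaryForm S.p₀ n j i : ℤ) : ℂ) = ((S.D.unitaryForm S.p₀ n i j : ℤ) : ℂ)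
      rw [h]
    · change (Int.castRingHom ℂ).mapMatrix _ * (Int.castRingHom ℂ).mapMatrix _ = _
      rw [← map_mul, S.D.unitaryForm_mul, map_one, Units.val_one, Int.cast_one])

end UnitarySystem

/-- Symplectic groups; all sizes are even. There are no entries `1` in front of the blocks and no
blocks `δ(g)`. -/
structure SymplecticSystem where
  D : BlockData
  N₀_even : Even D.N₀
  t'_zero : ∀ n, D.t' n = 0
  s_zero : ∀ n, D.s n = 0
  t''_even : ∀ n, Even (D.t'' n)

/-- The direct system of the symplectic groups over `𝕂 = ℝ` or `ℂ`. The form is an orthogonal sum of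
standard antisymmetric forms; the space `a n` consists of the real diagonal matrices in the Lie
algebra. -/
noncomputable def SymplecticSystem.system (S : SymplecticSystem) (𝕂 : Type) [NormedRing 𝕂]
    [NormedAlgebra ℝ 𝕂] [StarRing 𝕂] [ClassicalScalar 𝕂] : ClassicalSystem 𝕂 where
  D := S.D
  sesq := false
  B n := (Int.castRingHom 𝕂).mapMatrix
    (S.D.form (standardSymplectic _) (fun _ => 0) (fun _ => standardSymplectic _) n)
  inv := false
  w n := SignedPerm.one (S.D.size n)
  T n := realDiagonal 𝕂 (S.D.size n)
  B_succ n := ⟨_, _, S.D.cast_blk n _ _ _⟩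
  twist_mem n _ hg := conj_mem false _ _ _
    (by rw [SignedPerm.unit_one, adj_one, one_mul, mul_one]) hg

/-- The quaternion `i`. -/
def quatI : ℍ[ℝ] := ⟨0, 1, 0, 0⟩

/-- The quaternion `j`. -/
def quatJ : ℍ[ℝ] := ⟨0, 0, 1, 0⟩

theorem adj_quatI (N : ℕ) :
    adj false (quatI • (1 : Matrix (Fin N) (Fin N) ℍ[ℝ])) = quatI • 1 := by
  ext1 i j
  change ClassicalScalar.tr ((quatI • (1 : Matrix (Fin N) (Fin N) ℍ[ℝ])) j i) = _
  by_cases h : i = j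
  · subst h
    rw [Matrix.smul_apply, Matrix.one_apply_eq, smul_eq_mul, mul_one]
    ext <;> simp [ClassicalScalar.tr, quatI]
  · rw [Matrix.smul_apply, Matrix.smul_apply, Matrix.one_apply_ne h, Matrix.one_apply_ne (Ne.symm h),
      smul_zero, BlockData.scalar_tr_zero]

theorem cast_mul_quatI {N : ℕ} (M : Matrix (Fin N) (Fin N) ℤ) :
    (Int.castRingHom ℍ[ℝ]).mapMatrix M * (quatI • 1) =
      (quatI • 1) * (Int.castRingHom ℍ[ℝ]).mapMatrix M := by
  rw [← Matrix.diagonal_one, ← Matrix.diagonal_smul]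
  ext1 i j
  rw [Matrix.mul_diagonal, Matrix.diagonal_mul]
  change ((M i j : ℤ) : ℍ[ℝ]) * (quatI * 1) = (quatI * 1) * ((M i j : ℤ) : ℍ[ℝ])
  rw [mul_one]
  exact (Int.cast_commute (M i j) quatI).eq

theorem quatI_mul (N : ℕ) :
    (quatI • (1 : Matrix (Fin N) (Fin N) ℍ[ℝ])) * (quatI • 1) = (((-1 : ℤˣ) : ℤ) : Matrix _ _ _) := by
  have h : quatI * quatI = -1 := by
    ext <;> simp <;> simp [quatI]
  rw [smul_mul_assoc, one_mul, smul_smul, h]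
  simp

/-- The data for the groups `SO (size n; ℂ)` and `SO* (2 size n)`. There are no entries `1` in front
of the blocks. The involution `π n` of the coordinates has at most one fixed point. -/
structure OrthogonalSystem where
  D : BlockData
  t'_zero : ∀ n, D.t' n = 0
  π : ∀ n, Fin (D.size n) → Fin (D.size n)
  π_invol : ∀ n, Function.Involutive (π n)
  π_fixed : ∀ n i j, π n i = i → π n j = j → i = j

namespace OrthogonalSystem

/-- The direct system of the groups `SO (size n; ℂ)`, with `δ(g) = J (gᵗ)⁻¹ J⁻¹`. The space `a n` has
a basis of matrices with two entries `i` and `-i`, in the positions `(i, π i)` and `(π i, i)`. -/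
noncomputable def complexSystem (S : OrthogonalSystem) : ClassicalSystem ℂ where
  D := S.D
  sesq := false
  B _ := 1
  inv := true
  w n := SignedPerm.reversal (S.D.size n)
  T n := pairSpan Complex.I (S.π n)
  B_succ n := ⟨1, 1, S.D.blk_one.symm⟩
  twist_mem n g hg := conj_mem false 1 _ _ (by
    have h : adj false ((SignedPerm.reversal (S.D.size n)).unit ℂ :
        Matrix (Fin (S.D.size n)) (Fin (S.D.size n)) ℂ) =
        ((SignedPerm.reversal (S.D.size n)).unit ℂ :
          Matrix (Fin (S.D.size n)) (Fin (S.D.size n)) ℂ) := by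
      have h0 := SignedPerm.reversal_transpose (S.D.size n)
      exact congrArg (Int.castRingHom ℂ).mapMatrix h0
    rw [mul_one, h, SignedPerm.unit_reversal_mul]) (transpInv_mem_orthogonal g hg)

/-- The direct system of the groups `SO* (2 size n)`, the quaternionic groups that preserve the
skew-hermitian form with matrix `i`, with `δ(g) = J (gᵗ)⁻¹ J⁻¹`. The space `a n` has
a basis of matrices with two entries `j` and `-j`, in the positions `(i, π i)` and `(π i, i)`. -/
noncomputable def starSystem (S : OrthogonalSystem) : ClassicalSystem ℍ[ℝ] where
  D := S.D
  sesq := true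
  B _ := quatI • 1
  inv := true
  w n := SignedPerm.reversal (S.D.size n)
  T n := pairSpan quatJ (S.π n)
  B_succ n := ⟨quatI • 1, quatI • 1, by
    rw [← S.D.blk_smul, S.D.blk_one]⟩
  twist_mem n g hg := conj_mem true _ _ _ (by
    have h : adj true ((SignedPerm.reversal (S.D.size n)).unit ℍ[ℝ] :
        Matrix (Fin (S.D.size n)) (Fin (S.D.size n)) ℍ[ℝ]) =
        ((SignedPerm.reversal (S.D.size n)).unit ℍ[ℝ] :
          Matrix (Fin (S.D.size n)) (Fin (S.D.size n)) ℍ[ℝ]) := by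
      have h0 := SignedPerm.reversal_transpose (S.D.size n)
      exact (UnitarySystem.adj_cast _).trans (congrArg (Int.castRingHom ℍ[ℝ]).mapMatrix h0)
    rw [h]
    change (Int.castRingHom ℍ[ℝ]).mapMatrix _ * _ * _ = _
    rw [cast_mul_quatI, mul_assoc]
    refine (congrArg _ (SignedPerm.unit_reversal_mul ℍ[ℝ] (S.D.size n))).trans (mul_one _)) 
    (transpInv_mem_hermitian _ (adj_quatI _) (-1) (quatI_mul _) g hg)

end OrthogonalSystem

/-- The diagonal embedding direct systems: special linear groups over `ℝ`, `ℂ` and the quaternions,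
unitary groups over `ℝ`, `ℂ` and the quaternions, symplectic groups over `ℝ` and `ℂ`, the groups
`SO (d; ℂ)` and the groups `SO* (2 d)`. -/
inductive DiagonalSystem : Type
  | linear (F : ScalarKind) (S : LinearSystem)
  | unitary (F : ScalarKind) (S : UnitarySystem F)
  | symplecticReal (S : SymplecticSystem)
  | symplecticComplex (S : SymplecticSystem)
  | complexOrthogonal (S : OrthogonalSystem)
  | starOrthogonal (S : OrthogonalSystem)

namespace DiagonalSystem

/-- The sizes in a diagonal embedding direct system. -/
def data : DiagonalSystem → BlockData
  | linear _ S => S.D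
  | unitary _ S => S.D
  | symplecticReal S => S.D
  | symplecticComplex S => S.D
  | complexOrthogonal S => S.D
  | starOrthogonal S => S.D

/-- The direct system is of classical type: `r n + s n = 1` for all sufficiently large `n`. -/
def IsClassical (S : DiagonalSystem) : Prop := S.data.IsClassical

/-- The Lie algebras `g n` of the groups, the differentials of the homomorphisms between them, and
the subspaces `k n` and `a n`. -/
noncomputable def tower : DiagonalSystem → LieTower
  | linear .real S => (S.system ℝ).tower
  | linear .complex S => (S.system ℂ).tower
  | linear .quaternion S => (S.system ℍ[ℝ]).tower
  | unitary .real S => (S.system ℝ).tower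
  | unitary .complex S => S.complexSystem.tower
  | unitary .quaternion S => (S.system ℍ[ℝ]).tower
  | symplecticReal S => (S.system ℝ).tower
  | symplecticComplex S => (S.system ℂ).tower
  | complexOrthogonal S => S.complexSystem.tower
  | starOrthogonal S => S.starSystem.tower

end DiagonalSystem

/-! All families are brought to one common form: at each level `a n` is a commutative space of
hermitian matrices, spanned by elements ξ with ξ³ = ξ that involve at most two coordinates
(`ClassicalSystem.Standard`). Then ad ξ is left minus right multiplication by ξ, hence
diagonalizable with eigenvalues among -2, -1, 0, 1, 2 (`isFiveValued_ad`), and every level splits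
into joint eigenspaces of `a n`.

Suppose that the system is not of classical type. The invariant that decides everything is the
largest number of nonzero entries of a matrix in distinct rows and columns. An embedding multiplies
such matchings by r + s, so under the maps of the system the matching number of a nonzero element
tends to infinity (`spreads`). A root vector, however, admits no matching of size larger than 4:
some ξ in `a n` with two coordinates acts on it by a nonzero scalar, which forces all of its nonzero
entries into two rows and two columns (`matching_le`). Hence no nonzero element stays a root vector
forever. Consequently the image of any root vector eventually has at least two root components, so
every root has two different extensions to roots of some higher level (`exists_branch`). The
resulting tree has uncountably many branches (`not_countable_limitRoots`). Moreover all root spaces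
of the limit vanish, and 𝔤 = 𝔪 + 𝔞 is impossible because 𝔪 + 𝔞 centralizes 𝔞 while some root exists
at a finite level (`not_reductive`).

Suppose that the system is of classical type. From some level on each map is X ↦ F X Fᵀ or X ↦ -F Xᵗ
Fᵀ for a signed injection F of coordinates (`exists_place`), so the trace forms are preserved. A
functional in the inverse limit is represented at level ν k by a vector of `a (ν k)`; the vector of
a higher level projects orthogonally onto the one of a lower level, so the norms do not decrease. As
only finitely many norms occur, a maximal one is attained, and from there on the vectors are images
of one another. Thus the functional is the extension by zero of a root (`limitRoots_subset`).
Conversely the extension by zero of a root is again a root (`IsLinear.persists`,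
`persists_of_frame`). The one exception concerns roots whose root vectors meet a coordinate that is
not paired by `a n`: such roots survive to a higher level if that level also has an unpaired
coordinate. This is why a cofinal subsystem is needed, along which unpaired coordinates exist always
or never. Finally, an element of a level generates, over all later `a m`, modules supported on a
bounded number of coordinates; the dimensions stabilize, so the element lies in a finite-dimensional
submodule of the limit, which splits into joint eigenspaces (`boundedModules`,
`mem_iSup_rootSpace`). The eigenspace for 0 is contained in 𝔪 + 𝔞 because each `a n` is maximal
(`reductive`). -/

set_option linter.unusedSectionVars false

/-! ## Joint eigenspaces -/

section JointEigenspaces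

variable {V A : Type*} [AddCommGroup V] [Module ℝ V] [AddCommGroup A] [Module ℝ A]

/-- The joint eigenspace of a linear family of endomorphisms for the linear functional `γ`. -/
def jointEigenspace (ρ : A →ₗ[ℝ] Module.End ℝ V) (γ : Module.Dual ℝ A) : Submodule ℝ V where
  carrier := {v | ∀ ξ, ρ ξ v = γ ξ • v}
  zero_mem' := fun ξ => by rw [map_zero, smul_zero]
  add_mem' := fun hx hy ξ => by rw [map_add, hx ξ, hy ξ, smul_add]
  smul_mem' := fun c _ hx ξ => by rw [map_smul, hx ξ, smul_comm]

/-- An endomorphism whose eigenvalues are at most `-2`, `-1`, `0`, `1`, `2`, and that is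
diagonalizable. -/
def IsFiveValued (F : Module.End ℝ V) : Prop := F ^ 5 - (5 : ℝ) • F ^ 3 + (4 : ℝ) • F = 0

/-- The polynomial x⁵ - 5x³ + 4x has the five simple roots 0, ±1, ±2, so Lagrange interpolation at
these points writes the identity as a sum of operators with values in the eigenspaces. -/
theorem IsFiveValued.iSup_eigenspace {F : Module.End ℝ V} (h : IsFiveValued F) :
    ⨆ μ, F.eigenspace μ = ⊤ := by
  rw [eq_top_iff]
  rintro x -
  have key : ∀ (G : Module.End ℝ V) (μ : ℝ), F * G - μ • G = 0 → G x ∈ ⨆ μ, F.eigenspace μ := by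
    intro G μ hG
    refine Submodule.mem_iSup_of_mem μ (Module.End.mem_eigenspace_iff.2 ?_)
    have := congrArg (fun H : Module.End ℝ V => H x) hG
    simpa [sub_eq_zero] using this
  -- The Lagrange polynomials at 0, 1, -1, 2, -2, in this order; multiplying one of them by (F - μ)
  -- gives a multiple of the annihilating polynomial, and their sum is 1.
  have h0 := key ((1/4 : ℝ) • (F ^ 4 - (5 : ℝ) • F ^ 2 + (4 : ℝ) • 1)) 0 (by
    calc _ = (1/4 : ℝ) • (F ^ 5 - (5 : ℝ) • F ^ 3 + (4 : ℝ) • F) := by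
          simp only [mul_smul_comm, mul_sub, mul_add, mul_one, ← pow_succ']; module
      _ = 0 := by rw [h, smul_zero])
  have h1 := key ((-1/6 : ℝ) • (F ^ 4 + F ^ 3 - (4 : ℝ) • F ^ 2 - (4 : ℝ) • F)) 1 (by
    calc _ = (-1/6 : ℝ) • (F ^ 5 - (5 : ℝ) • F ^ 3 + (4 : ℝ) • F) := by
          simp only [mul_smul_comm, mul_sub, mul_add, ← pow_succ', ← sq]; module
      _ = 0 := by rw [h, smul_zero])
  have h2 := key ((-1/6 : ℝ) • (F ^ 4 - F ^ 3 - (4 : ℝ) • F ^ 2 + (4 : ℝ) • F)) (-1) (by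
    calc _ = (-1/6 : ℝ) • (F ^ 5 - (5 : ℝ) • F ^ 3 + (4 : ℝ) • F) := by
          simp only [mul_smul_comm, mul_sub, mul_add, ← pow_succ', ← sq]; module
      _ = 0 := by rw [h, smul_zero])
  have h3 := key ((1/24 : ℝ) • (F ^ 4 + (2 : ℝ) • F ^ 3 - F ^ 2 - (2 : ℝ) • F)) 2 (by
    calc _ = (1/24 : ℝ) • (F ^ 5 - (5 : ℝ) • F ^ 3 + (4 : ℝ) • F) := by
          simp only [mul_smul_comm, mul_sub, mul_add, ← pow_succ', ← sq]; module
      _ = 0 := by rw [h, smul_zero])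
  have h4 := key ((1/24 : ℝ) • (F ^ 4 - (2 : ℝ) • F ^ 3 - F ^ 2 + (2 : ℝ) • F)) (-2) (by
    calc _ = (1/24 : ℝ) • (F ^ 5 - (5 : ℝ) • F ^ 3 + (4 : ℝ) • F) := by
          simp only [mul_smul_comm, mul_sub, mul_add, ← pow_succ', ← sq]; module
      _ = 0 := by rw [h, smul_zero])
  have hs := Submodule.add_mem _ (Submodule.add_mem _ (Submodule.add_mem _ (Submodule.add_mem _
    h0 h1) h2) h3) h4
  convert hs using 1
  simp only [LinearMap.smul_apply, LinearMap.add_apply, LinearMap.sub_apply, Module.End.one_apply]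
  module

theorem IsFiveValued.eigenvalue {F : Module.End ℝ V} (h : IsFiveValued F) {μ : ℝ} {v : V}
    (hv : v ≠ 0) (hμ : F v = μ • v) : μ ∈ ({-2, -1, 0, 1, 2} : Set ℝ) := by
  have hp : ∀ k : ℕ, (F ^ k) v = μ ^ k • v := by
    intro k
    induction k with
    | zero => simp
    | succ k ih => rw [pow_succ', Module.End.mul_apply, ih, map_smul, hμ, smul_smul, pow_succ]
  have h1 := congrArg (fun H : Module.End ℝ V => H v) h
  simp only [LinearMap.add_apply, LinearMap.sub_apply, LinearMap.smul_apply, hp, hμ,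
    LinearMap.zero_apply, smul_smul, ← sub_smul, ← add_smul] at h1
  have h2 := (smul_eq_zero.1 h1).resolve_right hv
  have h3 : (μ + 2) * ((μ + 1) * (μ * ((μ - 1) * (μ - 2)))) = 0 := by rw [← h2]; ring
  rcases mul_eq_zero.1 h3 with h | h
  · left; linarith
  rcases mul_eq_zero.1 h with h | h
  · right; left; linarith
  rcases mul_eq_zero.1 h with h | h
  · right; right; left; exact h
  rcases mul_eq_zero.1 h with h | h
  · right; right; right; left; linarith
  · right; right; right; right; rw [Set.mem_singleton_iff]; linarith

/-- Split a generalized eigenvector into an eigenvector for `μ` and eigenvectors for other values.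
The second part is a generalized eigenvector for `μ` too, so it vanishes by independence. This turns
the simultaneous decomposition for commuting families, which concerns generalized eigenspaces, into
one for eigenspaces. -/
theorem maxGenEigenspace_eq_of_iSup_eigenspace {F : Module.End ℝ V} (h : ⨆ μ, F.eigenspace μ = ⊤)
    (μ : ℝ) : F.maxGenEigenspace μ = F.eigenspace μ := by
  refine le_antisymm ?_ Module.End.eigenspace_le_maxGenEigenspace
  intro x hx
  have hx' : x ∈ ⨆ μ, F.eigenspace μ := h ▸ Submodule.mem_top
  have hle : ⨆ μ, F.eigenspace μ ≤ F.eigenspace μ ⊔ ⨆ (ν) (_ : ν ≠ μ), F.eigenspace ν := by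
    refine iSup_le fun ν => ?_
    by_cases hν : ν = μ
    · exact hν ▸ le_sup_left
    · exact le_sup_of_le_right (le_iSup₂_of_le ν hν le_rfl)
  obtain ⟨y, hy, z, hz, rfl⟩ := Submodule.mem_sup.1 (hle hx')
  have hd := (F.independent_maxGenEigenspace) μ
  have hz' : z ∈ ⨆ (ν) (_ : ν ≠ μ), F.maxGenEigenspace ν :=
    (iSup₂_mono fun ν _ => Module.End.eigenspace_le_maxGenEigenspace) hz
  have hz2 : z ∈ F.maxGenEigenspace μ := by
    have := Submodule.sub_mem _ hx (Module.End.eigenspace_le_maxGenEigenspace hy)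
    simpa using this
  rw [Submodule.disjoint_def.1 hd z hz2 hz', add_zero]
  exact hy

/-- Commuting diagonalizable endomorphisms that depend linearly on a parameter decompose every
finite-dimensional invariant subspace into joint eigenspaces. -/
theorem le_iSup_jointEigenspace (ρ : A →ₗ[ℝ] Module.End ℝ V)
    (hcomm : ∀ ξ ζ, Commute (ρ ξ) (ρ ζ)) (Θ : Set A) (hspan : Submodule.span ℝ Θ = ⊤)
    (hΘ : ∀ ξ ∈ Θ, IsFiveValued (ρ ξ)) (W : Submodule ℝ V) [FiniteDimensional ℝ W]
    (hW : ∀ ξ, ∀ v ∈ W, ρ ξ v ∈ W) :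
    W ≤ ⨆ γ, jointEigenspace ρ γ ⊓ W := by
  let f : Θ → Module.End ℝ W := fun ξ => (ρ ξ).restrict (hW ξ)
  have hpow : ∀ ξ (k : ℕ) (x : W), (((f ξ) ^ k) x : V) = ((ρ ξ) ^ k) x := by
    intro ξ k x
    induction k with
    | zero => rfl
    | succ k ih =>
      rw [pow_succ', pow_succ', Module.End.mul_apply, Module.End.mul_apply, ← ih]
      rfl
  have hf5 : ∀ ξ, IsFiveValued (f ξ) := by
    intro ξ
    ext x
    have h := congrArg (fun H : Module.End ℝ V => H x) (hΘ ξ ξ.2)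
    simp only [LinearMap.add_apply, LinearMap.sub_apply, LinearMap.smul_apply,
      LinearMap.zero_apply, Submodule.coe_add, Submodule.coe_sub, Submodule.coe_smul, hpow,
      Submodule.coe_zero] at h ⊢
    exact h
  have h1 := Module.End.iSup_iInf_maxGenEigenspace_eq_top_of_iSup_maxGenEigenspace_eq_top_of_commute
    f (by
      intro ξ ζ _
      ext x
      exact congrArg (fun H : Module.End ℝ V => H x) (hcomm ξ ζ).eq) (by
      intro ξ
      rw [eq_top_iff, ← (hf5 ξ).iSup_eigenspace]
      exact iSup_mono fun μ => Module.End.eigenspace_le_maxGenEigenspace)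
  simp only [fun ξ => maxGenEigenspace_eq_of_iSup_eigenspace (hf5 ξ).iSup_eigenspace] at h1
  have h2 : W = (⨆ χ : Θ → ℝ, ⨅ ξ, (f ξ).eigenspace (χ ξ)).map W.subtype := by
    rw [h1, Submodule.map_top, Submodule.range_subtype]
  refine h2.le.trans ?_
  rw [Submodule.map_iSup]
  refine iSup_le fun χ => ?_
  rintro _ ⟨v, hv, rfl⟩
  by_cases hv0 : v = 0
  · rw [hv0, map_zero]; exact Submodule.zero_mem _
  have hv' : ∀ ξ : Θ, ρ ξ v = χ ξ • (v : V) := by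
    intro ξ
    have := (Submodule.mem_iInf _).1 hv ξ
    exact congrArg Subtype.val (Module.End.mem_eigenspace_iff.1 this)
  have hvne : (v : V) ≠ 0 := fun h => hv0 (Subtype.ext h)
  -- A nonzero vector that is an eigenvector for all elements of `Θ` is one for their span. Its
  -- eigenvalue is then unique, hence linear in ξ, and this is the functional sought.
  have hall : ∀ ξ, ∃ c : ℝ, ρ ξ v = c • (v : V) := by
    intro ξ
    have hξ : ξ ∈ Submodule.span ℝ Θ := hspan ▸ Submodule.mem_top
    induction hξ using Submodule.span_induction with
    | mem ξ hξ => exact ⟨_, hv' ⟨ξ, hξ⟩⟩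
    | zero => exact ⟨0, by simp⟩
    | add ξ ζ _ _ h h' =>
      obtain ⟨c, hc⟩ := h
      obtain ⟨d, hd⟩ := h'
      exact ⟨c + d, by rw [map_add, LinearMap.add_apply, hc, hd, add_smul]⟩
    | smul r ξ _ h =>
      obtain ⟨c, hc⟩ := h
      exact ⟨r * c, by rw [map_smul, LinearMap.smul_apply, hc, smul_smul]⟩
  choose c hc using hall
  refine Submodule.mem_iSup_of_mem
    { toFun := c
      map_add' := fun ξ ζ => by
        apply smul_left_injective ℝ hvne
        simp only [add_smul, ← hc, map_add, LinearMap.add_apply]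
      map_smul' := fun r ξ => by
        apply smul_left_injective ℝ hvne
        simp only [smul_eq_mul, RingHom.id_apply, mul_smul, ← hc, map_smul,
          LinearMap.smul_apply] } ⟨hc, v.2⟩

end JointEigenspaces

/-! ## Direct limits of Lie algebras with diagonalizable subspaces -/

namespace LieTower

variable (T : LieTower)

theorem of_trans (n m : ℕ) (h : n ≤ m) (x : T.L n) : T.of m (T.trans n m h x) = T.of n x :=
  Quotient.sound ⟨m, le_rfl, h, by simp [trans_self]⟩

theorem trans_trans (i j k : ℕ) (hij : i ≤ j) (hjk : j ≤ k) (x : T.L i) :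
    T.trans j k hjk (T.trans i j hij x) = T.trans i k (hij.trans hjk) x :=
  DirectedSystem.map_map (f := fun i j h => T.trans i j h) hij hjk x

theorem trans_succ_apply (n m : ℕ) (h : n ≤ m) (x : T.L n) :
    T.trans n (m + 1) (h.trans (Nat.le_succ m)) x = T.f m (T.trans n m h x) := by
  rw [trans_succ _ _ _ h, LieHom.comp_apply]

theorem trans_self_apply (n : ℕ) (x : T.L n) : T.trans n n le_rfl x = x := by
  rw [trans_self]; rfl

theorem trans_one_apply (n : ℕ) (x : T.L n) : T.trans n (n + 1) (Nat.le_succ n) x = T.f n x := by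
  rw [T.trans_succ_apply n n le_rfl, trans_self_apply]

theorem exists_of (x : T.Limit) : ∃ n y, T.of n y = x := by
  obtain ⟨n, y, h⟩ := DirectLimit.exists_eq_mk _ x
  exact ⟨n, y, h.symm⟩

variable {T}

theorem Aligned.trans_mem (h : T.Aligned) (n m : ℕ) (hnm : n ≤ m) {x : T.L n} (hx : x ∈ T.a n) :
    T.trans n m hnm x ∈ T.a m := by
  induction hnm with
  | refl => rwa [trans_self_apply]
  | step hnm ih =>
    rw [T.trans_succ_apply _ _ hnm]
    exact h _ (Submodule.mem_map_of_mem ih)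

/-- The map `a n → a m` for `n ≤ m`. -/
noncomputable def Aligned.transA (h : T.Aligned) (n m : ℕ) (hnm : n ≤ m) : T.a n →ₗ[ℝ] T.a m :=
  (T.trans n m hnm : T.L n →ₗ[ℝ] T.L m).restrict fun _ hx => h.trans_mem n m hnm hx

theorem Aligned.coe_transA (h : T.Aligned) (n m : ℕ) (hnm : n ≤ m) (x : T.a n) :
    (h.transA n m hnm x : T.L m) = T.trans n m hnm x := rfl

theorem Aligned.ofA_transA (h : T.Aligned) (n m : ℕ) (hnm : n ≤ m) (x : T.a n) :
    T.ofA m (h.transA n m hnm x) = T.ofA n x :=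
  Subtype.ext (T.of_trans n m hnm x)

theorem Aligned.transA_trans (h : T.Aligned) (i j k : ℕ) (hij : i ≤ j) (hjk : j ≤ k) (x : T.a i) :
    h.transA j k hjk (h.transA i j hij x) = h.transA i k (hij.trans hjk) x :=
  Subtype.ext (T.trans_trans i j k hij hjk x)

theorem Aligned.res_transA (h : T.Aligned) (n m : ℕ) (hnm : n ≤ m) (γ : Module.Dual ℝ T.limitA) :
    T.res m γ ∘ₗ h.transA n m hnm = T.res n γ := by
  ext x
  exact congrArg γ (h.ofA_transA n m hnm x)

/-- The images of the `a n` in the limit increase with n, so their sum is their union. -/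
theorem Aligned.exists_ofA (h : T.Aligned) (ξ : T.limitA) :
    ∃ n, ∀ m, n ≤ m → ∃ x : T.a m, T.ofA m x = ξ := by
  obtain ⟨ξ, hξ⟩ := ξ
  have hmono : Monotone fun n => (T.a n).map (T.of n : T.L n →ₗ[ℝ] T.Limit) := by
    refine monotone_nat_of_le_succ fun n => ?_
    rintro _ ⟨x, hx, rfl⟩
    refine ⟨T.trans n (n + 1) (Nat.le_succ n) x, h.trans_mem _ _ _ hx, ?_⟩
    exact T.of_trans _ _ _ x
  obtain ⟨n, hn⟩ := (Submodule.mem_iSup_of_directed _ hmono.directed_le).1 hξ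
  refine ⟨n, fun m hm => ?_⟩
  obtain ⟨x, hx, hxξ⟩ := hmono hm hn
  exact ⟨⟨x, hx⟩, Subtype.ext hxξ⟩

theorem commute_ad_of_lie_eq_zero {L : Type} [LieRing L] [LieAlgebra ℝ L] {x y : L} (hxy : ⁅x, y⁆ = 0) :
    Commute (LieAlgebra.ad ℝ L x) (LieAlgebra.ad ℝ L y) := by
  rw [commute_iff_lie_eq, ← LieHom.map_lie, hxy, map_zero]

variable (T) in
/-- The adjoint action of `a n` on level `n`. -/
noncomputable def adA (n : ℕ) : T.a n →ₗ[ℝ] Module.End ℝ (T.L n) :=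
  (LieAlgebra.ad ℝ (T.L n) : T.L n →ₗ[ℝ] Module.End ℝ (T.L n)) ∘ₗ (T.a n).subtype

theorem adA_apply (n : ℕ) (ξ : T.a n) (x : T.L n) : T.adA n ξ x = ⁅(ξ : T.L n), x⁆ := rfl

theorem mem_jointEigenspace_adA {n : ℕ} {γ : Module.Dual ℝ (T.a n)} {x : T.L n} :
    x ∈ jointEigenspace (T.adA n) γ ↔ ∀ ξ : T.a n, ⁅(ξ : T.L n), x⁆ = γ ξ • x := Iff.rfl

theorem mem_rootSpace {γ : Module.Dual ℝ T.limitA} {η : T.Limit} :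
    η ∈ T.rootSpace γ ↔ ∀ ξ : T.limitA, ⁅(ξ : T.Limit), η⁆ = γ ξ • η := Iff.rfl

variable (T) in
/-- The homomorphisms are injective and compatible with the subspaces `a n`, which are abelian and
spanned by elements of `Θ n` that act diagonalizably. -/
structure Diagonalizable (Θ : ∀ n, Set (T.L n)) : Prop where
  finite : ∀ n, FiniteDimensional ℝ (T.L n)
  injective : ∀ n, Function.Injective (T.f n)
  aligned : T.Aligned
  span : ∀ n, T.a n = Submodule.span ℝ (Θ n)
  map : ∀ n, ∀ ξ ∈ Θ n, T.f n ξ ∈ Θ (n + 1)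
  comm : ∀ n, ∀ ξ ∈ T.a n, ∀ ζ ∈ T.a n, ⁅ξ, ζ⁆ = 0
  five : ∀ n, ∀ ξ ∈ Θ n, IsFiveValued (LieAlgebra.ad ℝ (T.L n) ξ)

namespace Diagonalizable

variable {Θ : ∀ n, Set (T.L n)} (h : T.Diagonalizable Θ)

include h

theorem trans_injective (n m : ℕ) (hnm : n ≤ m) : Function.Injective (T.trans n m hnm) := by
  induction hnm with
  | refl => intro x y hxy; rwa [trans_self_apply, trans_self_apply] at hxy
  | step hnm ih =>
    intro x y hxy
    rw [T.trans_succ_apply _ _ hnm, T.trans_succ_apply _ _ hnm] at hxy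
    exact ih (h.injective _ hxy)

theorem of_injective (n : ℕ) : Function.Injective (T.of n) :=
  DirectLimit.mk_injective _ (fun i j hij => h.trans_injective i j hij) n

theorem commute_adA (n : ℕ) (ξ ζ : T.a n) : Commute (T.adA n ξ) (T.adA n ζ) :=
  commute_ad_of_lie_eq_zero (h.comm n ξ ξ.2 ζ ζ.2)

theorem le_iSup (n : ℕ) (W : Submodule ℝ (T.L n)) (hW : ∀ ξ ∈ T.a n, ∀ x ∈ W, ⁅ξ, x⁆ ∈ W) :
    W ≤ ⨆ γ, jointEigenspace (T.adA n) γ ⊓ W := by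
  have := h.finite n
  refine le_iSup_jointEigenspace (T.adA n) (h.commute_adA n) ((T.a n).subtype ⁻¹' (Θ n)) ?_
    (fun ξ (hξ : (ξ : T.L n) ∈ Θ n) => h.five n ξ hξ) W fun ξ x hx => hW ξ ξ.2 x hx
  have hΘ : Θ n ⊆ Set.range (T.a n).subtype := by
    rw [Submodule.coe_subtype, Subtype.range_val, h.span n]
    exact Submodule.subset_span
  apply Submodule.map_injective_of_injective (T.a n).subtype_injective
  rw [Submodule.map_span, Submodule.map_top, Submodule.range_subtype,
    Set.image_preimage_eq_of_subset hΘ, ← h.span n]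

/-- The image of a joint eigenvector is a sum of joint eigenvectors for functionals that extend the
given one. -/
theorem f_mem_iSup (n : ℕ) {γ : Module.Dual ℝ (T.a n)} {η : T.L n}
    (hη : η ∈ jointEigenspace (T.adA n) γ) :
    T.f n η ∈ ⨆ (γ' : Module.Dual ℝ (T.a (n + 1)))
      (_ : γ' ∘ₗ h.aligned.transA n (n + 1) (Nat.le_succ n) = γ),
        jointEigenspace (T.adA (n + 1)) γ' := by
  -- The vectors of level n + 1 on which the image of `a n` acts through `γ`. Since `a (n + 1)` is
  -- commutative, W is invariant under it and splits; the functional of every nonzero component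
  -- restricts to `γ`.
  let W : Submodule ℝ (T.L (n + 1)) :=
    jointEigenspace (T.adA (n + 1) ∘ₗ h.aligned.transA n (n + 1) (Nat.le_succ n)) γ
  have hact : ∀ (ξ : T.a n) (x : T.L (n + 1)),
      (T.adA (n + 1) ∘ₗ h.aligned.transA n (n + 1) (Nat.le_succ n)) ξ x = ⁅T.f n ξ, x⁆ := by
    intro ξ x
    rw [LinearMap.comp_apply, adA_apply, Aligned.coe_transA, trans_one_apply]
  have hηW : T.f n η ∈ W := by
    intro ξ
    rw [hact, ← LieHom.map_lie, mem_jointEigenspace_adA.1 hη ξ]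
    exact map_smul (T.f n : T.L n →ₗ[ℝ] T.L (n + 1)) _ _
  refine SetLike.le_def.1 (iSup_le fun γ' => ?_) (h.le_iSup (n + 1) W ?_ hηW)
  · rintro x ⟨hx, hxW⟩
    by_cases hx0 : x = 0
    · rw [hx0]; exact Submodule.zero_mem _
    · refine Submodule.mem_iSup_of_mem γ' (Submodule.mem_iSup_of_mem ?_ hx)
      ext ξ
      have h1 := hxW ξ
      rw [LinearMap.comp_apply, hx] at h1
      exact smul_left_injective ℝ hx0 h1
  · intro ξ hξ x hx ζ
    have hc := h.commute_adA (n + 1) (h.aligned.transA n (n + 1) (Nat.le_succ n) ζ) ⟨ξ, hξ⟩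
    have h1 := congrArg (fun H : Module.End ℝ (T.L (n + 1)) => H x) hc.eq
    simp only [Module.End.mul_apply] at h1
    refine h1.trans ?_
    have h2 := hx ζ
    rw [LinearMap.comp_apply] at h2
    rw [h2, map_smul]
    rfl

theorem mem_roots_of_comp {n m : ℕ} (hnm : n ≤ m) {γ : Module.Dual ℝ (T.a m)} {η : T.L m}
    (hη0 : η ≠ 0) (hη : η ∈ jointEigenspace (T.adA m) γ) {γ' : Module.Dual ℝ (T.a n)}
    (hγ' : γ' ≠ 0) (hγ : γ ∘ₗ h.aligned.transA n m hnm = γ') : γ ∈ T.roots m := by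
  refine ⟨?_, η, hη0, hη⟩
  rintro rfl
  exact hγ' (by rw [← hγ, LinearMap.zero_comp])

end Diagonalizable

/-! ### Roots that spread out -/

variable (T) in
/-- No nonzero element of a level stays a joint eigenvector for a nonzero functional at all higher
levels. -/
def Spreads : Prop := ∀ n (η : T.L n), η ≠ 0 → ∃ m, ∃ hnm : n ≤ m,
  ∀ γ : Module.Dual ℝ (T.a m), γ ≠ 0 → T.trans n m hnm η ∉ jointEigenspace (T.adA m) γ

/-- `γ'` restricts to `γ`, and to roots of all levels in between. -/
def RootPath (hal : T.Aligned) (x y : Σ n, Module.Dual ℝ (T.a n)) : Prop :=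
  ∃ hxy : x.1 ≤ y.1, y.2 ∘ₗ hal.transA x.1 y.1 hxy = x.2 ∧
    ∀ j, x.1 ≤ j → ∀ hj : j ≤ y.1, y.2 ∘ₗ hal.transA j y.1 hj ∈ T.roots j

theorem RootPath.trans {hal : T.Aligned} {x y z : Σ n, Module.Dual ℝ (T.a n)}
    (hxy : RootPath hal x y) (hyz : RootPath hal y z) : RootPath hal x z := by
  obtain ⟨h1, h2, h3⟩ := hxy
  obtain ⟨h4, h5, h6⟩ := hyz
  have key : ∀ j (hj : j ≤ y.1), z.2 ∘ₗ hal.transA j z.1 (hj.trans h4) =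
      y.2 ∘ₗ hal.transA j y.1 hj := by
    intro j hj
    rw [← h5]
    ext v
    simp only [LinearMap.comp_apply, hal.transA_trans]
  refine ⟨h1.trans h4, ?_, fun j hxj hj => ?_⟩
  · rw [key x.1 h1, h2]
  · rcases le_total j y.1 with hjy | hjy
    · rw [key j hjy]; exact h3 j hxj hjy
    · exact h6 j hjy hj

theorem Aligned.transA_self (hal : T.Aligned) (n : ℕ) : hal.transA n n le_rfl = LinearMap.id :=
  LinearMap.ext fun x => Subtype.ext (T.trans_self_apply n x)

theorem RootPath.refl {hal : T.Aligned} {x : Σ n, Module.Dual ℝ (T.a n)} (hx : x.2 ∈ T.roots x.1) :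
    RootPath hal x x := by
  have h0 : x.2 ∘ₗ hal.transA x.1 x.1 le_rfl = x.2 := by rw [hal.transA_self, LinearMap.comp_id]
  refine ⟨le_rfl, h0, fun j h1 h2 => ?_⟩
  obtain rfl : j = x.1 := le_antisymm h2 h1
  rw [h0]; exact hx

theorem RootPath.succ {hal : T.Aligned} {n : ℕ} {γ : Module.Dual ℝ (T.a n)}
    {γ' : Module.Dual ℝ (T.a (n + 1))} (hγ : γ ∈ T.roots n) (hγ' : γ' ∈ T.roots (n + 1))
    (hc : γ' ∘ₗ hal.transA n (n + 1) (Nat.le_succ n) = γ) :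
    RootPath hal ⟨n, γ⟩ ⟨n + 1, γ'⟩ := by
  refine ⟨Nat.le_succ n, hc, fun j (h1 : n ≤ j) (h2 : j ≤ n + 1) => ?_⟩
  rcases h1.eq_or_lt with rfl | h3
  · exact hc.symm ▸ hγ
  · obtain rfl : j = n + 1 := le_antisymm h2 h3
    change γ' ∘ₗ _ ∈ _
    rw [hal.transA_self, LinearMap.comp_id]; exact hγ'

theorem RootPath.root {hal : T.Aligned} {x y : Σ n, Module.Dual ℝ (T.a n)}
    (hxy : RootPath hal x y) : y.2 ∈ T.roots y.1 := by
  have := hxy.2.2 y.1 hxy.1 le_rfl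
  rwa [hal.transA_self, LinearMap.comp_id] at this

/-- Compatible functionals on a cofinal sequence of levels define a functional on the limit. -/
theorem Aligned.exists_functional (hal : T.Aligned)
    (hinj : ∀ n, Function.Injective (T.of n)) (x : ℕ → Σ n, Module.Dual ℝ (T.a n))
    (hx : StrictMono fun k => (x k).1)
    (hc : ∀ j k (hjk : j ≤ k), (x k).2 ∘ₗ hal.transA (x j).1 (x k).1 (hx.monotone hjk) = (x j).2) :
    ∃ γ : Module.Dual ℝ T.limitA, ∀ k, T.res (x k).1 γ = (x k).2 := by
  have hex : ∀ ξ : T.limitA, ∃ k, ∃ v : T.a (x k).1, T.ofA (x k).1 v = ξ := by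
    intro ξ
    obtain ⟨n, hn⟩ := hal.exists_ofA ξ
    exact ⟨n, hn _ hx.le_apply⟩
  have huni : ∀ j k (v : T.a (x j).1) (w : T.a (x k).1), T.ofA (x j).1 v = T.ofA (x k).1 w →
      (x j).2 v = (x k).2 w := by
    have : ∀ j k, j ≤ k → ∀ (v : T.a (x j).1) (w : T.a (x k).1),
        T.ofA (x j).1 v = T.ofA (x k).1 w → (x j).2 v = (x k).2 w := by
      intro j k hjk v w hvw
      rw [← hal.ofA_transA _ _ (hx.monotone hjk)] at hvw
      rw [← hc j k hjk, LinearMap.comp_apply]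
      congr 1
      exact Subtype.ext (hinj _ (congrArg Subtype.val hvw))
    intro j k v w hvw
    rcases le_total j k with hjk | hjk
    · exact this j k hjk v w hvw
    · exact (this k j hjk w v hvw.symm).symm
  choose k v hv using hex
  -- The value does not depend on the representative of ξ. Linearity then follows by moving two
  -- elements to a common level.
  have hval : ∀ j (w : T.a (x j).1), (x (k (T.ofA _ w))).2 (v (T.ofA _ w)) = (x j).2 w :=
    fun j w => huni _ _ _ _ (hv _)
  have hto : ∀ j l (_ : j ≤ l) (w : T.a (x j).1), ∃ w' : T.a (x l).1,
      T.ofA _ w' = T.ofA _ w := fun j l hjl w =>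
    ⟨hal.transA _ _ (hx.monotone hjl) w, hal.ofA_transA _ _ _ w⟩
  refine ⟨{ toFun := fun ξ => (x (k ξ)).2 (v ξ), map_add' := ?_, map_smul' := ?_ }, fun j => ?_⟩
  · intro ξ ζ
    obtain ⟨w, hw⟩ := hto _ _ (le_max_left (k ξ) (k ζ)) (v ξ)
    obtain ⟨w', hw'⟩ := hto _ _ (le_max_right (k ξ) (k ζ)) (v ζ)
    rw [hv] at hw hw'
    have h1 := hval _ (w + w')
    have h2 := hval _ w
    have h3 := hval _ w'
    rw [map_add, hw, hw'] at h1
    rw [hw] at h2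
    rw [hw'] at h3
    rw [h1, h2, h3, map_add]
  · intro c ξ
    have h1 := hval _ (c • v ξ)
    rw [map_smul, hv] at h1
    rw [h1, map_smul, RingHom.id_apply]
  · ext w
    exact hval j w

namespace Diagonalizable

variable {Θ : ∀ n, Set (T.L n)} (h : T.Diagonalizable Θ)

include h

/-- If the root had only one extension at every higher level, the image of its root vector would
have a single component each time. It would then remain a joint eigenvector for a nonzero functional
forever, which `Spreads` excludes. -/
theorem exists_branch (hs : T.Spreads) {n : ℕ} {γ : Module.Dual ℝ (T.a n)} (hγ : γ ∈ T.roots n) :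
    ∃ m, n < m ∧ ∃ γ₁ γ₂ : Module.Dual ℝ (T.a m), γ₁ ≠ γ₂ ∧
      RootPath h.aligned ⟨n, γ⟩ ⟨m, γ₁⟩ ∧ RootPath h.aligned ⟨n, γ⟩ ⟨m, γ₂⟩ := by
  by_contra hcon
  push Not at hcon
  obtain ⟨hγ0, η, hη0, hη⟩ := hγ
  have key : ∀ m (hnm : n ≤ m), ∃ γ' : Module.Dual ℝ (T.a m),
      RootPath h.aligned ⟨n, γ⟩ ⟨m, γ'⟩ ∧
        T.trans n m hnm η ∈ jointEigenspace (T.adA m) γ' := by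
    intro m hnm
    induction hnm with
    | refl => exact ⟨γ, RootPath.refl ⟨hγ0, η, hη0, hη⟩, by rwa [trans_self_apply]⟩
    | @step m hnm ih =>
      obtain ⟨γ', hp, hmem⟩ := ih
      rw [T.trans_succ_apply _ _ hnm]
      have h1 := h.f_mem_iSup m hmem
      have hpath : ∀ γ'' : Module.Dual ℝ (T.a (m + 1)),
          γ'' ∘ₗ h.aligned.transA m (m + 1) (Nat.le_succ m) = γ' →
          jointEigenspace (T.adA (m + 1)) γ'' ≠ ⊥ →
          RootPath h.aligned ⟨n, γ⟩ ⟨m + 1, γ''⟩ := by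
        intro γ'' hc hbot
        obtain ⟨x, hx, hx0⟩ := Submodule.exists_mem_ne_zero_of_ne_bot hbot
        exact hp.trans (RootPath.succ hp.root
          (h.mem_roots_of_comp (Nat.le_succ m) hx0 hx hp.root.1 hc) hc)
      have hne : T.f m (T.trans n m hnm η) ≠ 0 := by
        intro h0
        rw [← T.trans_succ_apply n m hnm] at h0
        exact hη0 (h.trans_injective _ _ _ (h0.trans (map_zero _).symm))
      -- The image of `η` is not zero, so at least one of its components is present.
      have hex : ∃ γ₀ : Module.Dual ℝ (T.a (m + 1)),
          γ₀ ∘ₗ h.aligned.transA m (m + 1) (Nat.le_succ m) = γ' ∧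
            jointEigenspace (T.adA (m + 1)) γ₀ ≠ ⊥ := by
        by_contra hno
        push Not at hno
        apply hne
        rw [← Submodule.mem_bot ℝ]
        refine SetLike.le_def.1 (iSup₂_le fun γ'' hc => ?_) h1
        exact (hno γ'' hc).le
      obtain ⟨γ₀, hc₀, hb₀⟩ := hex
      refine ⟨γ₀, hpath γ₀ hc₀ hb₀, ?_⟩
      -- A nonzero joint eigenspace for an extension other than `γ₀` would give a second path,
      -- contrary to `hcon`; so the whole image belongs to `γ₀`.
      refine SetLike.le_def.1 (iSup₂_le fun γ'' hc => ?_) h1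
      by_cases hb : jointEigenspace (T.adA (m + 1)) γ'' = ⊥
      · rw [hb]; exact bot_le
      · by_cases heq : γ'' = γ₀
        · rw [heq]
        · exact absurd (hpath γ₀ hc₀ hb₀)
            (hcon (m + 1) (Nat.lt_succ_of_le hnm) γ'' γ₀ heq (hpath γ'' hc hb))
  obtain ⟨m, hnm, hm⟩ := hs n η hη0
  obtain ⟨γ', hp, hmem⟩ := key m hnm
  exact hm γ' hp.root.1 hmem

/-- Cantor's diagonal argument on the tree of roots: given an enumeration `g`, the k-th branching is
used to leave the functional `g k`, and the functional defined by the resulting path is not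
enumerated. -/
theorem not_countable_limitRoots (hs : T.Spreads) (hroot : ∃ n, (T.roots n).Nonempty)
    (ν : ℕ → ℕ) (hν : StrictMono ν) : ¬ (T.limitRoots ν).Countable := by
  intro hcount
  obtain ⟨g, hg⟩ := Set.countable_iff_exists_subset_range.1 hcount
  obtain ⟨n₀, γ₀, hγ₀⟩ := hroot
  let State := {x : Σ n, Module.Dual ℝ (T.a n) // x.2 ∈ T.roots x.1}
  have hstep : ∀ (x : State) (β : Module.Dual ℝ T.limitA), ∃ y : State, x.1.1 < y.1.1 ∧
      RootPath h.aligned x.1 y.1 ∧ T.res y.1.1 β ≠ y.1.2 := by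
    intro x β
    obtain ⟨m, hm, γ₁, γ₂, hne, h1, h2⟩ := h.exists_branch hs x.2
    by_cases hβ : T.res m β = γ₁
    -- Two different functionals on the same level cannot both be the restriction of `β`; the path
    -- continues with one that is not.
    · exact ⟨⟨⟨m, γ₂⟩, h2.root⟩, hm, h2, fun hβ' => hne (hβ.symm.trans hβ')⟩
    · exact ⟨⟨⟨m, γ₁⟩, h1.root⟩, hm, h1, hβ⟩
  choose next hlt hpath hneq using hstep
  let x : ℕ → State := fun k => Nat.rec ⟨⟨n₀, γ₀⟩, hγ₀⟩ (fun k y => next y (g k)) k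
  have hx : StrictMono fun k => (x k).1.1 := strictMono_nat_of_lt_succ fun k => hlt (x k) (g k)
  have hp : ∀ j k, j ≤ k → RootPath h.aligned (x j).1 (x k).1 := by
    intro j k hjk
    induction hjk with
    | refl => exact RootPath.refl (x j).2
    | step _ ih => exact ih.trans (hpath _ _)
  obtain ⟨γ, hγ⟩ := h.aligned.exists_functional h.of_injective (fun k => (x k).1) hx
    fun j k hjk => (hp j k hjk).2.1
  -- The levels `ν k` need not be levels where the path branches. It is for them that a `RootPath`
  -- records that the restrictions to all intermediate levels are roots.
  have hmem : γ ∈ T.limitRoots ν := by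
    refine Filter.eventually_atTop.2 ⟨n₀, fun k hk => ?_⟩
    have h1 : ν k ≤ (x (ν k)).1.1 := hx.le_apply
    have h2 := (hp 0 (ν k) (Nat.zero_le _)).2.2 (ν k) (hk.trans hν.le_apply) h1
    rw [← hγ] at h2
    rwa [h.aligned.res_transA] at h2
  obtain ⟨k, hk⟩ := hg hmem
  exact hneq (x k) (g k) ((congrArg (T.res _) hk).trans (hγ (k + 1)))

/-- The equation of a root vector in the limit descends to every level that contains the vector,
because the maps into the limit are injective. -/
theorem res_trans_mem {γ : Module.Dual ℝ T.limitA} {n : ℕ} {η : T.L n}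
    (hη : T.of n η ∈ T.rootSpace γ) (m : ℕ) (hnm : n ≤ m) :
    T.trans n m hnm η ∈ jointEigenspace (T.adA m) (T.res m γ) := by
  intro ξ
  apply h.of_injective m
  have h1 := mem_rootSpace.1 hη (T.ofA m ξ)
  rw [adA_apply, LieHom.map_lie, of_trans]
  refine h1.trans ?_
  rw [map_smul, of_trans]
  rfl

theorem exists_res_ne_zero {γ : Module.Dual ℝ T.limitA} (hγ : γ ≠ 0) :
    ∃ n, ∀ m, n ≤ m → T.res m γ ≠ 0 := by
  obtain ⟨ξ, hξ⟩ : ∃ ξ, γ ξ ≠ 0 := by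
    by_contra hno
    push Not at hno
    exact hγ (LinearMap.ext hno)
  obtain ⟨n, hn⟩ := h.aligned.exists_ofA ξ
  refine ⟨n, fun m hm h0 => hξ ?_⟩
  obtain ⟨x, hx⟩ := hn m hm
  rw [← hx]
  exact congrArg (fun β : Module.Dual ℝ (T.a m) => β x) h0

omit h in
theorem limitRoots_ne_zero {ν : ℕ → ℕ} {γ : Module.Dual ℝ T.limitA} (hγ : γ ∈ T.limitRoots ν) :
    γ ≠ 0 := by
  rintro rfl
  obtain ⟨k, hk⟩ := Filter.Eventually.exists hγ
  exact hk.1 (LinearMap.zero_comp _)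

/-- A nonzero root vector of the limit comes from some level and remains a joint eigenvector at all
later ones. Once the restriction of `γ` has become nonzero, this contradicts `Spreads`. -/
theorem rootSpace_eq_bot (hs : T.Spreads) {γ : Module.Dual ℝ T.limitA} (hγ : γ ≠ 0) :
    T.rootSpace γ = ⊥ := by
  rw [eq_bot_iff]
  intro x hx
  by_contra hx0
  obtain ⟨n₁, y, rfl⟩ := T.exists_of x
  obtain ⟨n₂, hn₂⟩ := h.exists_res_ne_zero hγ
  let n := max n₁ n₂
  have hy : T.trans n₁ n (le_max_left _ _) y ≠ 0 := by
    intro h0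
    apply hx0
    rw [← of_trans _ _ _ (le_max_left n₁ n₂), h0, map_zero]
    exact Submodule.zero_mem _
  obtain ⟨m, hnm, hm⟩ := hs _ _ hy
  refine hm (T.res m γ) (hn₂ m ((le_max_right _ _).trans hnm)) ?_
  rw [trans_trans]
  exact h.res_trans_mem hx m _

/-- With all root spaces equal to zero, the decomposition would say that the limit is 𝔪 + 𝔞, which
centralizes 𝔞. A root vector of a finite level is not centralized. -/
theorem not_reductive (hs : T.Spreads) (hroot : ∃ n, (T.roots n).Nonempty) (ν : ℕ → ℕ) :
    ¬ T.RestrictedRootReductive ν := by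
  intro hred
  obtain ⟨n, γ, hγ, η, hη0, hη⟩ := hroot
  have hbot : (⨆ γ ∈ T.limitRoots ν, T.rootSpace γ) = ⊥ := by
    rw [eq_bot_iff]
    exact iSup₂_le fun γ hγ => (h.rootSpace_eq_bot hs (limitRoots_ne_zero hγ)).le
  rw [RestrictedRootReductive, hbot, sup_bot_eq] at hred
  have hA : ∀ ξ ζ : T.limitA, ⁅(ξ : T.Limit), (ζ : T.Limit)⁆ = 0 := by
    intro ξ ζ
    obtain ⟨n₁, h₁⟩ := h.aligned.exists_ofA ξ
    obtain ⟨n₂, h₂⟩ := h.aligned.exists_ofA ζ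
    obtain ⟨x, rfl⟩ := h₁ _ (le_max_left n₁ n₂)
    obtain ⟨y, rfl⟩ := h₂ _ (le_max_right n₁ n₂)
    change ⁅T.of _ x.1, T.of _ y.1⁆ = 0
    rw [← LieHom.map_lie, h.comm _ _ x.2 _ y.2, map_zero]
  obtain ⟨ξ, hξ⟩ : ∃ ξ, γ ξ ≠ 0 := by
    by_contra hno
    push Not at hno
    exact hγ (LinearMap.ext hno)
  have hmem : T.of n η ∈ T.limitM ⊔ T.limitA := hred ▸ Submodule.mem_top
  obtain ⟨y, hy, z, hz, hyz⟩ := Submodule.mem_sup.1 hmem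
  have h0 : ⁅(T.ofA n ξ : T.Limit), T.of n η⁆ = 0 := by
    rw [← hyz, lie_add, hy.2 _ (T.ofA n ξ).2, hA _ ⟨z, hz⟩, add_zero]
  change ⁅T.of n ξ, T.of n η⁆ = 0 at h0
  rw [← LieHom.map_lie, hη ξ] at h0
  have h1 := h.of_injective n (h0.trans (map_zero (T.of n)).symm)
  exact (smul_ne_zero hξ hη0) h1

end Diagonalizable

end LieTower

namespace LieTower

variable {T : LieTower}

/-! ### Elements that generate finite-dimensional modules -/

variable (T) in
/-- Every element of a level `n ≥ n₀` generates modules of bounded dimension over the `a m`,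
`m ≥ n`. -/
def BoundedModules (n₀ : ℕ) : Prop := ∀ n, n₀ ≤ n → ∀ x : T.L n, ∃ C : ℕ, ∀ m (hnm : n ≤ m),
  ∃ W : Submodule ℝ (T.L m), T.trans n m hnm x ∈ W ∧ (∀ ξ ∈ T.a m, ∀ y ∈ W, ⁅ξ, y⁆ ∈ W) ∧
    Module.finrank ℝ W ≤ C

variable (T) in
/-- The centralizer of `a n` is contained in `k n + a n`. -/
def MaximalAbelian : Prop :=
  ∀ n (x : T.L n), (∀ ξ ∈ T.a n, ⁅ξ, x⁆ = 0) → x ∈ T.k n ⊔ T.a n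

variable (T) in
/-- The smallest subspace that contains `x` and is invariant under `a n`. -/
def cyclic (n : ℕ) (x : T.L n) : Submodule ℝ (T.L n) :=
  sInf {W | x ∈ W ∧ ∀ ξ ∈ T.a n, ∀ y ∈ W, ⁅ξ, y⁆ ∈ W}

theorem mem_cyclic (n : ℕ) (x : T.L n) : x ∈ T.cyclic n x :=
  Submodule.mem_sInf.2 fun _ hW => hW.1

theorem lie_mem_cyclic {n : ℕ} {x : T.L n} {ξ y : T.L n} (hξ : ξ ∈ T.a n)
    (hy : y ∈ T.cyclic n x) : ⁅ξ, y⁆ ∈ T.cyclic n x :=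
  Submodule.mem_sInf.2 fun W hW => hW.2 ξ hξ y (Submodule.mem_sInf.1 hy W hW)

theorem cyclic_le {n : ℕ} {x : T.L n} {W : Submodule ℝ (T.L n)} (hx : x ∈ W)
    (hW : ∀ ξ ∈ T.a n, ∀ y ∈ W, ⁅ξ, y⁆ ∈ W) : T.cyclic n x ≤ W := sInf_le ⟨hx, hW⟩

theorem Aligned.map_cyclic_le (hal : T.Aligned) (n m : ℕ) (hnm : n ≤ m) (x : T.L n) :
    (T.cyclic n x).map (T.trans n m hnm : T.L n →ₗ[ℝ] T.L m) ≤
      T.cyclic m (T.trans n m hnm x) := by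
  rw [Submodule.map_le_iff_le_comap]
  refine cyclic_le (mem_cyclic _ _) fun ξ hξ y hy => ?_
  change T.trans n m hnm ⁅ξ, y⁆ ∈ T.cyclic m (T.trans n m hnm x)
  rw [LieHom.map_lie]
  exact lie_mem_cyclic (hal.trans_mem n m hnm hξ) hy

theorem exists_forall_eq_of_monotone_of_le {u : ℕ → ℕ} (hu : Monotone u) {C : ℕ}
    (hC : ∀ n, u n ≤ C) : ∃ n, ∀ m, n ≤ m → u m = u n := by
  obtain ⟨n, hn⟩ : ∃ n, ∀ m, u m ≤ u n := by
    have hb : BddAbove (Set.range u) := ⟨C, by rintro _ ⟨n, rfl⟩; exact hC n⟩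
    obtain ⟨n, hn⟩ := Nat.sSup_mem (Set.range_nonempty u) hb
    exact ⟨n, fun m => hn.symm ▸ le_csSup hb ⟨m, rfl⟩⟩
  exact ⟨n, fun m hm => le_antisymm (hn m) (hu hm)⟩

namespace Diagonalizable

variable {Θ : ∀ n, Set (T.L n)} (h : T.Diagonalizable Θ)

include h

theorem trans_mem_span (n m : ℕ) (hnm : n ≤ m) {ξ : T.L n} (hξ : ξ ∈ Θ n) :
    T.trans n m hnm ξ ∈ Θ m := by
  induction hnm with
  | refl => rwa [trans_self_apply]
  | step hnm ih => rw [T.trans_succ_apply _ _ hnm]; exact h.map _ _ ih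

theorem lie_limitA (ξ ζ : T.limitA) : ⁅(ξ : T.Limit), (ζ : T.Limit)⁆ = 0 := by
  obtain ⟨n₁, h₁⟩ := h.aligned.exists_ofA ξ
  obtain ⟨n₂, h₂⟩ := h.aligned.exists_ofA ζ
  obtain ⟨x, rfl⟩ := h₁ _ (le_max_left n₁ n₂)
  obtain ⟨y, rfl⟩ := h₂ _ (le_max_right n₁ n₂)
  change ⁅T.of _ x.1, T.of _ y.1⁆ = 0
  rw [← LieHom.map_lie, h.comm _ _ x.2 _ y.2, map_zero]

/-- The identity between powers of ad ξ is checked on one vector at a time, at a level that contains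
both ξ and the vector. -/
theorem isFiveValued_limit (n : ℕ) {ξ : T.L n} (hξ : ξ ∈ Θ n) :
    IsFiveValued (LieAlgebra.ad ℝ T.Limit (T.of n ξ)) := by
  refine LinearMap.ext fun x => ?_
  obtain ⟨n', y, rfl⟩ := T.exists_of x
  have h1 := congrArg (fun F : Module.End ℝ _ => F (T.trans n' _ (le_max_right n n') y))
    (h.five _ _ (h.trans_mem_span n _ (le_max_left n n') hξ))
  have h2 := congrArg (T.of _) h1
  have hp : ∀ k : ℕ, T.of _ (((LieAlgebra.ad ℝ _ (T.trans n _ (le_max_left n n') ξ)) ^ k)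
      (T.trans n' _ (le_max_right n n') y)) =
      ((LieAlgebra.ad ℝ T.Limit (T.of n ξ)) ^ k) (T.of n' y) := by
    intro k
    induction k with
    | zero => exact T.of_trans _ _ _ y
    | succ k ih =>
      rw [pow_succ', pow_succ', Module.End.mul_apply, Module.End.mul_apply, ← ih,
        LieAlgebra.ad_apply, LieAlgebra.ad_apply, LieHom.map_lie, T.of_trans]
  have hp1 := hp 1
  simp only [pow_one] at hp1
  simp only [LinearMap.add_apply, LinearMap.sub_apply, LinearMap.smul_apply, LinearMap.zero_apply,
    map_add, map_sub, map_smul, map_zero, hp, hp1] at h2 ⊢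
  exact h2

/-- A root vector of the limit is, at every sufficiently high level, a root vector for the
restricted functional; so every nonzero weight of the limit is in the inverse limit along any `ν`.
-/
theorem mem_limitRoots_of_rootSpace {ν : ℕ → ℕ} (hν : StrictMono ν) {γ : Module.Dual ℝ T.limitA}
    (hγ : γ ≠ 0) {x : T.Limit} (hx0 : x ≠ 0) (hx : x ∈ T.rootSpace γ) : γ ∈ T.limitRoots ν := by
  obtain ⟨n₁, y, rfl⟩ := T.exists_of x
  obtain ⟨n₂, hn₂⟩ := h.exists_res_ne_zero hγ
  refine Filter.eventually_atTop.2 ⟨max n₁ n₂, fun k hk => ?_⟩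
  have hk' := hk.trans (hν.le_apply (x := k))
  refine ⟨hn₂ _ ((le_max_right _ _).trans hk'), T.trans n₁ _ ((le_max_left _ _).trans hk') y, ?_,
    h.res_trans_mem hx _ _⟩
  intro h0
  apply hx0
  rw [← of_trans _ _ _ ((le_max_left n₁ n₂).trans hk'), h0, map_zero]

theorem mem_limitM_sup_limitA (hmax : T.MaximalAbelian) {x : T.Limit}
    (hx : ∀ ξ ∈ T.limitA, ⁅ξ, x⁆ = 0) : x ∈ T.limitM ⊔ T.limitA := by
  obtain ⟨n, y, rfl⟩ := T.exists_of x
  have hy : ∀ ξ ∈ T.a n, ⁅ξ, y⁆ = 0 := by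
    intro ξ hξ
    apply h.of_injective n
    rw [LieHom.map_lie, map_zero]
    exact hx _ (T.ofA n ⟨ξ, hξ⟩).2
  obtain ⟨u, hu, v, hv, rfl⟩ := Submodule.mem_sup.1 (hmax n y hy)
  have hvA : T.of n v ∈ T.limitA := (T.ofA n ⟨v, hv⟩).2
  rw [map_add]
  refine Submodule.add_mem_sup ⟨?_, fun ξ hξ => ?_⟩ hvA
  · exact (_root_.le_iSup (fun n => (T.k n).map (T.of n : T.L n →ₗ[ℝ] T.Limit)) n)
      (Submodule.mem_map_of_mem hu)
  -- The component `u` is the difference of `y` and `v`, both of which commute with the whole limit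
  -- of the `a n`; maximality at level n alone would only give commutation with `a n`.
  · have h1 := hx ξ hξ
    rw [map_add, lie_add, h.lie_limitA ⟨ξ, hξ⟩ ⟨_, hvA⟩, add_zero] at h1
    exact h1

/-- The modules generated by the images of `y` over the `a m` are mapped into one another and have
bounded dimension, so from a level `m₀` on each is the image of the one before. The image of the
module of level `m₀` in the limit is therefore finite-dimensional and invariant under the whole
limit of the `a m`. -/
theorem mem_iSup_rootSpace {n₀ : ℕ} (hb : T.BoundedModules n₀) (x : T.Limit) :
    x ∈ ⨆ γ, T.rootSpace γ := by
  obtain ⟨n₁, y₁, rfl⟩ := T.exists_of x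
  let n := max n₀ n₁
  rw [← T.of_trans n₁ n (le_max_right _ _)]
  generalize T.trans n₁ n (le_max_right _ _) y₁ = y
  obtain ⟨C, hC⟩ := hb n (le_max_left _ _) y
  let c : ∀ m, n ≤ m → Submodule ℝ (T.L m) := fun m hm => T.cyclic m (T.trans n m hm y)
  have hfin : ∀ m (hm : n ≤ m), FiniteDimensional ℝ (T.L m) := fun m _ => h.finite m
  have hmap : ∀ m m' (hm : n ≤ m) (hmm : m ≤ m'),
      (c m hm).map (T.trans m m' hmm : T.L m →ₗ[ℝ] T.L m') ≤ c m' (hm.trans hmm) := by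
    intro m m' hm hmm
    have := h.aligned.map_cyclic_le m m' hmm (T.trans n m hm y)
    rwa [trans_trans] at this
  have hrank : ∀ m m' (hm : n ≤ m) (hmm : m ≤ m'),
      Module.finrank ℝ ((c m hm).map (T.trans m m' hmm : T.L m →ₗ[ℝ] T.L m')) =
        Module.finrank ℝ (c m hm) := fun m m' hm hmm =>
    (Submodule.equivMapOfInjective (T.trans m m' hmm : T.L m →ₗ[ℝ] T.L m')
      (h.trans_injective m m' hmm) _).finrank_eq.symm
  have hmono : Monotone fun i => Module.finrank ℝ (c (n + i) (Nat.le_add_right n i)) := by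
    intro i j hij
    have := hfin (n + j) (Nat.le_add_right n j)
    have h1 := Submodule.finrank_mono (hmap (n + i) (n + j) (Nat.le_add_right n i) (by omega))
    rwa [hrank] at h1
  obtain ⟨i₀, hi₀⟩ := exists_forall_eq_of_monotone_of_le hmono (C := C) fun i => by
    obtain ⟨W, h1, h2, h3⟩ := hC (n + i) (Nat.le_add_right n i)
    have := hfin (n + i) (Nat.le_add_right n i)
    exact (Submodule.finrank_mono (cyclic_le h1 h2)).trans h3
  let m₀ := n + i₀
  have hm₀ : n ≤ m₀ := Nat.le_add_right n i₀
  have hstab : ∀ m (hm : m₀ ≤ m), (c m₀ hm₀).map (T.trans m₀ m hm : T.L m₀ →ₗ[ℝ] T.L m) =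
      c m (hm₀.trans hm) := by
    intro m hm
    have := hfin m (hm₀.trans hm)
    apply Submodule.eq_of_le_of_finrank_eq (hmap m₀ m hm₀ hm)
    rw [hrank]
    obtain ⟨j, rfl⟩ := Nat.exists_eq_add_of_le (hm₀.trans hm)
    exact (hi₀ j (by omega)).symm
  let M : Submodule ℝ T.Limit := (c m₀ hm₀).map (T.of m₀ : T.L m₀ →ₗ[ℝ] T.Limit)
  have := hfin m₀ hm₀
  have hyM : T.of n y ∈ M := ⟨_, mem_cyclic _ _, T.of_trans n m₀ hm₀ y⟩
  have hM : ∀ ξ : T.limitA, ∀ v ∈ M, ⁅(ξ : T.Limit), v⁆ ∈ M := by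
    -- An element of the limit `a` lives at a level beyond `m₀`; there it preserves the cyclic
    -- module, which by stability is the image of the one at level `m₀`.
    rintro ξ _ ⟨v, hv, rfl⟩
    obtain ⟨l, hl⟩ := h.aligned.exists_ofA ξ
    obtain ⟨ζ, rfl⟩ := hl (max m₀ l) (le_max_right _ _)
    have h1 : T.trans m₀ _ (le_max_left m₀ l) v ∈ c (max m₀ l) (hm₀.trans (le_max_left _ _)) := by
      rw [← hstab _ (le_max_left m₀ l)]
      exact Submodule.mem_map_of_mem hv
    have h2 := lie_mem_cyclic ζ.2 h1
    change _ ∈ c (max m₀ l) (hm₀.trans (le_max_left _ _)) at h2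
    rw [← hstab _ (le_max_left m₀ l)] at h2
    obtain ⟨w, hw, hwe⟩ := h2
    refine ⟨w, hw, ?_⟩
    have h3 := congrArg (T.of _) hwe
    rw [LieHom.map_lie, T.of_trans] at h3
    exact (T.of_trans _ _ _ w).symm.trans h3
  have hle := le_iSup_jointEigenspace
    ((LieAlgebra.ad ℝ T.Limit : T.Limit →ₗ[ℝ] Module.End ℝ T.Limit) ∘ₗ T.limitA.subtype)
    (fun ξ ζ => commute_ad_of_lie_eq_zero (h.lie_limitA ξ ζ))
    (T.limitA.subtype ⁻¹' (⋃ l, T.of l '' Θ l)) ?_ ?_ M hM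
  · refine SetLike.le_def.1 (iSup_le fun γ => ?_) (hle hyM)
    exact inf_le_left.trans (_root_.le_iSup T.rootSpace γ)
  · have hsub : (⋃ l, T.of l '' Θ l) ⊆ Set.range T.limitA.subtype := by
      rw [Submodule.coe_subtype, Subtype.range_val]
      refine Set.iUnion_subset fun l => ?_
      rintro _ ⟨ξ, hξ, rfl⟩
      exact (T.ofA l ⟨ξ, h.span l ▸ Submodule.subset_span hξ⟩).2
    apply Submodule.map_injective_of_injective T.limitA.subtype_injective
    rw [Submodule.map_span, Submodule.map_top, Submodule.range_subtype,
      Set.image_preimage_eq_of_subset hsub, Submodule.span_iUnion]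
    refine iSup_congr fun l => ?_
    rw [h.span l, Submodule.map_span]
    rfl
  · rintro ξ hξ
    obtain ⟨l, ζ, hζ, hζξ⟩ := Set.mem_iUnion.1 hξ
    have := h.isFiveValued_limit l hζ
    rw [hζξ] at this
    exact this

/-- The joint eigenspace for 0 is the centralizer of 𝔞, which maximality puts into 𝔪 + 𝔞; all other
nonzero joint eigenspaces belong to elements of the inverse limit of the roots. -/
theorem reductive {n₀ : ℕ} (hb : T.BoundedModules n₀) (hmax : T.MaximalAbelian) {ν : ℕ → ℕ}
    (hν : StrictMono ν) : T.RestrictedRootReductive ν := by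
  rw [RestrictedRootReductive, eq_top_iff]
  rintro x -
  refine SetLike.le_def.1 (iSup_le fun γ => ?_) (h.mem_iSup_rootSpace hb x)
  intro y hy
  by_cases hγ : γ = 0
  · subst hγ
    refine Submodule.mem_sup_left (h.mem_limitM_sup_limitA hmax fun ξ hξ => ?_)
    have := hy ⟨ξ, hξ⟩
    rwa [LinearMap.zero_apply, zero_smul] at this
  · by_cases hy0 : y = 0
    · rw [hy0]; exact Submodule.zero_mem _
    · exact Submodule.mem_sup_right (Submodule.mem_iSup_of_mem γ (Submodule.mem_iSup_of_mem
        (h.mem_limitRoots_of_rootSpace hν hγ hy0 hy) hy))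

end Diagonalizable

/-! ### The invariant forms -/

variable (T) in
/-- The forms are bilinear, symmetric and positive definite on the `a n`. -/
structure PositiveForm : Prop where
  add_left : ∀ n (x y z : T.L n), T.form n (x + y) z = T.form n x z + T.form n y z
  smul_left : ∀ n (c : ℝ) (x y : T.L n), T.form n (c • x) y = c * T.form n x y
  symm : ∀ n (x y : T.L n), T.form n x y = T.form n y x
  pos : ∀ n, ∀ x ∈ T.a n, x ≠ 0 → 0 < T.form n x x
variable (T) in
/-- From level `n₀` on, the forms are preserved by the homomorphisms. -/
def FormInvariant (n₀ : ℕ) : Prop :=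
  ∀ n, n₀ ≤ n → ∀ x y : T.L n, T.form (n + 1) (T.f n x) (T.f n y) = T.form n x y

theorem FormInvariant.trans {n₀ : ℕ} (hI : T.FormInvariant n₀) (n m : ℕ) (hn : n₀ ≤ n)
    (hnm : n ≤ m) (x y : T.L n) :
    T.form m (T.trans n m hnm x) (T.trans n m hnm y) = T.form n x y := by
  induction hnm with
  | refl => rw [trans_self_apply, trans_self_apply]
  | step hnm ih =>
    rw [T.trans_succ_apply _ _ hnm, T.trans_succ_apply _ _ hnm, hI _ (hn.trans hnm), ih]

namespace PositiveForm

variable (hF : T.PositiveForm)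

include hF

theorem add_right (n : ℕ) (x y z : T.L n) :
    T.form n x (y + z) = T.form n x y + T.form n x z := by
  rw [hF.symm, hF.add_left, hF.symm n y, hF.symm n z]

theorem smul_right (n : ℕ) (c : ℝ) (x y : T.L n) : T.form n x (c • y) = c * T.form n x y := by
  rw [hF.symm, hF.smul_left, hF.symm n y]

theorem sub_left (n : ℕ) (x y z : T.L n) :
    T.form n (x - y) z = T.form n x z - T.form n y z := by
  have h1 := hF.add_left n (x - y) y z
  rw [sub_add_cancel] at h1
  linarith

/-- The form as a bilinear form. -/
def toBilin (n : ℕ) : LinearMap.BilinForm ℝ (T.L n) :=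
  LinearMap.mk₂ ℝ (T.form n) (hF.add_left n) (fun c x y => hF.smul_left n c x y)
    (hF.add_right n) (fun c x y => hF.smul_right n c x y)

/-- The form is positive definite on `a m`, hence nondegenerate on the image of `a n`, which
therefore has an orthogonal complement. -/
theorem exists_orthogonal {Θ : ∀ n, Set (T.L n)} (h : T.Diagonalizable Θ) (n m : ℕ) (hnm : n ≤ m)
    (y : T.a m) : ∃ (x : T.a n) (z : T.a m), y = h.aligned.transA n m hnm x + z ∧
      ∀ u ∈ T.a n, T.form m (T.trans n m hnm u) z = 0 := by
  have := h.finite m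
  let B := (hF.toBilin m).restrict (T.a m)
  have hB : B.IsRefl := fun x y hxy => (hF.symm m y x).trans hxy
  let P := LinearMap.range (h.aligned.transA n m hnm)
  have hnd : (B.restrict P).Nondegenerate := by
    constructor
    · intro p hp
      by_contra hp0
      have := hF.pos m p.1.1 p.1.2 fun h0 => hp0 (Subtype.ext (Subtype.ext h0))
      exact this.ne' (hp p)
    · intro p hp
      by_contra hp0
      have := hF.pos m p.1.1 p.1.2 fun h0 => hp0 (Subtype.ext (Subtype.ext h0))
      exact this.ne' (hp p)
  have hc := LinearMap.BilinForm.isCompl_orthogonal_of_restrict_nondegenerate hB hnd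
  have hy : y ∈ P ⊔ B.orthogonal P := hc.sup_eq_top ▸ Submodule.mem_top
  obtain ⟨_, ⟨x, rfl⟩, z, hz, hxz⟩ := Submodule.mem_sup.1 hy
  refine ⟨x, z, hxz.symm, fun u hu => ?_⟩
  exact LinearMap.BilinForm.mem_orthogonal_iff.1 hz _ ⟨⟨u, hu⟩, rfl⟩

end PositiveForm

variable (T) in
/-- Roots are represented by elements whose norms belong to a fixed finite set. -/
def FinitelyManyNorms : Prop := ∃ F : Set ℝ, F.Finite ∧ ∀ n, ∀ γ ∈ T.roots n,
  ∃ η ∈ T.a n, (∀ ξ : T.a n, γ ξ = T.form n η ξ) ∧ T.form n η η ∈ F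

variable (T) in
/-- Every root of level `n` extends by zero to a root of level `m`. -/
def Persists (n m : ℕ) (hnm : n ≤ m) : Prop := ∀ γ ∈ T.roots n, ∃ η : T.L m, η ≠ 0 ∧
  (∀ ξ : T.a n, ⁅T.trans n m hnm ξ, η⁆ = γ ξ • η) ∧
  ∀ y ∈ T.a m, (∀ x ∈ T.a n, T.form m (T.trans n m hnm x) y = 0) → ⁅y, η⁆ = 0

namespace Diagonalizable

variable {Θ : ∀ n, Set (T.L n)} (h : T.Diagonalizable Θ) (hF : T.PositiveForm)

include h

/-- A root is determined by its values on a basis chosen from `Θ n`, and each value is an eigenvalue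
of a five-valued operator. -/
theorem countable_roots (n : ℕ) : (T.roots n).Countable := by
  have := h.finite n
  have hΘ : Θ n ⊆ T.a n := by rw [h.span n]; exact Submodule.subset_span
  obtain ⟨t, htΘ, htspan, hlin⟩ := exists_linearIndependent ℝ (Θ n)
  have hfin : t.Finite := hlin.setFinite
  have : Finite t := hfin
  let V : Set ℝ := {-2, -1, 0, 1, 2}
  have hV : V.Finite := Set.toFinite _
  have : Finite V := hV
  have hval : ∀ γ ∈ T.roots n, ∀ ξ : t, γ ⟨ξ, hΘ (htΘ ξ.2)⟩ ∈ V := by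
    rintro γ ⟨-, η, hη0, hη⟩ ξ
    exact (h.five n ξ (htΘ ξ.2)).eigenvalue hη0 (hη ⟨ξ, hΘ (htΘ ξ.2)⟩)
  let F : T.roots n → (t → V) := fun γ ξ => ⟨γ.1 ⟨ξ, hΘ (htΘ ξ.2)⟩, hval γ.1 γ.2 ξ⟩
  have hF : Function.Injective F := by
    intro γ γ' hγ
    apply Subtype.ext
    ext ⟨ξ, hξ⟩
    have hξ' : ξ ∈ Submodule.span ℝ t := by rw [htspan, ← h.span n]; exact hξ
    have hta : Submodule.span ℝ t ≤ T.a n := by rw [htspan, h.span n]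
    have : ∀ ζ (hζ : ζ ∈ Submodule.span ℝ t), γ.1 ⟨ζ, hta hζ⟩ = γ'.1 ⟨ζ, hta hζ⟩ := by
      intro ζ hζ
      induction hζ using Submodule.span_induction with
      | mem ζ hζ => exact congrArg Subtype.val (congrFun hγ ⟨ζ, hζ⟩)
      | zero => exact (map_zero γ.1).trans (map_zero γ'.1).symm
      | add x y hx hy hx' hy' =>
        have h1 := congrArg₂ (· + ·) hx' hy'
        simp only [← map_add] at h1
        exact h1
      | smul c x hx hx' =>
        have h1 := congrArg (c • ·) hx'
        simp only [← map_smul] at h1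
        exact h1
    exact this ξ hξ'
  exact (Set.countable_coe_iff.1 (hF.countable))

include hF

/-- An extension by zero is determined by its restriction to `a n`, since each later `a m` is the
sum of the image of `a n` and its orthogonal complement. -/
theorem countable_extendedRoots (n : ℕ) : (T.extendedRoots n).Countable := by
  refine Set.MapsTo.countable_of_injOn (f := T.res n) (fun γ hγ => hγ.1) ?_ (h.countable_roots n)
  intro γ hγ γ' hγ' heq
  ext ξ
  obtain ⟨l, hl⟩ := h.aligned.exists_ofA ξ
  obtain ⟨y, rfl⟩ := hl (max n l) (le_max_right _ _)
  obtain ⟨x, z, rfl, hz⟩ := hF.exists_orthogonal h n _ (le_max_left n l) y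
  have h1 := hγ.2 _ (le_max_left n l) z hz
  have h2 := hγ'.2 _ (le_max_left n l) z hz
  have h3 := congrArg (fun β : Module.Dual ℝ (T.a n) => β x) heq
  change γ (T.ofA _ z) = 0 at h1
  change γ' (T.ofA _ z) = 0 at h2
  change γ (T.ofA n x) = γ' (T.ofA n x) at h3
  rw [map_add, map_add, map_add, h1, h2, h.aligned.ofA_transA, h3]

/-- Let `η k` represent the restriction of `γ` to level `ν k`. Compatibility of the restrictions
makes `η k` the orthogonal projection of every later `η l`. At a `k` with maximal norm, nothing is
left over in the orthogonal direction, so `γ` vanishes on the complement of `a (ν k)`. -/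
theorem limitRoots_subset {n₀ : ℕ} (hI : T.FormInvariant n₀) (hn : T.FinitelyManyNorms) {ν : ℕ → ℕ} (hν : StrictMono ν)
    (hν₀ : ∀ k, n₀ ≤ ν k) : T.limitRoots ν ⊆ ⋃ k, T.extendedRoots (ν k) := by
  intro γ hγ
  obtain ⟨k₀, hk₀⟩ := Filter.eventually_atTop.1 hγ
  obtain ⟨F, hFin, hF'⟩ := hn
  choose! η hηa hη hηF using fun k (hk : k₀ ≤ k) => hF' _ _ (hk₀ k hk)
  -- A maximum exists only because the norms range over a finite set.
  obtain ⟨k, hk, hmax⟩ : ∃ k, k₀ ≤ k ∧ ∀ l, k₀ ≤ l →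
      T.form (ν l) (η l) (η l) ≤ T.form (ν k) (η k) (η k) := by
    let s : Set ℝ := (fun k => T.form (ν k) (η k) (η k)) '' Set.Ici k₀
    have hs : s.Finite := hFin.subset (by rintro _ ⟨k, hk, rfl⟩; exact hηF k hk)
    obtain ⟨_, ⟨k, hk, rfl⟩, hmax⟩ := Set.exists_max_image s id hs ⟨_, k₀, Set.self_mem_Ici, rfl⟩
    exact ⟨k, hk, fun l hl => hmax _ ⟨l, hl, rfl⟩⟩
  refine Set.mem_iUnion.2 ⟨k, hk₀ k hk, fun m hm y hy => ?_⟩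
  let l := max k m
  have hkl : ν k ≤ ν l := hν.monotone (le_max_left _ _)
  have hml : m ≤ ν l := (le_max_right k m).trans hν.le_apply
  have hl : k₀ ≤ l := hk.trans (le_max_left _ _)
  have hn₀m : n₀ ≤ m := (hν₀ k).trans hm
  have hηk : T.trans (ν k) (ν l) hkl (η k) ∈ T.a (ν l) := h.aligned.trans_mem _ _ _ (hηa k hk)
  have hres : ∀ x : T.a (ν k), T.form (ν l) (η l) (T.trans (ν k) (ν l) hkl x) =
      T.form (ν k) (η k) x := by
    intro x
    have h1 := hη l hl (h.aligned.transA _ _ hkl x)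
    have h2 := hη k hk x
    rw [Aligned.coe_transA] at h1
    rw [← h1, ← h2]
    exact congrArg γ (h.aligned.ofA_transA _ _ hkl x)
  have h1 := hres ⟨η k, hηa k hk⟩
  have h2 := hI.trans _ _ (hν₀ k) hkl (η k) (η k)
  -- The squared norm of the difference is the squared norm of `η l` minus that of `η k`, which is
  -- not positive by the choice of k.
  have h3 : η l = T.trans (ν k) (ν l) hkl (η k) := by
    by_contra hne
    have h4 := hF.pos (ν l) (η l - T.trans (ν k) (ν l) hkl (η k))
      (Submodule.sub_mem _ (hηa l hl) hηk) (sub_ne_zero.2 hne)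
    rw [hF.sub_left, hF.symm _ (η l), hF.symm _ (T.trans (ν k) (ν l) hkl (η k)), hF.sub_left,
      hF.sub_left, h2, h1, hF.symm _ (T.trans (ν k) (ν l) hkl (η k)), h1] at h4
    have h5 := hmax l hl
    linarith
  -- The value of `γ` at `y` is computed at level `ν l`; as `η l` comes from `η k` through level m,
  -- invariance of the form reduces it to a product at level m, which is zero by assumption.
  have h4 := hη l hl (h.aligned.transA m _ hml y)
  rw [h3, Aligned.coe_transA, ← T.trans_trans (ν k) m (ν l) hm hml, hI.trans _ _ hn₀m,
    hy _ (hηa k hk)] at h4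
  rw [← h4]
  exact (congrArg γ (h.aligned.ofA_transA _ _ hml y)).symm

/-- An element of the higher `a` is split orthogonally: on the image of the lower `a` the vector
given by `Persists` has the old eigenvalues, and the complement acts on it by zero, just as the
extended functional does. -/
theorem extendedRoots_subset {ν : ℕ → ℕ} (hν : StrictMono ν)
    (hp : ∀ k l (hkl : k ≤ l), T.Persists (ν k) (ν l) (hν.monotone hkl)) (k : ℕ) :
    T.extendedRoots (ν k) ⊆ T.limitRoots ν := by
  rintro γ ⟨hγ, hγ0⟩
  refine Filter.eventually_atTop.2 ⟨k, fun l hl => ?_⟩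
  obtain ⟨η, hη0, hη, hη'⟩ := hp k l hl _ hγ
  refine ⟨?_, η, hη0, fun y => ?_⟩
  · intro h0
    apply hγ.1
    rw [← h.aligned.res_transA (ν k) (ν l) (hν.monotone hl), h0, LinearMap.zero_comp]
  · obtain ⟨x, z, rfl, hz⟩ := hF.exists_orthogonal h _ _ (hν.monotone hl) y
    have h1 := hγ0 _ (hν.monotone hl) z hz
    rw [Submodule.coe_add, add_lie, hη' z z.2 hz, add_zero, Aligned.coe_transA, hη, map_add, h1,
      add_zero]
    congr 1
    exact (congrArg γ (h.aligned.ofA_transA _ _ (hν.monotone hl) x)).symm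

/-- The uncountability result holds along every sequence of levels, so it refutes both countability
along `ν` and a countable union along a subsequence of `ν`. The reduction of the second statement to
the third uses that an extended root set is countable for each level. -/
theorem tfae (hmax : T.MaximalAbelian) (hn : T.FinitelyManyNorms) {P : Prop}
    (hP : P → ∃ n₀, T.FormInvariant n₀ ∧ T.BoundedModules n₀ ∧
      ∀ (ν : ℕ → ℕ) (hν : StrictMono ν), (∀ k, n₀ ≤ ν k) → ∃ (μ : ℕ → ℕ) (hμ : StrictMono μ),
        ∀ k l (hkl : k ≤ l), T.Persists (ν (μ k)) (ν (μ l)) ((hν.comp hμ).monotone hkl))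
    (hnP : ¬ P → T.Spreads ∧ ∃ n, (T.roots n).Nonempty) (ν : ℕ → ℕ) (hν : StrictMono ν) :
    List.TFAE [P, (T.limitRoots ν).Countable,
      ∃ μ : ℕ → ℕ, StrictMono μ ∧ T.limitRoots (ν ∘ μ) = ⋃ k, T.extendedRoots (ν (μ k)),
      T.RestrictedRootReductive ν] := by
  have h21 : ∀ ν : ℕ → ℕ, StrictMono ν → (T.limitRoots ν).Countable → P := fun ν hν hc => by
    by_contra hp
    obtain ⟨h1, h2⟩ := hnP hp
    exact h.not_countable_limitRoots h1 h2 ν hν hc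
  have hcount : ∀ ν : ℕ → ℕ, (⋃ k, T.extendedRoots (ν k)).Countable := fun ν =>
    Set.countable_iUnion fun k => h.countable_extendedRoots hF (ν k)
  tfae_have 2 → 1 := h21 ν hν
  tfae_have 3 → 1 := fun ⟨μ, hμ, heq⟩ => by
    refine h21 (ν ∘ μ) (hν.comp hμ) ?_
    rw [heq]
    exact hcount (ν ∘ μ)
  tfae_have 1 → 3 := fun hp => by
    obtain ⟨n₀, hI, -, hpers⟩ := hP hp
    -- The first levels are discarded, since the form is invariant only from `n₀` on.
    have hsh : StrictMono fun k => n₀ + k := fun i j hij => Nat.add_lt_add_left hij n₀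
    obtain ⟨μ, hμ, hμp⟩ := hpers (fun k => ν (n₀ + k)) (hν.comp hsh) fun k =>
      (Nat.le_add_right n₀ k).trans hν.le_apply
    refine ⟨fun k => n₀ + μ k, hsh.comp hμ, Set.Subset.antisymm ?_ ?_⟩
    · exact h.limitRoots_subset hF hI hn (hν.comp (hsh.comp hμ)) fun k =>
        (Nat.le_add_right n₀ _).trans hν.le_apply
    · exact Set.iUnion_subset fun k =>
        h.extendedRoots_subset hF (ν := fun k => ν (n₀ + μ k)) (hν.comp (hsh.comp hμ)) hμp k
  tfae_have 3 → 2 := fun ⟨μ, hμ, heq⟩ => by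
    refine Set.Countable.mono ?_ (hcount (ν ∘ μ))
    refine Set.Subset.trans ?_ heq.subset
    -- A functional that restricts to roots at almost all `ν k` does so along a subsequence;
    -- thinning out the levels can only enlarge the inverse limit.
    exact fun γ hγ => hμ.tendsto_atTop.eventually hγ
  tfae_have 1 → 4 := fun hp => by
    obtain ⟨n₀, -, hb, -⟩ := hP hp
    exact h.reductive hb hmax hν
  tfae_have 4 → 1 := fun hred => by
    by_contra hp
    obtain ⟨h1, h2⟩ := hnP hp
    exact h.not_reductive h1 h2 ν hred
  tfae_finish

end Diagonalizable

end LieTower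

/-! ## Signed injections -/

section SignedInjections

/-- A column of integers with sum of squares 1 has a single nonzero entry, which is ±1;
orthogonality of two columns puts their entries into different rows. -/
theorem exists_of_transpose_mul_self_eq_one {ι κ : Type*} [Fintype ι] [DecidableEq ι]
    [DecidableEq κ] {F : Matrix ι κ ℤ} (hF : Fᵀ * F = 1) :
    ∃ (f : κ → ι) (ε : κ → ℤˣ), Function.Injective f ∧
      ∀ a i, F a i = if a = f i then (ε i : ℤ) else 0 := by
  have hcol : ∀ i, ∃ a, IsUnit (F a i) ∧ ∀ b, b ≠ a → F b i = 0 := by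
    intro i
    have h1 : ∑ a, F a i * F a i = 1 := by
      have := congrFun (congrFun hF i) i
      rwa [Matrix.mul_apply, Matrix.one_apply_eq] at this
    obtain ⟨a, -, ha⟩ : ∃ a ∈ Finset.univ, F a i * F a i ≠ 0 :=
      Finset.exists_ne_zero_of_sum_ne_zero (by rw [h1]; exact one_ne_zero)
    have hpos : 1 ≤ F a i * F a i := (mul_self_nonneg (F a i)).lt_of_ne' ha
    rw [← Finset.add_sum_erase _ _ (Finset.mem_univ a)] at h1
    have hnn : ∀ b ∈ Finset.univ.erase a, 0 ≤ F b i * F b i := fun b _ => mul_self_nonneg _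
    have h2 := Finset.sum_nonneg hnn
    have h3 : ∑ b ∈ Finset.univ.erase a, F b i * F b i = 0 := by omega
    have h4 : F a i * F a i = 1 := by omega
    refine ⟨a, IsUnit.of_mul_eq_one _ h4, fun b hb => ?_⟩
    exact mul_self_eq_zero.1 ((Finset.sum_eq_zero_iff_of_nonneg hnn).1 h3 b
      (Finset.mem_erase.2 ⟨hb, Finset.mem_univ b⟩))
  choose f hf hf0 using hcol
  have hval : ∀ a i, F a i = if a = f i then ((hf i).unit : ℤ) else 0 := by
    intro a i
    split_ifs with h
    · rw [h]; rfl
    · exact hf0 i a h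
  refine ⟨f, fun i => (hf i).unit, fun i j hij => ?_, hval⟩
  by_contra hne
  have h1 := congrFun (congrFun hF i) j
  rw [Matrix.mul_apply, Matrix.one_apply_ne hne] at h1
  rw [Finset.sum_eq_single (f i) (fun b _ hb => by
    rw [Matrix.transpose_apply, hf0 i b hb, zero_mul]) (fun h => absurd (Finset.mem_univ _) h)] at h1
  have h2 : F (f i) j ≠ 0 := hij ▸ (hf j).ne_zero
  exact mul_ne_zero (hf i).ne_zero h2 h1

variable {𝕂 : Type} [NormedRing 𝕂] {ι κ μ : Type} [Fintype ι] [Fintype κ] [Fintype μ]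
  [DecidableEq ι] [DecidableEq κ] [DecidableEq μ]

/-- An integer matrix as a matrix over `𝕂`. -/
def intMat (𝕂 : Type) [NormedRing 𝕂] {ι κ : Type} (F : Matrix ι κ ℤ) : Matrix ι κ 𝕂 :=
  F.map (Int.castRingHom 𝕂)

/-- The matrix `F X Fᵀ`. -/
def place (F : Matrix ι κ ℤ) (X : Matrix κ κ 𝕂) : Matrix ι ι 𝕂 :=
  intMat 𝕂 F * X * intMat 𝕂 Fᵀ

theorem intMat_mul (F : Matrix ι κ ℤ) (G : Matrix κ μ ℤ) :
    intMat 𝕂 (F * G) = intMat 𝕂 F * intMat 𝕂 G := Matrix.map_mul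

theorem intMat_one : intMat 𝕂 (1 : Matrix ι ι ℤ) = 1 :=
  Matrix.map_one _ (map_zero _) (map_one _)

theorem place_place (F : Matrix ι κ ℤ) (G : Matrix κ μ ℤ) (X : Matrix μ μ 𝕂) :
    place F (place G X) = place (F * G) X := by
  simp only [place, Matrix.transpose_mul, intMat_mul, Matrix.mul_assoc]

theorem place_mul {F : Matrix ι κ ℤ} (hF : Fᵀ * F = 1) (X Y : Matrix κ κ 𝕂) :
    place F X * place F Y = place F (X * Y) := by
  have h : intMat 𝕂 Fᵀ * intMat 𝕂 F = 1 := by rw [← intMat_mul, hF, intMat_one]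
  simp only [place, Matrix.mul_assoc]
  rw [← Matrix.mul_assoc (intMat 𝕂 Fᵀ) (intMat 𝕂 F), h, Matrix.one_mul]

theorem place_apply {F : Matrix ι κ ℤ} {f : κ → ι} {ε : κ → ℤˣ} (hf : Function.Injective f)
    (hF : ∀ a i, F a i = if a = f i then (ε i : ℤ) else 0) (X : Matrix κ κ 𝕂) (i j : κ) :
    place F X (f i) (f j) = ((ε i : ℤ) : 𝕂) * X i j * ((ε j : ℤ) : 𝕂) := by
  have h1 : ∀ k, intMat 𝕂 F (f i) k = if i = k then ((ε i : ℤ) : 𝕂) else 0 := by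
    intro k
    change ((F (f i) k : ℤ) : 𝕂) = _
    rw [hF]
    by_cases h : i = k
    · subst h; simp
    · rw [if_neg (fun h' => h (hf h')), if_neg h, Int.cast_zero]
  have h2 : ∀ k, intMat 𝕂 Fᵀ k (f j) = if k = j then ((ε j : ℤ) : 𝕂) else 0 := by
    intro k
    change ((F (f j) k : ℤ) : 𝕂) = _
    rw [hF]
    by_cases h : k = j
    · subst h; simp
    · rw [if_neg (fun h' => h (hf h').symm), if_neg h, Int.cast_zero]
  rw [place, Matrix.mul_apply]
  simp only [h2, mul_ite, mul_zero, Finset.sum_ite_eq', Finset.mem_univ, if_true]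
  rw [Matrix.mul_apply]
  simp only [h1, ite_mul, zero_mul, Finset.sum_ite_eq, Finset.mem_univ, if_true]

/-- The nonzero entries of F X Fᵀ lie in the rows and columns that are images of the injection. This
is what keeps elements confined to few coordinates in a system of classical type. -/
theorem place_support {F : Matrix ι κ ℤ} {f : κ → ι} {ε : κ → ℤˣ}
    (hF : ∀ a i, F a i = if a = f i then (ε i : ℤ) else 0) (X : Matrix κ κ 𝕂) {a b : ι}
    (h : place F X a b ≠ 0) : (∃ i, a = f i) ∧ ∃ j, b = f j := by
  have hz : ∀ a i, a ≠ f i → intMat 𝕂 F a i = 0 := by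
    intro a i hai
    change ((F a i : ℤ) : 𝕂) = 0
    rw [hF, if_neg hai, Int.cast_zero]
  constructor
  · by_contra hno
    push Not at hno
    apply h
    rw [place, Matrix.mul_assoc, Matrix.mul_apply]
    exact Finset.sum_eq_zero fun i _ => by rw [hz a i (hno i), zero_mul]
  · by_contra hno
    push Not at hno
    apply h
    rw [place, Matrix.mul_apply]
    refine Finset.sum_eq_zero fun i _ => ?_
    have : intMat 𝕂 Fᵀ i b = 0 := hz b i (hno i)
    rw [this, mul_zero]

end SignedInjections

/-! ## Matchings -/

/-- `X` has at least `k` nonzero entries in distinct rows and distinct columns. -/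
def HasMatching {𝕂 : Type} [Zero 𝕂] {ι : Type} (X : Matrix ι ι 𝕂) (k : ℕ) : Prop :=
  ∃ s : Finset (ι × ι), k ≤ s.card ∧ Set.InjOn Prod.fst (s : Set (ι × ι)) ∧
    Set.InjOn Prod.snd (s : Set (ι × ι)) ∧ ∀ p ∈ s, X p.1 p.2 ≠ 0

section Matchings

variable {𝕂 : Type} {ι κ : Type} [DecidableEq ι] [DecidableEq κ]

theorem hasMatching_one [Zero 𝕂] {X : Matrix ι ι 𝕂} (hX : X ≠ 0) : HasMatching X 1 := by
  obtain ⟨i, j, hij⟩ : ∃ i j, X i j ≠ 0 := by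
    by_contra hno
    push Not at hno
    exact hX (Matrix.ext hno)
  exact ⟨{(i, j)}, by simp, by simp, by simp, by simpa using hij⟩

/-- Each entry of a matching uses up a row or a column with index in `u`, and each row and column is
used at most once. -/
theorem HasMatching.le_of_cross [Zero 𝕂] {X : Matrix ι ι 𝕂} {k : ℕ} (h : HasMatching X k)
    (u : Finset ι) (hu : ∀ i j, X i j ≠ 0 → i ∈ u ∨ j ∈ u) : k ≤ 2 * u.card := by
  obtain ⟨s, hk, h1, h2, hs⟩ := h
  refine hk.trans ?_
  have hsub : s ⊆ s.filter (fun p => p.1 ∈ u) ∪ s.filter (fun p => p.2 ∈ u) := by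
    intro p hp
    rcases hu _ _ (hs p hp) with h | h
    · exact Finset.mem_union_left _ (Finset.mem_filter.2 ⟨hp, h⟩)
    · exact Finset.mem_union_right _ (Finset.mem_filter.2 ⟨hp, h⟩)
  have c1 : (s.filter (fun p => p.1 ∈ u)).card ≤ u.card :=
    Finset.card_le_card_of_injOn Prod.fst (fun p hp => (Finset.mem_filter.1 hp).2)
      (h1.mono fun p hp => (Finset.mem_filter.1 hp).1)
  have c2 : (s.filter (fun p => p.2 ∈ u)).card ≤ u.card :=
    Finset.card_le_card_of_injOn Prod.snd (fun p hp => (Finset.mem_filter.1 hp).2)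
      (h2.mono fun p hp => (Finset.mem_filter.1 hp).1)
  have c3 := Finset.card_le_card hsub
  have c4 := Finset.card_union_le (s.filter (fun p => p.1 ∈ u)) (s.filter (fun p => p.2 ∈ u))
  omega

theorem HasMatching.of_injective [Zero 𝕂] {X : Matrix κ κ 𝕂} {Y : Matrix ι ι 𝕂} {k : ℕ}
    (h : HasMatching X k) {f : κ → ι} (hf : Function.Injective f)
    (hXY : ∀ i j, X i j ≠ 0 → Y (f i) (f j) ≠ 0) : HasMatching Y k := by
  obtain ⟨s, hk, h1, h2, hs⟩ := h
  refine ⟨s.map ⟨Prod.map f f, hf.prodMap hf⟩, by rwa [Finset.card_map], ?_, ?_, ?_⟩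
  · intro p hp q hq hpq
    obtain ⟨p', hp', rfl⟩ := Finset.mem_map.1 hp
    obtain ⟨q', hq', rfl⟩ := Finset.mem_map.1 hq
    rw [h1 hp' hq' (hf hpq)]
  · intro p hp q hq hpq
    obtain ⟨p', hp', rfl⟩ := Finset.mem_map.1 hp
    obtain ⟨q', hq', rfl⟩ := Finset.mem_map.1 hq
    rw [h2 hp' hq' (hf hpq)]
  · intro p hp
    obtain ⟨p', hp', rfl⟩ := Finset.mem_map.1 hp
    exact hXY _ _ (hs p' hp')

theorem HasMatching.transpose [Zero 𝕂] {X : Matrix ι ι 𝕂} {k : ℕ} (h : HasMatching X k)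
    {Y : Matrix ι ι 𝕂} (hXY : ∀ i j, X i j ≠ 0 → Y j i ≠ 0) : HasMatching Y k := by
  obtain ⟨s, hk, h1, h2, hs⟩ := h
  refine ⟨s.map (Equiv.prodComm ι ι).toEmbedding, by rwa [Finset.card_map], ?_, ?_, ?_⟩
  · intro p hp q hq hpq
    obtain ⟨p', hp', rfl⟩ := Finset.mem_map.1 hp
    obtain ⟨q', hq', rfl⟩ := Finset.mem_map.1 hq
    rw [h2 hp' hq' hpq]
  · intro p hp q hq hpq
    obtain ⟨p', hp', rfl⟩ := Finset.mem_map.1 hp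
    obtain ⟨q', hq', rfl⟩ := Finset.mem_map.1 hq
    rw [h1 hp' hq' hpq]
  · intro p hp
    obtain ⟨p', hp', rfl⟩ := Finset.mem_map.1 hp
    exact hXY _ _ (hs p' hp')

/-- Blocks with disjoint rows and disjoint columns allow matchings to be united. -/
theorem HasMatching.blocks [Zero 𝕂] {β : Type} [Fintype β] {X : β → Matrix κ κ 𝕂}
    {Y : Matrix ι ι 𝕂} {k : ℕ} (h : ∀ b, HasMatching (X b) k) {f : β → κ → ι}
    (hf : Function.Injective fun p : β × κ => f p.1 p.2)
    (hXY : ∀ b i j, X b i j ≠ 0 → Y (f b i) (f b j) ≠ 0) :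
    HasMatching Y (Fintype.card β * k) := by
  choose s hk h1 h2 hs using h
  have hinj : Function.Injective fun p : (_ : β) × (κ × κ) => (f p.1 p.2.1, f p.1 p.2.2) := by
    rintro ⟨b, i, j⟩ ⟨c, i', j'⟩ hp
    obtain ⟨e1, e2⟩ := Prod.mk.inj hp
    have e3 := @hf (b, i) (c, i') e1
    have e4 := @hf (b, j) (c, j') e2
    simp only [Prod.mk.injEq] at e3 e4
    obtain ⟨rfl, rfl⟩ := e3
    obtain ⟨-, rfl⟩ := e4
    rfl
  refine ⟨(Finset.univ.sigma s).map ⟨_, hinj⟩, ?_, ?_, ?_, ?_⟩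
  · rw [Finset.card_map, Finset.card_sigma]
    calc Fintype.card β * k = ∑ _b : β, k := by simp
      _ ≤ _ := Finset.sum_le_sum fun b _ => hk b
  · intro p hp q hq hpq
    obtain ⟨⟨b, p'⟩, hp', rfl⟩ := Finset.mem_map.1 hp
    obtain ⟨⟨c, q'⟩, hq', rfl⟩ := Finset.mem_map.1 hq
    have e := @hf (b, p'.1) (c, q'.1) hpq
    simp only [Prod.mk.injEq] at e
    obtain ⟨rfl, e⟩ := e
    obtain rfl := h1 b (Finset.mem_sigma.1 hp').2 (Finset.mem_sigma.1 hq').2 e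
    rfl
  · intro p hp q hq hpq
    obtain ⟨⟨b, p'⟩, hp', rfl⟩ := Finset.mem_map.1 hp
    obtain ⟨⟨c, q'⟩, hq', rfl⟩ := Finset.mem_map.1 hq
    have e := @hf (b, p'.2) (c, q'.2) hpq
    simp only [Prod.mk.injEq] at e
    obtain ⟨rfl, e⟩ := e
    obtain rfl := h2 b (Finset.mem_sigma.1 hp').2 (Finset.mem_sigma.1 hq').2 e
    rfl
  · intro p hp
    obtain ⟨⟨b, p'⟩, hp', rfl⟩ := Finset.mem_map.1 hp
    exact hXY _ _ _ (hs b p' (Finset.mem_sigma.1 hp').2)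

end Matchings

/-! ## Embeddings of matrices -/

section Embeddings

variable {𝕂 : Type} [NormedRing 𝕂] [NormedAlgebra ℝ 𝕂] [StarRing 𝕂] [ClassicalScalar 𝕂]

theorem unit_int_mul_ne_zero {x : 𝕂} (hx : x ≠ 0) (ε ε' : ℤˣ) :
    ((ε : ℤ) : 𝕂) * x * ((ε' : ℤ) : 𝕂) ≠ 0 := by
  rcases Int.units_eq_one_or ε with rfl | rfl <;> rcases Int.units_eq_one_or ε' with rfl | rfl <;>
    simpa using hx

/-- The differential of `g ↦ (gᵗ)⁻¹` if `inv`, the identity otherwise. -/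
noncomputable def tflip {ι : Type} (inv : Bool) (X : Matrix ι ι 𝕂) : Matrix ι ι 𝕂 :=
  if inv then -transp X else X

theorem transp_neg {ι : Type} [Fintype ι] [DecidableEq ι] (X : Matrix ι ι 𝕂) :
    transp (-X) = -transp X := adj_neg false X

theorem transp_transp {ι : Type} [Fintype ι] [DecidableEq ι] (X : Matrix ι ι 𝕂) :
    transp (transp X) = X := adj_adj false X

theorem transp_mul {ι : Type} [Fintype ι] [DecidableEq ι] (X Y : Matrix ι ι 𝕂) :
    transp (X * Y) = transp Y * transp X := adj_mul false X Y

theorem tflip_tflip {ι : Type} [Fintype ι] [DecidableEq ι] (b c : Bool) (X : Matrix ι ι 𝕂) :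
    tflip b (tflip c X) = tflip (xor b c) X := by
  cases b <;> cases c <;> simp [tflip, transp_neg, transp_transp]

theorem scalar_tr_ne_zero {x : 𝕂} (hx : x ≠ 0) : ClassicalScalar.tr x ≠ 0 := by
  intro h
  apply hx
  apply ClassicalScalar.toC_injective
  have h1 := ClassicalScalar.toC_tr x
  rw [h, map_zero] at h1
  rw [map_zero]
  exact (Matrix.transpose_eq_zero.1 h1.symm)

theorem HasMatching.tflip {ι : Type} [DecidableEq ι] {X : Matrix ι ι 𝕂} {k : ℕ}
    (h : HasMatching X k) (b : Bool) : HasMatching (tflip b X) k := by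
  cases b
  · exact h
  · exact h.transpose fun i j hij => neg_ne_zero.2 (scalar_tr_ne_zero hij)

theorem dtwist_eq_place {N : ℕ} (inv : Bool) (w : SignedPerm N) (X : Matrix (Fin N) (Fin N) 𝕂) :
    dtwist inv w X = place w.1 (tflip inv X) := rfl

theorem HasMatching.dtwist {N : ℕ} {X : Matrix (Fin N) (Fin N) 𝕂} {k : ℕ} (h : HasMatching X k)
    (inv : Bool) (w : SignedPerm N) : HasMatching (dtwist inv w X) k := by
  obtain ⟨f, ε, hf, hF⟩ := exists_of_transpose_mul_self_eq_one (mul_eq_one_comm.1 w.2)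
  rw [dtwist_eq_place]
  exact (h.tflip inv).of_injective hf fun i j hij => by
    rw [place_apply hf hF]; exact unit_int_mul_ne_zero hij _ _

theorem BlockData.blk_inr_inl_apply (D : BlockData) {R : Type} [Zero R] {n : ℕ}
    (A : Matrix (Fin (D.t' n)) (Fin (D.t' n)) R)
    (X : Fin (D.r n + D.s n) → Matrix (Fin (D.size n)) (Fin (D.size n)) R)
    (C : Matrix (Fin (D.t'' n)) (Fin (D.t'' n)) R) (b : Fin (D.r n + D.s n))
    (i j : Fin (D.size n)) :
    D.blk n A X C (D.split n (.inr (.inl (i, b)))) (D.split n (.inr (.inl (j, b)))) = X b i j := by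
  simp [BlockData.blk, Matrix.blockDiagonal_apply]

/-- Every one of the r + s diagonal blocks is the given matrix up to transposition, signs and a
permutation of the coordinates, so each contributes a matching of the same size. -/
theorem HasMatching.dembed (D : BlockData) {n : ℕ} (inv : Bool) (w : SignedPerm (D.size n))
    {X : Matrix (Fin (D.size n)) (Fin (D.size n)) 𝕂} {k : ℕ} (h : HasMatching X k) :
    HasMatching (D.dembed n (_root_.dtwist inv w) X) ((D.r n + D.s n) * k) := by
  have h1 := HasMatching.blocks (Y := D.dembed n (_root_.dtwist inv w) X) (k := k)
    (X := fun b : Fin (D.r n + D.s n) => if b.val < D.r n then X else _root_.dtwist inv w X)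
    (f := fun b i => D.split n (.inr (.inl (i, b)))) (fun b => by
      split_ifs
      · exact h
      · exact h.dtwist inv w) (by
      rintro ⟨b, i⟩ ⟨c, j⟩ hbc
      have := (D.split n).injective hbc
      simp only [Sum.inr.injEq, Sum.inl.injEq, Prod.mk.injEq] at this
      rw [this.1, this.2]) (fun b i j hij => by
        simp only [BlockData.dembed, LinearMap.coe_mk, AddHom.coe_mk]
        rw [D.blk_inr_inl_apply]
        exact hij)
  rwa [Fintype.card_fin] at h1

/-- The inclusion of the coordinates of level `n` as block `b` at level `n + 1`. -/
def BlockData.blockIncl (D : BlockData) (n : ℕ) (b : Fin (D.r n + D.s n)) :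
    Matrix (Fin (D.size (n + 1))) (Fin (D.size n)) ℤ :=
  Matrix.of fun a i => if a = D.split n (.inr (.inl (i, b))) then 1 else 0

theorem BlockData.blockIncl_transpose_mul (D : BlockData) (n : ℕ) (b : Fin (D.r n + D.s n)) :
    (D.blockIncl n b)ᵀ * D.blockIncl n b = 1 := by
  ext i j
  rw [Matrix.mul_apply]
  simp only [BlockData.blockIncl, Matrix.transpose_apply, Matrix.of_apply, mul_ite, mul_one,
    mul_zero, Finset.sum_ite_eq', Finset.mem_univ, if_true, Matrix.one_apply]
  by_cases h : i = j
  · simp [h]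
  · simp [h, eq_comm]

/-- With a single block, the diagonal embedding has the form `X ↦ F X Fᵀ` or `X ↦ - F Xᵗ Fᵀ`. -/
theorem BlockData.dembed_eq_place (D : BlockData) {n : ℕ} (hn : D.r n + D.s n = 1) (inv : Bool)
    (w : SignedPerm (D.size n)) :
    ∃ (F : Matrix (Fin (D.size (n + 1))) (Fin (D.size n)) ℤ) (c : Bool), Fᵀ * F = 1 ∧
      ∀ X : Matrix (Fin (D.size n)) (Fin (D.size n)) 𝕂,
        D.dembed n (dtwist inv w) X = place F (tflip c X) := by
  let b₀ : Fin (D.r n + D.s n) := ⟨0, by omega⟩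
  have hb : ∀ b, b = b₀ := fun b => Fin.ext (by have := b.2; simp only [b₀]; omega)
  have hblk : ∀ Y : Fin (D.r n + D.s n) → Matrix (Fin (D.size n)) (Fin (D.size n)) 𝕂,
      D.blk n 0 Y 0 = place (D.blockIncl n b₀) (Y b₀) := by
    intro Y
    have hf : Function.Injective fun i : Fin (D.size n) => D.split n (.inr (.inl (i, b₀))) := by
      intro i j hij
      have := (D.split n).injective hij
      simpa using this
    have hF : ∀ a i, D.blockIncl n b₀ a i =
        if a = (fun i : Fin (D.size n) => D.split n (.inr (.inl (i, b₀)))) i then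
          (((fun _ => 1 : Fin (D.size n) → ℤˣ) i : ℤˣ) : ℤ) else 0 := by
      intro a i
      simp [BlockData.blockIncl]
    ext a c
    by_cases h : (∃ i, a = D.split n (.inr (.inl (i, b₀)))) ∧
        ∃ j, c = D.split n (.inr (.inl (j, b₀)))
    · obtain ⟨⟨i, rfl⟩, ⟨j, rfl⟩⟩ := h
      rw [D.blk_inr_inl_apply]
      have := place_apply hf hF (Y b₀) i j
      simp only [Units.val_one, Int.cast_one, one_mul, mul_one] at this
      exact this.symm
    · have h1 : place (D.blockIncl n b₀) (Y b₀) a c = 0 := by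
        by_contra hne
        exact h (place_support hF (Y b₀) hne)
      rw [h1]
      obtain ⟨a, rfl⟩ := (D.split n).surjective a
      obtain ⟨c, rfl⟩ := (D.split n).surjective c
      simp only [BlockData.blk, Matrix.reindex_apply, Matrix.submatrix_apply,
        Equiv.symm_apply_apply]
      rcases a with a | ⟨a, b⟩ | a <;> rcases c with c | ⟨c, b'⟩ | c <;> try simp
      exact absurd ⟨⟨a, by rw [hb b]⟩, ⟨c, by rw [hb b']⟩⟩ h
  by_cases hr : b₀.val < D.r n
  · refine ⟨D.blockIncl n b₀, false, D.blockIncl_transpose_mul n b₀, fun X => ?_⟩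
    simp only [BlockData.dembed, LinearMap.coe_mk, AddHom.coe_mk]
    rw [hblk, if_pos hr]
    rfl
  · refine ⟨D.blockIncl n b₀ * w.1, inv, ?_, fun X => ?_⟩
    · rw [Matrix.transpose_mul, Matrix.mul_assoc, ← Matrix.mul_assoc _ (D.blockIncl n b₀),
        D.blockIncl_transpose_mul, Matrix.one_mul]
      exact mul_eq_one_comm.1 w.2
    · simp only [BlockData.dembed, LinearMap.coe_mk, AddHom.coe_mk]
      rw [hblk, if_neg hr, dtwist_eq_place, place_place]

/-- The entries of `F` are integers, which are central and fixed by `tr`; so transposition affects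
only the middle factor. -/
theorem transp_place {ι κ : Type} [Fintype ι] [Fintype κ] [DecidableEq ι] [DecidableEq κ]
    (F : Matrix ι κ ℤ) (X : Matrix κ κ 𝕂) : transp (place F X) = place F (transp X) := by
  have htr0 : ClassicalScalar.tr (0 : 𝕂) = 0 := BlockData.scalar_tr_zero
  have hadd : ∀ x y : 𝕂, ClassicalScalar.tr (x + y) = ClassicalScalar.tr x + ClassicalScalar.tr y := by
    intro x y
    apply ClassicalScalar.toC_injective
    simp [ClassicalScalar.toC_tr]
  have hint : ∀ (m k : ℤ) (x : 𝕂), ClassicalScalar.tr ((m : 𝕂) * x * (k : 𝕂)) =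
      (k : 𝕂) * ClassicalScalar.tr x * (m : 𝕂) := by
    intro m k x
    apply ClassicalScalar.toC_injective
    simp [ClassicalScalar.toC_tr, Matrix.transpose_mul, mul_assoc]
  have hsum : ∀ {α : Type} (s : Finset α) (g : α → 𝕂),
      ClassicalScalar.tr (∑ i ∈ s, g i) = ∑ i ∈ s, ClassicalScalar.tr (g i) := by
    intro α s g
    classical
    induction s using Finset.induction_on with
    | empty => simpa using htr0
    | insert a s ha ih => rw [Finset.sum_insert ha, hadd, ih, Finset.sum_insert ha]
  ext a b
  change ClassicalScalar.tr (place F X b a) = _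
  have e1 : ∀ (Y : Matrix κ κ 𝕂) a b, place F Y a b =
      ∑ j, ∑ i, ((F a i : ℤ) : 𝕂) * Y i j * ((F b j : ℤ) : 𝕂) := by
    intro Y a b
    rw [place, Matrix.mul_apply]
    refine Finset.sum_congr rfl fun j _ => ?_
    rw [Matrix.mul_apply, Finset.sum_mul]
    rfl
  rw [e1, e1, hsum, Finset.sum_comm]
  simp only [hsum, hint]
  rfl

theorem tflip_place {ι κ : Type} [Fintype ι] [Fintype κ] [DecidableEq ι] [DecidableEq κ]
    (b : Bool) (F : Matrix ι κ ℤ) (X : Matrix κ κ 𝕂) : tflip b (place F X) = place F (tflip b X) := by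
  cases b
  · rfl
  · change -transp (place F X) = place F (-transp X)
    rw [transp_place, place, place, Matrix.mul_neg, Matrix.neg_mul]

end Embeddings

/-! ## Direct systems of classical groups whose subspaces are standard -/

section TraceForm

variable {𝕂 : Type} [NormedRing 𝕂] [NormedAlgebra ℝ 𝕂] [StarRing 𝕂] [ClassicalScalar 𝕂]
  {ι κ : Type} [Fintype ι] [DecidableEq ι] [Fintype κ] [DecidableEq κ]

variable (𝕂) in
/-- The real part of the trace of a scalar, as a complex matrix. -/
noncomputable def scalarTrace : 𝕂 →ₗ[ℝ] ℝ :=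
  Complex.reLm ∘ₗ (Matrix.traceLinearMap (Fin (ClassicalScalar.e 𝕂)) ℂ ℂ).restrictScalars ℝ ∘ₗ
    (ClassicalScalar.toC (𝕂 := 𝕂)).toLinearMap

theorem re_trace_cmat (X : Matrix ι ι 𝕂) :
    (cmat ι X).trace.re = ∑ i, scalarTrace 𝕂 (X i i) := by
  rw [Matrix.trace, Fintype.sum_prod_type, Complex.re_sum]
  rfl

/-- Only diagonal entries at images of the injection contribute, and there the two signs cancel. -/
theorem re_trace_cmat_place {F : Matrix ι κ ℤ} (hF : Fᵀ * F = 1) (X : Matrix κ κ 𝕂) :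
    (cmat ι (place F X)).trace.re = (cmat κ X).trace.re := by
  obtain ⟨f, ε, hf, hFe⟩ := exists_of_transpose_mul_self_eq_one hF
  rw [re_trace_cmat, re_trace_cmat]
  refine (Finset.sum_of_injOn f hf.injOn (fun _ _ => Finset.mem_univ _) ?_ ?_).symm
  · intro a _ ha
    by_contra hne
    have h1 : place F X a a ≠ 0 := fun h0 => hne (by rw [h0, map_zero])
    obtain ⟨⟨i, rfl⟩, -⟩ := place_support hFe X h1
    exact ha ⟨i, Finset.mem_coe.2 (Finset.mem_univ i), rfl⟩
  · intro i _
    rw [place_apply hf hFe]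
    rcases Int.units_eq_one_or (ε i) with h | h <;> simp [h]

theorem re_trace_cmat_tflip (b : Bool) (X Y : Matrix ι ι 𝕂) :
    (cmat ι (tflip b X * tflip b Y)).trace.re = (cmat ι (X * Y)).trace.re := by
  cases b
  · rfl
  · change (cmat ι (-transp X * -transp Y)).trace.re = _
    rw [neg_mul_neg, map_mul, cmat_transp, cmat_transp, ← Matrix.transpose_mul,
      Matrix.trace_transpose, map_mul, Matrix.trace_mul_comm]

theorem tflip_cube (b : Bool) (X : Matrix ι ι 𝕂) :
    tflip b X * tflip b X * tflip b X = tflip b (X * X * X) := by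
  cases b
  · rfl
  · change -transp X * -transp X * -transp X = -transp (X * X * X)
    rw [transp_mul, transp_mul, neg_mul_neg, mul_neg, mul_assoc]

/-- For a hermitian matrix the trace of its square is the sum of the squared absolute values of its
complex entries. -/
theorem re_trace_cmat_mul_self_pos {X : Matrix ι ι 𝕂} (hX : Xᴴ = X) (h0 : X ≠ 0) :
    0 < (cmat ι (X * X)).trace.re := by
  have h1 : cmat ι X ≠ 0 := fun h => h0 (cmat_injective (h.trans (map_zero _).symm))
  have h2 : (cmat ι (X * X)).trace = ∑ i, ∑ j, ((Complex.normSq (cmat ι X i j) : ℝ) : ℂ) := by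
    have h3 : X * X = Xᴴ * X := by rw [hX]
    rw [h3, map_mul, cmat_conjTranspose, Matrix.trace, Finset.sum_comm]
    refine Finset.sum_congr rfl fun i _ => ?_
    rw [Matrix.diag_apply, Matrix.mul_apply]
    refine Finset.sum_congr rfl fun j _ => ?_
    rw [Complex.normSq_eq_conj_mul_self]
    rfl
  rw [h2]
  simp only [← Complex.ofReal_sum, Complex.ofReal_re]
  have hnn : ∀ i, 0 ≤ ∑ j, Complex.normSq (cmat ι X i j) :=
    fun i => Finset.sum_nonneg fun j _ => Complex.normSq_nonneg _
  refine (Finset.sum_nonneg fun i _ => hnn i).lt_of_ne' fun h3 => h1 ?_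
  ext i j
  have h4 := (Finset.sum_eq_zero_iff_of_nonneg fun i _ => hnn i).1 h3 i (Finset.mem_univ i)
  have h5 := (Finset.sum_eq_zero_iff_of_nonneg fun j _ => Complex.normSq_nonneg _).1 h4 j
    (Finset.mem_univ j)
  exact Complex.normSq_eq_zero.1 h5

end TraceForm

section FiveValued

/-- Left and right multiplication by ξ commute and both satisfy t³ = t. Their difference ad ξ
therefore satisfies the polynomial whose roots are the differences of two numbers among -1, 0, 1. -/
theorem isFiveValued_ad {A : Type} [Ring A] [Algebra ℝ A] (L : LieSubalgebra ℝ A) (ξ : L)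
    (hξ : (ξ : A) * ξ * ξ = ξ) : IsFiveValued (LieAlgebra.ad ℝ L ξ) := by
  refine LinearMap.ext fun Y => Subtype.ext ?_
  obtain ⟨ξ, hξL⟩ := ξ
  obtain ⟨Y, hY⟩ := Y
  dsimp only at hξ
  have h1 : ∀ W : A, ξ * (ξ * (ξ * W)) = ξ * W := fun W => by
    rw [← mul_assoc, ← mul_assoc, hξ]
  have h2 : ξ * (ξ * ξ) = ξ := by rw [← mul_assoc, hξ]
  simp only [LinearMap.add_apply, LinearMap.sub_apply, LinearMap.smul_apply, LinearMap.zero_apply,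
    pow_succ, pow_zero, one_mul, Module.End.mul_apply, LieAlgebra.ad_apply, AddMemClass.coe_add,
    AddSubgroupClass.coe_sub, SetLike.val_smul, LieSubalgebra.coe_bracket, Ring.lie_def,
    ZeroMemClass.coe_zero]
  simp only [mul_sub, sub_mul, mul_assoc, h1, h2]
  module

end FiveValued

/-! ### Standard systems: growth of matchings and bounded modules -/

namespace ClassicalSystem

variable {𝕂 : Type} [NormedRing 𝕂] [NormedAlgebra ℝ 𝕂] [StarRing 𝕂] [ClassicalScalar 𝕂]
  [FiniteDimensional ℝ 𝕂] (S : ClassicalSystem 𝕂)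

/-- The elements of `a n`, as matrices. -/
noncomputable def aMat (n : ℕ) : Submodule ℝ (Matrix (Fin (S.D.size n)) (Fin (S.D.size n)) 𝕂) :=
  (S.g n).toSubmodule ⊓ S.T n

/-- The spaces `a n` consist of commuting hermitian matrices and are spanned by matrices with at
most two nonzero rows and columns and eigenvalues at most `-1`, `0`, `1`; they are maximal. -/
structure Standard : Prop where
  star_mem : ∀ n, ∀ X ∈ S.g n, Xᴴ ∈ S.g n
  herm : ∀ n, ∀ X ∈ S.T n, Xᴴ = X
  comm : ∀ n, ∀ X ∈ S.T n, ∀ Y ∈ S.T n, X * Y = Y * X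
  shape : ∀ n, ∃ τ : Fin (S.D.size n) → Fin (S.D.size n), Function.Involutive τ ∧
    ∀ X ∈ S.T n, ∀ i j, X i j ≠ 0 → j = τ i
  span : ∀ n, S.aMat n ≤ Submodule.span ℝ {X | X ∈ S.aMat n ∧ X * X * X = X ∧
    ∃ u : Finset (Fin (S.D.size n)), u.card ≤ 2 ∧ ∀ i j, X i j ≠ 0 → i ∈ u ∧ j ∈ u}
  maximal : ∀ n, ∀ X ∈ S.g n, Xᴴ = X → (∀ ξ ∈ S.aMat n, ξ * X = X * ξ) → X ∈ S.T n

variable {S}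

theorem mem_aMat_of_mem {n : ℕ} {ξ : S.g n} (hξ : ξ ∈ S.tower.a n) : ξ.1 ∈ S.aMat n :=
  ⟨ξ.2, hξ⟩

theorem coe_lie {n : ℕ} (X Y : S.g n) :
    ((⁅(X : S.tower.L n), (Y : S.tower.L n)⁆ : S.g n) : Matrix _ _ 𝕂) = X.1 * Y.1 - Y.1 * X.1 := rfl

theorem dembed_cube (n : ℕ) {X : Matrix (Fin (S.D.size n)) (Fin (S.D.size n)) 𝕂}
    (hX : X * X * X = X) :
    S.D.dembed n (dtwist S.inv (S.w n)) X * S.D.dembed n (dtwist S.inv (S.w n)) X *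
      S.D.dembed n (dtwist S.inv (S.w n)) X = S.D.dembed n (dtwist S.inv (S.w n)) X := by
  simp only [BlockData.dembed, LinearMap.coe_mk, AddHom.coe_mk]
  rw [BlockData.blk_mul, BlockData.blk_mul]
  congr 1
  · simp
  · funext b
    split_ifs
    · exact hX
    · have hw := mul_eq_one_comm.1 (S.w n).2
      rw [dtwist_eq_place, place_mul hw, place_mul hw, tflip_cube, hX]
  · simp

/-- A nonzero entry is a matching of size 1, and its image contains a matching of size r + s > 0. -/
theorem f_injective (n : ℕ) : Function.Injective (S.tower.f n) := by
  refine (injective_iff_map_eq_zero (S.tower.f n)).2 fun X hX => ?_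
  by_contra hX0
  have h1 : (X : S.g n).1 ≠ 0 := fun h => hX0 (Subtype.ext h)
  obtain ⟨s, hs, -, -, h2⟩ := (hasMatching_one h1).dembed S.D S.inv (S.w n)
  have h3 : 0 < s.card := lt_of_lt_of_le (by have := S.D.rs_pos n; omega) hs
  obtain ⟨p, hp⟩ := Finset.card_pos.1 h3
  refine h2 p hp ?_
  have h4 : S.D.dembed n (dtwist S.inv (S.w n)) (X : S.g n).1 = 0 := congrArg Subtype.val hX
  rw [h4]; rfl

variable (S) in
/-- The elements of `a n` with eigenvalues at most `-1`, `0`, `1`. -/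
def tripotents (n : ℕ) : Set (S.tower.L n) :=
  {ξ | ξ ∈ S.tower.a n ∧ (ξ : S.g n).1 * (ξ : S.g n).1 * (ξ : S.g n).1 = (ξ : S.g n).1}

namespace Standard

variable (hS : S.Standard)

include hS

theorem mem_span_small {n : ℕ} {ξ : S.tower.L n} (hξ : ξ ∈ S.tower.a n) :
    ξ ∈ Submodule.span ℝ {ζ : S.tower.L n | ζ ∈ S.tripotents n ∧
      ∃ u : Finset (Fin (S.D.size n)), u.card ≤ 2 ∧
        ∀ i j, (ζ : S.g n).1 i j ≠ 0 → i ∈ u ∧ j ∈ u} := by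
  have h1 := hS.span n (mem_aMat_of_mem hξ)
  let c : S.tower.L n →ₗ[ℝ] Matrix (Fin (S.D.size n)) (Fin (S.D.size n)) 𝕂 :=
    (S.g n).toSubmodule.subtype
  have h2 : c ξ ∈ (Submodule.span ℝ {ζ : S.tower.L n |
      ζ ∈ S.tripotents n ∧ ∃ u : Finset (Fin (S.D.size n)), u.card ≤ 2 ∧
        ∀ i j, (ζ : S.g n).1 i j ≠ 0 → i ∈ u ∧ j ∈ u}).map c := by
    rw [Submodule.map_span]
    refine Submodule.span_mono ?_ h1
    rintro X ⟨⟨hXg, hXT⟩, hX3, hXu⟩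
    exact ⟨⟨X, hXg⟩, ⟨⟨hXT, hX3⟩, hXu⟩, rfl⟩
  obtain ⟨ζ, hζ, he⟩ := h2
  rwa [← Subtype.ext he]

theorem diagonalizable (hal : S.tower.Aligned) : S.tower.Diagonalizable S.tripotents where
  finite n := FiniteDimensional.finiteDimensional_submodule (S.g n).toSubmodule
  injective := f_injective
  aligned := hal
  span n := by
    refine le_antisymm (fun ξ hξ => ?_) (Submodule.span_le.2 fun ξ hξ => hξ.1)
    exact Submodule.span_mono (fun ζ hζ => hζ.1) (hS.mem_span_small hξ)
  map n ξ hξ := ⟨hal n (Submodule.mem_map_of_mem hξ.1), dembed_cube n hξ.2⟩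
  comm n ξ hξ ζ hζ := Subtype.ext ((coe_lie ξ ζ).trans
    (sub_eq_zero.2 (hS.comm n _ hξ _ hζ)))
  five n ξ hξ := isFiveValued_ad (S.g n) ξ hξ.2

theorem positiveForm : S.tower.PositiveForm where
  add_left n x y z := by
    change (cmat _ (((x : S.g n).1 + (y : S.g n).1) * (z : S.g n).1)).trace.re = _
    rw [add_mul, map_add, Matrix.trace_add, Complex.add_re]
    rfl
  smul_left n c x y := by
    change (cmat _ ((c • (x : S.g n).1) * (y : S.g n).1)).trace.re = _
    rw [smul_mul_assoc, map_smul, Matrix.trace_smul, Complex.smul_re]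
    rfl
  symm n x y := by
    change (cmat _ ((x : S.g n).1 * (y : S.g n).1)).trace.re =
      (cmat _ ((y : S.g n).1 * (x : S.g n).1)).trace.re
    rw [map_mul, Matrix.trace_mul_comm, ← map_mul]
  pos n x hx hx0 := re_trace_cmat_mul_self_pos (hS.herm n _ hx) fun h => hx0 (Subtype.ext h)

/-- The Lie algebra is closed under conjugate transposition and `a n` is hermitian, so together with
X also its skew-hermitian and hermitian halves centralize `a n`. The first is in `k n`, the second
in `a n` by maximality. -/
theorem maximalAbelian : S.tower.MaximalAbelian := by
  intro n x hx
  obtain ⟨X, hX⟩ := x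
  let Y : Matrix (Fin (S.D.size n)) (Fin (S.D.size n)) 𝕂 := (1 / 2 : ℝ) • (X - Xᴴ)
  let Z : Matrix (Fin (S.D.size n)) (Fin (S.D.size n)) 𝕂 := (1 / 2 : ℝ) • (X + Xᴴ)
  have hXs := hS.star_mem n X hX
  have hY : Y ∈ S.g n := (S.g n).smul_mem _ (sub_mem hX hXs)
  have hZ : Z ∈ S.g n := (S.g n).smul_mem _ (add_mem hX hXs)
  have hsmul : ∀ (c : ℝ) (M : Matrix (Fin (S.D.size n)) (Fin (S.D.size n)) 𝕂),
      (c • M)ᴴ = c • Mᴴ := fun c M => adj_smul true c M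
  refine Submodule.mem_sup.2 ⟨⟨Y, hY⟩, ?_, ⟨Z, hZ⟩, ?_, Subtype.ext ?_⟩
  · change Yᴴ = -Y
    rw [hsmul, Matrix.conjTranspose_sub, Matrix.conjTranspose_conjTranspose, ← smul_neg, neg_sub]
  · refine hS.maximal n Z hZ ?_ fun ξ hξ => ?_
    · rw [hsmul, Matrix.conjTranspose_add, Matrix.conjTranspose_conjTranspose, add_comm]
    · have h1 : ξ * X = X * ξ :=
        sub_eq_zero.1 (congrArg Subtype.val (hx ⟨ξ, hξ.1⟩ hξ.2))
      have h2 := congrArg Matrix.conjTranspose h1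
      rw [Matrix.conjTranspose_mul, Matrix.conjTranspose_mul, hS.herm n ξ hξ.2] at h2
      rw [mul_smul_comm, smul_mul_assoc, mul_add, add_mul, h1, h2]
  · change Y + Z = X
    simp only [Y, Z]
    module

/-- Without roots the whole level would be the joint eigenspace for 0, so it would be centralized by
`a n`. -/
theorem roots_nonempty (hal : S.tower.Aligned)
    (h : ∃ n, ∃ ξ ∈ S.aMat n, ∃ Y ∈ S.g n, ξ * Y ≠ Y * ξ) :
    ∃ n, (S.tower.roots n).Nonempty := by
  obtain ⟨n, ξ, hξ, Y, hY, hne⟩ := h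
  refine ⟨n, ?_⟩
  by_contra hno
  rw [Set.not_nonempty_iff_eq_empty] at hno
  let y : S.tower.L n := (⟨Y, hY⟩ : S.g n)
  let x : S.tower.a n := ⟨(⟨ξ, hξ.1⟩ : S.g n), hξ.2⟩
  have h1 := (hS.diagonalizable hal).le_iSup n ⊤ (fun _ _ _ _ => Submodule.mem_top)
    (Submodule.mem_top : y ∈ (⊤ : Submodule ℝ (S.tower.L n)))
  have h2 : y ∈ jointEigenspace (S.tower.adA n) 0 := by
    refine SetLike.le_def.1 (iSup_le fun γ => ?_) h1
    rintro x ⟨hx, -⟩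
    by_cases hx0 : x = 0
    · rw [hx0]; exact Submodule.zero_mem _
    · by_cases hγ : γ = 0
      · rwa [← hγ]
      · have : γ ∈ S.tower.roots n := ⟨hγ, x, hx0, hx⟩
        rw [hno] at this
        exact this.elim
  have h3 : S.tower.adA n x y = 0 := (h2 x).trans (zero_smul ℝ y)
  exact hne (sub_eq_zero.1 (congrArg Subtype.val h3))

/-- The elements of `a n` with two coordinates span, so `γ` is nonzero on one of them. The
eigenvector equation then forces every nonzero entry of `η` into a row or column of these two
coordinates: two rows and two columns give at most 4. -/
theorem matching_le {n : ℕ} {γ : Module.Dual ℝ (S.tower.a n)} (hγ : γ ≠ 0) {η : S.tower.L n}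
    (hη : η ∈ jointEigenspace (S.tower.adA n) γ) {k : ℕ} (hk : HasMatching (η : S.g n).1 k) :
    k ≤ 4 := by
  have hex : ∃ ζ : S.tower.a n, γ ζ ≠ 0 ∧ ∃ u : Finset (Fin (S.D.size n)), u.card ≤ 2 ∧
      ∀ i j, (ζ.1 : S.g n).1 i j ≠ 0 → i ∈ u ∧ j ∈ u := by
    by_contra hno
    push Not at hno
    apply hγ
    ext ⟨ξ, hξ⟩
    have h0 := hS.mem_span_small hξ
    have hle : Submodule.span ℝ {ζ : S.tower.L n | ζ ∈ S.tripotents n ∧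
      ∃ u : Finset (Fin (S.D.size n)), u.card ≤ 2 ∧
        ∀ i j, (ζ : S.g n).1 i j ≠ 0 → i ∈ u ∧ j ∈ u} ≤
        (LinearMap.ker γ).map (S.tower.a n).subtype := by
      refine Submodule.span_le.2 ?_
      rintro ζ ⟨hζ, u, hu, hζu⟩
      refine ⟨⟨ζ, hζ.1⟩, ?_, rfl⟩
      by_contra hne
      obtain ⟨i, j, hij, hij'⟩ := hno ⟨ζ, hζ.1⟩ hne u hu
      exact hij' (hζu i j hij).1 (hζu i j hij).2
    obtain ⟨ζ, hζ, he⟩ := hle h0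
    have : ζ = ⟨ξ, hξ⟩ := Subtype.ext he
    rw [← this]
    exact hζ
  obtain ⟨ζ, hζ, u, hu, hζu⟩ := hex
  have h1 := hk.le_of_cross u fun i j hij => ?_
  · omega
  have h2 := congrArg (fun M : S.g n => M.1 i j) (hη ζ)
  have h3 : ((ζ.1 : S.g n).1 * (η : S.g n).1) i j - ((η : S.g n).1 * (ζ.1 : S.g n).1) i j =
      γ ζ • (η : S.g n).1 i j := h2
  -- If neither i nor j is in `u`, both products in the commutator have entry zero at (i, j),
  -- whereas the right-hand side is a nonzero multiple of a nonzero entry.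
  by_contra hno
  push Not at hno
  have h4 : ((ζ.1 : S.g n).1 * (η : S.g n).1) i j = 0 := by
    rw [Matrix.mul_apply]
    refine Finset.sum_eq_zero fun k _ => ?_
    by_cases hz : (ζ.1 : S.g n).1 i k = 0
    · rw [hz, zero_mul]
    · exact absurd (hζu _ _ hz).1 hno.1
  have h5 : ((η : S.g n).1 * (ζ.1 : S.g n).1) i j = 0 := by
    rw [Matrix.mul_apply]
    refine Finset.sum_eq_zero fun k _ => ?_
    by_cases hz : (ζ.1 : S.g n).1 k j = 0
    · rw [hz, mul_zero]
    · exact absurd (hζu _ _ hz).2 hno.2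
  rw [h4, h5, sub_zero] at h3
  exact smul_ne_zero hζ hij h3.symm

omit hS in
theorem _root_.HasMatching.mono {ι : Type} {X : Matrix ι ι 𝕂} {k l : ℕ} (h : HasMatching X k)
    (hl : l ≤ k) : HasMatching X l := by
  obtain ⟨s, hs, h'⟩ := h
  exact ⟨s, hl.trans hs, h'⟩

/-- Matchings never shrink, and they at least double at each of the infinitely many steps with r + s
≥ 2. Once a matching of size 5 is present, `matching_le` excludes every nonzero functional. -/
theorem spreads (hD : ¬ S.D.IsClassical) : S.tower.Spreads := by
  intro n η hη
  have hstep : ∀ (m : ℕ) (hnm : n ≤ m) (k : ℕ),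
      HasMatching ((S.tower.trans n m hnm η : S.tower.L m) : S.g m).1 k → ∀ l (hml : m ≤ l),
      HasMatching ((S.tower.trans n l (hnm.trans hml) η : S.tower.L l) : S.g l).1 k := by
    intro m hnm k hk l hml
    induction hml with
    | refl => exact hk
    | @step l hml ih =>
      rw [S.tower.trans_succ_apply n l (hnm.trans hml)]
      refine (ih.dembed S.D S.inv (S.w l)).mono ?_
      exact Nat.le_mul_of_pos_left _ (S.D.rs_pos l)
  have hgrow : ∀ k, ∃ m, ∃ hnm : n ≤ m,
      HasMatching ((S.tower.trans n m hnm η : S.tower.L m) : S.g m).1 (k + 1) := by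
    intro k
    induction k with
    | zero =>
      refine ⟨n, le_rfl, ?_⟩
      rw [S.tower.trans_self_apply]
      exact hasMatching_one fun h => hη (Subtype.ext h)
    | succ k ih =>
      obtain ⟨m, hnm, hm⟩ := ih
      have hl : ∃ l, m ≤ l ∧ S.D.r l + S.D.s l ≠ 1 := by
        by_contra hno
        push Not at hno
        exact hD ⟨m, hno⟩
      obtain ⟨l, hml, hl⟩ := hl
      refine ⟨l + 1, (hnm.trans hml).trans (Nat.le_succ l), ?_⟩
      rw [S.tower.trans_succ_apply n l (hnm.trans hml)]
      refine ((hstep m hnm _ hm l hml).dembed S.D S.inv (S.w l)).mono ?_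
      have h1 := S.D.rs_pos l
      calc k + 1 + 1 ≤ 2 * (k + 1) := by omega
        _ ≤ _ := Nat.mul_le_mul_right _ (by omega)
  obtain ⟨m, hnm, hm⟩ := hgrow 4
  refine ⟨m, hnm, fun γ hγ hmem => ?_⟩
  have := hS.matching_le hγ hmem hm
  omega

omit hS in
/-- In a system of classical type the homomorphisms have the form `X ↦ F X Fᵀ` or
`X ↦ - F Xᵗ Fᵀ`. -/
theorem exists_place {n₀ : ℕ} (hD : ∀ n, n₀ ≤ n → S.D.r n + S.D.s n = 1) (n m : ℕ) (hn : n₀ ≤ n)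
    (hnm : n ≤ m) : ∃ (F : Matrix (Fin (S.D.size m)) (Fin (S.D.size n)) ℤ) (c : Bool),
      Fᵀ * F = 1 ∧ ∀ x : S.tower.L n,
        ((S.tower.trans n m hnm x : S.tower.L m) : S.g m).1 = place F (tflip c (x : S.g n).1) := by
  induction hnm with
  | refl =>
    refine ⟨1, false, by simp, fun x => ?_⟩
    rw [S.tower.trans_self_apply, place, Matrix.transpose_one, intMat_one, one_mul, mul_one]
    rfl
  | @step m hnm ih =>
    obtain ⟨F, c, hF, h⟩ := ih
    obtain ⟨G, d, hG, h'⟩ := S.D.dembed_eq_place (𝕂 := 𝕂) (hD m (hn.trans hnm)) S.inv (S.w m)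
    refine ⟨G * F, xor d c, ?_, fun x => ?_⟩
    · rw [Matrix.transpose_mul, Matrix.mul_assoc, ← Matrix.mul_assoc Gᵀ, hG, Matrix.one_mul, hF]
    · rw [S.tower.trans_succ_apply n m hnm, ← place_place, ← tflip_tflip, ← tflip_place d F, ← h]
      exact h' _

-- The trace of a product is unchanged by a signed injection, and the sign and the reversal of order
-- caused by the negative transpose cancel in it.
omit hS in
theorem formInvariant {n₀ : ℕ} (hD : ∀ n, n₀ ≤ n → S.D.r n + S.D.s n = 1) :
    S.tower.FormInvariant n₀ := by
  intro n hn x y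
  obtain ⟨F, c, hF, h⟩ := exists_place hD n (n + 1) hn (Nat.le_succ n)
  have hx := h x
  have hy := h y
  rw [S.tower.trans_one_apply] at hx hy
  change (cmat _ ((S.tower.f n x : S.g (n + 1)).1 * (S.tower.f n y : S.g (n + 1)).1)).trace.re =
    (cmat _ ((x : S.g n).1 * (y : S.g n).1)).trace.re
  rw [hx, hy, place_mul hF, re_trace_cmat_place hF, re_trace_cmat_tflip]

/-- An element of `a m` has nonzero entries only at positions (i, τ i). Hence the matrices supported
on J × J form a module as soon as J is closed under `τ`. The image of x is supported on the image of
the injection, and closing it under `τ` at most doubles its size, whatever m is. -/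
theorem boundedModules {n₀ : ℕ} (hD : ∀ n, n₀ ≤ n → S.D.r n + S.D.s n = 1) :
    S.tower.BoundedModules n₀ := by
  intro n hn x
  refine ⟨(2 * S.D.size n) * ((2 * S.D.size n) * Module.finrank ℝ 𝕂), fun m hnm => ?_⟩
  obtain ⟨F, c, hF, h⟩ := exists_place hD n m hn hnm
  obtain ⟨f, ε, hf, hFe⟩ := exists_of_transpose_mul_self_eq_one hF
  obtain ⟨τ, hτ, hτT⟩ := hS.shape m
  let J : Finset (Fin (S.D.size m)) := Finset.univ.image f ∪ Finset.univ.image (τ ∘ f)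
  have hJ : J.card ≤ 2 * S.D.size n := by
    refine (Finset.card_union_le _ _).trans ?_
    have h1 := Finset.card_image_le (s := (Finset.univ : Finset (Fin (S.D.size n)))) (f := f)
    have h2 := Finset.card_image_le (s := (Finset.univ : Finset (Fin (S.D.size n)))) (f := τ ∘ f)
    rw [Finset.card_univ, Fintype.card_fin] at h1 h2
    omega
  have hτJ : ∀ i, i ∈ J → τ i ∈ J := by
    intro i hi
    rcases Finset.mem_union.1 hi with hi | hi
    · obtain ⟨j, -, rfl⟩ := Finset.mem_image.1 hi
      exact Finset.mem_union_right _ (Finset.mem_image.2 ⟨j, Finset.mem_univ j, rfl⟩)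
    · obtain ⟨j, -, rfl⟩ := Finset.mem_image.1 hi
      rw [Function.comp_apply, hτ]
      exact Finset.mem_union_left _ (Finset.mem_image.2 ⟨j, Finset.mem_univ j, rfl⟩)
  let W : Submodule ℝ (S.tower.L m) :=
    { carrier := {Y | ∀ i j, (Y : S.g m).1 i j ≠ 0 → i ∈ J ∧ j ∈ J}
      zero_mem' := fun i j hij => absurd rfl hij
      add_mem' := by
        intro Y Z hY hZ i j hij
        by_cases h1 : (Y : S.g m).1 i j = 0
        · refine hZ i j fun h2 => hij ?_
          exact (congrArg₂ (· + ·) h1 h2).trans (add_zero 0)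
        · exact hY i j h1
      smul_mem' := by
        intro c Y hY i j hij
        refine hY i j fun h1 => hij ?_
        exact (congrArg (c • ·) h1).trans (smul_zero c) }
  refine ⟨W, ?_, ?_, ?_⟩
  · intro i j hij
    rw [h x] at hij
    obtain ⟨⟨a, rfl⟩, ⟨b, rfl⟩⟩ := place_support hFe _ hij
    exact ⟨Finset.mem_union_left _ (Finset.mem_image_of_mem f (Finset.mem_univ a)),
      Finset.mem_union_left _ (Finset.mem_image_of_mem f (Finset.mem_univ b))⟩
  · intro ξ hξ Y hY i j hij
    have hij' : ((ξ : S.g m).1 * (Y : S.g m).1) i j - ((Y : S.g m).1 * (ξ : S.g m).1) i j ≠ 0 := hij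
    by_cases h1 : ((ξ : S.g m).1 * (Y : S.g m).1) i j = 0
    · rw [h1, zero_sub, neg_ne_zero, Matrix.mul_apply] at hij'
      obtain ⟨k, -, hk⟩ := Finset.exists_ne_zero_of_sum_ne_zero hij'
      have h2 := hY i k (left_ne_zero_of_mul hk)
      have h3 := hτT _ hξ k j (right_ne_zero_of_mul hk)
      exact ⟨h2.1, h3 ▸ hτJ k h2.2⟩
    · rw [Matrix.mul_apply] at h1
      obtain ⟨k, -, hk⟩ := Finset.exists_ne_zero_of_sum_ne_zero h1
      have h2 := hY k j (right_ne_zero_of_mul hk)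
      have h3 := hτT _ hξ i k (left_ne_zero_of_mul hk)
      refine ⟨?_, h2.2⟩
      have := hτJ k h2.1
      rwa [h3, hτ] at this
  -- Restriction to the rows and columns in J loses nothing, so the dimension is at most that of the
  -- square matrices of size |J|.
  · let R : W →ₗ[ℝ] Matrix J J 𝕂 :=
      { toFun := fun Y => (Y.1 : S.g m).1.submatrix (↑) (↑)
        map_add' := fun _ _ => rfl
        map_smul' := fun _ _ => rfl }
    have hR : Function.Injective R := by
      refine (injective_iff_map_eq_zero R).2 fun Y hY => Subtype.ext (Subtype.ext ?_)
      ext i j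
      by_contra hne
      have h1 := Y.2 i j hne
      exact hne (congrFun (congrFun hY ⟨i, h1.1⟩) ⟨j, h1.2⟩)
    refine (LinearMap.finrank_le_finrank_of_injective hR).trans ?_
    rw [Module.finrank_matrix, Fintype.card_coe, mul_assoc]
    gcongr

end Standard

end ClassicalSystem

/-! ## Frames of pairs -/

section PairFrame

variable {𝕂 : Type} [NormedRing 𝕂] [NormedAlgebra ℝ 𝕂] [StarRing 𝕂] [ClassicalScalar 𝕂]
  {ι : Type} [Fintype ι] [DecidableEq ι]

variable (𝕂 ι) in
/-- The real part of the trace of a matrix over `𝕂`, as a complex matrix. -/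
noncomputable def reTrace : Matrix ι ι 𝕂 →ₗ[ℝ] ℝ :=
  Complex.reLm ∘ₗ (Matrix.traceLinearMap (ι × Fin (ClassicalScalar.e 𝕂)) ℂ ℂ).restrictScalars ℝ ∘ₗ
    (cmat ι).toLinearMap

theorem reTrace_apply (X : Matrix ι ι 𝕂) : reTrace 𝕂 ι X = (cmat ι X).trace.re := rfl

theorem scalarTrace_one_pos [Nontrivial 𝕂] : 0 < scalarTrace 𝕂 1 := by
  have h : scalarTrace 𝕂 1 = ClassicalScalar.e 𝕂 := by simp [scalarTrace]
  rw [h, Nat.cast_pos]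
  by_contra h0
  have h1 : ClassicalScalar.e 𝕂 = 0 := by omega
  have : IsEmpty (Fin (ClassicalScalar.e 𝕂)) := by rw [h1]; infer_instance
  exact one_ne_zero (ClassicalScalar.toC_injective (Subsingleton.elim (ClassicalScalar.toC (1 : 𝕂))
    (ClassicalScalar.toC 0)))

variable (𝕂) in
/-- The projection to the coordinates `i` and `p i`. -/
def pairProj (p : ι → ι) (i : ι) : Matrix ι ι 𝕂 :=
  Matrix.diagonal fun a => if a = i ∨ a = p i then 1 else 0

/-- The space `A` is spanned by matrices `x i` that interchange the coordinates `i` and `p i`, or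
have eigenvectors there, and vanish elsewhere. -/
structure PairFrame (A : Submodule ℝ (Matrix ι ι 𝕂)) (p : ι → ι) (x : ι → Matrix ι ι 𝕂) :
    Prop where
  invol : Function.Involutive p
  mem : ∀ i, x i ∈ A
  fixed : ∀ i, p i = i → x i = 0
  sq : ∀ i, p i ≠ i → x i * x i = pairProj 𝕂 p i
  partner : ∀ i, x (p i) = x i ∨ x (p i) = -x i
  supp : ∀ i a b, x i a b ≠ 0 → (a = i ∨ a = p i) ∧ (b = i ∨ b = p i)
  le_span : A ≤ Submodule.span ℝ (Set.range x)

namespace PairFrame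

variable {A : Submodule ℝ (Matrix ι ι 𝕂)} {p : ι → ι} {x : ι → Matrix ι ι 𝕂}
  (h : PairFrame A p x)

include h

theorem row_eq_zero {i a : ι} (hi : a ≠ i) (hpi : a ≠ p i) (b : ι) : x i a b = 0 := by
  by_contra hne
  rcases (h.supp i a b hne).1 with h1 | h1
  · exact hi h1
  · exact hpi h1

theorem col_eq_zero {i b : ι} (hi : b ≠ i) (hpi : b ≠ p i) (a : ι) : x i a b = 0 := by
  by_contra hne
  rcases (h.supp i a b hne).2 with h1 | h1
  · exact hi h1
  · exact hpi h1

theorem mul_apply_eq_zero {i a : ι} (hi : a ≠ i) (hpi : a ≠ p i) (Y : Matrix ι ι 𝕂) (b : ι) :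
    (x i * Y) a b = 0 := by
  rw [Matrix.mul_apply]
  exact Finset.sum_eq_zero fun k _ => by rw [h.row_eq_zero hi hpi, zero_mul]

theorem apply_mul_eq_zero {i b : ι} (hi : b ≠ i) (hpi : b ≠ p i) (Y : Matrix ι ι 𝕂) (a : ι) :
    (Y * x i) a b = 0 := by
  rw [Matrix.mul_apply]
  exact Finset.sum_eq_zero fun k _ => by rw [h.col_eq_zero hi hpi, mul_zero]

theorem proj_mul (i : ι) : pairProj 𝕂 p i * x i = x i := by
  ext a b
  rw [pairProj, Matrix.diagonal_mul]
  split_ifs with ha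
  · rw [one_mul]
  · rw [zero_mul, h.row_eq_zero (fun h1 => ha (Or.inl h1)) (fun h1 => ha (Or.inr h1))]

theorem cube (i : ι) : x i * x i * x i = x i := by
  by_cases hi : p i = i
  · rw [h.fixed i hi, mul_zero]
  · rw [h.sq i hi, h.proj_mul]

theorem mul_of_ne {i o : ι} (h1 : o ≠ i) (h2 : o ≠ p i) : x i * x o = 0 := by
  ext a b
  rw [Matrix.mul_apply]
  refine Finset.sum_eq_zero fun k _ => ?_
  by_contra hne
  have h3 := (h.supp i a k (left_ne_zero_of_mul hne)).2
  have h4 := (h.supp o k b (right_ne_zero_of_mul hne)).1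
  rcases h3 with rfl | rfl <;> rcases h4 with h4 | h4
  · exact h1 h4.symm
  · exact h2 (by rw [h4, h.invol])
  · exact h2 h4.symm
  · exact h1 (h.invol.injective h4).symm

/-- The square of `x i` is the projection to two coordinates; this fixes the normalization 2
`scalarTrace 𝕂 1` used for all coefficients. -/
theorem reTrace_sq {i : ι} (hi : p i ≠ i) : reTrace 𝕂 ι (x i * x i) = 2 * scalarTrace 𝕂 1 := by
  rw [h.sq i hi, reTrace_apply, re_trace_cmat, pairProj]
  have h1 : ∀ a, scalarTrace 𝕂 (Matrix.diagonal
      (fun a => if a = i ∨ a = p i then (1 : 𝕂) else 0) a a) =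
      (if a = i then scalarTrace 𝕂 1 else 0) + if a = p i then scalarTrace 𝕂 1 else 0 := by
    intro a
    rw [Matrix.diagonal_apply_eq]
    by_cases h1 : a = i
    · subst h1
      simp [Ne.symm hi]
    · by_cases h2 : a = p i <;> simp [h1, h2, hi]
  simp only [h1, Finset.sum_add_distrib, Finset.sum_ite_eq', Finset.mem_univ, if_true]
  ring

theorem induction {P : Matrix ι ι 𝕂 → Prop} (hx : ∀ i, P (x i)) (h0 : P 0)
    (hadd : ∀ X Y, P X → P Y → P (X + Y)) (hsmul : ∀ (c : ℝ) X, P X → P (c • X))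
    {y : Matrix ι ι 𝕂} (hy : y ∈ A) : P y := by
  refine Submodule.span_induction (p := fun X _ => P X) ?_ h0 (fun X Y _ _ => hadd X Y)
    (fun c X _ => hsmul c X) (h.le_span hy)
  rintro _ ⟨i, rfl⟩
  exact hx i

/-- On the pair of `o`, an element of `A` acts as a real multiple of `x o`, because the other frame
elements, except the partner ±`x o`, vanish there. The trace recovers the coefficient. -/
theorem mul_eq [Nontrivial 𝕂] {y : Matrix ι ι 𝕂} (hy : y ∈ A) (o : ι) :
    y * x o = (reTrace 𝕂 ι (y * x o) / (2 * scalarTrace 𝕂 1)) • (x o * x o) := by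
  have he := scalarTrace_one_pos (𝕂 := 𝕂)
  refine h.induction (P := fun y => y * x o =
    (reTrace 𝕂 ι (y * x o) / (2 * scalarTrace 𝕂 1)) • (x o * x o)) (fun i => ?_) ?_
    (fun X Y hX hY => ?_) (fun c X hX => ?_) hy
  · by_cases ho : p o = o
    · rw [h.fixed o ho, mul_zero, mul_zero, smul_zero]
    have h1 : reTrace 𝕂 ι (x o * x o) / (2 * scalarTrace 𝕂 1) = 1 := by
      rw [h.reTrace_sq ho]; field_simp
    by_cases h2 : i = o
    · rw [h2, h1, one_smul]
    · by_cases h3 : i = p o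
      · rcases h.partner o with h4 | h4
        · rw [h3, h4, h1, one_smul]
        · rw [h3, h4, neg_mul, map_neg, neg_div, h1, neg_smul, one_smul]
      · rw [h.mul_of_ne (Ne.symm h2) (fun h4 => h3 (by rw [h4, h.invol])), map_zero, zero_div,
          zero_smul]
  · rw [zero_mul, map_zero, zero_div, zero_smul]
  · rw [add_mul, map_add, add_div, add_smul, ← hX, ← hY]
  · rw [smul_mul_assoc, map_smul, smul_eq_mul, mul_div_assoc, mul_smul, ← hX]

theorem mul_proj_eq [Nontrivial 𝕂] {y : Matrix ι ι 𝕂} (hy : y ∈ A) {o : ι} (ho : p o ≠ o) :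
    y * pairProj 𝕂 p o = (reTrace 𝕂 ι (y * x o) / (2 * scalarTrace 𝕂 1)) • x o := by
  have h1 := congrArg (· * x o) (h.mul_eq hy o)
  simp only [smul_mul_assoc, h.cube] at h1
  rw [← h.sq o ho, ← mul_assoc, h1]

theorem apply_fixed {y : Matrix ι ι 𝕂} (hy : y ∈ A) {u : ι} (hu : p u = u) (a : ι) :
    y a u = 0 := by
  refine h.induction (P := fun y => y a u = 0) (fun i => ?_) rfl
    (fun X Y hX hY => by rw [Matrix.add_apply, hX, hY, add_zero])
    (fun c X hX => by rw [Matrix.smul_apply, hX, smul_zero]) hy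
  by_cases h1 : u = i
  · rw [← h1, h.fixed u hu]; rfl
  · exact h.col_eq_zero h1 (fun h2 => h1 (by rw [← hu, h2, h.invol])) a

theorem fixed_apply {y : Matrix ι ι 𝕂} (hy : y ∈ A) {u : ι} (hu : p u = u) (a : ι) :
    y u a = 0 := by
  refine h.induction (P := fun y => y u a = 0) (fun i => ?_) rfl
    (fun X Y hX hY => by rw [Matrix.add_apply, hX, hY, add_zero])
    (fun c X hX => by rw [Matrix.smul_apply, hX, smul_zero]) hy
  by_cases h1 : u = i
  · rw [← h1, h.fixed u hu]; rfl
  · exact h.row_eq_zero h1 (fun h2 => h1 (by rw [← hu, h2, h.invol])) a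

/-- An element of `A` whose square projects to two coordinates is `± x a` for one of them. -/
theorem eq_smul_of_sq [Nontrivial 𝕂] {y : Matrix ι ι 𝕂} (hy : y ∈ A) {a b : ι}
    (hsq : y * y = Matrix.diagonal fun k => if k = a ∨ k = b then 1 else 0)
    (hcube : y * y * y = y) :
    p a = b ∧ ∃ c : ℝ, c * c = 1 ∧ y = c • x a := by
  have ha : p a ≠ a := by
    intro ha
    have h1 : (y * y) a a = 0 := by
      rw [Matrix.mul_apply]
      exact Finset.sum_eq_zero fun k _ => by rw [h.apply_fixed hy ha, mul_zero]
    rw [hsq, Matrix.diagonal_apply_eq, if_pos (Or.inl rfl)] at h1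
    exact one_ne_zero h1
  set c := reTrace 𝕂 ι (y * x a) / (2 * scalarTrace 𝕂 1) with hc
  have h1 : y * pairProj 𝕂 p a = c • x a := h.mul_proj_eq hy ha
  -- On the pair of `a` the square of `y` is the scalar c². Comparing with the prescribed projection
  -- at the entries `a` and `p a` gives c² = 1 and shows that `p a` is one of the two coordinates of
  -- the projection, hence `b`.
  have h2 : y * y * pairProj 𝕂 p a = (c * c) • pairProj 𝕂 p a := by
    rw [mul_assoc, h1, mul_smul_comm, h.mul_eq hy a, smul_smul, h.sq a ha]
  rw [hsq, pairProj, Matrix.diagonal_mul_diagonal] at h2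
  have h3 := congrFun (congrFun h2 a) a
  have h4 := congrFun (congrFun h2 (p a)) (p a)
  rw [Matrix.smul_apply, Matrix.diagonal_apply_eq, Matrix.diagonal_apply_eq, if_pos (Or.inl rfl),
    if_pos (Or.inl rfl), mul_one] at h3
  rw [Matrix.smul_apply, Matrix.diagonal_apply_eq, Matrix.diagonal_apply_eq,
    if_pos (Or.inr rfl), mul_one, ← h3] at h4
  have hb : p a = b := by
    by_contra hne
    rw [if_neg (by tauto)] at h4
    exact zero_ne_one h4
  have hcc : c * c = 1 := by
    have h5 : algebraMap ℝ 𝕂 (c * c) = algebraMap ℝ 𝕂 1 := by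
      rw [Algebra.algebraMap_eq_smul_one, Algebra.algebraMap_eq_smul_one, ← h3, one_smul]
    exact (algebraMap ℝ 𝕂).injective h5
  refine ⟨hb, c, hcc, ?_⟩
  have h6 : y * y = pairProj 𝕂 p a := by rw [hsq, pairProj, hb]
  rw [← h1, ← h6, ← mul_assoc, hcube]

end PairFrame

end PairFrame

/-! ### Roots in terms of a frame -/

namespace ClassicalSystem

variable {𝕂 : Type} [NormedRing 𝕂] [NormedAlgebra ℝ 𝕂] [StarRing 𝕂] [ClassicalScalar 𝕂]
  [FiniteDimensional ℝ 𝕂] {S : ClassicalSystem 𝕂}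

theorem root_apply {n : ℕ} {γ : Module.Dual ℝ (S.tower.a n)} {η : S.tower.L n}
    (hη : η ∈ jointEigenspace (S.tower.adA n) γ) {ξ : Matrix _ _ 𝕂} (hξ : ξ ∈ S.aMat n)
    (i j : Fin (S.D.size n)) :
    (ξ * (η : S.g n).1) i j - ((η : S.g n).1 * ξ) i j =
      γ ⟨(⟨ξ, hξ.1⟩ : S.g n), hξ.2⟩ • (η : S.g n).1 i j :=
  congrArg (fun M : S.g n => M.1 i j) (hη ⟨(⟨ξ, hξ.1⟩ : S.g n), hξ.2⟩)

theorem exists_apply_ne_zero {n : ℕ} {η : S.tower.L n} (hη : η ≠ 0) :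
    ∃ i j, (η : S.g n).1 i j ≠ 0 := by
  by_contra! hno
  exact hη (Subtype.ext (Matrix.ext hno))

/-- Two linear forms on `a n` agree if they agree on a frame. -/
theorem dual_ext {n : ℕ} {p : Fin (S.D.size n) → Fin (S.D.size n)}
    {x : Fin (S.D.size n) → Matrix (Fin (S.D.size n)) (Fin (S.D.size n)) 𝕂}
    (hx : PairFrame (S.aMat n) p x) {α β : Module.Dual ℝ (S.tower.a n)}
    (h : ∀ i, α ⟨(⟨x i, (hx.mem i).1⟩ : S.g n), (hx.mem i).2⟩ =
      β ⟨(⟨x i, (hx.mem i).1⟩ : S.g n), (hx.mem i).2⟩) : α = β := by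
  refine LinearMap.ext fun ξ => ?_
  have key : ∃ hξ : (ξ.1 : S.g n).1 ∈ S.aMat n,
      α ⟨(⟨(ξ.1 : S.g n).1, hξ.1⟩ : S.g n), hξ.2⟩ =
      β ⟨(⟨(ξ.1 : S.g n).1, hξ.1⟩ : S.g n), hξ.2⟩ := by
    refine hx.induction (P := fun X => ∃ hX : X ∈ S.aMat n,
      α ⟨(⟨X, hX.1⟩ : S.g n), hX.2⟩ = β ⟨(⟨X, hX.1⟩ : S.g n), hX.2⟩)
      (fun i => ⟨hx.mem i, h i⟩) ⟨zero_mem _, (map_zero α).trans (map_zero β).symm⟩ ?_ ?_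
      (mem_aMat_of_mem ξ.2)
    · rintro X Y ⟨hX, hX'⟩ ⟨hY, hY'⟩
      refine ⟨add_mem hX hY, ?_⟩
      have h1 := map_add α ⟨(⟨X, hX.1⟩ : S.g n), hX.2⟩ ⟨(⟨Y, hY.1⟩ : S.g n), hY.2⟩
      have h2 := map_add β ⟨(⟨X, hX.1⟩ : S.g n), hX.2⟩ ⟨(⟨Y, hY.1⟩ : S.g n), hY.2⟩
      rw [hX', hY', ← h2] at h1
      exact h1
    · rintro c X ⟨hX, hX'⟩
      refine ⟨Submodule.smul_mem _ c hX, ?_⟩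
      have h1 := map_smul α c ⟨(⟨X, hX.1⟩ : S.g n), hX.2⟩
      have h2 := map_smul β c ⟨(⟨X, hX.1⟩ : S.g n), hX.2⟩
      rw [hX', ← h2] at h1
      exact h1
  exact key.2

section Frame

variable {n : ℕ} {p : Fin (S.D.size n) → Fin (S.D.size n)}
    {x : Fin (S.D.size n) → Matrix (Fin (S.D.size n)) (Fin (S.D.size n)) 𝕂}
    (hx : PairFrame (S.aMat n) p x)

/-- The elements of a frame, as elements of `a n`. -/
noncomputable def frame (i : Fin (S.D.size n)) : S.tower.a n :=
  ⟨(⟨x i, (hx.mem i).1⟩ : S.g n), (hx.mem i).2⟩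

theorem frame_value {γ : Module.Dual ℝ (S.tower.a n)} {η : S.tower.L n} (hη0 : η ≠ 0)
    (hη : η ∈ jointEigenspace (S.tower.adA n) γ) (i : Fin (S.D.size n)) :
    γ (frame hx i) ∈ ({-2, -1, 0, 1, 2} : Set ℝ) :=
  (isFiveValued_ad (S.g n) (⟨x i, (hx.mem i).1⟩ : S.g n) (hx.cube i)).eigenvalue hη0
    (hη (frame hx i))

/-- If the pair of `o` contains neither i nor j, both products in the commutator of `x o` with `η`
vanish at (i, j). So a single nonzero entry of a root vector shows which frame elements the root can
see. -/
theorem frame_eq_zero {γ : Module.Dual ℝ (S.tower.a n)} {η : S.tower.L n}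
    (hη : η ∈ jointEigenspace (S.tower.adA n) γ) {i j : Fin (S.D.size n)}
    (hij : (η : S.g n).1 i j ≠ 0) {o : Fin (S.D.size n)} (h1 : i ≠ o) (h2 : i ≠ p o)
    (h3 : j ≠ o) (h4 : j ≠ p o) : γ (frame hx o) = 0 := by
  have h5 := root_apply hη (hx.mem o) i j
  rw [hx.mul_apply_eq_zero h1 h2, hx.apply_mul_eq_zero h3 h4, sub_zero] at h5
  exact (smul_eq_zero.1 h5.symm).resolve_right hij

variable [Nontrivial 𝕂]

/-- The form that takes the product with `x i`, normalized to be `1` at `x i`. -/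
noncomputable def coframe (x : Fin (S.D.size n) → Matrix (Fin (S.D.size n)) (Fin (S.D.size n)) 𝕂)
    (i : Fin (S.D.size n)) : Module.Dual ℝ (S.tower.a n) :=
  (2 * scalarTrace 𝕂 1)⁻¹ • reTrace 𝕂 _ ∘ₗ LinearMap.mulLeft ℝ (x i) ∘ₗ
    (S.g n).toSubmodule.subtype ∘ₗ (S.tower.a n).subtype

theorem coframe_apply (i : Fin (S.D.size n)) (ξ : S.tower.a n) :
    coframe x i ξ = (2 * scalarTrace 𝕂 1)⁻¹ * reTrace 𝕂 _ (x i * (ξ.1 : S.g n).1) := rfl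

theorem coframe_frame_self {i : Fin (S.D.size n)} (hi : p i ≠ i) :
    coframe x i (frame hx i) = 1 := by
  have he := scalarTrace_one_pos (𝕂 := 𝕂)
  rw [coframe_apply]
  refine (congrArg _ (hx.reTrace_sq hi)).trans ?_
  field_simp

theorem coframe_frame_of_ne {i o : Fin (S.D.size n)} (h1 : o ≠ i) (h2 : o ≠ p i) :
    coframe x i (frame hx o) = 0 := by
  rw [coframe_apply]
  refine (congrArg (fun M => (2 * scalarTrace 𝕂 1)⁻¹ * reTrace 𝕂 _ M) (hx.mul_of_ne h1 h2)).trans ?_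
  rw [map_zero, mul_zero]

theorem frame_partner (i : Fin (S.D.size n)) :
    frame hx (p i) = frame hx i ∨ frame hx (p i) = -frame hx i := by
  rcases hx.partner i with h | h
  · exact Or.inl (Subtype.ext (Subtype.ext h))
  · exact Or.inr (Subtype.ext (Subtype.ext h))

/-- A form that vanishes on the frame elements other than `x i` is a multiple of `coframe x i`. -/
theorem eq_smul_coframe {γ : Module.Dual ℝ (S.tower.a n)} {i : Fin (S.D.size n)}
    (h : ∀ o, o ≠ i → o ≠ p i → γ (frame hx o) = 0) : γ = γ (frame hx i) • coframe x i := by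
  refine dual_ext hx fun o => ?_
  change γ (frame hx o) = γ (frame hx i) * coframe x i (frame hx o)
  by_cases hi : p i = i
  · have h0 : frame hx i = 0 := Subtype.ext (Subtype.ext (hx.fixed i hi))
    by_cases h1 : o = i
    · rw [h1, h0, map_zero, zero_mul]
    · rw [h0, map_zero, zero_mul, h o h1 (by rwa [hi])]
  have hi1 := coframe_frame_self hx hi
  by_cases h1 : o = i
  · rw [h1, hi1, mul_one]
  · by_cases h2 : o = p i
    · rcases frame_partner hx i with h3 | h3
      · rw [h2, h3, hi1, mul_one]
      · rw [h2, h3, map_neg, map_neg, hi1, mul_neg, mul_one]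
    · rw [coframe_frame_of_ne hx h1 h2, h o h1 h2, mul_zero]

theorem eq_coframe_add_coframe {γ : Module.Dual ℝ (S.tower.a n)} {i j : Fin (S.D.size n)}
    (hj : j ≠ i) (hj' : j ≠ p i)
    (h : ∀ o, o ≠ i → o ≠ p i → o ≠ j → o ≠ p j → γ (frame hx o) = 0) :
    γ = γ (frame hx i) • coframe x i + γ (frame hx j) • coframe x j := by
  -- After subtracting the part at the pair of `j`, only the pair of `i` remains.
  have h1 : γ - γ (frame hx j) • coframe x j = γ (frame hx i) • coframe x i := by
    have h2 := eq_smul_coframe hx (γ := γ - γ (frame hx j) • coframe x j) (i := i) fun o h3 h4 => ?_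
    · rw [h2, LinearMap.sub_apply, LinearMap.smul_apply,
        coframe_frame_of_ne hx (Ne.symm hj) (fun h5 => hj' (by rw [h5, hx.invol])),
        smul_zero, sub_zero]
    · rw [LinearMap.sub_apply, LinearMap.smul_apply, smul_eq_mul, sub_eq_zero]
      by_cases hjf : p j = j
      · have h0 : frame hx j = 0 := Subtype.ext (Subtype.ext (hx.fixed j hjf))
        rw [h0, map_zero, zero_mul]
        by_cases h5 : o = j
        · rw [h5, h0, map_zero]
        · exact h o h3 h4 h5 (by rwa [hjf])
      have hj1 := coframe_frame_self hx hjf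
      by_cases h5 : o = j
      · rw [h5, hj1, mul_one]
      · by_cases h6 : o = p j
        · rcases frame_partner hx j with h7 | h7
          · rw [h6, h7, hj1, mul_one]
          · rw [h6, h7, map_neg, map_neg, hj1, mul_neg, mul_one]
        · rw [coframe_frame_of_ne hx h5 h6, h o h3 h4 h5 h6, mul_zero]
  rw [← h1, sub_add_cancel]

end Frame

variable [Nontrivial 𝕂]

/-- A nonzero entry (i, j) of a root vector shows that the root is a combination of at most two
coframe elements, those of i and j, with coefficients among -2, ..., 2. So its norm takes only
finitely many values. -/
theorem finitelyManyNorms_of_frame {p : ∀ n, Fin (S.D.size n) → Fin (S.D.size n)}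
    {x : ∀ n, Fin (S.D.size n) → Matrix (Fin (S.D.size n)) (Fin (S.D.size n)) 𝕂}
    (hx : ∀ n, PairFrame (S.aMat n) (p n) (x n)) : S.tower.FinitelyManyNorms := by
  let V : Set ℝ := {-2, -1, 0, 1, 2}
  have hV : V.Finite := Set.toFinite _
  refine ⟨Set.image2 (fun s t => (2 * scalarTrace 𝕂 1)⁻¹ * (s * s + t * t)) V V,
    hV.image2 _ hV, ?_⟩
  rintro n γ ⟨-, η, hη0, hη⟩
  replace hη : η ∈ jointEigenspace (S.tower.adA n) γ := hη
  obtain ⟨i, j, hij⟩ := exists_apply_ne_zero hη0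
  have hval := frame_value (hx n) hη0 hη
  have hrep : ∃ k l, ∃ t ∈ V, (t = 0 ∨ t = γ (frame (hx n) l)) ∧
      γ = γ (frame (hx n) k) • coframe (x n) k + t • coframe (x n) l := by
    by_cases h1 : j = i ∨ j = p n i
    -- If i and j are in the same pair, one term suffices; the second coefficient is set to zero.
    · refine ⟨i, j, 0, by simp [V], Or.inl rfl, ?_⟩
      rw [zero_smul, add_zero]
      refine eq_smul_coframe (hx n) fun o ho ho' => frame_eq_zero (hx n) hη hij (Ne.symm ho) ?_ ?_ ?_
      · intro h2; exact ho' (by rw [h2, (hx n).invol])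
      · rcases h1 with h1 | h1
        · rw [h1]; exact Ne.symm ho
        · rw [h1]; exact Ne.symm ho'
      · rcases h1 with h1 | h1
        · intro h2; exact ho' (by rw [← h1, h2, (hx n).invol])
        · intro h2; exact ho ((hx n).invol.injective (h2.symm.trans h1))
    · push Not at h1
      refine ⟨i, j, γ (frame (hx n) j), hval j, Or.inr rfl,
        eq_coframe_add_coframe (hx n) h1.1 h1.2 fun o h2 h3 h4 h5 =>
          frame_eq_zero (hx n) hη hij (Ne.symm h2) ?_ (Ne.symm h4) ?_⟩
      · intro h; exact h3 (by rw [h, (hx n).invol])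
      · intro h; exact h5 (by rw [h, (hx n).invol])
  obtain ⟨k, l, t, htV, ht, hγ⟩ := hrep
  -- The vector dual to `γ`: by normalization `coframe` at k is the trace form with `x n k` divided
  -- by 2 `scalarTrace 𝕂 1`.
  let h : S.tower.a n := (2 * scalarTrace 𝕂 1)⁻¹ •
    (γ (frame (hx n) k) • frame (hx n) k + t • frame (hx n) l)
  have hform : ∀ ξ : S.tower.a n, γ ξ = S.tower.form n h ξ := by
    intro ξ
    conv_lhs => rw [hγ]
    change γ (frame (hx n) k) * ((2 * scalarTrace 𝕂 1)⁻¹ * reTrace 𝕂 _ (x n k * (ξ.1 : S.g n).1)) +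
      t * ((2 * scalarTrace 𝕂 1)⁻¹ * reTrace 𝕂 _ (x n l * (ξ.1 : S.g n).1)) =
      reTrace 𝕂 _ (((2 * scalarTrace 𝕂 1)⁻¹ • (γ (frame (hx n) k) • x n k + t • x n l)) *
        (ξ.1 : S.g n).1)
    rw [smul_mul_assoc, add_mul, smul_mul_assoc, smul_mul_assoc, map_smul, map_add, map_smul,
      map_smul, smul_eq_mul, smul_eq_mul, smul_eq_mul]
    ring
  refine ⟨h, h.2, hform, ?_⟩
  rw [← hform h]
  refine ⟨γ (frame (hx n) k), hval k, t, htV, ?_⟩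
  rw [map_smul, map_add, map_smul, map_smul, smul_eq_mul, smul_eq_mul, smul_eq_mul]
  rcases ht with ht | ht
  · simp [ht]
  · rw [ht]

end ClassicalSystem

/-! ### Pair projections under signed injections -/

section

variable {𝕂 : Type} [NormedRing 𝕂] [NormedAlgebra ℝ 𝕂] [StarRing 𝕂] [ClassicalScalar 𝕂]
  {ι κ : Type} [Fintype ι] [DecidableEq ι] [Fintype κ] [DecidableEq κ]

theorem tr_one : ClassicalScalar.tr (1 : 𝕂) = 1 := by
  apply ClassicalScalar.toC_injective
  rw [ClassicalScalar.toC_tr, map_one, Matrix.transpose_one]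

theorem transp_pairProj (p : κ → κ) (i : κ) : transp (pairProj 𝕂 p i) = pairProj 𝕂 p i := by
  ext a b
  change ClassicalScalar.tr (pairProj 𝕂 p i b a) = pairProj 𝕂 p i a b
  rw [pairProj]
  by_cases hab : a = b
  · subst hab
    rw [Matrix.diagonal_apply_eq]
    split_ifs
    · exact tr_one
    · exact BlockData.scalar_tr_zero
  · rw [Matrix.diagonal_apply_ne _ hab, Matrix.diagonal_apply_ne _ (Ne.symm hab)]
    exact BlockData.scalar_tr_zero

theorem tflip_mul_self (b : Bool) {X : Matrix ι ι 𝕂} (hX : transp (X * X) = X * X) :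
    tflip b X * tflip b X = X * X := by
  cases b
  · rfl
  · change -transp X * -transp X = _
    rw [neg_mul_neg, ← transp_mul, hX]

theorem place_pairProj {F : Matrix ι κ ℤ} {f : κ → ι} {ε : κ → ℤˣ} (hf : Function.Injective f)
    (hF : ∀ a i, F a i = if a = f i then (ε i : ℤ) else 0) (p : κ → κ) (i : κ) :
    place F (pairProj 𝕂 p i) =
      Matrix.diagonal fun k => if k = f i ∨ k = f (p i) then 1 else 0 := by
  ext a b
  by_cases ha : ∃ k, a = f k
  · obtain ⟨k, rfl⟩ := ha
    by_cases hb : ∃ l, b = f l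
    · obtain ⟨l, rfl⟩ := hb
      rw [place_apply hf hF, pairProj]
      by_cases hkl : k = l
      · subst hkl
        rw [Matrix.diagonal_apply_eq, Matrix.diagonal_apply_eq]
        simp only [hf.eq_iff]
        rcases Int.units_eq_one_or (ε k) with h | h <;> split_ifs <;> simp [h]
      · rw [Matrix.diagonal_apply_ne _ hkl, Matrix.diagonal_apply_ne _ (hf.ne hkl)]
        simp
    · have h0 : place F (pairProj 𝕂 p i) (f k) b = 0 := by
        by_contra h
        exact hb (place_support hF _ h).2
      rw [h0, Matrix.diagonal_apply_ne]
      rintro rfl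
      exact hb ⟨k, rfl⟩
  · have h0 : place F (pairProj 𝕂 p i) a b = 0 := by
      by_contra h
      exact ha (place_support hF _ h).1
    rw [h0]
    by_cases hab : a = b
    · subst hab
      rw [Matrix.diagonal_apply_eq, if_neg]
      rintro (h | h)
      · exact ha ⟨_, h⟩
      · exact ha ⟨_, h⟩
    · rw [Matrix.diagonal_apply_ne _ hab]

theorem tflip_apply_ne_zero {b : Bool} {X : Matrix ι ι 𝕂} {i j : ι} (h : tflip b X i j ≠ 0) :
    X i j ≠ 0 ∨ X j i ≠ 0 := by
  cases b
  · exact Or.inl h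
  · refine Or.inr fun h0 => h ?_
    change -ClassicalScalar.tr (X j i) = 0
    rw [h0, BlockData.scalar_tr_zero, neg_zero]

end

/-! ### Matrices in the corner between a pair and an unpaired coordinate -/

namespace PairFrame

variable {𝕂 : Type} [NormedRing 𝕂] [NormedAlgebra ℝ 𝕂] [StarRing 𝕂] [ClassicalScalar 𝕂]
  {ι : Type} [Fintype ι] [DecidableEq ι] {A : Submodule ℝ (Matrix ι ι 𝕂)} {p : ι → ι}
  {x : ι → Matrix ι ι 𝕂} (h : PairFrame A p x) {a u : ι} (ha : p a ≠ a) (hu : p u = u)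
  {Y : Matrix ι ι 𝕂} (hY : ∀ k l, Y k l ≠ 0 → k = a ∧ l = u ∨ k = u ∧ l = a)

include h hu hY

theorem mul_corner {o : ι} (h1 : o ≠ a) (h2 : o ≠ p a) : x o * Y = 0 ∧ Y * x o = 0 := by
  have h3 : a ≠ p o := fun h4 => h2 (by rw [h4, h.invol])
  constructor
  · ext k l
    rw [Matrix.mul_apply]
    refine Finset.sum_eq_zero fun j _ => ?_
    by_cases hj : Y j l = 0
    · rw [hj, mul_zero]
    rcases hY j l hj with ⟨rfl, rfl⟩ | ⟨rfl, rfl⟩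
    · rw [h.col_eq_zero (Ne.symm h1) h3, zero_mul]
    · rw [h.apply_fixed (h.mem o) hu, zero_mul]
  · ext k l
    rw [Matrix.mul_apply]
    refine Finset.sum_eq_zero fun j _ => ?_
    by_cases hj : Y k j = 0
    · rw [hj, zero_mul]
    rcases hY k j hj with ⟨rfl, rfl⟩ | ⟨rfl, rfl⟩
    · rw [h.fixed_apply (h.mem o) hu, mul_zero]
    · rw [h.row_eq_zero (Ne.symm h1) h3, mul_zero]

/-- `Y` leads from `a` only to `u` and from `u` only to `a`, and `x a` vanishes in the row and the
column of the unpaired coordinate `u`. -/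
theorem mul_corner_mul : x a * Y * x a = 0 := by
  ext k l
  rw [Matrix.mul_assoc, Matrix.mul_apply]
  refine Finset.sum_eq_zero fun i _ => ?_
  rw [Matrix.mul_apply, Finset.mul_sum]
  refine Finset.sum_eq_zero fun j _ => ?_
  by_cases hj : Y i j = 0
  · rw [hj, zero_mul, mul_zero]
  rcases hY i j hj with ⟨rfl, rfl⟩ | ⟨rfl, rfl⟩
  · rw [h.fixed_apply (h.mem _) hu, mul_zero, mul_zero]
  · rw [h.apply_fixed (h.mem _) hu, zero_mul]

include ha

/-- The square of `x a` is the projection to `a` and `p a`. It keeps the entry (a, u) from the left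
and the entry (u, a) from the right, and each entry is counted once. -/
theorem proj_corner : x a * x a * Y + Y * (x a * x a) = Y := by
  have hua : u ≠ a := fun h1 => ha (h1 ▸ hu)
  have hup : u ≠ p a := fun h1 => hua (by rw [← hu, h1, h.invol])
  rw [h.sq a ha]
  ext k l
  rw [Matrix.add_apply, pairProj, Matrix.diagonal_mul, Matrix.mul_diagonal]
  by_cases hkl : Y k l = 0
  · rw [hkl, mul_zero, zero_mul, add_zero]
  rcases hY k l hkl with ⟨rfl, rfl⟩ | ⟨rfl, rfl⟩
  · rw [if_pos (Or.inl rfl), if_neg (by tauto), one_mul, mul_zero, add_zero]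
  · rw [if_pos (Or.inl rfl), if_neg (by tauto), mul_one, zero_mul, zero_add]

/-- The projections of `Y` to the eigenspaces for `1` and `-1` are joint eigenvectors. -/
theorem lie_corner [Nontrivial 𝕂] {σ : ℝ} (hσ : σ * σ = 1) {y : Matrix ι ι 𝕂} (hy : y ∈ A) :
    y * (Y + σ • (x a * Y - Y * x a)) - (Y + σ • (x a * Y - Y * x a)) * y =
      (σ * ((2 * scalarTrace 𝕂 1)⁻¹ * reTrace 𝕂 ι (x a * y))) •
        (Y + σ • (x a * Y - Y * x a)) := by
  have he := scalarTrace_one_pos (𝕂 := 𝕂)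
  set Z := Y + σ • (x a * Y - Y * x a) with hZ
  -- The square of ad (x a) maps `Y` to (x a)² Y + Y (x a)² - 2 (x a) Y (x a), which is `Y`. So `Y`
  -- plus σ times its image under ad (x a) is an eigenvector for σ when σ² = 1.
  have hself : x a * Z - Z * x a =
      (σ * ((2 * scalarTrace 𝕂 1)⁻¹ * reTrace 𝕂 ι (x a * x a))) • Z := by
    have h1 : (2 * scalarTrace 𝕂 1)⁻¹ * reTrace 𝕂 ι (x a * x a) = 1 := by
      rw [h.reTrace_sq ha]; field_simp
    have h2 := h.proj_corner ha hu hY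
    have h3 := h.mul_corner_mul hu hY
    have h4 : x a * Z - Z * x a = (x a * Y - Y * x a) +
        σ • ((x a * x a * Y + Y * (x a * x a)) - (x a * Y * x a + x a * Y * x a)) := by
      rw [hZ]
      simp only [mul_add, add_mul, mul_smul_comm, smul_mul_assoc, mul_sub, sub_mul, mul_assoc]
      module
    rw [h4, h2, h3, add_zero, sub_zero, h1, mul_one, hZ, smul_add, smul_smul, hσ, one_smul,
      add_comm]
  clear_value Z
  refine h.induction (P := fun y => y * Z - Z * y =
    (σ * ((2 * scalarTrace 𝕂 1)⁻¹ * reTrace 𝕂 ι (x a * y))) • Z) (fun o => ?_) ?_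
    (fun X W hX hW => ?_) (fun c X hX => ?_) hy
  · by_cases h1 : o = a
    · rw [h1, hself]
    · by_cases h2 : o = p a
      · rcases h.partner a with h3 | h3
        · rw [h2, h3, hself]
        · rw [h2, h3, neg_mul, mul_neg, mul_neg, map_neg, mul_neg, mul_neg, neg_smul, ← hself]
          abel
      · obtain ⟨h3, h4⟩ := h.mul_corner hu hY h1 h2
        have h5 := h.mul_of_ne h1 h2
        have h6 := h.mul_of_ne (i := o) (o := a) (Ne.symm h1) (fun h7 => h2 (by rw [h7, h.invol]))
        have h7 : x o * Z = 0 := by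
          rw [hZ, mul_add, h3, mul_smul_comm, mul_sub, ← mul_assoc, ← mul_assoc, h6, h3, zero_mul,
            zero_mul, sub_zero, smul_zero, add_zero]
        have h8 : Z * x o = 0 := by
          rw [hZ, add_mul, h4, smul_mul_assoc, sub_mul, mul_assoc, mul_assoc, h5, h4, mul_zero,
            mul_zero, sub_zero, smul_zero, add_zero]
        rw [h7, h8, h5, map_zero, mul_zero, mul_zero, zero_smul, sub_zero]
  · rw [zero_mul, mul_zero, mul_zero, map_zero, mul_zero, mul_zero, zero_smul, sub_zero]
  · rw [add_mul, mul_add Z, mul_add (x a), map_add, mul_add, mul_add, add_smul, ← hX, ← hW]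
    abel
  · rw [smul_mul_assoc, mul_smul_comm, mul_smul_comm, map_smul, smul_eq_mul, ← smul_sub, hX,
      smul_smul]
    congr 1
    ring

/-- Since `x a` has no entry at (a, a) and none in the column `u`, the commutator term does not
change the entry of `Y` at (a, u). -/
theorem corner_ne_zero (hxa : x a a a = 0) (hYau : Y a u ≠ 0) (σ : ℝ) :
    Y + σ • (x a * Y - Y * x a) ≠ 0 := by
  intro h0
  have hua : u ≠ a := fun h1 => ha (h1 ▸ hu)
  have h1 := congrFun (congrFun h0 a) u
  have h2 : (x a * Y) a u = 0 := by
    rw [Matrix.mul_apply]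
    refine Finset.sum_eq_zero fun k _ => ?_
    by_cases hk : Y k u = 0
    · rw [hk, mul_zero]
    rcases hY k u hk with ⟨rfl, -⟩ | ⟨-, h3⟩
    · rw [hxa, zero_mul]
    · exact absurd h3 hua
  have h3 : (Y * x a) a u = 0 := by
    rw [Matrix.mul_apply]
    exact Finset.sum_eq_zero fun k _ => by rw [h.apply_fixed (h.mem a) hu, mul_zero]
  rw [Matrix.add_apply, Matrix.smul_apply, Matrix.sub_apply, h2, h3, sub_zero, smul_zero,
    add_zero] at h1
  exact hYau h1

end PairFrame

/-! ### Persistence of roots, and the equivalence for systems with frames -/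

namespace ClassicalSystem

variable {𝕂 : Type} [NormedRing 𝕂] [NormedAlgebra ℝ 𝕂] [StarRing 𝕂] [ClassicalScalar 𝕂]
  [FiniteDimensional ℝ 𝕂] [Nontrivial 𝕂] {S : ClassicalSystem 𝕂}

/-- A root whose root vectors meet an unpaired coordinate is `± 1` on one element of the frame and
vanishes on the others. -/
theorem exists_eq_coframe {n : ℕ} {p : Fin (S.D.size n) → Fin (S.D.size n)}
    {x : Fin (S.D.size n) → Matrix (Fin (S.D.size n)) (Fin (S.D.size n)) 𝕂}
    (hx : PairFrame (S.aMat n) p x) {γ : Module.Dual ℝ (S.tower.a n)} (hγ : γ ≠ 0)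
    {η : S.tower.L n} (hη : η ∈ jointEigenspace (S.tower.adA n) γ) {i j : Fin (S.D.size n)}
    (hij : (η : S.g n).1 i j ≠ 0) (hu : p i = i ∨ p j = j) :
    ∃ k, p k ≠ k ∧ ∃ s : ℝ, s * s = 1 ∧ γ = s • coframe x k := by
  have hroot := fun k => root_apply hη (hx.mem k)
  have hcol : ∀ (M : Matrix (Fin (S.D.size n)) (Fin (S.D.size n)) 𝕂) u, p u = u → ∀ k a,
      (M * x k) a u = 0 := by
    intro M u hu k a
    rw [Matrix.mul_apply]
    exact Finset.sum_eq_zero fun l _ => by rw [hx.apply_fixed (hx.mem k) hu, mul_zero]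
  have hrow : ∀ (M : Matrix (Fin (S.D.size n)) (Fin (S.D.size n)) 𝕂) u, p u = u → ∀ k a,
      (x k * M) u a = 0 := by
    intro M u hu k a
    rw [Matrix.mul_apply]
    exact Finset.sum_eq_zero fun l _ => by rw [hx.fixed_apply (hx.mem k) hu, zero_mul]
  have hfix : ∀ o, p o = o → γ (frame hx o) = 0 := by
    intro o ho
    have h0 : frame hx o = 0 := Subtype.ext (Subtype.ext (hx.fixed o ho))
    rw [h0, map_zero]
  have key : ∃ k, (∀ o, o ≠ k → o ≠ p k → γ (frame hx o) = 0) ∧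
      γ (frame hx k) * γ (frame hx k) * γ (frame hx k) = γ (frame hx k) := by
    rcases hu with hu | hu
    · refine ⟨j, fun o h1 h2 => ?_, ?_⟩
      · by_cases h3 : i = o
        · exact hfix o (h3 ▸ hu)
        · refine frame_eq_zero hx hη hij h3 (fun h4 => h3 ?_) (Ne.symm h1)
            fun h4 => h2 (by rw [h4, hx.invol])
          rw [← hu, h4, hx.invol]
      · set s := γ (frame hx j)
        -- As `i` is unpaired, `x j * η` has no row i. The row i of `η` is thus an eigenvector of
        -- right multiplication by `x j` with eigenvalue -s, and x³ = x gives s³ = s.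
        have h1 : ∀ a, ((η : S.g n).1 * x j) i a = (-s) • (η : S.g n).1 i a := by
          intro a
          have h2 := hroot j i a
          rw [hrow _ i hu, zero_sub] at h2
          rw [neg_smul, ← neg_eq_iff_eq_neg]
          exact h2
        have h2 : ∀ (M : Matrix (Fin (S.D.size n)) (Fin (S.D.size n)) 𝕂) (c : ℝ),
            (∀ a, M i a = c • (η : S.g n).1 i a) →
            ∀ a, (M * x j) i a = (-s * c) • (η : S.g n).1 i a := by
          intro M c hM a
          rw [mul_comm, mul_smul, ← h1 a, Matrix.mul_apply, Matrix.mul_apply, Finset.smul_sum]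
          exact Finset.sum_congr rfl fun l _ => by rw [hM, smul_mul_assoc]
        have h3 := h2 _ _ (h2 _ _ h1) j
        rw [mul_assoc, mul_assoc, ← mul_assoc (x j), hx.cube, h1] at h3
        have h4 := smul_left_injective ℝ hij h3
        simp only [neg_mul_neg] at h4
        linarith
    · refine ⟨i, fun o h1 h2 => ?_, ?_⟩
      · by_cases h3 : j = o
        · exact hfix o (h3 ▸ hu)
        · refine frame_eq_zero hx hη hij (Ne.symm h1) (fun h4 => h2 (by rw [h4, hx.invol])) h3
            fun h4 => h3 ?_
          rw [← hu, h4, hx.invol]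
      · set s := γ (frame hx i)
        have h1 : ∀ a, (x i * (η : S.g n).1) a j = s • (η : S.g n).1 a j := by
          intro a
          have h2 := hroot i a j
          rw [hcol _ j hu, sub_zero] at h2
          exact h2
        have h2 : ∀ (M : Matrix (Fin (S.D.size n)) (Fin (S.D.size n)) 𝕂) (c : ℝ),
            (∀ a, M a j = c • (η : S.g n).1 a j) →
            ∀ a, (x i * M) a j = (s * c) • (η : S.g n).1 a j := by
          intro M c hM a
          rw [mul_comm, mul_smul, ← h1 a, Matrix.mul_apply, Matrix.mul_apply, Finset.smul_sum]
          exact Finset.sum_congr rfl fun l _ => by rw [hM, mul_smul_comm]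
        have h3 := h2 _ _ (h2 _ _ h1) i
        rw [← mul_assoc, ← mul_assoc, hx.cube, h1] at h3
        have h4 := smul_left_injective ℝ hij h3
        linarith
  obtain ⟨k, hk, hs⟩ := key
  have h1 := eq_smul_coframe hx hk
  have h0 : γ (frame hx k) ≠ 0 := by
    intro h0
    rw [h0, zero_smul] at h1
    exact hγ h1
  refine ⟨k, fun h2 => h0 (hfix k h2), γ (frame hx k), mul_right_cancel₀ h0 (by rw [hs, one_mul]), h1⟩

/-- If every nonzero entry of the root vector joins paired coordinates, its image is the required
vector. Otherwise the unpaired coordinate may acquire a partner at level m, and the image may fail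
to be a joint eigenvector. The root is then ± one coframe element, and a new root vector is built
between the image of its pair and an unpaired coordinate `u` of level m; this is the only use of
`hfix`. -/
theorem persists_of_frame (hS : S.Standard) (hal : S.tower.Aligned)
    {p : ∀ n, Fin (S.D.size n) → Fin (S.D.size n)}
    {x : ∀ n, Fin (S.D.size n) → Matrix (Fin (S.D.size n)) (Fin (S.D.size n)) 𝕂}
    (hx : ∀ n, PairFrame (S.aMat n) (p n) (x n))
    (hcorner : ∀ n i u, p n i ≠ i → p n u = u → x n i i i = 0 ∧ ∃ Y ∈ S.g n, Y i u ≠ 0 ∧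
      ∀ k l, Y k l ≠ 0 → k = i ∧ l = u ∨ k = u ∧ l = i)
    {n₀ : ℕ} (hD : ∀ n, n₀ ≤ n → S.D.r n + S.D.s n = 1) (n m : ℕ) (hn : n₀ ≤ n) (hnm : n ≤ m)
    (hfix : (∃ u, p n u = u) → ∃ u, p m u = u) : S.tower.Persists n m hnm := by
  rintro γ ⟨hγ, η, hη0, hη⟩
  replace hη : η ∈ jointEigenspace (S.tower.adA n) γ := hη
  obtain ⟨F, c, hF, hFx⟩ := Standard.exists_place hD n m hn hnm
  obtain ⟨f, ε, hf, hFe⟩ := exists_of_transpose_mul_self_eq_one hF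
  have he := scalarTrace_one_pos (𝕂 := 𝕂)
  -- The image of a frame element belongs to the frame up to sign: its square is the projection to
  -- two coordinates, which an element of `a m` can have only at a pair.
  have himage : ∀ i, p n i ≠ i → p m (f i) = f (p n i) ∧ ∃ r : ℝ, r * r = 1 ∧
      place F (tflip c (x n i)) = r • x m (f i) := by
    intro i hi
    have h1 : place F (tflip c (x n i)) ∈ S.aMat m := by
      have h2 := mem_aMat_of_mem (hal.trans_mem n m hnm (frame (hx n) i).2)
      rwa [hFx] at h2
    have hsq := (hx n).sq i hi
    have h2 : place F (tflip c (x n i)) * place F (tflip c (x n i)) =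
        Matrix.diagonal fun k => if k = f i ∨ k = f (p n i) then 1 else 0 := by
      rw [place_mul hF, tflip_mul_self c (by rw [hsq, transp_pairProj]), hsq,
        place_pairProj hf hFe]
    refine (hx m).eq_smul_of_sq h1 h2 ?_
    rw [place_mul hF, place_mul hF, tflip_cube, (hx n).cube]
  have htrace : ∀ X Y : Matrix (Fin (S.D.size n)) (Fin (S.D.size n)) 𝕂,
      reTrace 𝕂 _ (place F (tflip c X) * place F (tflip c Y)) = reTrace 𝕂 _ (X * Y) := by
    intro X Y
    rw [place_mul hF, reTrace_apply, re_trace_cmat_place hF, re_trace_cmat_tflip, reTrace_apply]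
  -- Orthogonality to the image of `a n` is orthogonality to the frame elements of the image pairs.
  have horth : ∀ y ∈ S.tower.a m, (∀ z ∈ S.tower.a n,
      S.tower.form m (S.tower.trans n m hnm z) y = 0) → ∀ i, p n i ≠ i →
      reTrace 𝕂 _ (x m (f i) * (y : S.g m).1) = 0 := by
    intro y _ hyz i hi
    obtain ⟨h1, r, hr, h2⟩ := himage i hi
    have h3 := hyz _ (frame (hx n) i).2
    change reTrace 𝕂 _ ((S.tower.trans n m hnm (frame (hx n) i).1 : S.g m).1 * (y : S.g m).1) = 0
      at h3
    rw [hFx] at h3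
    change reTrace 𝕂 _ (place F (tflip c (x n i)) * _) = 0 at h3
    rw [h2, smul_mul_assoc, map_smul, smul_eq_mul] at h3
    exact (mul_eq_zero.1 h3).resolve_left fun h0 => by rw [h0, mul_zero] at hr; exact zero_ne_one hr
  by_cases hcase : ∃ i j, (η : S.g n).1 i j ≠ 0 ∧ (p n i = i ∨ p n j = j)
  · obtain ⟨i, j, hij, hu⟩ := hcase
    obtain ⟨k, hk, s, hs, hγs⟩ := exists_eq_coframe (hx n) hγ hη hij hu
    obtain ⟨u, hu'⟩ := hfix (hu.elim (fun h => ⟨i, h⟩) fun h => ⟨j, h⟩)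
    obtain ⟨h1, r, hr, h2⟩ := himage k hk
    have hfk : p m (f k) ≠ f k := by rw [h1]; exact hf.ne hk
    obtain ⟨hd, Y, hYg, hYu, hY⟩ := hcorner m (f k) u hfk hu'
    have hxg := (hx m).mem (f k)
    -- The sign combines `s`, the value of the root on `x n k`, with `r`, the sign by which `x n k`
    -- is mapped to the frame element at `f k`.
    have hZg : Y + (s * r) • (x m (f k) * Y - Y * x m (f k)) ∈ S.g m :=
      add_mem hYg ((S.g m).smul_mem _ ((S.g m).lie_mem hxg.1 hYg))
    have hσ : (s * r) * (s * r) = 1 := by rw [mul_mul_mul_comm, hs, hr, one_mul]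
    let Z : S.tower.L m := (⟨_, hZg⟩ : S.g m)
    have hlie : ∀ y ∈ S.tower.a m, ⁅y, Z⁆ =
        ((s * r) * ((2 * scalarTrace 𝕂 1)⁻¹ * reTrace 𝕂 _ (x m (f k) * (y : S.g m).1))) • Z := fun y hy =>
      Subtype.ext ((hx m).lie_corner hfk hu' hY hσ (mem_aMat_of_mem hy))
    refine ⟨Z, ?_, ?_, ?_⟩
    · intro h0
      exact (hx m).corner_ne_zero hfk hu' hY hd hYu _ (congrArg Subtype.val h0)
    · intro ξ
      refine (hlie _ (hal.trans_mem n m hnm ξ.2)).trans ?_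
      rw [hγs, LinearMap.smul_apply, coframe_apply, hFx, smul_eq_mul, mul_assoc]
      congr 2
      have h3 : x m (f k) = r • place F (tflip c (x n k)) := by
        rw [h2, smul_smul, hr, one_smul]
      rw [h3, smul_mul_assoc, map_smul, htrace, smul_eq_mul]
      rw [mul_left_comm, ← mul_assoc r r, hr, one_mul]
    · intro y hy hyz
      refine (hlie y hy).trans ?_
      rw [horth y hy hyz k hk, mul_zero, mul_zero, zero_smul]
  · push Not at hcase
    refine ⟨S.tower.trans n m hnm η, ?_, ?_, ?_⟩
    · intro h0
      exact hη0 ((hS.diagonalizable hal).trans_injective n m hnm (h0.trans (map_zero _).symm))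
    · intro ξ
      rw [← LieHom.map_lie]
      refine (congrArg _ (hη ξ)).trans ?_
      exact map_smul (S.tower.trans n m hnm : S.tower.L n →ₗ[ℝ] S.tower.L m) _ _
    · intro y hy hyz
      -- An element orthogonal to the image of `a n` has coefficient zero on every image pair, so
      -- its rows and columns there vanish. They contain the whole support of the image of `η`, and
      -- both products are zero.
      have hycol : ∀ i, p n i ≠ i → ∀ a, (y : S.g m).1 a (f i) = 0 := by
        intro i hi a
        obtain ⟨h1, -⟩ := himage i hi
        have hfi : p m (f i) ≠ f i := by rw [h1]; exact hf.ne hi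
        have h3 := congrFun (congrFun ((hx m).mul_proj_eq (mem_aMat_of_mem hy) hfi) a) (f i)
        rw [reTrace_apply, map_mul, Matrix.trace_mul_comm, ← map_mul, ← reTrace_apply,
          horth y hy hyz i hi, zero_div, zero_smul, pairProj, Matrix.mul_diagonal,
          if_pos (Or.inl rfl), mul_one] at h3
        exact h3
      have hyrow : ∀ i, p n i ≠ i → ∀ a, (y : S.g m).1 (f i) a = 0 := by
        intro i hi a
        have h3 := congrFun (congrFun (hS.herm m _ hy) (f i)) a
        refine h3.symm.trans ?_
        rw [Matrix.conjTranspose_apply]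
        exact (congrArg star (hycol i hi a)).trans (star_zero _)
      have hsupp : ∀ a b, place F (tflip c (η : S.g n).1) a b ≠ 0 →
          (∃ i, p n i ≠ i ∧ a = f i) ∧ ∃ j, p n j ≠ j ∧ b = f j := by
        intro a b hab
        obtain ⟨⟨i, rfl⟩, ⟨j, rfl⟩⟩ := place_support hFe _ hab
        rw [place_apply hf hFe] at hab
        rcases tflip_apply_ne_zero (right_ne_zero_of_mul (left_ne_zero_of_mul hab)) with h3 | h3
        · exact ⟨⟨i, (hcase i j h3).1, rfl⟩, ⟨j, (hcase i j h3).2, rfl⟩⟩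
        · exact ⟨⟨i, (hcase j i h3).2, rfl⟩, ⟨j, (hcase j i h3).1, rfl⟩⟩
      refine Subtype.ext ?_
      change (y : S.g m).1 * (S.tower.trans n m hnm η : S.g m).1 -
        (S.tower.trans n m hnm η : S.g m).1 * (y : S.g m).1 = 0
      rw [hFx]
      ext a b
      rw [Matrix.sub_apply, Matrix.mul_apply, Matrix.mul_apply,
        Finset.sum_eq_zero fun k _ => ?_, Finset.sum_eq_zero fun k _ => ?_, sub_zero]
      · rfl
      · by_cases hk : place F (tflip c (η : S.g n).1) a k = 0
        · rw [hk, zero_mul]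
        · obtain ⟨-, i, hi, rfl⟩ := hsupp a k hk
          rw [hyrow i hi, mul_zero]
      · by_cases hk : place F (tflip c (η : S.g n).1) k b = 0
        · rw [hk, mul_zero]
        · obtain ⟨⟨i, hi, rfl⟩, -⟩ := hsupp k b hk
          rw [hycol i hi, zero_mul]

/-- A sequence of levels has a subsequence along which a property always or never holds. -/
theorem exists_strictMono_forall_imp (Q : ℕ → Prop) :
    ∃ μ : ℕ → ℕ, StrictMono μ ∧ ∀ k l, Q (μ k) → Q (μ l) := by
  by_cases h : ∃ᶠ k in Filter.atTop, Q k
  · obtain ⟨μ, hμ, h1⟩ := Filter.extraction_of_frequently_atTop h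
    exact ⟨μ, hμ, fun _ l _ => h1 l⟩
  · obtain ⟨μ, hμ, h1⟩ := Filter.extraction_of_eventually_atTop (Filter.not_frequently.1 h)
    exact ⟨μ, hμ, fun k _ hk => absurd hk (h1 k)⟩

/-- `Q` is the property of a level that a root may need for its survival; along a suitable
subsequence it holds always or never, so the implication between any two levels is automatic. -/
theorem Standard.tfae (hS : S.Standard) (hal : S.tower.Aligned)
    (hnorms : S.tower.FinitelyManyNorms) (Q : ℕ → Prop)
    (hpers : ∀ n₀, (∀ n, n₀ ≤ n → S.D.r n + S.D.s n = 1) → ∀ n m (hnm : n ≤ m), n₀ ≤ n →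
      (Q n → Q m) → S.tower.Persists n m hnm)
    (hroots : ¬ S.D.IsClassical → ∃ n, ∃ ξ ∈ S.aMat n, ∃ Y ∈ S.g n, ξ * Y ≠ Y * ξ)
    (ν : ℕ → ℕ) (hν : StrictMono ν) :
    List.TFAE [
      S.D.IsClassical,
      (S.tower.limitRoots ν).Countable,
      ∃ μ : ℕ → ℕ, StrictMono μ ∧
        S.tower.limitRoots (ν ∘ μ) = ⋃ k, S.tower.extendedRoots (ν (μ k)),
      S.tower.RestrictedRootReductive ν] := by
  refine (hS.diagonalizable hal).tfae hS.positiveForm hS.maximalAbelian hnorms ?_ ?_ ν hν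
  · rintro ⟨n₀, hD⟩
    refine ⟨n₀, Standard.formInvariant hD, hS.boundedModules hD, fun ν hν hν₀ => ?_⟩
    obtain ⟨μ, hμ, h⟩ := exists_strictMono_forall_imp fun k => Q (ν k)
    exact ⟨μ, hμ, fun k l hkl => hpers n₀ hD _ _ _ (hν₀ _) (h k l)⟩
  · intro hD
    exact ⟨hS.spreads hD, hS.roots_nonempty hal (hroots hD)⟩

theorem Standard.tfae_of_frame (hS : S.Standard) (hal : S.tower.Aligned)
    {p : ∀ n, Fin (S.D.size n) → Fin (S.D.size n)}
    {x : ∀ n, Fin (S.D.size n) → Matrix (Fin (S.D.size n)) (Fin (S.D.size n)) 𝕂}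
    (hx : ∀ n, PairFrame (S.aMat n) (p n) (x n))
    (hcorner : ∀ n i u, p n i ≠ i → p n u = u → x n i i i = 0 ∧ ∃ Y ∈ S.g n, Y i u ≠ 0 ∧
      ∀ k l, Y k l ≠ 0 → k = i ∧ l = u ∨ k = u ∧ l = i)
    (hroots : ¬ S.D.IsClassical → ∃ n, ∃ ξ ∈ S.aMat n, ∃ Y ∈ S.g n, ξ * Y ≠ Y * ξ)
    (ν : ℕ → ℕ) (hν : StrictMono ν) :
    List.TFAE [
      S.D.IsClassical,
      (S.tower.limitRoots ν).Countable,
      ∃ μ : ℕ → ℕ, StrictMono μ ∧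
        S.tower.limitRoots (ν ∘ μ) = ⋃ k, S.tower.extendedRoots (ν (μ k)),
      S.tower.RestrictedRootReductive ν] :=
  hS.tfae hal (finitelyManyNorms_of_frame hx) (fun n => ∃ u, p n u = u)
    (fun _ hD n m hnm hn => persists_of_frame hS hal hx hcorner hD n m hn hnm) hroots ν hν

end ClassicalSystem

/-! ### Growth of the sizes -/

namespace BlockData

variable (D : BlockData)

theorem size_pos (n : ℕ) : 0 < D.size n := by
  induction n with
  | zero => exact D.N₀_pos
  | succ n ih =>
    have h := Nat.mul_pos ih (D.rs_pos n)
    change 0 < D.t' n + (D.size n * (D.r n + D.s n) + D.t'' n)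
    omega

theorem size_mono : Monotone D.size := by
  refine monotone_nat_of_le_succ fun n => ?_
  have h := Nat.le_mul_of_pos_right (D.size n) (D.rs_pos n)
  change D.size n ≤ D.t' n + (D.size n * (D.r n + D.s n) + D.t'' n)
  omega

/-- The sizes are unbounded if the system is not of classical type. -/
theorem exists_le_size {D : BlockData} (hD : ¬ D.IsClassical) (N : ℕ) :
    ∃ n, ∀ m, n ≤ m → N ≤ D.size m := by
  suffices h : ∃ n, N ≤ D.size n from h.imp fun n hn m hm => hn.trans (D.size_mono hm)
  induction N with
  | zero => exact ⟨0, Nat.zero_le _⟩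
  | succ N ih =>
    obtain ⟨n, hn⟩ := ih
    have hl : ∃ l, n ≤ l ∧ D.r l + D.s l ≠ 1 := by
      by_contra hno
      push Not at hno
      exact hD ⟨n, hno⟩
    obtain ⟨l, hl, hl1⟩ := hl
    refine ⟨l + 1, ?_⟩
    have h1 := D.rs_pos l
    have h2 := Nat.mul_le_mul_left (D.size l) (show 2 ≤ D.r l + D.s l by omega)
    have h3 := D.size_mono hl
    have h4 := D.size_pos l
    change N + 1 ≤ D.t' l + (D.size l * (D.r l + D.s l) + D.t'' l)
    omega

end BlockData

/-! ### Real diagonal matrices -/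

section RealDiagonal

variable {𝕂 : Type} [NormedRing 𝕂] [NormedAlgebra ℝ 𝕂] [StarRing 𝕂] [ClassicalScalar 𝕂]
  {ι κ : Type} [Fintype ι] [DecidableEq ι] [Fintype κ] [DecidableEq κ]

theorem star_real_smul (c : ℝ) (x : 𝕂) : star (c • x) = c • star x := by
  apply ClassicalScalar.toC_injective
  rw [ClassicalScalar.toC_star, map_smul, map_smul, ClassicalScalar.toC_star]
  ext i j
  simp

theorem eq_zero_of_eq_neg {x : 𝕂} (h : x = -x) : x = 0 := by
  have h1 : (2 : ℝ) • x = 0 := by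
    rw [two_smul]
    exact add_eq_zero_iff_eq_neg.2 h
  exact (smul_eq_zero.1 h1).resolve_left two_ne_zero

theorem star_algebraMap (c : ℝ) : star (algebraMap ℝ 𝕂 c) = algebraMap ℝ 𝕂 c := by
  rw [Algebra.algebraMap_eq_smul_one, star_real_smul, star_one]

theorem tr_algebraMap (c : ℝ) : ClassicalScalar.tr (algebraMap ℝ 𝕂 c) = algebraMap ℝ 𝕂 c := by
  apply ClassicalScalar.toC_injective
  rw [ClassicalScalar.toC_tr, AlgHom.commutes, Matrix.algebraMap_eq_diagonal,
    Matrix.diagonal_transpose]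

theorem trace_cmat (X : Matrix ι ι 𝕂) :
    (cmat ι X).trace = ∑ i, (ClassicalScalar.toC (X i i)).trace := by
  rw [Matrix.trace, Fintype.sum_prod_type]
  rfl

theorem trace_toC_algebraMap (c : ℝ) :
    (ClassicalScalar.toC (algebraMap ℝ 𝕂 c)).trace = ((c * scalarTrace 𝕂 1 : ℝ) : ℂ) := by
  rw [AlgHom.commutes, Matrix.algebraMap_eq_diagonal, Matrix.trace_diagonal]
  simp [scalarTrace, mul_comm]

variable (𝕂) in
/-- The diagonal matrix with given real entries. -/
noncomputable def realDiag (d : ι → ℝ) : Matrix ι ι 𝕂 := Matrix.diagonal fun i => algebraMap ℝ 𝕂 (d i)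

theorem realDiag_mul (d d' : ι → ℝ) :
    realDiag 𝕂 d * realDiag 𝕂 d' = realDiag 𝕂 fun i => d i * d' i := by
  simp [realDiag, Matrix.diagonal_mul_diagonal]

theorem realDiag_mul_apply (d : ι → ℝ) (X : Matrix ι ι 𝕂) (i j : ι) :
    (realDiag 𝕂 d * X) i j = d i • X i j := by
  rw [realDiag, Matrix.diagonal_mul, Algebra.smul_def]

theorem mul_realDiag_apply (d : ι → ℝ) (X : Matrix ι ι 𝕂) (i j : ι) :
    (X * realDiag 𝕂 d) i j = d j • X i j := by
  rw [realDiag, Matrix.mul_diagonal, Algebra.smul_def, Algebra.commutes]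

theorem realDiag_apply_ne (d : ι → ℝ) {i j : ι} (hij : i ≠ j) : realDiag 𝕂 d i j = 0 :=
  Matrix.diagonal_apply_ne _ hij

theorem realDiag_apply_self (d : ι → ℝ) (i : ι) : realDiag 𝕂 d i i = algebraMap ℝ 𝕂 (d i) :=
  Matrix.diagonal_apply_eq _ i

theorem realDiag_comm (d d' : ι → ℝ) :
    realDiag 𝕂 d * realDiag 𝕂 d' = realDiag 𝕂 d' * realDiag 𝕂 d := by
  simp only [realDiag_mul, mul_comm]

theorem realDiag_eq_sum (c : ι → ℝ) (e : ι → ι → ℝ) {d : ι → ℝ} (h : ∀ a, d a = ∑ i, c i * e i a) :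
    realDiag 𝕂 d = ∑ i, c i • realDiag 𝕂 (e i) := by
  ext a b
  rw [Matrix.sum_apply]
  by_cases hab : a = b
  · subst hab
    rw [realDiag_apply_self, h, map_sum]
    refine Finset.sum_congr rfl fun i _ => ?_
    rw [Matrix.smul_apply, realDiag_apply_self, map_mul, Algebra.smul_def]
  · rw [realDiag_apply_ne _ hab, Finset.sum_eq_zero]
    intro i _
    rw [Matrix.smul_apply, realDiag_apply_ne _ hab, smul_zero]

theorem conjTranspose_realDiag (d : ι → ℝ) : (realDiag 𝕂 d)ᴴ = realDiag 𝕂 d := by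
  rw [realDiag, Matrix.diagonal_conjTranspose]
  congr 1
  funext i
  exact star_algebraMap (d i)

theorem transp_realDiag (d : ι → ℝ) : transp (realDiag 𝕂 d) = realDiag 𝕂 d := by
  ext i j
  change ClassicalScalar.tr (realDiag 𝕂 d j i) = _
  by_cases hij : i = j
  · subst hij
    rw [realDiag_apply_self, tr_algebraMap]
  · rw [realDiag_apply_ne d hij, realDiag_apply_ne d (Ne.symm hij), BlockData.scalar_tr_zero]

theorem trace_cmat_realDiag (d : ι → ℝ) :
    (cmat ι (realDiag 𝕂 d)).trace = (((∑ i, d i) * scalarTrace 𝕂 1 : ℝ) : ℂ) := by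
  rw [trace_cmat, Finset.sum_mul, Complex.ofReal_sum]
  exact Finset.sum_congr rfl fun i _ => by rw [realDiag_apply_self, trace_toC_algebraMap]

theorem reTrace_realDiag_mul (d d' : ι → ℝ) :
    reTrace 𝕂 ι (realDiag 𝕂 d * realDiag 𝕂 d') = (∑ i, d i * d' i) * scalarTrace 𝕂 1 := by
  rw [realDiag_mul, reTrace_apply, trace_cmat_realDiag, Complex.ofReal_re]

theorem mem_realDiagonal {N : ℕ} {X : Matrix (Fin N) (Fin N) 𝕂} :
    X ∈ realDiagonal 𝕂 N ↔ ∃ d, X = realDiag 𝕂 d := by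
  constructor
  · intro hX
    refine Submodule.span_induction (p := fun X _ => ∃ d, X = realDiag 𝕂 d) ?_ ⟨0, ?_⟩ ?_ ?_ hX
    · rintro _ ⟨i, rfl⟩
      refine ⟨Pi.single i 1, ?_⟩
      ext a b
      by_cases hab : a = b
      · subst hab
        rw [realDiag_apply_self]
        by_cases ha : a = i
        · subst ha; simp
        · simp [ha, Ne.symm ha]
      · rw [realDiag_apply_ne _ hab]
        refine (Matrix.single_apply i i (1 : 𝕂) a b).trans (if_neg ?_)
        rintro ⟨rfl, rfl⟩
        exact hab rfl
    · ext a b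
      by_cases hab : a = b
      · subst hab; simp [realDiag_apply_self]
      · rw [realDiag_apply_ne _ hab]; rfl
    · rintro _ _ _ _ ⟨d, rfl⟩ ⟨d', rfl⟩
      refine ⟨d + d', ?_⟩
      simp [realDiag, Matrix.diagonal_add]
    · rintro c _ _ ⟨d, rfl⟩
      refine ⟨c • d, ?_⟩
      rw [realDiag, realDiag, ← Matrix.diagonal_smul]
      congr 1
      funext i
      simp [Algebra.smul_def]
  · rintro ⟨d, rfl⟩
    have h : realDiag 𝕂 d = ∑ i, d i • Matrix.single i i (1 : 𝕂) := by
      ext a b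
      rw [Matrix.sum_apply]
      by_cases hab : a = b
      · subst hab
        rw [Finset.sum_eq_single a]
        · rw [realDiag_apply_self, Matrix.smul_apply, Matrix.single_apply_same,
            Algebra.algebraMap_eq_smul_one]
        · intro i _ hi
          rw [Matrix.smul_apply, Matrix.single_apply, if_neg (fun h => hi h.1), smul_zero]
        · simp
      · rw [realDiag_apply_ne _ hab, Finset.sum_eq_zero]
        intro i _
        rw [Matrix.smul_apply, Matrix.single_apply, if_neg, smul_zero]
        rintro ⟨rfl, rfl⟩
        exact hab rfl
    rw [h]
    exact sum_mem fun i _ => Submodule.smul_mem _ _ (Submodule.subset_span ⟨i, rfl⟩)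

theorem sum_sub_single {N : ℕ} (i j : Fin N) (d : Fin N → ℝ) :
    ∑ k, (Pi.single i (1 : ℝ) - Pi.single j 1 : Fin N → ℝ) k * d k = d i - d j := by
  simp [sub_mul, Finset.sum_sub_distrib, Pi.single_apply]

theorem place_realDiag {F : Matrix ι κ ℤ} {f : κ → ι} {ε : κ → ℤˣ} (hf : Function.Injective f)
    (hF : ∀ a i, F a i = if a = f i then (ε i : ℤ) else 0) (d : κ → ℝ) :
    place F (realDiag 𝕂 d) = realDiag 𝕂 (Function.extend f d 0) := by
  ext a b
  by_cases ha : ∃ k, a = f k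
  · obtain ⟨k, rfl⟩ := ha
    by_cases hb : ∃ l, b = f l
    · obtain ⟨l, rfl⟩ := hb
      rw [place_apply hf hF]
      by_cases hkl : k = l
      · subst hkl
        rw [realDiag_apply_self, realDiag_apply_self, hf.extend_apply]
        rcases Int.units_eq_one_or (ε k) with h | h <;> simp [h]
      · rw [realDiag_apply_ne _ hkl, realDiag_apply_ne _ (hf.ne hkl), mul_zero, zero_mul]
    · have h0 : place F (realDiag 𝕂 d) (f k) b = 0 := by
        by_contra h
        exact hb (place_support hF _ h).2
      rw [h0, realDiag_apply_ne]
      rintro rfl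
      exact hb ⟨k, rfl⟩
  · have h0 : place F (realDiag 𝕂 d) a b = 0 := by
      by_contra h
      exact ha (place_support hF _ h).1
    rw [h0]
    by_cases hab : a = b
    · subst hab
      rw [realDiag_apply_self, Function.extend_apply']
      · simp
      · rintro ⟨k, rfl⟩
        exact ha ⟨k, rfl⟩
    · rw [realDiag_apply_ne _ hab]

end RealDiagonal

/-! ### The linear equations of the Lie algebras -/

namespace ClassicalSystem

variable {𝕂 : Type} [NormedRing 𝕂] [NormedAlgebra ℝ 𝕂] [StarRing 𝕂] [ClassicalScalar 𝕂]
  [FiniteDimensional ℝ 𝕂] {S : ClassicalSystem 𝕂}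

theorem mem_g {n : ℕ} {X : Matrix (Fin (S.D.size n)) (Fin (S.D.size n)) 𝕂} :
    X ∈ S.g n ↔ (cmat _ X).trace = 0 ∧ adj S.sesq X * S.B n + S.B n * X = 0 :=
  generates_classicalGroup_iff S.sesq (S.B n) X

end ClassicalSystem

/-! ### Special linear systems -/

namespace ClassicalSystem

variable {𝕂 : Type} [NormedRing 𝕂] [NormedAlgebra ℝ 𝕂] [StarRing 𝕂] [ClassicalScalar 𝕂]
  [FiniteDimensional ℝ 𝕂] {S : ClassicalSystem 𝕂}

variable (S) in
/-- The Lie algebras consist of all matrices of trace zero, the spaces `a n` of the real diagonal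
ones among them. -/
structure IsLinear : Prop where
  mem_g : ∀ n X, X ∈ S.g n ↔ (cmat (Fin (S.D.size n)) X).trace = 0
  T_eq : ∀ n, S.T n = realDiagonal 𝕂 (S.D.size n)

namespace IsLinear

variable (h : S.IsLinear)

variable [Nontrivial 𝕂]

include h

theorem mem_aMat {n : ℕ} {X : Matrix (Fin (S.D.size n)) (Fin (S.D.size n)) 𝕂} :
    X ∈ S.aMat n ↔ ∃ d, X = realDiag 𝕂 d ∧ ∑ i, d i = 0 := by
  have he := scalarTrace_one_pos (𝕂 := 𝕂)
  have htr : ∀ d : Fin (S.D.size n) → ℝ,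
      realDiag 𝕂 d ∈ S.g n ↔ ∑ i, d i = 0 := by
    intro d
    rw [h.mem_g, trace_cmat_realDiag, Complex.ofReal_eq_zero, mul_eq_zero, or_iff_left he.ne']
  constructor
  · rintro ⟨hX, hXT⟩
    obtain ⟨d, rfl⟩ := mem_realDiagonal.1 (h.T_eq n ▸ hXT)
    exact ⟨d, rfl, (htr d).1 hX⟩
  · rintro ⟨d, rfl, hd⟩
    exact ⟨(htr d).2 hd, h.T_eq n ▸ mem_realDiagonal.2 ⟨d, rfl⟩⟩

theorem diff_mem (n : ℕ) (i j : Fin (S.D.size n)) :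
    realDiag 𝕂 (Pi.single i 1 - Pi.single j 1) ∈ S.aMat n := by
  refine h.mem_aMat.2 ⟨_, rfl, ?_⟩
  simpa only [mul_one, sub_self] using sum_sub_single i j fun _ => 1

theorem standard (hreal : ∀ q : 𝕂, star q = q → ∃ r : ℝ, q = algebraMap ℝ 𝕂 r) :
    S.Standard where
  star_mem n X hX := by
    rw [h.mem_g] at hX ⊢
    rw [cmat_conjTranspose, Matrix.trace_conjTranspose, hX, star_zero]
  herm n X hX := by
    obtain ⟨d, rfl⟩ := mem_realDiagonal.1 (h.T_eq n ▸ hX)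
    exact conjTranspose_realDiag d
  comm n X hX Y hY := by
    obtain ⟨d, rfl⟩ := mem_realDiagonal.1 (h.T_eq n ▸ hX)
    obtain ⟨d', rfl⟩ := mem_realDiagonal.1 (h.T_eq n ▸ hY)
    exact realDiag_comm d d'
  shape n := by
    refine ⟨id, fun _ => rfl, fun X hX i j hij => ?_⟩
    obtain ⟨d, rfl⟩ := mem_realDiagonal.1 (h.T_eq n ▸ hX)
    by_contra hne
    exact hij (realDiag_apply_ne d (Ne.symm hne))
  span n := by
    intro X hX
    obtain ⟨d, rfl, hd⟩ := h.mem_aMat.1 hX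
    let o : Fin (S.D.size n) := ⟨0, S.D.size_pos n⟩
    -- The multiples of the unit at the base coordinate `o` add up to the trace, which is zero.
    have hsum : realDiag 𝕂 d = ∑ i, d i • realDiag 𝕂 (Pi.single i 1 - Pi.single o 1) := by
      refine realDiag_eq_sum d _ fun a => ?_
      simp only [Pi.sub_apply, mul_sub, Finset.sum_sub_distrib, ← Finset.sum_mul, hd, zero_mul,
        sub_zero]
      simp [Pi.single_apply]
    rw [hsum]
    refine sum_mem fun i _ => Submodule.smul_mem _ _ (Submodule.subset_span
      ⟨h.diff_mem n i o, ?_, {i, o}, Finset.card_le_two, fun a b hab => ?_⟩)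
    · rw [realDiag_mul, realDiag_mul]
      congr 1
      funext a
      simp only [Pi.sub_apply, Pi.single_apply]
      split_ifs <;> norm_num
    · by_cases hne : a = b
      · subst hne
        rw [realDiag_apply_self] at hab
        have : a = i ∨ a = o := by
          by_contra hno
          push Not at hno
          apply hab
          simp [hno.1, hno.2]
        simp only [Finset.mem_insert, Finset.mem_singleton]
        exact ⟨this, this⟩
      · exact absurd (realDiag_apply_ne _ hne) hab
  maximal n X hX hXs hcomm := by
    have hd : ∀ i, ∃ r : ℝ, X i i = algebraMap ℝ 𝕂 r := fun i =>
      hreal _ (congrFun (congrFun hXs i) i)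
    choose d hd using hd
    rw [h.T_eq]
    refine mem_realDiagonal.2 ⟨d, ?_⟩
    ext i j
    by_cases hij : i = j
    · subst hij
      rw [realDiag_apply_self, hd]
    · rw [realDiag_apply_ne _ hij]
      -- Commuting with the difference of the i-th and j-th diagonal units says that the entry at
      -- (i, j) equals its negative.
      have hij' := congrFun (congrFun (hcomm _ (h.diff_mem n i j)) i) j
      rw [realDiag_mul_apply, mul_realDiag_apply] at hij'
      simp only [Pi.sub_apply, Pi.single_eq_same, Pi.single_eq_of_ne hij,
        Pi.single_eq_of_ne (Ne.symm hij), sub_zero, zero_sub, one_smul, neg_smul] at hij'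
      exact eq_zero_of_eq_neg hij'

/-- The position of any nonzero entry of a root vector determines the root: a diagonal matrix
multiplies the entry at (i, j) by the difference of its i-th and j-th entries. -/
theorem root_eq {n : ℕ} {γ : Module.Dual ℝ (S.tower.a n)}
    {η : S.tower.L n}
    (hη : η ∈ jointEigenspace (S.tower.adA n) γ) {i j : Fin (S.D.size n)}
    (hij : (η : S.g n).1 i j ≠ 0) {d : Fin (S.D.size n) → ℝ}
    (hd : realDiag 𝕂 d ∈ S.aMat n) :
    γ ⟨(⟨realDiag 𝕂 d, hd.1⟩ : S.g n), hd.2⟩ = d i - d j := by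
  refine smul_left_injective ℝ hij ((root_apply hη hd i j).symm.trans ?_)
  refine (congrArg₂ (· - ·) (realDiag_mul_apply d _ i j) (mul_realDiag_apply d _ i j)).trans ?_
  exact (sub_smul _ _ _).symm

theorem finitelyManyNorms : S.tower.FinitelyManyNorms := by
  have he := scalarTrace_one_pos (𝕂 := 𝕂)
  refine ⟨{2 / scalarTrace 𝕂 1}, Set.finite_singleton _, ?_⟩
  rintro n γ ⟨hγ, η, hη0, hη⟩
  replace hη : η ∈ jointEigenspace (S.tower.adA n) γ := hη
  obtain ⟨i, j, hij⟩ := exists_apply_ne_zero hη0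
  -- The vector dual to the root. It is a difference of two diagonal units divided by `scalarTrace 𝕂
  -- 1`, so every root has the norm 2 / `scalarTrace 𝕂 1`.
  let ζ : S.tower.a n := (scalarTrace 𝕂 1)⁻¹ •
    ⟨(⟨_, (h.diff_mem n i j).1⟩ : S.g n), (h.diff_mem n i j).2⟩
  have hform : ∀ ξ : S.tower.a n, γ ξ = S.tower.form n ζ ξ := by
    rintro ⟨⟨X, hX⟩, hXa⟩
    have hX' : X ∈ S.aMat n := ⟨hX, hXa⟩
    obtain ⟨d, rfl, -⟩ := h.mem_aMat.1 hX'
    refine (h.root_eq hη hij hX').trans ?_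
    change _ = reTrace 𝕂 _ (((scalarTrace 𝕂 1)⁻¹ • realDiag 𝕂 (Pi.single i 1 - Pi.single j 1)) *
      realDiag 𝕂 d)
    rw [smul_mul_assoc, map_smul, reTrace_realDiag_mul, sum_sub_single, smul_eq_mul]
    field_simp
  have hne : i ≠ j := by
    rintro rfl
    apply hγ
    refine LinearMap.ext ?_
    rintro ⟨⟨X, hX⟩, hXa⟩
    have hX' : X ∈ S.aMat n := ⟨hX, hXa⟩
    obtain ⟨d, rfl, -⟩ := h.mem_aMat.1 hX'
    exact (h.root_eq hη hij hX').trans (sub_self _)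
  refine ⟨ζ, ζ.2, hform, ?_⟩
  rw [← hform ζ, Set.mem_singleton_iff, map_smul, h.root_eq hη hij (h.diff_mem n i j)]
  simp only [Pi.sub_apply, Pi.single_eq_same, Pi.single_eq_of_ne hne,
        Pi.single_eq_of_ne (Ne.symm hne), smul_eq_mul]
  field_simp
  norm_num

/-- The image of the root vector always works: a diagonal matrix orthogonal to the images of all
differences of units is constant on the coordinates in the image of the injection, so it commutes
with every matrix supported there. -/
theorem persists (hS : S.Standard) (hal : S.tower.Aligned) {n₀ : ℕ}
    (hD : ∀ n, n₀ ≤ n → S.D.r n + S.D.s n = 1) (n m : ℕ) (hn : n₀ ≤ n) (hnm : n ≤ m) :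
    S.tower.Persists n m hnm := by
  rintro γ ⟨hγ, η, hη0, hη⟩
  obtain ⟨F, c, hF, hFx⟩ := Standard.exists_place (S := S) hD n m hn hnm
  obtain ⟨f, ε, hf, hFe⟩ := exists_of_transpose_mul_self_eq_one hF
  have he := scalarTrace_one_pos (𝕂 := 𝕂)
  refine ⟨S.tower.trans n m hnm η, ?_, ?_, ?_⟩
  · intro h0
    exact hη0 ((hS.diagonalizable hal).trans_injective n m hnm (h0.trans (map_zero _).symm))
  · intro ξ
    rw [← LieHom.map_lie]
    refine (congrArg _ (hη ξ)).trans ?_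
    exact map_smul (S.tower.trans n m hnm :
      S.tower.L n →ₗ[ℝ] S.tower.L m) _ _
  · rintro ⟨y, hy⟩ hya hyz
    have hy' : y ∈ S.aMat m := ⟨hy, hya⟩
    obtain ⟨d, rfl, -⟩ := h.mem_aMat.1 hy'
    have hconst : ∀ i j, d (f i) = d (f j) := by
      intro i j
      let z : S.tower.L n := (⟨_, (h.diff_mem n i j).1⟩ : S.g n)
      have h1 : reTrace 𝕂 _ ((S.tower.trans n m hnm z : S.g m).1 * realDiag 𝕂 d) = 0 :=
        hyz z (h.diff_mem n i j).2
      rw [hFx] at h1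
      change reTrace 𝕂 _ (place F (tflip c (realDiag 𝕂 (Pi.single i 1 - Pi.single j 1))) *
        realDiag 𝕂 d) = 0 at h1
      have h2 : reTrace 𝕂 _ (place F (realDiag 𝕂 (Pi.single i 1 - Pi.single j 1)) *
          realDiag 𝕂 d) = 0 := by
        cases c
        · exact h1
        · change reTrace 𝕂 _ (place F (-transp (realDiag 𝕂 (Pi.single i 1 - Pi.single j 1))) *
            realDiag 𝕂 d) = 0 at h1
          rw [transp_realDiag, place, Matrix.mul_neg, Matrix.neg_mul, Matrix.neg_mul, map_neg, neg_eq_zero] at h1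
          exact h1
      rw [place_realDiag hf hFe, reTrace_realDiag_mul] at h2
      have h3 := (mul_eq_zero.1 h2).resolve_right he.ne'
      have h4 : ∑ k, Function.extend f (Pi.single i 1 - Pi.single j 1 : Fin (S.D.size n) → ℝ) 0 k *
          d k = ∑ k, (Pi.single i 1 - Pi.single j 1 : Fin (S.D.size n) → ℝ) k * d (f k) := by
        refine (Finset.sum_of_injOn f hf.injOn (fun _ _ => Finset.mem_univ _) ?_ ?_).symm
        · intro a _ ha
          rw [Function.extend_apply', Pi.zero_apply, zero_mul]
          rintro ⟨k, rfl⟩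
          exact ha ⟨k, Finset.mem_coe.2 (Finset.mem_univ k), rfl⟩
        · intro k _
          rw [hf.extend_apply]
      rw [h4, sum_sub_single i j fun k => d (f k)] at h3
      exact sub_eq_zero.1 h3
    refine Subtype.ext ?_
    change realDiag 𝕂 d * (S.tower.trans n m hnm η : S.g m).1 -
      (S.tower.trans n m hnm η : S.g m).1 * realDiag 𝕂 d = 0
    rw [hFx]
    ext a b
    rw [Matrix.sub_apply]
    refine (congrArg₂ (· - ·) (realDiag_mul_apply d _ a b) (mul_realDiag_apply d _ a b)).trans ?_
    change _ = (0 : 𝕂)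
    rw [← sub_smul]
    by_cases hab : place F (tflip c (η : S.g n).1) a b = 0
    · rw [hab, smul_zero]
    · obtain ⟨⟨i, rfl⟩, ⟨j, rfl⟩⟩ := place_support hFe _ hab
      rw [hconst i j, sub_self, zero_smul]

/-- The sizes are unbounded, so a level of size at least 2 exists, and there an off-diagonal matrix
unit is a root vector. -/
theorem exists_not_commute (hD : ¬ S.D.IsClassical) :
    ∃ n, ∃ ξ ∈ S.aMat n, ∃ Y ∈ S.g n, ξ * Y ≠ Y * ξ := by
  obtain ⟨n, hn⟩ := BlockData.exists_le_size hD 2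
  have hn := hn n le_rfl
  let i : Fin (S.D.size n) := ⟨0, by omega⟩
  let j : Fin (S.D.size n) := ⟨1, by omega⟩
  have hij : i ≠ j := fun hij => by simpa [i, j] using congrArg Fin.val hij
  refine ⟨n, _, h.diff_mem n i j, Matrix.single i j 1, ?_, fun hY => ?_⟩
  · rw [h.mem_g, trace_cmat]
    refine Finset.sum_eq_zero fun k _ => ?_
    rw [Matrix.single_apply, if_neg, map_zero, Matrix.trace_zero]
    rintro ⟨rfl, hj⟩
    exact hij hj.symm
  · have h1 := congrFun (congrFun hY i) j
    refine one_ne_zero (α := 𝕂) (eq_zero_of_eq_neg ?_)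
    have h2 := (realDiag_mul_apply (𝕂 := 𝕂) _ _ i j).symm.trans
      (h1.trans (mul_realDiag_apply _ _ i j))
    simpa [Pi.single_eq_of_ne hij, Pi.single_eq_of_ne (Ne.symm hij)] using h2

theorem tfae (hreal : ∀ q : 𝕂, star q = q → ∃ r : ℝ, q = algebraMap ℝ 𝕂 r)
    (hal : S.tower.Aligned) (ν : ℕ → ℕ) (hν : StrictMono ν) :
    List.TFAE [
      S.D.IsClassical,
      (S.tower.limitRoots ν).Countable,
      ∃ μ : ℕ → ℕ, StrictMono μ ∧
        S.tower.limitRoots (ν ∘ μ) = ⋃ k, S.tower.extendedRoots (ν (μ k)),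
      S.tower.RestrictedRootReductive ν] :=
  (h.standard hreal).tfae hal h.finitelyManyNorms (fun _ => True)
    (fun _ hD n m hnm hn _ => h.persists (h.standard hreal) hal hD n m hn hnm) h.exists_not_commute ν hν

end IsLinear

end ClassicalSystem

/-! ### Stability of the Lie algebras under conjugate transposition -/

section Adjoint

variable {𝕂 : Type} [NormedRing 𝕂] [NormedAlgebra ℝ 𝕂] [StarRing 𝕂] [ClassicalScalar 𝕂]
  {ι : Type} [Fintype ι] [DecidableEq ι]

theorem transp_conjTranspose (X : Matrix ι ι 𝕂) : transp Xᴴ = (transp X)ᴴ := by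
  apply cmat_injective
  rw [cmat_transp, cmat_conjTranspose, cmat_conjTranspose, cmat_transp]
  rfl

/-- The equations for the Lie algebra of a unitary group are preserved by the conjugate transpose. -/
theorem conjTranspose_mul_add_mul {B X : Matrix ι ι 𝕂} (hB : B * B = 1 ∨ B * B = -1)
    (h : Xᴴ * B + B * X = 0) : Xᴴᴴ * B + B * Xᴴ = 0 := by
  -- Multiplying the equation by B on both sides moves B past X; as B² = ±1, this is the equation
  -- for the conjugate transpose up to sign.
  have h1 : B * (Xᴴ * B + B * X) * B = B * Xᴴ * (B * B) + B * B * X * B := by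
    simp only [mul_add, add_mul, mul_assoc]
  rw [h, mul_zero, zero_mul] at h1
  rw [Matrix.conjTranspose_conjTranspose]
  rcases hB with hB | hB
  · rw [hB, mul_one, one_mul, add_comm] at h1
    exact h1.symm
  · rw [hB, mul_neg, mul_one, neg_mul, one_mul, neg_mul, ← neg_add, eq_comm, neg_eq_zero,
      add_comm] at h1
    exact h1

/-- The equations for the Lie algebra of an orthogonal or symplectic group are preserved by the
conjugate transpose. -/
theorem transp_conjTranspose_mul_add_mul {B X : Matrix ι ι 𝕂} (hB : B * B = 1 ∨ B * B = -1)
    (hBs : Bᴴ = B ∨ Bᴴ = -B) (h : transp X * B + B * X = 0) :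
    transp Xᴴ * B + B * Xᴴ = 0 := by
  have h2 := congrArg Matrix.conjTranspose h
  rw [Matrix.conjTranspose_add, Matrix.conjTranspose_mul, Matrix.conjTranspose_mul,
    ← transp_conjTranspose, Matrix.conjTranspose_zero] at h2
  have h3 : B * transp Xᴴ + Xᴴ * B = 0 := by
    rcases hBs with hBs | hBs
    · rwa [hBs] at h2
    · rwa [hBs, neg_mul, mul_neg, ← neg_add, neg_eq_zero] at h2
  have h1 : B * (B * transp Xᴴ + Xᴴ * B) * B = B * B * transp Xᴴ * B + B * Xᴴ * (B * B) := by
    simp only [mul_add, add_mul, mul_assoc]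
  rw [h3, mul_zero, zero_mul] at h1
  rcases hB with hB | hB
  · rw [hB, mul_one, one_mul] at h1
    exact h1.symm
  · rw [hB, mul_neg, mul_one, neg_mul, one_mul, neg_mul, ← neg_add, eq_comm, neg_eq_zero] at h1
    exact h1

end Adjoint

/-! ### Matrices that exchange two coordinates -/

section PairMatrix

variable {𝕂 : Type} [NormedRing 𝕂] [NormedAlgebra ℝ 𝕂] [StarRing 𝕂] [ClassicalScalar 𝕂]
  {ι : Type} [Fintype ι] [DecidableEq ι]

/-- The matrix with entries `c` at `(i, p i)` and `c*` at `(p i, i)`, or zero if `p i = i`. -/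
def pairMatrix (c : 𝕂) (p : ι → ι) (i : ι) : Matrix ι ι 𝕂 := Matrix.of fun a b =>
  if p i = i then 0 else if a = i ∧ b = p i then c else if a = p i ∧ b = i then star c else 0

theorem pairMatrix_eq (c : 𝕂) {p : ι → ι} {i : ι} (hi : p i ≠ i) :
    pairMatrix c p i = Matrix.single i (p i) c + Matrix.single (p i) i (star c) := by
  ext a b
  simp only [pairMatrix, Matrix.of_apply, Matrix.add_apply, Matrix.single_apply, if_neg hi]
  by_cases h1 : a = i ∧ b = p i
  · obtain ⟨rfl, rfl⟩ := h1
    simp [hi]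
  · by_cases h2 : a = p i ∧ b = i
    · obtain ⟨rfl, rfl⟩ := h2
      simp [hi]
    · rw [if_neg h1, if_neg h2, if_neg (by tauto), if_neg (by tauto), add_zero]

theorem pairMatrix_apply_ne_zero {c : 𝕂} {p : ι → ι} {i a b : ι} (h : pairMatrix c p i a b ≠ 0) :
    p i ≠ i ∧ (a = i ∧ b = p i ∨ a = p i ∧ b = i) := by
  simp only [pairMatrix, Matrix.of_apply] at h
  split_ifs at h with h1 h2 h3
  · exact absurd rfl h
  · exact ⟨h1, Or.inl h2⟩
  · exact ⟨h1, Or.inr h3⟩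
  · exact absurd rfl h

theorem pairMatrix_apply_right {c : 𝕂} {p : ι → ι} {i : ι} (hi : p i ≠ i) :
    pairMatrix c p i i (p i) = c := by
  simp [pairMatrix, hi]

theorem pairMatrix_apply_left {c : 𝕂} {p : ι → ι} {i : ι} (hi : p i ≠ i) :
    pairMatrix c p i (p i) i = star c := by
  simp [pairMatrix, hi]

theorem conjTranspose_pairMatrix (c : 𝕂) (p : ι → ι) (i : ι) :
    (pairMatrix c p i)ᴴ = pairMatrix c p i := by
  by_cases hi : p i = i
  · ext a b
    simp [pairMatrix, hi]
  · rw [pairMatrix_eq c hi, Matrix.conjTranspose_add, Matrix.conjTranspose_single,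
      Matrix.conjTranspose_single, star_star, add_comm]

theorem pairMatrix_mul_self {c : 𝕂} (h1 : c * star c = 1) (h2 : star c * c = 1) {p : ι → ι} {i : ι}
    (hi : p i ≠ i) : pairMatrix c p i * pairMatrix c p i = pairProj 𝕂 p i := by
  rw [pairMatrix_eq c hi, add_mul, mul_add, mul_add,
    Matrix.single_mul_single_of_ne _ _ _ _ hi, Matrix.single_mul_single_same,
    Matrix.single_mul_single_same, Matrix.single_mul_single_of_ne _ _ _ _ (Ne.symm hi), h1, h2,
    zero_add, add_zero]
  ext a b
  rw [pairProj, Matrix.add_apply, Matrix.single_apply, Matrix.single_apply]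
  by_cases hab : a = b
  · subst hab
    rw [Matrix.diagonal_apply_eq]
    by_cases ha : a = i
    · subst ha
      simp [hi]
    · by_cases hb : a = p i
      · subst hb
        simpa [hi] using fun h3 => absurd h3.symm hi
      · simp [ha, hb, Ne.symm ha, Ne.symm hb]
  · rw [Matrix.diagonal_apply_ne _ hab, if_neg, if_neg, add_zero]
    · rintro ⟨rfl, h⟩; exact hab h
    · rintro ⟨rfl, h⟩; exact hab h

theorem pairMatrix_partner {c : 𝕂} (hc : star c = c ∨ star c = -c) {p : ι → ι}
    (hp : Function.Involutive p) (i : ι) :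
    pairMatrix c p (p i) = pairMatrix c p i ∨ pairMatrix c p (p i) = -pairMatrix c p i := by
  by_cases hi : p i = i
  · rw [hi]; exact Or.inl rfl
  · rw [pairMatrix_eq c hi, pairMatrix_eq c (fun h => hi (hp.injective h)), hp]
    rcases hc with hc | hc
    · rw [hc, add_comm]; exact Or.inl rfl
    · refine Or.inr ?_
      have hneg : ∀ (a b : ι) (q : 𝕂), Matrix.single a b (-q) = -Matrix.single a b q := fun a b q =>
        (Matrix.singleAddMonoidHom a b).map_neg q
      rw [hc, hneg, hneg, neg_add, neg_neg, add_comm]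

theorem pairSpan_eq (c : 𝕂) {N : ℕ} (p : Fin N → Fin N) :
    pairSpan c p = Submodule.span ℝ (Set.range (pairMatrix c p)) := by
  refine le_antisymm (Submodule.span_le.2 ?_) (Submodule.span_le.2 ?_)
  · rintro _ ⟨i, hi, rfl⟩
    exact Submodule.subset_span ⟨i, pairMatrix_eq c hi⟩
  · rintro _ ⟨i, rfl⟩
    by_cases hi : p i = i
    · have h0 : pairMatrix c p i = 0 := by
        ext a b
        simp [pairMatrix, hi]
      rw [h0]
      exact Submodule.zero_mem _
    · exact Submodule.subset_span ⟨i, hi, pairMatrix_eq c hi⟩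

variable {c : 𝕂} {p : ι → ι} (hp : Function.Involutive p) (h1 : c * star c = 1)
  (h2 : star c * c = 1) {X : Matrix ι ι 𝕂} (hXs : Xᴴ = X)
  (hcomm : ∀ o, pairMatrix c p o * X = X * pairMatrix c p o)

include h1 h2 hcomm

/-- A matrix that commutes with all `pairMatrix c p o` preserves the pairs. -/
theorem apply_eq_zero_of_commute {k l : ι} (hkl : l ≠ k) (hkp : l ≠ p k) (hk : p k ≠ k) :
    X k l = 0 ∧ X l k = 0 := by
  -- Commuting with a pair matrix implies commuting with its square, the projection to the pair, and
  -- this excludes entries leading out of the pair.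
  have h3 : pairProj 𝕂 p k * X = X * pairProj 𝕂 p k := by
    rw [← pairMatrix_mul_self h1 h2 hk, mul_assoc, hcomm, ← mul_assoc, hcomm, mul_assoc]
  constructor
  · have h4 := congrFun (congrFun h3 k) l
    rw [pairProj, Matrix.diagonal_mul, Matrix.mul_diagonal, if_pos (Or.inl rfl),
      if_neg (by tauto), one_mul, mul_zero] at h4
    exact h4
  · have h4 := congrFun (congrFun h3 l) k
    rw [pairProj, Matrix.diagonal_mul, Matrix.mul_diagonal, if_pos (Or.inl rfl),
      if_neg (by tauto), zero_mul, mul_one] at h4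
    exact h4.symm

include hXs

/-- The entry at (k, k) of the commutation relation says that X k (p k) times c* equals its own
conjugate, so it is real; multiplying back by c gives the claim. -/
theorem exists_apply_eq_smul_of_commute (hreal : ∀ q : 𝕂, star q = q → ∃ r : ℝ, q = algebraMap ℝ 𝕂 r)
    {k : ι} (hk : p k ≠ k) : ∃ r : ℝ, X k (p k) = r • c := by
  have h3 := congrFun (congrFun (hcomm k) k) k
  rw [Matrix.mul_apply, Matrix.mul_apply, Finset.sum_eq_single (p k), Finset.sum_eq_single (p k),
    pairMatrix_apply_right hk, pairMatrix_apply_left hk] at h3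
  · have h4 : X (p k) k = star (X k (p k)) := (congrFun (congrFun hXs (p k)) k).symm
    obtain ⟨r, hr⟩ := hreal (X k (p k) * star c) (by rw [star_mul, star_star, ← h4, h3])
    refine ⟨r, ?_⟩
    rw [← mul_one (X k (p k)), ← h2, ← mul_assoc, hr, Algebra.smul_def]
  · intro a _ ha
    by_cases h0 : pairMatrix c p k a k = 0
    · rw [h0, mul_zero]
    · rcases (pairMatrix_apply_ne_zero h0).2 with ⟨-, h⟩ | ⟨h, -⟩
      · exact absurd h.symm hk
      · exact absurd h ha
  · simp
  · intro a _ ha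
    by_cases h0 : pairMatrix c p k k a = 0
    · rw [h0, zero_mul]
    · rcases (pairMatrix_apply_ne_zero h0).2 with ⟨-, h⟩ | ⟨h, -⟩
      · exact absurd h ha
      · exact absurd h.symm hk
  · simp

include hp

/-- A hermitian matrix that commutes with all `pairMatrix c p o` is a combination of them, if its
entries on the diagonal and between fixed points vanish. -/
theorem mem_span_pairMatrix_of_commute
    (hreal : ∀ q : 𝕂, star q = q → ∃ r : ℝ, q = algebraMap ℝ 𝕂 r)
    (hdiag : ∀ k, X k k = 0) (hfix : ∀ k l, p k = k → p l = l → X k l = 0) :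
    X ∈ Submodule.span ℝ (Set.range (pairMatrix c p)) := by
  have hex : ∀ k, ∃ r : ℝ, p k ≠ k → X k (p k) = r • c := by
    intro k
    by_cases hk : p k = k
    · exact ⟨0, fun h => absurd hk h⟩
    · obtain ⟨r, hr⟩ := exists_apply_eq_smul_of_commute h1 h2 hXs hcomm hreal hk
      exact ⟨r, fun _ => hr⟩
  choose t ht using hex
  -- The factor 1/2 occurs because each pair is counted from both of its coordinates. Hermitian
  -- symmetry of X matches the two coefficients, so the two terms agree.
  have hX : X = ∑ o, (t o / 2) • pairMatrix c p o := by
    ext k l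
    rw [Matrix.sum_apply]
    by_cases hl : l = p k
    · subst hl
      by_cases hk : p k = k
      · rw [hk, hdiag, Finset.sum_eq_zero]
        intro o _
        by_cases h0 : pairMatrix c p o k k = 0
        · rw [Matrix.smul_apply, h0, smul_zero]
        · obtain ⟨h3, ⟨h4, h5⟩ | ⟨h4, h5⟩⟩ := pairMatrix_apply_ne_zero h0
          · exact absurd (h5.symm.trans h4) h3
          · exact absurd (h4.symm.trans h5) h3
      · have hk' : p (p k) ≠ p k := fun h => hk (hp.injective h)
        rw [← Finset.sum_subset (Finset.subset_univ {k, p k}), Finset.sum_pair (Ne.symm hk)]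
        · rw [Matrix.smul_apply, Matrix.smul_apply, pairMatrix_apply_right hk]
          have h3 : pairMatrix c p (p k) k (p k) = star c := by
            have := pairMatrix_apply_left (c := c) hk'
            rwa [hp] at this
          have h4 : t (p k) • star c = t k • c := by
            have h5 := ht (p k) hk'
            rw [hp] at h5
            have h6 := congrFun (congrFun hXs k) (p k)
            rw [Matrix.conjTranspose_apply, h5, star_real_smul, ht k hk] at h6
            exact h6
          rw [h3, ht k hk, div_eq_inv_mul, div_eq_inv_mul, mul_smul, mul_smul, h4, ← add_smul]
          rw [← two_mul, mul_inv_cancel₀ two_ne_zero, one_smul]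
        · intro o _ ho
          by_cases h0 : pairMatrix c p o k (p k) = 0
          · rw [Matrix.smul_apply, h0, smul_zero]
          · refine absurd ?_ ho
            obtain ⟨h3, ⟨h4, h5⟩ | ⟨h4, h5⟩⟩ := pairMatrix_apply_ne_zero h0
            · simp [h4]
            · simp [h5]
    · have h0 : X k l = 0 := by
        by_cases hkl : l = k
        · rw [hkl, hdiag]
        by_cases hk : p k = k
        · by_cases hl' : p l = l
          · exact hfix k l hk hl'
          · refine (apply_eq_zero_of_commute h1 h2 hcomm (Ne.symm hkl) (fun h => hl ?_) hl').2
            rw [h, hp]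
        · exact (apply_eq_zero_of_commute h1 h2 hcomm hkl hl hk).1
      rw [h0, Finset.sum_eq_zero]
      intro o _
      by_cases h0 : pairMatrix c p o k l = 0
      · rw [Matrix.smul_apply, h0, smul_zero]
      · obtain ⟨h3, ⟨h4, h5⟩ | ⟨h4, h5⟩⟩ := pairMatrix_apply_ne_zero h0
        · exact absurd (h5.trans (h4 ▸ rfl)) hl
        · exact absurd (by rw [h4, h5, hp]) hl
  rw [hX]
  exact sum_mem fun o _ => Submodule.smul_mem _ _ (Submodule.subset_span ⟨o, rfl⟩)

end PairMatrix

/-! ### Systems whose subspaces are spanned by pair matrices -/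

namespace ClassicalSystem

variable {𝕂 : Type} [NormedRing 𝕂] [NormedAlgebra ℝ 𝕂] [StarRing 𝕂] [ClassicalScalar 𝕂]
  [FiniteDimensional ℝ 𝕂]

/-- The spaces `a n` are spanned by matrices of pairs of coordinates. -/
structure IsPaired (S : ClassicalSystem 𝕂) (c : 𝕂)
    (p : ∀ n, Fin (S.D.size n) → Fin (S.D.size n)) : Prop where
  T_eq : ∀ n, S.T n = pairSpan c (p n)
  invol : ∀ n, Function.Involutive (p n)
  mul_star : c * star c = 1
  star_eq : star c = c ∨ star c = -c
  pair_mem : ∀ n i, pairMatrix c (p n) i ∈ S.g n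
  star_mem : ∀ n, ∀ X ∈ S.g n, Xᴴ ∈ S.g n
  diag : ∀ n, ∀ X ∈ S.g n, Xᴴ = X → ∀ k, X k k = 0
  fixed : ∀ n, ∀ X ∈ S.g n, Xᴴ = X → ∀ k l, p n k = k → p n l = l → X k l = 0
  corner : ∀ n i u, i ≠ u → ∃ Y ∈ S.g n, Y i u ≠ 0 ∧
    ∀ k l, Y k l ≠ 0 → k = i ∧ l = u ∨ k = u ∧ l = i
  exists_pair : ¬ S.D.IsClassical → ∃ n, ∀ m, n ≤ m → ∃ i, p m i ≠ i

namespace IsPaired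

variable {S : ClassicalSystem 𝕂} {c : 𝕂} {p : ∀ n, Fin (S.D.size n) → Fin (S.D.size n)}
  (h : S.IsPaired c p)

include h

theorem star_mul : star c * c = 1 := by
  rcases h.star_eq with hc | hc
  · have := h.mul_star
    rwa [hc] at this ⊢
  · have := h.mul_star
    rw [hc, mul_neg] at this
    rwa [hc, neg_mul]

theorem pair_mem_aMat (n : ℕ) (i : Fin (S.D.size n)) : pairMatrix c (p n) i ∈ S.aMat n := by
  refine ⟨h.pair_mem n i, ?_⟩
  rw [h.T_eq, pairSpan_eq]
  exact Submodule.subset_span ⟨i, rfl⟩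

theorem pairFrame (n : ℕ) : PairFrame (S.aMat n) (p n) (pairMatrix c (p n)) where
  invol := h.invol n
  mem := h.pair_mem_aMat n
  fixed i hi := by
    ext a b
    simp [pairMatrix, hi]
  sq i hi := pairMatrix_mul_self h.mul_star h.star_mul hi
  partner := pairMatrix_partner h.star_eq (h.invol n)
  supp i a b hab := by
    rcases (pairMatrix_apply_ne_zero hab).2 with ⟨h1, h2⟩ | ⟨h1, h2⟩
    · exact ⟨Or.inl h1, Or.inr h2⟩
    · exact ⟨Or.inr h1, Or.inl h2⟩
  le_span := by
    rw [← pairSpan_eq, ← h.T_eq]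
    exact inf_le_right

theorem le_aMat (n : ℕ) : S.T n ≤ S.aMat n := by
  rw [h.T_eq, pairSpan_eq]
  refine Submodule.span_le.2 ?_
  rintro _ ⟨i, rfl⟩
  exact h.pair_mem_aMat n i

theorem standard (hreal : ∀ q : 𝕂, star q = q → ∃ r : ℝ, q = algebraMap ℝ 𝕂 r) : S.Standard where
  star_mem := h.star_mem
  herm n X hX := by
    refine (h.pairFrame n).induction (P := fun X => Xᴴ = X)
      (fun i => conjTranspose_pairMatrix c (p n) i) Matrix.conjTranspose_zero ?_ ?_ (h.le_aMat n hX)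
    · intro X Y hX hY
      rw [Matrix.conjTranspose_add, hX, hY]
    · intro r X hX
      have h1 : (r • X)ᴴ = r • Xᴴ := adj_smul true r X
      rw [h1, hX]
  comm n X hX Y hY := by
    refine (h.pairFrame n).induction (P := fun X => X * Y = Y * X) (fun i => ?_) ?_ ?_ ?_
      (h.le_aMat n hX)
    · refine (h.pairFrame n).induction (P := fun Y => pairMatrix c (p n) i * Y =
        Y * pairMatrix c (p n) i) (fun j => ?_) ?_ ?_ ?_ (h.le_aMat n hY)
      · by_cases h1 : j = i
        · rw [h1]
        by_cases h2 : j = p n i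
        · rcases (h.pairFrame n).partner i with h3 | h3
          · rw [h2, h3]
          · rw [h2, h3, mul_neg, neg_mul]
        · rw [(h.pairFrame n).mul_of_ne h1 h2, (h.pairFrame n).mul_of_ne (Ne.symm h1)]
          intro h3
          exact h2 (by rw [h3, h.invol])
      · rw [mul_zero, zero_mul]
      · intro X Y hX hY
        rw [mul_add, add_mul, hX, hY]
      · intro r X hX
        rw [mul_smul_comm, smul_mul_assoc, hX]
    · rw [mul_zero, zero_mul]
    · intro X Y hX hY
      rw [mul_add, add_mul, hX, hY]
    · intro r X hX
      rw [mul_smul_comm, smul_mul_assoc, hX]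
  shape n := by
    refine ⟨p n, h.invol n, fun X hX i j => ?_⟩
    refine (h.pairFrame n).induction (P := fun X => X i j ≠ 0 → j = p n i) (fun o ho => ?_) ?_ ?_ ?_
      (h.le_aMat n hX)
    · rcases (pairMatrix_apply_ne_zero ho).2 with ⟨h1, h2⟩ | ⟨h1, h2⟩
      · rw [h1, h2]
      · rw [h1, h2, h.invol]
    · exact fun h0 => absurd rfl h0
    · intro X Y hX hY hXY
      by_cases h0 : X i j = 0
      · refine hY fun h1 => hXY ?_
        rw [Matrix.add_apply, h0, h1, add_zero]
      · exact hX h0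
    · intro r X hX hrX
      refine hX fun h0 => hrX ?_
      rw [Matrix.smul_apply, h0, smul_zero]
  span n := by
    refine inf_le_right.trans ?_
    rw [h.T_eq, pairSpan_eq]
    refine Submodule.span_mono ?_
    rintro _ ⟨i, rfl⟩
    refine ⟨h.pair_mem_aMat n i, (h.pairFrame n).cube i, {i, p n i}, Finset.card_le_two,
      fun a b hab => ?_⟩
    have h1 := (h.pairFrame n).supp i a b hab
    simpa only [Finset.mem_insert, Finset.mem_singleton] using h1
  maximal n X hX hXs hcomm := by
    rw [h.T_eq, pairSpan_eq]
    exact mem_span_pairMatrix_of_commute (h.invol n) h.mul_star h.star_mul hXs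
      (fun o => hcomm _ (h.pair_mem_aMat n o)) hreal (h.diag n X hX hXs) (h.fixed n X hX hXs)

/-- At a level with a pair and at least three coordinates, take a corner matrix from the pair to a
coordinate outside. If it commuted with the pair matrix, it would commute with the projection to the
pair and have no entry there. -/
theorem exists_not_commute (hD : ¬ S.D.IsClassical) :
    ∃ n, ∃ ξ ∈ S.aMat n, ∃ Y ∈ S.g n, ξ * Y ≠ Y * ξ := by
  obtain ⟨n₁, h₁⟩ := h.exists_pair hD
  obtain ⟨n₂, h₂⟩ := BlockData.exists_le_size hD 3
  obtain ⟨n, hn₁, hn₂⟩ : ∃ n, n₁ ≤ n ∧ n₂ ≤ n := ⟨_, le_max_left _ _, le_max_right _ _⟩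
  obtain ⟨i, hi⟩ := h₁ n hn₁
  have hsize := h₂ n hn₂
  have hj : ∃ j, j ∉ ({i, p n i} : Finset (Fin (S.D.size n))) := by
    by_contra! hno
    have h3 : (Finset.univ : Finset (Fin (S.D.size n))) ⊆ {i, p n i} := fun j _ => hno j
    have h4 := (Finset.card_le_card h3).trans Finset.card_le_two
    rw [Finset.card_univ, Fintype.card_fin] at h4
    omega
  obtain ⟨j, hj⟩ := hj
  rw [Finset.mem_insert, Finset.mem_singleton, not_or] at hj
  obtain ⟨Y, hY, hij, -⟩ := h.corner n i j (Ne.symm hj.1)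
  refine ⟨n, _, h.pair_mem_aMat n i, Y, hY, fun hcomm => hij ?_⟩
  have h1 : pairProj 𝕂 (p n) i * Y = Y * pairProj 𝕂 (p n) i := by
    rw [← (h.pairFrame n).sq i hi, mul_assoc, hcomm, ← mul_assoc, hcomm, mul_assoc]
  have h2 := congrFun (congrFun h1 i) j
  rw [pairProj, Matrix.diagonal_mul, Matrix.mul_diagonal, if_pos (Or.inl rfl), if_neg (by tauto),
    one_mul, mul_zero] at h2
  exact h2

theorem tfae [Nontrivial 𝕂] (hreal : ∀ q : 𝕂, star q = q → ∃ r : ℝ, q = algebraMap ℝ 𝕂 r)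
    (hal : S.tower.Aligned) (ν : ℕ → ℕ) (hν : StrictMono ν) :
    List.TFAE [
      S.D.IsClassical,
      (S.tower.limitRoots ν).Countable,
      ∃ μ : ℕ → ℕ, StrictMono μ ∧
        S.tower.limitRoots (ν ∘ μ) = ⋃ k, S.tower.extendedRoots (ν (μ k)),
      S.tower.RestrictedRootReductive ν] := by
  refine (h.standard hreal).tfae_of_frame hal h.pairFrame (fun n i u hi hu => ⟨?_, ?_⟩)
    h.exists_not_commute ν hν
  · by_contra h0
    obtain ⟨h3, ⟨-, h4⟩ | ⟨h4, -⟩⟩ := pairMatrix_apply_ne_zero h0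
    · exact h3 h4.symm
    · exact h3 h4.symm
  · refine h.corner n i u ?_
    rintro rfl
    exact hi hu

end IsPaired

end ClassicalSystem

/-! ### Verification for the families of groups -/

theorem LinearSystem.isLinear (S : LinearSystem) (𝕂 : Type) [NormedRing 𝕂] [NormedAlgebra ℝ 𝕂]
    [StarRing 𝕂] [ClassicalScalar 𝕂] [FiniteDimensional ℝ 𝕂] : (S.system 𝕂).IsLinear where
  mem_g n X := by
    refine ClassicalSystem.mem_g.trans (and_iff_left ?_)
    have hB : (S.system 𝕂).B n = 0 := rfl
    rw [hB, mul_zero, zero_mul, add_zero]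
  T_eq _ := rfl

section Entries

variable {𝕂 : Type} [NormedRing 𝕂] [NormedAlgebra ℝ 𝕂] [StarRing 𝕂] [ClassicalScalar 𝕂]
  {ι : Type} [Fintype ι] [DecidableEq ι]

theorem trace_cmat_eq_zero {X : Matrix ι ι 𝕂} (h : ∀ i, X i i = 0) : (cmat ι X).trace = 0 := by
  rw [trace_cmat]
  exact Finset.sum_eq_zero fun i _ => by rw [h, map_zero, Matrix.trace_zero]

theorem pairMatrix_diag (c : 𝕂) (p : ι → ι) (i k : ι) : pairMatrix c p i k k = 0 := by
  by_contra h0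
  obtain ⟨h1, ⟨h2, h3⟩ | ⟨h2, h3⟩⟩ := pairMatrix_apply_ne_zero h0
  · exact h1 (h3.symm.trans h2)
  · exact h1 (h2.symm.trans h3)

/-- The matrix with entries `1` at `(i, u)` and `c` at `(u, i)`. -/
def cornerMatrix (c : 𝕂) (i u : ι) : Matrix ι ι 𝕂 := Matrix.of fun a b =>
  if a = i ∧ b = u then 1 else if a = u ∧ b = i then c else 0

theorem cornerMatrix_apply (c : 𝕂) (i u a b : ι) : cornerMatrix c i u a b =
    if a = i ∧ b = u then 1 else if a = u ∧ b = i then c else 0 := rfl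

theorem cornerMatrix_apply_ne_zero {c : 𝕂} {i u a b : ι} (h : cornerMatrix c i u a b ≠ 0) :
    a = i ∧ b = u ∨ a = u ∧ b = i := by
  rw [cornerMatrix_apply] at h
  split_ifs at h with h1 h2
  · exact Or.inl h1
  · exact Or.inr h2
  · exact absurd rfl h

theorem cornerMatrix_diag (c : 𝕂) {i u : ι} (hiu : i ≠ u) (k : ι) : cornerMatrix c i u k k = 0 := by
  by_contra h0
  rcases cornerMatrix_apply_ne_zero h0 with ⟨h1, h2⟩ | ⟨h1, h2⟩
  · exact hiu (h1.symm.trans h2)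
  · exact hiu (h2.symm.trans h1)

theorem exists_cornerMatrix [Nontrivial 𝕂] {P : Matrix ι ι 𝕂 → Prop} {c : 𝕂} {i u : ι}
    (hg : P (cornerMatrix c i u)) : ∃ Y, P Y ∧ Y i u ≠ 0 ∧
      ∀ k l, Y k l ≠ 0 → k = i ∧ l = u ∨ k = u ∧ l = i := by
  refine ⟨_, hg, ?_, fun k l => cornerMatrix_apply_ne_zero⟩
  rw [cornerMatrix_apply, if_pos ⟨rfl, rfl⟩]
  exact one_ne_zero

theorem exists_ne_of_fixed {N : ℕ} (hN : 2 ≤ N) {p : Fin N → Fin N}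
    (h : ∀ i j, p i = i → p j = j → i = j) : ∃ i, p i ≠ i := by
  by_contra! hno
  have := h ⟨0, by omega⟩ ⟨1, by omega⟩ (hno _) (hno _)
  simp at this

end Entries

namespace ClassicalSystem

section Unitary

variable {𝕂 : Type} [NormedRing 𝕂] [NormedAlgebra ℝ 𝕂] [StarRing 𝕂] [ClassicalScalar 𝕂]
  [FiniteDimensional ℝ 𝕂] [Nontrivial 𝕂]

/-- A hermitian matrix in the Lie algebra has entries only between coordinates of opposite signs. So
its diagonal vanishes, and so does the block of the unpaired coordinates, which all have the same
sign. Since both signs occur at all high levels, some coordinate is paired there. -/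
theorem isPaired_of_unitary {R : ClassicalSystem 𝕂} {p : ∀ n, Fin (R.D.size n) → Fin (R.D.size n)}
    {ε : ∀ n, Fin (R.D.size n) → ℤˣ} (hs : R.sesq = true)
    (hB : ∀ n, R.B n = Matrix.diagonal fun i => ((ε n i : ℤ) : 𝕂))
    (hT : ∀ n, R.T n = pairSpan 1 (p n)) (hp : ∀ n, Function.Involutive (p n))
    (hpair : ∀ n i, p n i ≠ i → ε n (p n i) = -ε n i)
    (hfixed : ∀ n i j, p n i = i → p n j = j → ε n i = ε n j)
    (hex : ∃ n, ∀ m, n ≤ m → ∃ i j, ε m i ≠ ε m j) : R.IsPaired 1 p := by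
  have hg : ∀ n X, X ∈ R.g n ↔ (cmat _ X).trace = 0 ∧
      ∀ k l, star (X l k) * ((ε n l : ℤ) : 𝕂) + ((ε n k : ℤ) : 𝕂) * X k l = 0 := by
    intro n X
    rw [mem_g, hs, hB]
    refine and_congr_right fun _ => ?_
    rw [← Matrix.ext_iff]
    refine forall_congr' fun k => forall_congr' fun l => ?_
    rw [Matrix.add_apply, Matrix.mul_diagonal, Matrix.diagonal_mul]
    rfl
  have hBB : ∀ n, R.B n * R.B n = 1 := by
    intro n
    rw [hB, Matrix.diagonal_mul_diagonal, ← Matrix.diagonal_one]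
    congr 1
    funext i
    rcases Int.units_eq_one_or (ε n i) with h | h <;> simp [h]
  -- For hermitian X the equation reads ε X + ε X = 0 at two coordinates of the same sign ε.
  have hzero : ∀ n, ∀ X ∈ R.g n, Xᴴ = X → ∀ k l, ε n k = ε n l → X k l = 0 := by
    intro n X hX hXs k l hkl
    have h1 := ((hg n X).1 hX).2 k l
    have h2 : star (X l k) = X k l := congrFun (congrFun hXs k) l
    rw [h2, hkl] at h1
    apply eq_zero_of_eq_neg
    rcases Int.units_eq_one_or (ε n l) with h | h
    · simpa [h, add_eq_zero_iff_eq_neg] using h1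
    · rw [h] at h1
      simp only [Units.val_neg, Units.val_one, Int.cast_neg, Int.cast_one, mul_neg, mul_one,
        neg_mul, one_mul] at h1
      exact eq_neg_of_add_eq_zero_left (by rw [← neg_eq_zero, neg_add, h1])
  refine
    { T_eq := hT
      invol := hp
      mul_star := by rw [star_one, mul_one]
      star_eq := Or.inl (star_one 𝕂)
      pair_mem := fun n i => (hg n _).2 ⟨trace_cmat_eq_zero (pairMatrix_diag 1 (p n) i), ?_⟩
      star_mem := fun n X hX => ?_
      diag := fun n X hX hXs k => hzero n X hX hXs k k rfl
      fixed := fun n X hX hXs k l hk hl => hzero n X hX hXs k l (hfixed n k l hk hl)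
      corner := fun n i u hiu => exists_cornerMatrix (P := (· ∈ R.g n))
        -- The second entry of the corner matrix is forced by the equation for the form.
        (c := -(((ε n i * ε n u : ℤˣ) : ℤ) : 𝕂)) ((hg n _).2
          ⟨trace_cmat_eq_zero (cornerMatrix_diag _ hiu), ?_⟩)
      exists_pair := fun _ => ?_ }
  · intro k l
    have h2 : star (pairMatrix (1 : 𝕂) (p n) i l k) = pairMatrix (1 : 𝕂) (p n) i k l :=
      congrFun (congrFun (conjTranspose_pairMatrix (1 : 𝕂) (p n) i) k) l
    rw [h2]
    by_cases h0 : pairMatrix (1 : 𝕂) (p n) i k l = 0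
    · rw [h0, zero_mul, mul_zero, add_zero]
    · obtain ⟨h3, h4⟩ := pairMatrix_apply_ne_zero h0
      have h5 : ε n k = -ε n l := by
        rcases h4 with ⟨h4, h5⟩ | ⟨h4, h5⟩
        · rw [h4, h5, hpair n i h3, neg_neg]
        · rw [h4, h5, hpair n i h3]
      rw [h5, Units.val_neg, Int.cast_neg, neg_mul, (Int.cast_commute _ _).eq, add_neg_cancel]
  · obtain ⟨h1, h2⟩ := mem_g.1 hX
    rw [hs] at h2
    refine mem_g.2 ⟨?_, ?_⟩
    · rw [cmat_conjTranspose, Matrix.trace_conjTranspose, h1, star_zero]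
    · rw [hs]
      exact conjTranspose_mul_add_mul (Or.inl (hBB n)) h2
  · intro k l
    rw [cornerMatrix_apply, cornerMatrix_apply]
    by_cases h1 : k = i ∧ l = u
    · obtain ⟨rfl, rfl⟩ := h1
      rw [if_neg (fun h => hiu h.2), if_pos ⟨rfl, rfl⟩, if_pos ⟨rfl, rfl⟩]
      rcases Int.units_eq_one_or (ε n k) with h | h <;>
        rcases Int.units_eq_one_or (ε n l) with h' | h' <;> simp [h, h']
    · by_cases h2 : k = u ∧ l = i
      · obtain ⟨rfl, rfl⟩ := h2
        rw [if_pos ⟨rfl, rfl⟩, if_neg (fun h => hiu h.2), if_pos ⟨rfl, rfl⟩]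
        rcases Int.units_eq_one_or (ε n k) with h | h <;>
          rcases Int.units_eq_one_or (ε n l) with h' | h' <;> simp [h, h']
      · rw [if_neg (by tauto), if_neg (by tauto), if_neg (by tauto), if_neg (by tauto), star_zero,
          zero_mul, mul_zero, add_zero]
  · refine hex.imp fun n hn m hm => ?_
    obtain ⟨i, j, hij⟩ := hn m hm
    by_contra! hno
    exact hij (hfixed m i j (hno i) (hno j))

end Unitary

/-- The Lie algebra consists of the antisymmetric matrices, whose diagonal is zero; as at most one
coordinate is unpaired, the condition on unpaired coordinates is contained in this. The matrices of
pairs belong to it because the conjugate of the imaginary unit is its negative. -/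
theorem isPaired_of_complexOrthogonal {R : ClassicalSystem ℂ}
    {p : ∀ n, Fin (R.D.size n) → Fin (R.D.size n)} (hs : R.sesq = false) (hB : ∀ n, R.B n = 1)
    (hT : ∀ n, R.T n = pairSpan Complex.I (p n)) (hp : ∀ n, Function.Involutive (p n))
    (hfixed : ∀ n i j, p n i = i → p n j = j → i = j) : R.IsPaired Complex.I p := by
  have hg : ∀ n X, X ∈ R.g n ↔ (cmat _ X).trace = 0 ∧ ∀ k l, X l k = -X k l := by
    intro n X
    rw [mem_g, hs, hB, mul_one, one_mul]
    refine and_congr_right fun _ => ?_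
    rw [← Matrix.ext_iff]
    exact forall_congr' fun k => forall_congr' fun l => add_eq_zero_iff_eq_neg
  have hdiag : ∀ n, ∀ X ∈ R.g n, ∀ k, X k k = 0 := fun n X hX k =>
    eq_zero_of_eq_neg (((hg n X).1 hX).2 k k)
  refine
    { T_eq := hT
      invol := hp
      mul_star := by simp
      star_eq := Or.inr Complex.conj_I
      pair_mem := fun n i => (hg n _).2 ⟨trace_cmat_eq_zero (pairMatrix_diag _ (p n) i), ?_⟩
      star_mem := fun n X hX => ?_
      diag := fun n X hX _ k => hdiag n X hX k
      fixed := fun n X hX _ k l hk hl => ?_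
      corner := fun n i u hiu => exists_cornerMatrix (P := (· ∈ R.g n)) (c := -1) ((hg n _).2
          ⟨trace_cmat_eq_zero (cornerMatrix_diag _ hiu), ?_⟩)
      exists_pair := fun hD => ?_ }
  · intro k l
    by_cases hi : p n i = i
    · simp [pairMatrix, hi]
    by_cases h1 : k = i ∧ l = p n i
    · obtain ⟨rfl, rfl⟩ := h1
      rw [pairMatrix_apply_left hi, pairMatrix_apply_right hi]
      exact Complex.conj_I
    by_cases h2 : k = p n i ∧ l = i
    · obtain ⟨rfl, rfl⟩ := h2
      rw [pairMatrix_apply_left hi, pairMatrix_apply_right hi]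
      exact (neg_eq_iff_eq_neg.2 Complex.conj_I).symm
    have h3 : pairMatrix Complex.I (p n) i k l = 0 := by
      by_contra h0
      rcases (pairMatrix_apply_ne_zero h0).2 with h | h
      · exact h1 h
      · exact h2 h
    have h4 : pairMatrix Complex.I (p n) i l k = 0 := by
      by_contra h0
      rcases (pairMatrix_apply_ne_zero h0).2 with h | h
      · exact h2 h.symm
      · exact h1 h.symm
    rw [h3, h4, neg_zero]
  · obtain ⟨h1, h2⟩ := (hg n X).1 hX
    refine (hg n _).2 ⟨?_, fun k l => ?_⟩
    · rw [cmat_conjTranspose, Matrix.trace_conjTranspose, h1, star_zero]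
    · rw [Matrix.conjTranspose_apply, Matrix.conjTranspose_apply, h2, star_neg]
  · rw [hfixed n k l hk hl]
    exact hdiag n X hX l
  · intro k l
    rw [cornerMatrix_apply, cornerMatrix_apply]
    by_cases h1 : k = i ∧ l = u
    · obtain ⟨rfl, rfl⟩ := h1
      rw [if_neg (fun h => hiu h.2), if_pos ⟨rfl, rfl⟩, if_pos ⟨rfl, rfl⟩]
    · by_cases h2 : k = u ∧ l = i
      · obtain ⟨rfl, rfl⟩ := h2
        rw [if_pos ⟨rfl, rfl⟩, if_neg (fun h => hiu h.2), if_pos ⟨rfl, rfl⟩, neg_neg]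
      · rw [if_neg (by tauto), if_neg (by tauto), if_neg (by tauto), if_neg (by tauto), neg_zero]
  · obtain ⟨n, hn⟩ := BlockData.exists_le_size hD 2
    exact ⟨n, fun m hm => exists_ne_of_fixed (hn m hm) (hfixed m)⟩

theorem isPaired_of_starOrthogonal {R : ClassicalSystem ℍ[ℝ]}
    {p : ∀ n, Fin (R.D.size n) → Fin (R.D.size n)} (hs : R.sesq = true)
    (hB : ∀ n, R.B n = quatI • 1)
    (hT : ∀ n, R.T n = pairSpan quatJ (p n)) (hp : ∀ n, Function.Involutive (p n))
    (hfixed : ∀ n i j, p n i = i → p n j = j → i = j) : R.IsPaired quatJ p := by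
  have hB' : ∀ n, R.B n = Matrix.diagonal fun _ => quatI := by
    intro n
    rw [hB]
    ext1 i j
    by_cases hij : i = j
    · subst hij
      rw [Matrix.smul_apply, Matrix.one_apply_eq, Matrix.diagonal_apply_eq, smul_eq_mul, mul_one]
    · rw [Matrix.smul_apply, Matrix.one_apply_ne hij, Matrix.diagonal_apply_ne _ hij, smul_zero]
  have hg : ∀ n X, X ∈ R.g n ↔ (cmat _ X).trace = 0 ∧
      ∀ k l, star (X l k) * quatI + quatI * X k l = 0 := by
    intro n X
    rw [mem_g, hs, hB']
    refine and_congr_right fun _ => ?_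
    rw [← Matrix.ext_iff]
    refine forall_congr' fun k => forall_congr' fun l => ?_
    rw [Matrix.add_apply, Matrix.mul_diagonal, Matrix.diagonal_mul]
    rfl
  have hII : quatI * quatI = -1 := by
    ext <;> simp <;> simp [quatI]
  have hJs : star quatJ = -quatJ := by
    ext <;> simp <;> simp [quatJ]
  have hJJ : quatJ * star quatJ = 1 := by
    ext <;> simp <;> simp [quatJ]
  -- The anticommutation of i and j puts the matrices of pairs with entries ±j into the Lie algebra.
  have hIJ : quatJ * quatI + quatI * quatJ = 0 := by
    ext <;> simp <;> simp [quatI, quatJ]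
  have hBB : ∀ n, R.B n * R.B n = -1 := by
    intro n
    rw [hB', Matrix.diagonal_mul_diagonal, hII, ← Matrix.diagonal_one, ← Matrix.diagonal_neg]
  have hdiag : ∀ n, ∀ X ∈ R.g n, Xᴴ = X → ∀ k, X k k = 0 := by
    intro n X hX hXs k
    have h1 := ((hg n X).1 hX).2 k k
    have h2 : star (X k k) = X k k := congrFun (congrFun hXs k) k
    -- A diagonal entry of a hermitian matrix is real and commutes with i, so the equation of the
    -- Lie algebra says that twice its product with i is zero.
    have h3 := Quaternion.star_eq_self.1 h2
    rw [h2, h3, ← (Quaternion.coe_commutes _ quatI), add_eq_zero_iff_eq_neg] at h1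
    have h4 := eq_zero_of_eq_neg h1
    have h5 := congrArg (fun q : ℍ[ℝ] => -(q * quatI)) h4
    simp only [mul_assoc, hII, mul_neg, mul_one, neg_neg, zero_mul, neg_zero] at h5
    rw [h3, h5]
  refine
    { T_eq := hT
      invol := hp
      mul_star := hJJ
      star_eq := Or.inr hJs
      pair_mem := fun n i => (hg n _).2 ⟨trace_cmat_eq_zero (pairMatrix_diag _ (p n) i), ?_⟩
      star_mem := fun n X hX => ?_
      diag := hdiag
      fixed := fun n X hX hXs k l hk hl => ?_
      corner := fun n i u hiu => exists_cornerMatrix (P := (· ∈ R.g n)) (c := -1) ((hg n _).2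
          ⟨trace_cmat_eq_zero (cornerMatrix_diag _ hiu), ?_⟩)
      exists_pair := fun hD => ?_ }
  · intro k l
    have h2 : star (pairMatrix quatJ (p n) i l k) = pairMatrix quatJ (p n) i k l :=
      congrFun (congrFun (conjTranspose_pairMatrix quatJ (p n) i) k) l
    rw [h2]
    have h3 : pairMatrix quatJ (p n) i k l ∈ ({0, quatJ, -quatJ} : Set ℍ[ℝ]) := by
      simp only [pairMatrix, Matrix.of_apply]
      split_ifs <;> simp [hJs]
    rcases h3 with h3 | h3 | h3
    · rw [h3, zero_mul, mul_zero, add_zero]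
    · rw [h3, hIJ]
    · rw [h3, neg_mul, mul_neg, ← neg_add, hIJ, neg_zero]
  · obtain ⟨h1, h2⟩ := mem_g.1 hX
    rw [hs] at h2
    refine mem_g.2 ⟨?_, ?_⟩
    · rw [cmat_conjTranspose, Matrix.trace_conjTranspose, h1, star_zero]
    · rw [hs]
      exact conjTranspose_mul_add_mul (Or.inr (hBB n)) h2
  · rw [hfixed n k l hk hl]
    exact hdiag n X hX hXs l
  · intro k l
    rw [cornerMatrix_apply, cornerMatrix_apply]
    by_cases h1 : k = i ∧ l = u
    · obtain ⟨rfl, rfl⟩ := h1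
      rw [if_neg (fun h => hiu h.2), if_pos ⟨rfl, rfl⟩, if_pos ⟨rfl, rfl⟩, star_neg, star_one,
        neg_one_mul, mul_one, neg_add_cancel]
    · by_cases h2 : k = u ∧ l = i
      · obtain ⟨rfl, rfl⟩ := h2
        rw [if_pos ⟨rfl, rfl⟩, if_neg (fun h => hiu h.2), if_pos ⟨rfl, rfl⟩, star_one, one_mul,
          mul_neg_one, add_neg_cancel]
      · rw [if_neg (by tauto), if_neg (by tauto), if_neg (by tauto), if_neg (by tauto), star_zero,
          zero_mul, mul_zero, add_zero]
  · obtain ⟨n, hn⟩ := BlockData.exists_le_size hD 2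
    exact ⟨n, fun m hm => exists_ne_of_fixed (hn m hm) (hfixed m)⟩

end ClassicalSystem

/-! ## The signs of the unitary forms -/

namespace BlockData

variable (D : BlockData)

theorem blk_inl_apply {R : Type} [Zero R] {n : ℕ} (A : Matrix (Fin (D.t' n)) (Fin (D.t' n)) R)
    (X : Fin (D.r n + D.s n) → Matrix (Fin (D.size n)) (Fin (D.size n)) R)
    (C : Matrix (Fin (D.t'' n)) (Fin (D.t'' n)) R) (i j : Fin (D.t' n)) :
    D.blk n A X C (D.split n (.inl i)) (D.split n (.inl j)) = A i j := by
  simp [BlockData.blk]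

theorem blk_inr_inr_apply {R : Type} [Zero R] {n : ℕ} (A : Matrix (Fin (D.t' n)) (Fin (D.t' n)) R)
    (X : Fin (D.r n + D.s n) → Matrix (Fin (D.size n)) (Fin (D.size n)) R)
    (C : Matrix (Fin (D.t'' n)) (Fin (D.t'' n)) R) (i j : Fin (D.t'' n)) :
    D.blk n A X C (D.split n (.inr (.inr i))) (D.split n (.inr (.inr j))) = C i j := by
  simp [BlockData.blk]

theorem blk_diagonal {R : Type} [Zero R] {n : ℕ} (a : Fin (D.t' n) → R)
    (x : Fin (D.r n + D.s n) → Fin (D.size n) → R) (c : Fin (D.t'' n) → R) :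
    ∃ y, D.blk n (Matrix.diagonal a) (fun b => Matrix.diagonal (x b)) (Matrix.diagonal c) =
      Matrix.diagonal y := by
  rw [BlockData.blk, Matrix.blockDiagonal_diagonal, Matrix.fromBlocks_diagonal,
    Matrix.fromBlocks_diagonal, Matrix.reindex_apply, Matrix.submatrix_diagonal_equiv]
  exact ⟨_, rfl⟩

/-- The form is diagonal at each level and its square is 1, so its diagonal entries are units of ℤ.
-/
theorem exists_unitaryForm_eq (p₀ n : ℕ) : ∃ ε : Fin (D.size n) → ℤˣ,
    D.unitaryForm p₀ n = Matrix.diagonal fun i => (ε i : ℤ) := by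
  have h1 : ∃ y, D.unitaryForm p₀ n = Matrix.diagonal y := by
    induction n with
    | zero => exact ⟨_, rfl⟩
    | succ n ih =>
      obtain ⟨y, hy⟩ := ih
      obtain ⟨z, hz⟩ := D.blk_diagonal (n := n) (fun _ => (1 : ℤ)) (fun _ => y) (fun _ => -1)
      refine ⟨z, Eq.trans ?_ hz⟩
      change D.blk n 1 (fun _ => D.unitaryForm p₀ n) (-1) = _
      rw [hy, Matrix.diagonal_one, ← Matrix.diagonal_neg, ← Matrix.diagonal_one]
      rfl
  obtain ⟨y, hy⟩ := h1
  have h2 := D.unitaryForm_mul p₀ n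
  rw [hy, Matrix.diagonal_mul_diagonal] at h2
  have h3 : ∀ i, IsUnit (y i) := by
    intro i
    have h4 := congrFun (congrFun h2 i) i
    rw [Matrix.diagonal_apply_eq, Matrix.one_apply_eq] at h4
    exact IsUnit.of_mul_eq_one _ h4
  choose ε hε using h3
  exact ⟨ε, hy.trans (congrArg Matrix.diagonal (funext fun i => (hε i).symm))⟩

/-- A value on the diagonal of the form persists. -/
theorem exists_unitaryForm_apply {D : BlockData} {p₀ : ℕ} {v : ℤ} {n : ℕ}
    (h : ∃ i, D.unitaryForm p₀ n i i = v) (m : ℕ) (hnm : n ≤ m) :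
    ∃ i, D.unitaryForm p₀ m i i = v := by
  induction hnm with
  | refl => exact h
  | @step m _ ih =>
    obtain ⟨i, hi⟩ := ih
    exact ⟨D.split m (.inr (.inl (i, ⟨0, D.rs_pos m⟩))), (D.blk_inr_inl_apply _ _ _ _ i i).trans hi⟩

end BlockData

namespace UnitarySystem

variable {F : ScalarKind} (S : UnitarySystem F)

theorem exists_pos : ∃ n, ∃ i, S.D.unitaryForm S.p₀ n i i = 1 := by
  rcases S.pos with h | ⟨n, hn⟩
  · refine ⟨0, ⟨0, S.D.N₀_pos⟩, ?_⟩
    refine (Matrix.diagonal_apply_eq _ _).trans ?_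
    exact if_pos h
  · refine ⟨n + 1, S.D.split n (.inl ⟨0, hn⟩), ?_⟩
    exact (S.D.blk_inl_apply _ _ _ _ _).trans (Matrix.one_apply_eq _)

theorem exists_neg : ∃ n, ∃ i, S.D.unitaryForm S.p₀ n i i = -1 := by
  rcases S.neg with h | ⟨n, hn⟩
  · refine ⟨0, ⟨S.p₀, h⟩, ?_⟩
    refine (Matrix.diagonal_apply_eq _ _).trans ?_
    exact if_neg (lt_irrefl _)
  · refine ⟨n + 1, S.D.split n (.inr (.inr ⟨0, hn⟩)), ?_⟩
    refine (S.D.blk_inr_inr_apply _ _ _ _ _).trans ?_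
    change -((1 : Matrix (Fin (S.D.t'' n)) (Fin (S.D.t'' n)) ℤ) ⟨0, hn⟩ ⟨0, hn⟩) = -1
    rw [Matrix.one_apply_eq]

/-- The conditions concern each level separately and not the maps, so the automorphism δ is left
arbitrary; the real, complex and quaternionic systems are instances. -/
theorem isPaired {𝕂 : Type} [NormedRing 𝕂] [NormedAlgebra ℝ 𝕂] [StarRing 𝕂] [ClassicalScalar 𝕂]
    [FiniteDimensional ℝ 𝕂] [Nontrivial 𝕂] (b : Bool) (w : ∀ n, SignedPerm (S.D.size n))
    (htw : ∀ n, ∀ g ∈ classicalGroup true (S.B 𝕂 n),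
      twist b (w n) g ∈ classicalGroup true (S.B 𝕂 n)) :
    (ClassicalSystem.mk S.D true (S.B 𝕂) b w (fun n => pairSpan (1 : 𝕂) (S.π n)) (S.B_succ 𝕂)
      htw).IsPaired (1 : 𝕂) S.π := by
  choose ε hε using S.D.exists_unitaryForm_eq S.p₀
  have hεi : ∀ n i, S.D.unitaryForm S.p₀ n i i = ε n i := fun n i => by
    rw [hε, Matrix.diagonal_apply_eq]
  refine ClassicalSystem.isPaired_of_unitary (ε := ε) rfl (fun n => ?_) (fun _ => rfl) S.π_invol
    (fun n i hi => ?_) (fun n i j hi hj => ?_) ?_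
  · change (Int.castRingHom 𝕂).mapMatrix (S.D.unitaryForm S.p₀ n) = _
    rw [hε, RingHom.mapMatrix_apply, Matrix.diagonal_map (map_zero _)]
    rfl
  · have h := S.π_pair n i hi
    rw [hεi, hεi] at h
    exact Units.ext (by rw [Units.val_neg]; linarith)
  · have h := S.π_fixed n i j hi hj
    rw [hεi, hεi] at h
    exact Units.ext h
  · obtain ⟨n₁, h₁⟩ := S.exists_pos
    obtain ⟨n₂, h₂⟩ := S.exists_neg
    refine ⟨max n₁ n₂, fun m hm => ?_⟩
    obtain ⟨i, hi⟩ := BlockData.exists_unitaryForm_apply h₁ m ((le_max_left _ _).trans hm)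
    obtain ⟨j, hj⟩ := BlockData.exists_unitaryForm_apply h₂ m ((le_max_right _ _).trans hm)
    refine ⟨i, j, fun h => ?_⟩
    rw [hεi] at hi hj
    rw [h, hj] at hi
    norm_num at hi

end UnitarySystem

/-! ## Symplectic systems -/

theorem standardSymplectic_transpose {M : ℕ} (hM : Even M) :
    (standardSymplectic M)ᵀ = -standardSymplectic M := by
  ext i j
  simp only [standardSymplectic, Matrix.transpose_apply, Matrix.of_apply, Matrix.neg_apply]
  obtain ⟨k, rfl⟩ := hM
  have hi := i.2
  have hj := j.2
  split_ifs <;> first | rfl | omega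

theorem standardSymplectic_mul {M : ℕ} (hM : Even M) :
    (standardSymplectic M)ᵀ * standardSymplectic M = 1 := by
  obtain ⟨m, rfl⟩ := hM
  ext i k
  have hi := i.2
  have hk := k.2
  -- The only row in which column i of the form has a nonzero entry: the partner of i, half the
  -- dimension away.
  let o : Fin (m + m) := if h : i.1 < m then ⟨i.1 + m, by omega⟩ else ⟨i.1 - m, by omega⟩
  have ho : o.1 = if i.1 < m then i.1 + m else i.1 - m := by
    simp only [o]; split_ifs <;> rfl
  have hm : (m + m) / 2 = m := by omega
  rw [Matrix.mul_apply, Finset.sum_eq_single o]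
  · simp only [standardSymplectic, Matrix.transpose_apply, Matrix.of_apply, Matrix.one_apply, hm, ho,
      Fin.ext_iff]
    split_ifs <;> first | rfl | omega
  · intro j _ hj
    have hj2 := j.2
    have hj' : j.1 ≠ o.1 := fun h => hj (Fin.ext h)
    rw [ho] at hj'
    simp only [standardSymplectic, Matrix.transpose_apply, Matrix.of_apply, hm]
    split_ifs at hj' ⊢ <;> first | omega
  · simp

namespace SymplecticSystem

variable (S : SymplecticSystem)

/-- The integral form at level `n`. -/
def intForm (n : ℕ) : Matrix (Fin (S.D.size n)) (Fin (S.D.size n)) ℤ :=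
  S.D.form (standardSymplectic _) (fun _ => 0) (fun _ => standardSymplectic _) n

theorem intForm_transpose (n : ℕ) : (S.intForm n)ᵀ = -S.intForm n := by
  induction n with
  | zero => exact standardSymplectic_transpose S.N₀_even
  | succ n ih =>
    change (S.D.blk n 0 (fun _ => S.intForm n) (standardSymplectic _))ᵀ =
      -S.D.blk n 0 (fun _ => S.intForm n) (standardSymplectic _)
    rw [BlockData.blk_transpose, ih, standardSymplectic_transpose (S.t''_even n),
      Matrix.transpose_zero]
    have h := BlockData.blk_smul (D := S.D) (n := n) (-1 : ℤ) (0 : Matrix _ _ ℤ)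
      (fun _ => S.intForm n) (standardSymplectic _)
    simpa using h.symm

theorem intForm_mul (n : ℕ) : (S.intForm n)ᵀ * S.intForm n = 1 := by
  induction n with
  | zero => exact standardSymplectic_mul S.N₀_even
  | succ n ih =>
    -- There are no coordinates in front of the blocks, so the zero form there is also the identity.
    have h0 : (0 : Matrix (Fin (S.D.t' n)) (Fin (S.D.t' n)) ℤ) = 1 := by
      ext i
      have := i.2
      have := S.t'_zero n
      omega
    change (S.D.blk n 0 (fun _ => S.intForm n) (standardSymplectic _))ᵀ *
      S.D.blk n 0 (fun _ => S.intForm n) (standardSymplectic _) = 1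
    rw [BlockData.blk_transpose, BlockData.blk_mul, ih, standardSymplectic_mul (S.t''_even n),
      Matrix.transpose_zero, mul_zero, h0, BlockData.blk_one]

/-- The form is monomial: it pairs the coordinates. -/
theorem exists_intForm_eq (n : ℕ) : ∃ (p : Fin (S.D.size n) → Fin (S.D.size n))
    (σ : Fin (S.D.size n) → ℤˣ), Function.Involutive p ∧ (∀ k, σ (p k) = -σ k) ∧
      ∀ k l, S.intForm n k l = if l = p k then (σ k : ℤ) else 0 := by
  obtain ⟨f, ε, -, h⟩ := exists_of_transpose_mul_self_eq_one (S.intForm_mul n)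
  have hanti : ∀ k l, S.intForm n k l = -S.intForm n l k := fun k l =>
    congrFun (congrFun (S.intForm_transpose n) l) k
  have h1 : ∀ k l, S.intForm n k l = if l = f k then (((-ε k : ℤˣ)) : ℤ) else 0 := by
    intro k l
    rw [hanti, h]
    split_ifs <;> simp
  -- Antisymmetry describes each entry both by its row and by its column; comparing the two
  -- descriptions shows that f is an involution under which the signs alternate.
  have h2 : ∀ k, f (f k) = k ∧ -ε (f k) = ε k := by
    intro k
    have h3 := h1 (f k) k
    rw [h, if_pos rfl] at h3
    split_ifs at h3 with h4
    · exact ⟨h4.symm, Units.ext h3.symm⟩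
    · exact absurd h3 (Units.ne_zero _)
  exact ⟨f, fun k => -ε k, fun k => (h2 k).1, fun k =>
    (show -ε (f k) = - -ε k by rw [(h2 k).2, neg_neg]), h1⟩

end SymplecticSystem

/-! ### The Lie algebras and frames of symplectic systems -/

namespace ClassicalSystem

variable {𝕂 : Type} [NormedRing 𝕂] [NormedAlgebra ℝ 𝕂] [StarRing 𝕂] [ClassicalScalar 𝕂]
  [FiniteDimensional ℝ 𝕂]

/-- The forms are antisymmetric and pair the coordinates, the spaces `a n` consist of diagonal
matrices. -/
structure IsSymplectic (S : ClassicalSystem 𝕂) (p : ∀ n, Fin (S.D.size n) → Fin (S.D.size n))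
    (σ : ∀ n, Fin (S.D.size n) → ℤˣ) : Prop where
  sesq_eq : S.sesq = false
  T_eq : ∀ n, S.T n = realDiagonal 𝕂 (S.D.size n)
  invol : ∀ n, Function.Involutive (p n)
  sign : ∀ n k, σ n (p n k) = -σ n k
  B_apply : ∀ n k l, S.B n k l = if l = p n k then ((σ n k : ℤ) : 𝕂) else 0

namespace IsSymplectic

variable {S : ClassicalSystem 𝕂} {p : ∀ n, Fin (S.D.size n) → Fin (S.D.size n)}
  {σ : ∀ n, Fin (S.D.size n) → ℤˣ} (h : S.IsSymplectic p σ)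

include h

theorem ne (n : ℕ) (k : Fin (S.D.size n)) : p n k ≠ k := by
  intro hk
  have h1 := congrArg Units.val (h.sign n k)
  rw [hk, Units.val_neg] at h1
  exact (σ n k).ne_zero (self_eq_neg.1 h1)

theorem mul_B_apply (n : ℕ) (X : Matrix (Fin (S.D.size n)) (Fin (S.D.size n)) 𝕂)
    (k l : Fin (S.D.size n)) : (X * S.B n) k l = -(X k (p n l) * ((σ n l : ℤ) : 𝕂)) := by
  rw [Matrix.mul_apply, Finset.sum_eq_single (p n l)]
  · rw [h.B_apply, if_pos (h.invol n l).symm, h.sign, Units.val_neg, Int.cast_neg, mul_neg]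
  · intro a _ ha
    rw [h.B_apply, if_neg (fun h1 => ha (by rw [h1, h.invol])), mul_zero]
  · simp

theorem B_mul_apply (n : ℕ) (X : Matrix (Fin (S.D.size n)) (Fin (S.D.size n)) 𝕂)
    (k l : Fin (S.D.size n)) : (S.B n * X) k l = ((σ n k : ℤ) : 𝕂) * X (p n k) l := by
  rw [Matrix.mul_apply, Finset.sum_eq_single (p n k)]
  · rw [h.B_apply, if_pos rfl]
  · intro a _ ha
    rw [h.B_apply, if_neg ha, zero_mul]
  · simp

theorem mem_g (n : ℕ) (X : Matrix (Fin (S.D.size n)) (Fin (S.D.size n)) 𝕂) :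
    X ∈ S.g n ↔ (cmat _ X).trace = 0 ∧ ∀ k l,
      ((σ n k : ℤ) : 𝕂) * X (p n k) l = ClassicalScalar.tr (X (p n l) k) * ((σ n l : ℤ) : 𝕂) := by
  rw [ClassicalSystem.mem_g, h.sesq_eq]
  refine and_congr_right fun _ => ?_
  rw [← Matrix.ext_iff]
  refine forall_congr' fun k => forall_congr' fun l => ?_
  rw [Matrix.add_apply, h.mul_B_apply, h.B_mul_apply, Matrix.zero_apply, neg_add_eq_zero, eq_comm]
  rfl

variable [Nontrivial 𝕂]

/-- The equation for the form asks that the entries at paired coordinates be opposite; the trace is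
then zero automatically, since pairing permutes the coordinates. -/
theorem realDiag_mem_g (n : ℕ) (d : Fin (S.D.size n) → ℝ) :
    realDiag 𝕂 d ∈ S.g n ↔ ∀ k, d (p n k) = -d k := by
  rw [h.mem_g]
  constructor
  · rintro ⟨-, h1⟩ k
    have h2 := h1 k (p n k)
    rw [h.invol, realDiag_apply_self, realDiag_apply_self, tr_algebraMap, h.sign, Units.val_neg,
      Int.cast_neg, mul_neg, (Int.cast_commute _ _).eq, ← neg_mul, ← map_neg] at h2
    refine (algebraMap ℝ 𝕂).injective ?_
    rcases Int.units_eq_one_or (σ n k) with hk | hk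
    · simpa [hk] using h2
    · rw [map_neg]
      exact neg_eq_iff_eq_neg.1 (by simpa [hk] using h2)
  · intro hd
    refine ⟨?_, fun k l => ?_⟩
    · rw [trace_cmat_realDiag]
      have h1 : ∑ i, d i = -∑ i, d i := by
        rw [← Finset.sum_neg_distrib]
        simp only [← hd]
        exact (Equiv.sum_comp (h.invol n).toPerm d).symm
      have h2 : ∑ i, d i = 0 := self_eq_neg.1 h1
      rw [h2, zero_mul, Complex.ofReal_zero]
    · by_cases hkl : p n k = l
      · subst hkl
        rw [h.invol, realDiag_apply_self, realDiag_apply_self, tr_algebraMap, h.sign,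
          Units.val_neg, Int.cast_neg, mul_neg, (Int.cast_commute _ _).eq, ← neg_mul, ← map_neg, hd]
      · rw [realDiag_apply_ne _ hkl, realDiag_apply_ne, mul_zero, BlockData.scalar_tr_zero, zero_mul]
        rintro rfl
        exact hkl (h.invol n l)

theorem mem_aMat (n : ℕ) (X : Matrix (Fin (S.D.size n)) (Fin (S.D.size n)) 𝕂) :
    X ∈ S.aMat n ↔ ∃ d, X = realDiag 𝕂 d ∧ ∀ k, d (p n k) = -d k := by
  constructor
  · rintro ⟨hX, hXT⟩
    obtain ⟨d, rfl⟩ := mem_realDiagonal.1 (h.T_eq n ▸ hXT)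
    exact ⟨d, rfl, (h.realDiag_mem_g n d).1 hX⟩
  · rintro ⟨d, rfl, hd⟩
    exact ⟨(h.realDiag_mem_g n d).2 hd, h.T_eq n ▸ mem_realDiagonal.2 ⟨d, rfl⟩⟩

theorem diff_mem (n : ℕ) (i : Fin (S.D.size n)) :
    realDiag 𝕂 (Pi.single i 1 - Pi.single (p n i) 1) ∈ S.aMat n := by
  refine (h.mem_aMat n _).2 ⟨_, rfl, fun k => ?_⟩
  have h1 : p n k = i ↔ k = p n i := ⟨fun hk => by rw [← hk, h.invol], fun hk => by rw [hk, h.invol]⟩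
  have h2 : p n k = p n i ↔ k = i := (h.invol n).injective.eq_iff
  simp only [Pi.sub_apply, Pi.single_apply, h1, h2, neg_sub]

/-- The frame elements have eigenvectors in the coordinates instead of exchanging them, and passing
to the partner changes the sign. There are no unpaired coordinates. -/
theorem pairFrame (n : ℕ) : PairFrame (S.aMat n) (p n)
    (fun i => realDiag 𝕂 (Pi.single i 1 - Pi.single (p n i) 1)) where
  invol := h.invol n
  mem := h.diff_mem n
  fixed i hi := absurd hi (h.ne n i)
  sq i hi := by
    rw [realDiag_mul, realDiag, pairProj]
    congr 1
    funext a
    by_cases h1 : a = i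
    · subst h1
      simp [Ne.symm hi]
    · by_cases h2 : a = p n i
      · subst h2
        simp [hi]
      · simp [h1, h2]
  partner i := by
    right
    rw [h.invol]
    ext a b
    rw [Matrix.neg_apply]
    by_cases hab : a = b
    · subst hab
      rw [realDiag_apply_self, realDiag_apply_self, ← map_neg, ← Pi.neg_apply, neg_sub]
    · rw [realDiag_apply_ne _ hab, realDiag_apply_ne _ hab, neg_zero]
  supp i a b hab := by
    by_cases hne : a = b
    · subst hne
      rw [realDiag_apply_self] at hab
      have h1 : a = i ∨ a = p n i := by
        by_contra hno
        push Not at hno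
        apply hab
        simp [hno.1, hno.2]
      exact ⟨h1, h1⟩
    · exact absurd (realDiag_apply_ne _ hne) hab
  le_span X hX := by
    obtain ⟨d, rfl, hd⟩ := (h.mem_aMat n X).1 hX
    -- Each pair occurs twice in the sum with equal terms, whence the factor 1/2.
    have hsum : realDiag 𝕂 d =
        ∑ i, (d i / 2) • realDiag 𝕂 (Pi.single i 1 - Pi.single (p n i) 1) := by
      refine realDiag_eq_sum (fun i => d i / 2) _ fun a => ?_
      have h2 : ∀ i, a = p n i ↔ p n a = i := fun i =>
        ⟨fun hk => by rw [hk, h.invol], fun hk => by rw [← hk, h.invol]⟩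
      simp only [Pi.sub_apply, mul_sub, Finset.sum_sub_distrib, Pi.single_apply, h2, mul_ite,
        mul_one, mul_zero, Finset.sum_ite_eq, Finset.mem_univ, if_true, hd]
      ring
    rw [hsum]
    exact sum_mem fun i _ => Submodule.smul_mem _ _ (Submodule.subset_span ⟨i, rfl⟩)

theorem B_mul_B (n : ℕ) : S.B n * S.B n = -1 := by
  ext k l
  rw [h.B_mul_apply, h.B_apply, h.invol, Matrix.neg_apply, h.sign]
  by_cases hkl : k = l
  · subst hkl
    rw [if_pos rfl, Matrix.one_apply_eq]
    rcases Int.units_eq_one_or (σ n k) with hk | hk <;> simp [hk]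
  · rw [if_neg (Ne.symm hkl), Matrix.one_apply_ne hkl, mul_zero, neg_zero]

theorem conjTranspose_B (n : ℕ) : (S.B n)ᴴ = -S.B n := by
  ext k l
  rw [Matrix.conjTranspose_apply, Matrix.neg_apply, h.B_apply, h.B_apply]
  by_cases hkl : l = p n k
  · rw [if_pos hkl, if_pos (by rw [hkl, h.invol]), hkl, h.sign]
    rcases Int.units_eq_one_or (σ n k) with hk | hk <;> simp [hk]
  · rw [if_neg hkl, if_neg (fun h1 => hkl (by rw [h1, h.invol])), star_zero, neg_zero]

theorem standard (hreal : ∀ q : 𝕂, star q = q → ∃ r : ℝ, q = algebraMap ℝ 𝕂 r) : S.Standard where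
  star_mem n X hX := by
    obtain ⟨h1, h2⟩ := ClassicalSystem.mem_g.1 hX
    rw [h.sesq_eq] at h2
    refine ClassicalSystem.mem_g.2 ⟨?_, ?_⟩
    · rw [cmat_conjTranspose, Matrix.trace_conjTranspose, h1, star_zero]
    · rw [h.sesq_eq]
      exact transp_conjTranspose_mul_add_mul (Or.inr (h.B_mul_B n)) (Or.inr (h.conjTranspose_B n)) h2
  herm n X hX := by
    obtain ⟨d, rfl⟩ := mem_realDiagonal.1 (h.T_eq n ▸ hX)
    exact conjTranspose_realDiag d
  comm n X hX Y hY := by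
    obtain ⟨d, rfl⟩ := mem_realDiagonal.1 (h.T_eq n ▸ hX)
    obtain ⟨d', rfl⟩ := mem_realDiagonal.1 (h.T_eq n ▸ hY)
    exact realDiag_comm d d'
  shape n := by
    refine ⟨id, fun _ => rfl, fun X hX i j hij => ?_⟩
    obtain ⟨d, rfl⟩ := mem_realDiagonal.1 (h.T_eq n ▸ hX)
    by_contra hne
    exact hij (realDiag_apply_ne d (Ne.symm hne))
  span n := by
    refine (h.pairFrame n).le_span.trans (Submodule.span_mono ?_)
    rintro _ ⟨i, rfl⟩
    refine ⟨h.diff_mem n i, (h.pairFrame n).cube i, {i, p n i}, Finset.card_le_two,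
      fun a b hab => ?_⟩
    have h1 := (h.pairFrame n).supp i a b hab
    simpa only [Finset.mem_insert, Finset.mem_singleton] using h1
  maximal n X hX hXs hcomm := by
    rw [h.T_eq]
    have hd : ∀ i, ∃ r : ℝ, X i i = algebraMap ℝ 𝕂 r := fun i =>
      hreal _ (congrFun (congrFun hXs i) i)
    choose d hd using hd
    refine mem_realDiagonal.2 ⟨d, ?_⟩
    ext i j
    by_cases hij : i = j
    · subst hij
      rw [realDiag_apply_self, hd]
    · rw [realDiag_apply_ne _ hij]
      -- The frame element of i has entry 1 at i, -1 at the partner of i and 0 elsewhere. So the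
      -- entry of X at (i, j) is zero directly, or equals its negative when j is the partner.
      have h1 := congrFun (congrFun (hcomm _ (h.diff_mem n i)) i) j
      rw [realDiag_mul_apply, mul_realDiag_apply] at h1
      simp only [Pi.sub_apply, Pi.single_eq_same, Pi.single_eq_of_ne (Ne.symm (h.ne n i)),
        Pi.single_eq_of_ne (Ne.symm hij), sub_zero, zero_sub, one_smul, neg_smul] at h1
      by_cases hj : j = p n i
      · rw [hj, Pi.single_eq_same, one_smul] at h1
        rw [hj]
        exact eq_zero_of_eq_neg h1
      · rwa [Pi.single_eq_of_ne hj, zero_smul, neg_zero] at h1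

/-- The matrix unit from a coordinate to its partner is in the Lie algebra and is a root vector with
value 2; it exists at level 0, so growth of the sizes is not needed. -/
theorem exists_not_commute : ∃ n, ∃ ξ ∈ S.aMat n, ∃ Y ∈ S.g n, ξ * Y ≠ Y * ξ := by
  let i : Fin (S.D.size 0) := ⟨0, S.D.size_pos 0⟩
  have hi := h.ne 0 i
  refine ⟨0, _, h.diff_mem 0 i, Matrix.single i (p 0 i) 1, (h.mem_g 0 _).2 ⟨?_, fun k l => ?_⟩,
    fun hY => ?_⟩
  · refine trace_cmat_eq_zero fun k => ?_
    rw [Matrix.single_apply, if_neg]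
    rintro ⟨h1, h2⟩
    exact hi (h2.trans h1.symm)
  · rw [Matrix.single_apply, Matrix.single_apply]
    by_cases hkl : k = p 0 i ∧ l = p 0 i
    · obtain ⟨rfl, rfl⟩ := hkl
      rw [h.invol, if_pos ⟨rfl, rfl⟩, tr_one, one_mul, mul_one]
    · rw [if_neg, if_neg, mul_zero, BlockData.scalar_tr_zero, zero_mul]
      · rintro ⟨h1, h2⟩
        exact hkl ⟨h2.symm, by rw [h1, h.invol]⟩
      · rintro ⟨h1, h2⟩
        exact hkl ⟨by rw [h1, h.invol], h2.symm⟩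
  · have h1 := congrFun (congrFun hY i) (p 0 i)
    rw [realDiag_mul_apply, mul_realDiag_apply, Matrix.single_apply_same] at h1
    simp only [Pi.sub_apply, Pi.single_eq_same, Pi.single_eq_of_ne hi,
      Pi.single_eq_of_ne (Ne.symm hi), sub_zero, zero_sub, one_smul, neg_smul] at h1
    exact one_ne_zero (eq_zero_of_eq_neg h1)

theorem tfae (hreal : ∀ q : 𝕂, star q = q → ∃ r : ℝ, q = algebraMap ℝ 𝕂 r)
    (hal : S.tower.Aligned) (ν : ℕ → ℕ) (hν : StrictMono ν) :
    List.TFAE [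
      S.D.IsClassical,
      (S.tower.limitRoots ν).Countable,
      ∃ μ : ℕ → ℕ, StrictMono μ ∧
        S.tower.limitRoots (ν ∘ μ) = ⋃ k, S.tower.extendedRoots (ν (μ k)),
      S.tower.RestrictedRootReductive ν] :=
  -- Every coordinate has a partner, so the condition on corners is vacuous.
  (h.standard hreal).tfae_of_frame hal h.pairFrame (fun n _ u _ hu => absurd hu (h.ne n u))
    (fun _ => h.exists_not_commute) ν hν

end IsSymplectic

end ClassicalSystem

theorem SymplecticSystem.exists_isSymplectic (S : SymplecticSystem) (𝕂 : Type) [NormedRing 𝕂]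
    [NormedAlgebra ℝ 𝕂] [StarRing 𝕂] [ClassicalScalar 𝕂] [FiniteDimensional ℝ 𝕂] :
    ∃ p σ, (S.system 𝕂).IsSymplectic p σ := by
  choose p σ hp hσ h using S.exists_intForm_eq
  refine ⟨p, σ, rfl, fun _ => rfl, hp, hσ, fun n k l => ?_⟩
  change ((S.intForm n k l : ℤ) : 𝕂) = _
  refine (congrArg (Int.cast : ℤ → 𝕂) (h n k l)).trans ?_
  by_cases hl : l = p n k
  · exact (congrArg (Int.cast : ℤ → 𝕂) (if_pos hl)).trans (if_pos hl).symm
  · exact (congrArg (Int.cast : ℤ → 𝕂) (if_neg hl)).trans (Int.cast_zero.trans (if_neg hl).symm)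

/-! ## The equivalence -/

theorem real_of_star_eq (q : ℝ) (_ : star q = q) : ∃ r : ℝ, q = algebraMap ℝ ℝ r := ⟨q, rfl⟩

theorem complex_of_star_eq (q : ℂ) (h : star q = q) : ∃ r : ℝ, q = algebraMap ℝ ℂ r :=
  ⟨q.re, (Complex.conj_eq_iff_re.1 h).symm⟩

theorem quaternion_of_star_eq (q : ℍ[ℝ]) (h : star q = q) : ∃ r : ℝ, q = algebraMap ℝ ℍ[ℝ] r :=
  ⟨q.re, Quaternion.star_eq_self.1 h⟩

theorem proposition9p2 (S : DiagonalSystem) (hS : S.tower.Aligned) (ν : ℕ → ℕ)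
    (hν : StrictMono ν) :
    List.TFAE [
      S.IsClassical,
      (S.tower.limitRoots ν).Countable,
      ∃ μ : ℕ → ℕ, StrictMono μ ∧
        S.tower.limitRoots (ν ∘ μ) = ⋃ k, S.tower.extendedRoots (ν (μ k)),
      S.tower.RestrictedRootReductive ν] := by
  cases S with
  | linear F S =>
    cases F with
    | real => exact (S.isLinear ℝ).tfae real_of_star_eq hS ν hν
    | complex => exact (S.isLinear ℂ).tfae complex_of_star_eq hS ν hν
    | quaternion => exact (S.isLinear ℍ[ℝ]).tfae quaternion_of_star_eq hS ν hν
  | unitary F S =>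
    cases F with
    -- The three unitary systems have the shape treated in `UnitarySystem.isPaired` by definition
    -- and differ only in the automorphism δ.
    | real => exact (S.isPaired _ _ (S.system ℝ).twist_mem).tfae real_of_star_eq hS ν hν
    | complex => exact (S.isPaired _ _ S.complexSystem.twist_mem).tfae complex_of_star_eq hS ν hν
    | quaternion =>
      exact (S.isPaired _ _ (S.system ℍ[ℝ]).twist_mem).tfae quaternion_of_star_eq hS ν hν
  | symplecticReal S =>
    obtain ⟨p, σ, h⟩ := S.exists_isSymplectic ℝ
    exact h.tfae real_of_star_eq hS ν hν
  | symplecticComplex S =>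
    obtain ⟨p, σ, h⟩ := S.exists_isSymplectic ℂ
    exact h.tfae complex_of_star_eq hS ν hν
  | complexOrthogonal S =>
    exact (ClassicalSystem.isPaired_of_complexOrthogonal (R := S.complexSystem) rfl (fun _ => rfl)
      (fun _ => rfl) S.π_invol S.π_fixed).tfae complex_of_star_eq hS ν hν
  | starOrthogonal S =>
    exact (ClassicalSystem.isPaired_of_starOrthogonal (R := S.starSystem) rfl (fun _ => rfl)
      (fun _ => rfl) S.π_invol S.π_fixed).tfae quaternion_of_star_eq hS ν hν
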